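/- Let $d\ge 1$, $T>0$, $\Lambda=(0,2\pi)^d$, $D_T=\Lambda\times(0,T)$. For $\xi\in\mathbb Z^d$ put $|\xi|=\max_j|\xi_j|$; let $\hat\phi_\xi=(2\pi)^{-d}\int_\Lambda\phi(x)e^{-i\xi\cdot x}\,dx$ and $P_N\phi(x)=\sum_{|\xi|\le N}\hat\phi_\xi e^{i\xi\cdot x}$. Let $0<\theta<1$ and let $s\in\mathbb N$ satisfy $s\ge\frac{4+\lfloor d/2\rfloor}{1-\theta}$. Assume: * $f=(f_1,\dots,f_d)$ with $f_j\in C^s(\mathbb R)$; * $\mu\ge0$ is a measure on $\mathbb R^d\setminus\{0\}$ with $\int_{|z|>0}|z|^2\wedge1\,d\mu(z)<\infty$ (Euclidean $|z|$) that is symmetric, $\mu(-B)=\mu(B)$ for Borel $B\subseteq\mathbb R^d\setminus\{0\}$; put $$\mathcal L^\mu[\phi](x)=\int_{|z|>0}\phi(x+z)-\phi(x)-z\cdot\partial_x\phi(x)\mathbf 1_{|z|<1}\,d\mu(z);$$ * $u_0$ is $2\pi$-periodic in each coordinate and $u_0\in L^\infty(\Lambda)\cap BV(\Lambda)$; * $\epsilon_N>0$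 and $m_N\in\mathbb N$ satisfy $\epsilon_N\sim N^{-\theta}$ and $m_N\sim N^{\theta/2}(\log N)^{-d/2}$ as $N\to\infty$, where $\sim$ means equality up to factors bounded above and away from $0$; * the real numbers $\hat Q^{j,k}_p(t)$ ($m_N\le p\le N$, $0\le t\le T$, depending also on $N$) are nondecreasing in $p$ and satisfy $|\hat Q^{j,k}_p(t)-\delta_{jk}|\le C\,m_N^2p^{-2}$ with $C$ independent of $N$, $p$, $t$. For every $N\in\mathbb N$ let $u_N(x,t)=\sum_{|\xi|\le N}\hat u_\xi(t)e^{i\xi\cdot x}$ be a real-valued solution on $[0,T]$ of the spectral vanishing viscosity approximation $$\partial_tu_N+\partial_x\cdot P_Nf(u_N)=\mathcal L^\mu[u_N]-\epsilon_N\sum_{m_N\le|\xi|\le N}\Big(\sum_{j,k=1}^d\hat Q^{j,k}_{|\xi|}(t)\,\xi_j\xi_k\Big)\hat u_\xi(t)e^{i\xi\cdot x},\qquad u_N(\cdot,0)=P_Nu_0 .$$ Assume finally that $$\sup_N\ \max_j\ \sup\{|f_j^{(s)}(v)|:\ |v|\le|u_N(x,t)|\text{ for some }x\in\mathbb R^d,\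 t\in[0,T]\}<\infty$$ (which holds in particular if each $f_j^{(s)}$ is bounded on $\mathbb R$) and that $\sup_N\epsilon_N^s\|\partial_x^su_N(\cdot,0)\|_{L^2(\Lambda)}<\infty$, where $\|\partial_x^s\phi\|_{L^2}^2=\sum_{|\alpha|=s}\|\partial_x^\alpha\phi\|_{L^2}^2$. Then a subsequence of $(u_N)$ converges in $C([0,T];L^1(\Lambda))$ to a limit $u\in C([0,T];L^1(\Lambda))\cap L^\infty(D_T)\cap L^\infty(0,T;BV(\Lambda))$. -/

import Mathlib

open MeasureTheory Filter Topology Asymptotics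

noncomputable section

namespace SVV

/-- Euclidean space of dimension `d`. -/
abbrev E (d : ℕ) : Type := EuclideanSpace ℝ (Fin d)

/-- The `j`-th coordinate direction. -/
def dir {d : ℕ} (j : Fin d) : E d := EuclideanSpace.single j 1

/-- The period cell `Λ = (0, 2π)^d`. -/
def cell (d : ℕ) : Set (E d) := {x | ∀ j, 0 < x j ∧ x j < 2 * Real.pi}

/-- Lebesgue measure on the period cell. -/
def cellVol (d : ℕ) : Measure (E d) := volume.restrict (cell d)

/-- `2π`-periodicity in each coordinate direction. -/
def IsPeriodic {d : ℕ} (v : E d → ℝ) : Prop :=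
  ∀ (j : Fin d) (x : E d), v (x + (2 * Real.pi) • dir j) = v x

/-! ### Functions of bounded variation -/

/-- Divergence of a vector field. -/
def divergence {d : ℕ} (φ : E d → E d) (x : E d) : ℝ :=
  ∑ j, (fderiv ℝ φ x (dir j)) j

/-- Total variation on the open set `Λ`: the supremum of `∫_Λ v div φ` over all compactly supported
`C¹` vector fields `φ` on `Λ` with `|φ| ≤ 1`. -/
def variation {d : ℕ} (v : E d → ℝ) : ENNReal :=
  ⨆ (φ : E d → E d) (_ : ContDiff ℝ 1 φ) (_ : HasCompactSupport φ) (_ : tsupport φ ⊆ cell d)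
    (_ : ∀ x, ‖φ x‖ ≤ 1), ENNReal.ofReal (∫ x, v x * divergence φ x ∂(cellVol d))

/-- The norm of `BV(Λ)`: the `L¹` norm plus the total variation. -/
def bvNorm {d : ℕ} (v : E d → ℝ) : ENNReal :=
  eLpNorm v 1 (cellVol d) + variation v

/-! ### Partial derivatives -/

/-- The partial derivative `∂_j`. -/
def partialD {d : ℕ} {F : Type*} [NormedAddCommGroup F] [NormedSpace ℝ F]
    (j : Fin d) (φ : E d → F) : E d → F :=
  fun x => lineDeriv ℝ φ x (dir j)

/-- `∂^α = ∂_1^{α_1} ⋯ ∂_d^{α_d}` for a multi-index `α`. -/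
def multiD {d : ℕ} (α : Fin d → ℕ) (φ : E d → ℝ) : E d → ℝ :=
  (List.finRange d).foldr (fun j g => (partialD j)^[α j] g) φ

/-- `‖∂^s φ‖_{L²(Λ)}`, where `‖∂^s φ‖² = ∑_{|α| = s} ‖∂^α φ‖²`. -/
def derivNorm {d : ℕ} (s : ℕ) (φ : E d → ℝ) : ℝ :=
  Real.sqrt (∑ α ∈ Finset.piAntidiag (Finset.univ : Finset (Fin d)) s,
    ∫ x, (multiD α φ x) ^ 2 ∂(cellVol d))

/-! ### Fourier series -/

/-- The size of a frequency, `|ξ| = max_j |ξ_j|`. -/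
def freqSize {d : ℕ} (ξ : Fin d → ℤ) : ℕ := Finset.univ.sup fun j => (ξ j).natAbs

/-- The frequencies with `|ξ| ≤ N`. -/
def freqs (d N : ℕ) : Finset (Fin d → ℤ) :=
  Fintype.piFinset fun _ => Finset.Icc (-(N : ℤ)) (N : ℤ)

/-- The pairing `ξ · x`. -/
def pair {d : ℕ} (ξ : Fin d → ℤ) (x : E d) : ℝ := ∑ j, (ξ j : ℝ) * x j

/-- The exponential `e^{i ξ · x}`. -/
def expo {d : ℕ} (ξ : Fin d → ℤ) (x : E d) : ℂ := Complex.exp (Complex.I * (pair ξ x : ℂ))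

/-- The Fourier coefficient `(2π)^{-d} ∫_Λ φ(x) e^{-i ξ · x} dx`. -/
def coeff {d : ℕ} (φ : E d → ℝ) (ξ : Fin d → ℤ) : ℂ :=
  ((2 * Real.pi : ℝ) ^ d : ℂ)⁻¹ *
    ∫ x, (φ x : ℂ) * Complex.exp (-(Complex.I * (pair ξ x : ℂ))) ∂(cellVol d)

/-- The Fourier projection `P_N φ`. -/
def proj {d : ℕ} (N : ℕ) (φ : E d → ℝ) (x : E d) : ℂ :=
  ∑ ξ ∈ freqs d N, coeff φ ξ * expo ξ x

/-- Real `N`-trigonometric polynomials. -/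
def IsTrigPoly {d : ℕ} (N : ℕ) (φ : E d → ℝ) : Prop :=
  ∃ c : (Fin d → ℤ) → ℂ, ∀ x, (φ x : ℂ) = ∑ ξ ∈ freqs d N, c ξ * expo ξ x

/-! ### The nonlocal operator -/

/-- `∫_{|z|>0} |z|² ∧ 1 dμ(z) < ∞`. -/
def IsLevy {d : ℕ} (μ : Measure (E d)) : Prop :=
  IntegrableOn (fun z : E d => min (‖z‖ ^ 2) 1) {0}ᶜ μ

/-- Symmetry of `μ` on Borel subsets of `ℝ^d ∖ {0}`. -/
def IsSymm {d : ℕ} (μ : Measure (E d)) : Prop :=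
  ∀ B : Set (E d), MeasurableSet B → B ⊆ {0}ᶜ → μ ((fun z => -z) ⁻¹' B) = μ B

/-- `∫_{|z|>0} φ(x+z) - φ(x) - z · ∂φ(x) 1_{|z|<1} dμ(z)`. -/
def levy {d : ℕ} (μ : Measure (E d)) (φ : E d → ℝ) (x : E d) : ℝ :=
  ∫ z in ({0}ᶜ : Set (E d)),
    (φ (x + z) - φ x - Set.indicator (Metric.ball 0 1) (fun z => fderiv ℝ φ x z) z) ∂μ

/-! ### The spectral vanishing viscosity method -/

/-- Symbols `Q̂_p^{j,k}(t)` (`m ≤ p ≤ N`, `0 ≤ t ≤ T`), for all `N`: they increase with `p`, and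
`|Q̂_p^{j,k} - δ_{jk}| ≤ C m_N² p^{-2}` with one constant for all `N`, `p`, `t`. -/
structure IsViscosityFamily {d : ℕ} (T : ℝ) (m : ℕ → ℕ)
    (Q : ℕ → Fin d → Fin d → ℕ → ℝ → ℝ) : Prop where
  mono : ∀ N j k, ∀ t ∈ Set.Icc 0 T, MonotoneOn (fun p => Q N j k p t) (Set.Icc (m N) N)
  bound : ∃ C : ℝ, ∀ N j k, ∀ p ∈ Set.Icc (m N) N, ∀ t ∈ Set.Icc 0 T,
    |Q N j k p t - (if j = k then 1 else 0)| * (p : ℝ) ^ 2 ≤ C * (m N : ℝ) ^ 2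

/-- The term `∑_{j,k} ∂²_{jk} Q^{j,k} ∗ φ` for the kernels
`Q^{j,k}(x) = ∑_{p=m}^N Q̂_p^{j,k} ∑_{|ξ|=p} e^{i ξ · x}`, that is,
`- ∑_{m ≤ |ξ| ≤ N} (∑_{j,k} Q̂_{|ξ|}^{j,k} ξ_j ξ_k) φ̂_ξ e^{i ξ · x}`. -/
def viscTerm {d : ℕ} (N m : ℕ) (q : Fin d → Fin d → ℕ → ℝ) (φ : E d → ℝ) (x : E d) : ℂ :=
  -∑ ξ ∈ (freqs d N).filter (fun ξ => m ≤ freqSize ξ),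
    ((∑ j, ∑ k, q j k (freqSize ξ) * (ξ j : ℝ) * (ξ k : ℝ) : ℝ) : ℂ) * coeff φ ξ * expo ξ x

/-- `u t x` is a solution on `[0,T]` of the semi-discrete SVV approximation
`∂_t u + ∂_x · P_N f(u) = L^μ[u] + ε ∑_{j,k} ∂²_{jk} Q^{j,k} ∗ u`, `u(·,0) = P_N u₀`,
among the real `N`-trigonometric polynomials. -/
structure IsSVVSolution {d : ℕ} (T : ℝ) (f : Fin d → ℝ → ℝ) (μ : Measure (E d)) (u₀ : E d → ℝ)
    (N m : ℕ) (ε : ℝ) (q : Fin d → Fin d → ℕ → ℝ → ℝ) (u : ℝ → E d → ℝ) : Prop where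
  trig : ∀ t ∈ Set.Icc 0 T, IsTrigPoly N (u t)
  cont : ∀ x, ContinuousOn (fun t => u t x) (Set.Icc 0 T)
  init : ∀ x, (u 0 x : ℂ) = proj N u₀ x
  eqn : ∀ t ∈ Set.Ioo 0 T, ∀ x,
    HasDerivAt (fun τ => (u τ x : ℂ))
      (-(∑ j, partialD j (proj N fun y => f j (u t y)) x) + (levy μ (u t) x : ℂ)
        + (ε : ℂ) * viscTerm N m (fun j k p => q j k p t) (u t) x) t

end SVV

end

/-! The scheme is an honest viscous equation up to two errors (`dt_eq`): ∂_t u = -∂·f(u) + L u + ε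
Δu + `projErr` + `viscErr`. Here `projErr` is the part of ∂·f(u) removed by P_N, and `viscErr` is ε
times the Fourier multiplier with symbol Σ ξ_j² minus the viscosity symbol. Tested against η'(u)
with η convex, the flux integrates to zero, the Laplacian and the Lévy operator have the good sign,
and only the errors remain (`Entropy.integral_dt_le`).

Viscosity error. The multiplier has size O(m²), so Parseval bounds it in L² by ε m² ‖u‖, and ε m² =
O((log N)^{-d}) tends to 0 (`integral_viscErr_sq_le`). In L^{2k}, projections of M. Riesz type and
Abel summation along the monotone symbols cost one logarithm (`exists_nrm_viscDefect_le`); ε m² (1 +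
log N) is still bounded.

Projection error. As long as |u| ≤ A, an energy estimate for the derivatives of order s, with a
Moser estimate for f(u), bounds ε^s ‖∂^s u‖ by a power of A (`exists_sob_le`). The discarded tail is
then at most C A^p N^{-2} with p = 2s² + 2s + 1 (`exists_projErr_le`); the condition s(1-θ) ≥ 4 +
⌊d/2⌋ enters because (Nε)^{2s} must dominate N^{d+7}.

Bootstrap. There is no sup bound to start from. While ∫ u^{2k} ≤ B with k = dp, Nikolskii's
inequality permits A^p of order N, so the projection error is O(1/N), and Gronwall for the entropy
v^{2k} returns a value strictly below B (`exists_integral_pow_le`). Hence finitely many moments are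
bounded uniformly in N and the total error tends to 0 in L² (`exists_controlled`).

Consequences. Entropies approximating |v|, applied to u(·+y) - u, show that the L¹ modulus of
continuity grows by at most a vanishing error (`Admissible.integral_abs_translate_sub_le`). The
cubes of the positive parts of ±u - C₀ have vanishing integrals (`Controlled.integral_cubePos_le`).
The data are controlled because the bound on ε^s ‖∂^s P_N u₀‖, read on the shell |ξ| = N for every
N, forces decay of the coefficients of u₀; so the P_N u₀ are uniformly bounded and Lipschitz
(`exists_initial_bounds`).

Compactness. Each Fourier coefficient is Lipschitz in time uniformly in N, and the translation
estimate makes the high-frequency tails uniformly small in ℓ². A subsequence is therefore Cauchy in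
L², hence in L¹, uniformly in time (`CompactFamily.exists_cauchy`). The limit inherits the bound C₀
from the cubes and its variation bound from the translations (`CompactFamily.exists_limit`). -/

noncomputable section
namespace SVV

/-! ### Periodic functions and integration over the cell -/

/-- `2π`-periodicity in each coordinate direction, for functions with arbitrary values. -/
def Per {d : ℕ} {F : Type*} (g : E d → F) : Prop :=
  ∀ j : Fin d, Function.Periodic g ((2 * Real.pi) • dir j)

/-- Half-open cubes of side `2π`. -/
def cube {d : ℕ} (a : Fin d → ℝ) : Set (E d) :=
  {x | ∀ j, x j ∈ Set.Ioc (2 * Real.pi * a j) (2 * Real.pi * (a j + 1))}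

variable {d : ℕ} {F : Type*}

lemma Per.comp {G : Type*} {g : E d → F} (hg : Per g) (φ : F → G) : Per fun x => φ (g x) :=
  fun j x => congrArg φ (hg j x)

lemma Per.add_right {g : E d → F} (hg : Per g) (h : E d) : Per fun x => g (x + h) := fun j x => by
  change g (x + _ + h) = _
  rw [add_right_comm]; exact hg j _

lemma Per.int_shift {g : E d → F} (hg : Per g) (n : Fin d → ℤ) (x : E d) :
    g (x + ∑ j, n j • ((2 * Real.pi) • dir j)) = g x := by
  have : ∀ (S : Finset (Fin d)) x, g (x + ∑ j ∈ S, n j • ((2 * Real.pi) • dir j)) = g x := by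
    intro S
    induction S using Finset.induction_on with
    | empty => simp
    | insert a S ha ih =>
      intro x
      rw [Finset.sum_insert ha, ← add_assoc, ih]
      exact (hg a).zsmul (n a) x
  exact this _ x

/-- Rescaling by 2π turns a periodic function into a function on (ℝ/ℤ)^d. This is the bridge to
integration over the torus and to the convergence theorem for its Fourier series. -/
lemma Per.exists_lift {g : E d → F} (hg : Per g) :
    ∃ G : UnitAddTorus (Fin d) → F, ∀ y : Fin d → ℝ,
      G (fun i => (y i : UnitAddCircle)) = g (WithLp.toLp 2 ((2 * Real.pi) • y)) := by
  refine ⟨fun t => g (WithLp.toLp 2 ((2 * Real.pi) • fun i => Quotient.out (t i))), fun y => ?_⟩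
  have h : ∀ i, ∃ n : ℤ, y i = Quotient.out (y i : UnitAddCircle) + n := by
    intro i
    have : ((Quotient.out (y i : UnitAddCircle) : ℝ) : UnitAddCircle) = (y i : UnitAddCircle) :=
      Quotient.out_eq _
    rw [eq_comm, ← sub_eq_zero, ← AddCircle.coe_sub, AddCircle.coe_eq_zero_iff] at this
    obtain ⟨n, hn⟩ := this
    exact ⟨n, by simp at hn; linarith⟩
  choose n hn using h
  rw [← hg.int_shift fun i => -n i]
  refine congrArg g ?_
  ext i
  have := hn i
  simp [dir, Finset.sum_apply, Pi.single_apply]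
  linear_combination (-2 * Real.pi) * this

lemma integral_cube [NormedAddCommGroup F] [NormedSpace ℝ F] (g : E d → F) (a : Fin d → ℝ) :
    ∫ x in cube a, g x = ((2 * Real.pi) ^ d) •
      ∫ y in {y : Fin d → ℝ | ∀ i, y i ∈ Set.Ioc (a i) (a i + 1)},
        g (WithLp.toLp 2 ((2 * Real.pi) • y)) := by
  have hpi : (0 : ℝ) < 2 * Real.pi := by positivity
  rw [← (PiLp.volume_preserving_toLp (Fin d)).setIntegral_preimage_emb
    (MeasurableEquiv.toLp 2 (Fin d → ℝ)).measurableEmbedding,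
    Measure.setIntegral_comp_smul volume (fun y => g (WithLp.toLp 2 y)) _ hpi.ne', smul_smul]
  have : (2 * Real.pi) ^ d * |((2 * Real.pi) ^ Module.finrank ℝ (Fin d → ℝ))⁻¹| = 1 := by
    rw [abs_of_pos (by positivity)]; simp
  rw [this, one_smul]
  congr 2
  ext y
  simp only [cube, Set.mem_preimage, Set.mem_ofPred_eq, Set.mem_smul_set_iff_inv_smul_mem₀ hpi.ne',
    Pi.smul_apply, smul_eq_mul]
  refine forall_congr' fun j => ?_
  simp only [Set.mem_Ioc]
  rw [lt_inv_mul_iff₀ hpi, inv_mul_le_iff₀ hpi]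

lemma cell_ae_eq_cube : cell d =ᵐ[volume] (cube 0 : Set (E d)) := by
  have h : ((fun x : E d => x.ofLp) ⁻¹' (Set.univ.pi fun _ : Fin d => Set.Ioo 0 (2 * Real.pi)))
      =ᵐ[volume] ((fun x : E d => x.ofLp) ⁻¹' (Set.univ.pi fun _ : Fin d =>
        Set.Ioc 0 (2 * Real.pi))) :=
    (PiLp.volume_preserving_ofLp (Fin d)).quasiMeasurePreserving.preimage_ae_eq
      (Measure.univ_pi_Ioo_ae_eq_Icc.trans Measure.univ_pi_Ioc_ae_eq_Icc.symm)
  have h1 : cell d = (fun x : E d => x.ofLp) ⁻¹' (Set.univ.pi fun _ => Set.Ioo 0 (2 * Real.pi)) := by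
    ext x; simp [cell]
  have h2 : (cube 0 : Set (E d)) =
      (fun x : E d => x.ofLp) ⁻¹' (Set.univ.pi fun _ => Set.Ioc 0 (2 * Real.pi)) := by
    ext x; simp [cube]
  rw [h1, h2]
  exact h

lemma integral_cellVol [NormedAddCommGroup F] [NormedSpace ℝ F] (g : E d → F) :
    ∫ x, g x ∂(cellVol d) = ∫ x in cube 0, g x :=
  setIntegral_congr_set cell_ae_eq_cube

/-- The shifted cell is another fundamental cube of the period lattice, and all such cubes give the
integral of the lift over the torus. -/
lemma integral_cellVol_add [NormedAddCommGroup F] [NormedSpace ℝ F] {g : E d → F} (hg : Per g)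
    (h : E d) : ∫ x, g (x + h) ∂(cellVol d) = ∫ x, g x ∂(cellVol d) := by
  have hpi : (0 : ℝ) < 2 * Real.pi := by positivity
  obtain ⟨G, hG⟩ := hg.exists_lift
  have key : ∀ a b : Fin d → ℝ, ∫ x in cube a, g x = ∫ x in cube b, g x := by
    intro a b
    simp only [integral_cube, ← hG]
    rw [← UnitAddTorus.integral_preimage G a, ← UnitAddTorus.integral_preimage G b]
  have h3 := (measurePreserving_add_right (volume : Measure (E d)) h).setIntegral_preimage_emb
    (measurableEmbedding_addRight h) g (cube fun j => h j / (2 * Real.pi))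
  rw [integral_cellVol, integral_cellVol, key 0 (fun j => h j / (2 * Real.pi)), ← h3]
  congr 2
  ext x
  simp only [cube, Set.mem_preimage, Set.mem_ofPred_eq, Set.mem_Ioc]
  refine forall_congr' fun j => ?_
  have : 2 * Real.pi * (h j / (2 * Real.pi)) = h j := by field_simp
  rw [mul_add, this]
  simp only [PiLp.add_apply, Pi.zero_apply]
  constructor <;> rintro ⟨h1, h2⟩ <;> constructor <;> linarith

end SVV

end

/-! ### Compactness of the cell and integration by parts for periodic functions -/

noncomputable section
namespace SVV

variable {d : ℕ} {F : Type*}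

lemma isCompact_closedCube : IsCompact {x : E d | ∀ j, x j ∈ Set.Icc 0 (2 * Real.pi)} := by
  have h : IsCompact (Set.univ.pi fun _ : Fin d => Set.Icc (0 : ℝ) (2 * Real.pi)) :=
    isCompact_univ_pi fun _ => isCompact_Icc
  have := h.image (PiLp.continuous_toLp 2 (fun _ : Fin d => ℝ))
  convert this using 1
  ext x
  constructor
  · intro hx
    exact ⟨x.ofLp, fun j _ => hx j, rfl⟩
  · rintro ⟨y, hy, rfl⟩ j
    exact hy j trivial

lemma cell_subset : cell d ⊆ {x : E d | ∀ j, x j ∈ Set.Icc 0 (2 * Real.pi)} :=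
  fun _ hx j => ⟨(hx j).1.le, (hx j).2.le⟩

lemma isOpen_cell : IsOpen (cell d) := by
  have : cell d = ⋂ j, {x : E d | 0 < x j ∧ x j < 2 * Real.pi} := by ext; simp [cell]
  rw [this]
  refine isOpen_iInter_of_finite fun j => ?_
  have h : Continuous fun x : E d => x j := by fun_prop
  exact (isOpen_lt continuous_const h).inter (isOpen_lt h continuous_const)

instance : IsFiniteMeasure (cellVol d) := by
  refine ⟨?_⟩
  rw [cellVol, Measure.restrict_apply_univ]
  exact (measure_mono cell_subset).trans_lt isCompact_closedCube.measure_lt_top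

lemma integrable_cellVol [NormedAddCommGroup F] {g : E d → F} (hg : Continuous g) :
    Integrable g (cellVol d) :=
  (hg.continuousOn.integrableOn_compact isCompact_closedCube).mono_set cell_subset

lemma Per.exists_bound [NormedAddCommGroup F] {g : E d → F} (hg : Per g) (hc : Continuous g) :
    ∃ C, 0 ≤ C ∧ ∀ x, ‖g x‖ ≤ C := by
  have hpi : (0 : ℝ) < 2 * Real.pi := by positivity
  obtain ⟨C, hC⟩ := isCompact_closedCube.exists_bound_of_continuousOn (hc.continuousOn)
  refine ⟨max C 0, le_max_right _ _, fun x => le_max_of_le_left ?_⟩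
  rw [← hg.int_shift fun j => -⌊x j / (2 * Real.pi)⌋]
  apply hC
  intro j
  have h1 := Int.floor_le (x j / (2 * Real.pi))
  have h2 := Int.lt_floor_add_one (x j / (2 * Real.pi))
  rw [le_div_iff₀ hpi] at h1
  rw [div_lt_iff₀ hpi] at h2
  simp [dir, Finset.sum_apply, Pi.single_apply]
  constructor <;> linarith

lemma Per.fderiv [NormedAddCommGroup F] [NormedSpace ℝ F] {g : E d → F} (hg : Per g) :
    Per (fderiv ℝ g) := by
  intro j x
  rw [← fderiv_comp_add_right]
  congr 1
  exact funext (hg j)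

/-- Integration by parts: derivatives of periodic functions have mean zero. -/
lemma integral_fderiv_eq_zero [NormedAddCommGroup F] [NormedSpace ℝ F]
    {g : E d → F} (hg : Per g) (hc : ContDiff ℝ 1 g) (v : E d) :
    ∫ x, fderiv ℝ g x v ∂(cellVol d) = 0 := by
  have hc' : Continuous (_root_.fderiv ℝ g) := hc.continuous_fderiv one_ne_zero
  obtain ⟨C, hC0, hC⟩ := hg.fderiv.exists_bound hc'
  have hd : ∀ x : E d, ∀ τ : ℝ, HasDerivAt (fun τ : ℝ => g (x + τ • v))
      (_root_.fderiv ℝ g (x + τ • v) v) τ := by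
    intro x τ
    have h1 : HasDerivAt (fun τ : ℝ => x + τ • v) v τ := by
      simpa using ((hasDerivAt_id τ).smul_const v).const_add x
    exact ((hc.differentiable one_ne_zero _).hasFDerivAt).comp_hasDerivAt τ h1
  -- Differentiate ∫ g(x + τ v) dx at τ = 0 under the integral sign; translation invariance makes
  -- this integral constant in τ.
  have key := (hasDerivAt_integral_of_dominated_loc_of_deriv_le (μ := cellVol d) (𝕜 := ℝ)
    (F := fun τ x => g (x + τ • v)) (F' := fun τ x => _root_.fderiv ℝ g (x + τ • v) v)
    (x₀ := 0) (s := Set.univ) (bound := fun _ => C * ‖v‖) univ_mem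
    (Eventually.of_forall fun τ => (integrable_cellVol (by fun_prop)).aestronglyMeasurable)
    (integrable_cellVol (by fun_prop))
    (integrable_cellVol (by fun_prop)).aestronglyMeasurable
    (Eventually.of_forall fun x τ _ =>
      ((_root_.fderiv ℝ g (x + τ • v)).le_opNorm v).trans (by gcongr; exact hC _))
    (integrable_const _) (Eventually.of_forall fun x τ _ => hd x τ)).2
  have h2 : (fun τ : ℝ => ∫ x, g (x + τ • v) ∂(cellVol d)) =
      fun _ => ∫ x, g x ∂(cellVol d) := funext fun τ => integral_cellVol_add hg _
  rw [h2] at key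
  simpa using key.unique (hasDerivAt_const 0 _)

/-! ### Exponentials and trigonometric polynomials -/

@[simp] lemma pair_add (ξ : Fin d → ℤ) (x y : E d) : pair ξ (x + y) = pair ξ x + pair ξ y := by
  simp [pair, mul_add, Finset.sum_add_distrib]

@[simp] lemma pair_smul (ξ : Fin d → ℤ) (a : ℝ) (x : E d) : pair ξ (a • x) = a * pair ξ x := by
  simp [pair, Finset.mul_sum, mul_left_comm]

@[simp] lemma pair_dir (ξ : Fin d → ℤ) (j : Fin d) : pair ξ (dir j) = ξ j := by
  simp [pair, dir]

lemma pair_add_freq (ξ η : Fin d → ℤ) (x : E d) : pair (ξ + η) x = pair ξ x + pair η x := by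
  simp [pair, add_mul, Finset.sum_add_distrib]

lemma pair_neg_freq (ξ : Fin d → ℤ) (x : E d) : pair (-ξ) x = -pair ξ x := by
  simp [pair]

/-- `pair ξ` as a continuous linear functional. -/
def pairL (ξ : Fin d → ℤ) : E d →L[ℝ] ℝ := LinearMap.toContinuousLinearMap
  { toFun := pair ξ, map_add' := pair_add ξ, map_smul' := by simp }

@[simp] lemma pairL_apply (ξ : Fin d → ℤ) (x : E d) : pairL ξ x = pair ξ x := rfl

lemma contDiff_pair (ξ : Fin d → ℤ) {n : WithTop ℕ∞} : ContDiff ℝ n (pair ξ : E d → ℝ) :=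
  (pairL ξ).contDiff

lemma expo_add (ξ : Fin d → ℤ) (x y : E d) : expo ξ (x + y) = expo ξ x * expo ξ y := by
  simp [expo, mul_add, Complex.exp_add]

lemma expo_add_freq (ξ η : Fin d → ℤ) (x : E d) : expo (ξ + η) x = expo ξ x * expo η x := by
  simp [expo, pair_add_freq, mul_add, Complex.exp_add]

lemma expo_zero_freq (x : E d) : expo 0 x = 1 := by simp [expo, pair]

lemma norm_expo (ξ : Fin d → ℤ) (x : E d) : ‖expo ξ x‖ = 1 := by
  rw [expo, mul_comm]; exact Complex.norm_exp_ofReal_mul_I _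

lemma conj_expo (ξ : Fin d → ℤ) (x : E d) : (starRingEnd ℂ) (expo ξ x) = expo (-ξ) x := by
  simp [expo, ← Complex.exp_conj, pair_neg_freq]

lemma exp_neg_pair (ξ : Fin d → ℤ) (x : E d) :
    Complex.exp (-(Complex.I * (pair ξ x : ℂ))) = expo (-ξ) x := by
  simp [expo, pair_neg_freq]

lemma per_expo (ξ : Fin d → ℤ) : Per (expo ξ : E d → ℂ) := by
  intro j x
  rw [expo_add]
  have : expo ξ ((2 * Real.pi) • dir j : E d) = 1 := by
    rw [expo, pair_smul, pair_dir, Complex.exp_eq_one_iff]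
    exact ⟨ξ j, by push_cast; ring⟩
  rw [this, mul_one]

@[fun_prop] lemma contDiff_expo (ξ : Fin d → ℤ) {n : WithTop ℕ∞} :
    ContDiff ℝ n (expo ξ : E d → ℂ) := by
  unfold expo
  have := contDiff_pair (d := d) ξ (n := n)
  exact (contDiff_const.mul (Complex.ofRealCLM.contDiff.comp this)).cexp

@[fun_prop] lemma continuous_expo (ξ : Fin d → ℤ) : Continuous (expo ξ : E d → ℂ) :=
  (contDiff_expo ξ (n := 0)).continuous

lemma hasFDerivAt_expo (ξ : Fin d → ℤ) (x : E d) :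
    HasFDerivAt (expo ξ : E d → ℂ)
      ((Complex.I * expo ξ x) • Complex.ofRealCLM.comp (pairL ξ)) x := by
  have h1 : HasFDerivAt (fun x : E d => Complex.I * (pair ξ x : ℂ))
      (Complex.I • Complex.ofRealCLM.comp (pairL ξ)) x :=
    ((Complex.ofRealCLM.comp (pairL ξ)).hasFDerivAt (x := x)).const_mul Complex.I
  have := h1.cexp
  rw [smul_smul, mul_comm] at this
  exact this

/-- The trigonometric polynomial with coefficients `c` on the frequencies `S`. -/
def trig (S : Finset (Fin d → ℤ)) (c : (Fin d → ℤ) → ℂ) (x : E d) : ℂ := ∑ ξ ∈ S, c ξ * expo ξ x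

lemma per_trig (S : Finset (Fin d → ℤ)) (c : (Fin d → ℤ) → ℂ) : Per (trig S c) := fun j x => by
  simp only [trig, (per_expo _ j x : _)]

@[fun_prop] lemma contDiff_trig (S : Finset (Fin d → ℤ)) (c : (Fin d → ℤ) → ℂ) {n : WithTop ℕ∞} :
    ContDiff ℝ n (trig S c) := by
  unfold trig
  fun_prop

@[fun_prop] lemma continuous_trig (S : Finset (Fin d → ℤ)) (c : (Fin d → ℤ) → ℂ) :
    Continuous (trig S c) := (contDiff_trig S c (n := 0)).continuous

lemma trig_add_right (S : Finset (Fin d → ℤ)) (c : (Fin d → ℤ) → ℂ) (x h : E d) :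
    trig S c (x + h) = trig S (fun ξ => c ξ * expo ξ h) x := by
  simp only [trig, expo_add]
  exact Finset.sum_congr rfl fun ξ _ => by ring

lemma trig_sub (S : Finset (Fin d → ℤ)) (c c' : (Fin d → ℤ) → ℂ) (x : E d) :
    trig S c x - trig S c' x = trig S (fun ξ => c ξ - c' ξ) x := by
  simp [trig, sub_mul]

lemma hasFDerivAt_trig (S : Finset (Fin d → ℤ)) (c : (Fin d → ℤ) → ℂ) (x : E d) :
    HasFDerivAt (trig S c)
      (∑ ξ ∈ S, c ξ • ((Complex.I * expo ξ x) • Complex.ofRealCLM.comp (pairL ξ))) x := by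
  have : trig S c = fun x => ∑ ξ ∈ S, c ξ * expo ξ x := rfl
  rw [this]
  exact HasFDerivAt.fun_sum fun ξ _ => (hasFDerivAt_expo ξ x).const_mul (c ξ)

lemma fderiv_trig (S : Finset (Fin d → ℤ)) (c : (Fin d → ℤ) → ℂ) (x v : E d) :
    fderiv ℝ (trig S c) x v = trig S (fun ξ => Complex.I * (pair ξ v : ℂ) * c ξ) x := by
  rw [(hasFDerivAt_trig S c x).fderiv]
  simp only [trig, sum_apply, smul_apply,
    ContinuousLinearMap.comp_apply, pairL_apply, Complex.ofRealCLM_apply, smul_eq_mul]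
  exact Finset.sum_congr rfl fun ξ _ => by ring

/-! ### Orthogonality, Parseval, Bessel and Fourier inversion -/

lemma integral_expo (ξ : Fin d → ℤ) :
    ∫ x, expo ξ x ∂(cellVol d) = if ξ = 0 then ((2 * Real.pi) ^ d : ℂ) else 0 := by
  split_ifs with h
  · subst h
    have : ∫ x : E d, expo 0 x ∂(cellVol d) = ∫ _, (1 : ℂ) ∂(cellVol d) := by
      simp [expo_zero_freq]
    rw [this, integral_cellVol, integral_cube, setIntegral_const]
    have h2 : {y : Fin d → ℝ | ∀ i, y i ∈ Set.Ioc ((0 : Fin d → ℝ) i) ((0 : Fin d → ℝ) i + 1)} =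
      Set.univ.pi fun _ => Set.Ioc 0 1 := by ext; simp
    rw [h2, Measure.real, Real.volume_pi_Ioc]
    simp
  · obtain ⟨j, hj⟩ := Function.ne_iff.1 h
    -- Translation by half a period in a direction with ξ j ≠ 0 multiplies the exponential by -1 and
    -- leaves the integral unchanged.
    have h1 := integral_cellVol_add (per_expo (d := d) ξ) ((Real.pi / ξ j) • dir j)
    simp only [expo_add] at h1
    rw [integral_mul_const] at h1
    have h2 : expo ξ ((Real.pi / ξ j) • dir j : E d) = -1 := by
      have : (ξ j : ℂ) ≠ 0 := by exact_mod_cast hj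
      rw [expo, pair_smul, pair_dir, ← Complex.exp_pi_mul_I]
      congr 1
      push_cast
      field_simp
    rw [h2] at h1
    have h3 : (2 : ℂ) * ∫ x, expo ξ x ∂(cellVol d) = 0 := by linear_combination -h1
    simpa using h3

lemma two_pi_pow_ne : ((2 * Real.pi) ^ d : ℂ) ≠ 0 := by
  have := Real.pi_pos.ne'
  exact pow_ne_zero _ (mul_ne_zero two_ne_zero (by exact_mod_cast this))

lemma integral_trig_mul_expo (S : Finset (Fin d → ℤ)) (c : (Fin d → ℤ) → ℂ) (η : Fin d → ℤ) :
    ∫ x, trig S c x * expo (-η) x ∂(cellVol d) =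
      if η ∈ S then ((2 * Real.pi) ^ d : ℂ) * c η else 0 := by
  have h : ∀ x, trig S c x * expo (-η) x = ∑ ξ ∈ S, c ξ * expo (ξ + -η) x := by
    intro x
    simp only [trig, Finset.sum_mul, expo_add_freq]
    exact Finset.sum_congr rfl fun ξ _ => by ring
  simp only [h]
  rw [integral_finsetSum _ fun ξ _ => integrable_cellVol (by fun_prop)]
  simp only [integral_const_mul, integral_expo, add_neg_eq_zero]
  simp [mul_comm]

lemma coeff_eq (φ : E d → ℝ) (ξ : Fin d → ℤ) : coeff φ ξ = ((2 * Real.pi) ^ d : ℂ)⁻¹ *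
    ∫ x, (φ x : ℂ) * expo (-ξ) x ∂(cellVol d) := by
  simp [coeff, exp_neg_pair]

lemma coeff_of_eq_trig {φ : E d → ℝ} {S : Finset (Fin d → ℤ)} {c : (Fin d → ℤ) → ℂ}
    (h : ∀ x, (φ x : ℂ) = trig S c x) (ξ : Fin d → ℤ) : coeff φ ξ = if ξ ∈ S then c ξ else 0 := by
  rw [coeff_eq]
  simp only [h, integral_trig_mul_expo]
  split_ifs
  · rw [← mul_assoc, inv_mul_cancel₀ two_pi_pow_ne, one_mul]
  · simp

lemma trig_congr {S : Finset (Fin d → ℤ)} {c c' : (Fin d → ℤ) → ℂ} (h : ∀ ξ ∈ S, c ξ = c' ξ)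
    (x : E d) : trig S c x = trig S c' x :=
  Finset.sum_congr rfl fun ξ hξ => by rw [h ξ hξ]

/-- A trigonometric polynomial is given by its Fourier coefficients. -/
lemma IsTrigPoly.eq_trig {N : ℕ} {φ : E d → ℝ} (h : IsTrigPoly N φ) (x : E d) :
    (φ x : ℂ) = trig (freqs d N) (coeff φ) x := by
  obtain ⟨c, hc⟩ := h
  change ∀ x, (φ x : ℂ) = trig (freqs d N) c x at hc
  rw [hc]
  exact trig_congr (fun ξ hξ => by rw [coeff_of_eq_trig hc, if_pos hξ]) x

/-- Parseval's identity for trigonometric polynomials. -/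
lemma integral_norm_sq_trig (S : Finset (Fin d → ℤ)) (c : (Fin d → ℤ) → ℂ) :
    ∫ x, ‖trig S c x‖ ^ 2 ∂(cellVol d) = (2 * Real.pi) ^ d * ∑ ξ ∈ S, ‖c ξ‖ ^ 2 := by
  have h : ∀ x, ((‖trig S c x‖ ^ 2 : ℝ) : ℂ) =
      ∑ η ∈ S, (starRingEnd ℂ) (c η) * (trig S c x * expo (-η) x) := by
    intro x
    rw [Complex.ofReal_pow, ← Complex.mul_conj', trig, map_sum, Finset.mul_sum]
    exact Finset.sum_congr rfl fun η _ => by rw [map_mul, conj_expo]; ring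
  have h2 : ((∫ x, ‖trig S c x‖ ^ 2 ∂(cellVol d) : ℝ) : ℂ) =
      ((2 * Real.pi) ^ d * ∑ ξ ∈ S, ‖c ξ‖ ^ 2 : ℝ) := by
    rw [← integral_complex_ofReal]
    simp only [h]
    rw [integral_finsetSum _ fun ξ _ => integrable_cellVol (by fun_prop)]
    simp only [integral_const_mul, integral_trig_mul_expo]
    push_cast
    rw [Finset.mul_sum]
    refine Finset.sum_congr rfl fun η hη => ?_
    rw [if_pos hη, ← Complex.mul_conj']
    ring
  exact_mod_cast h2

/-- Bessel's inequality. -/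
lemma sum_norm_coeff_sq_le {g : E d → ℝ} (hg : Continuous g) (S : Finset (Fin d → ℤ)) :
    (2 * Real.pi) ^ d * ∑ ξ ∈ S, ‖coeff g ξ‖ ^ 2 ≤ ∫ x, g x ^ 2 ∂(cellVol d) := by
  set T := trig S (coeff g) with hT
  -- Expand the nonnegative distance between g and its partial sum T: the cross term is -2 and ‖T‖²
  -- is +1 times the same sum of squared coefficients.
  have h1 : ∀ x, ‖(g x : ℂ) - T x‖ ^ 2 =
      g x ^ 2 - 2 * (∑ ξ ∈ S, (starRingEnd ℂ) (coeff g ξ) * ((g x : ℂ) * expo (-ξ) x)).re +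
        ‖T x‖ ^ 2 := by
    intro x
    have h2 : ∑ ξ ∈ S, (starRingEnd ℂ) (coeff g ξ) * ((g x : ℂ) * expo (-ξ) x) =
        (g x : ℂ) * (starRingEnd ℂ) (T x) := by
      rw [hT, trig, map_sum, Finset.mul_sum]
      exact Finset.sum_congr rfl fun η _ => by rw [map_mul, conj_expo]; ring
    rw [h2]
    rw [← Complex.normSq_eq_norm_sq, ← Complex.normSq_eq_norm_sq, Complex.normSq_sub]
    simp [Complex.normSq_apply]
    ring
  have h3 : 0 ≤ ∫ x, ‖(g x : ℂ) - T x‖ ^ 2 ∂(cellVol d) := integral_nonneg fun x => by positivity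
  have h4 : ∫ x, (∑ ξ ∈ S, (starRingEnd ℂ) (coeff g ξ) * ((g x : ℂ) * expo (-ξ) x)) ∂(cellVol d) =
      ((2 * Real.pi) ^ d * ∑ ξ ∈ S, ‖coeff g ξ‖ ^ 2 : ℝ) := by
    rw [integral_finsetSum _ fun ξ _ => integrable_cellVol (by fun_prop)]
    simp only [integral_const_mul]
    push_cast
    rw [Finset.mul_sum]
    refine Finset.sum_congr rfl fun η hη => ?_
    rw [← Complex.mul_conj']
    have : ∫ x, (g x : ℂ) * expo (-η) x ∂(cellVol d) = ((2 * Real.pi) ^ d : ℂ) * coeff g η := by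
      rw [coeff_eq, ← mul_assoc, mul_inv_cancel₀ two_pi_pow_ne, one_mul]
    rw [this]; ring
  have h5 := congrArg Complex.re h4
  rw [Complex.ofReal_re] at h5
  have h6 : (∫ x, (∑ ξ ∈ S, (starRingEnd ℂ) (coeff g ξ) * ((g x : ℂ) * expo (-ξ) x)) ∂(cellVol d)).re
      = ∫ x, (∑ ξ ∈ S, (starRingEnd ℂ) (coeff g ξ) * ((g x : ℂ) * expo (-ξ) x)).re
        ∂(cellVol d) := by
    have := integral_re (𝕜 := ℂ) (integrable_cellVol (d := d) (g := fun x =>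
      ∑ ξ ∈ S, (starRingEnd ℂ) (coeff g ξ) * ((g x : ℂ) * expo (-ξ) x)) (by fun_prop))
    simpa using this.symm
  rw [h6] at h5
  simp only [h1] at h3
  rw [integral_add (integrable_cellVol (by fun_prop)) (integrable_cellVol (by fun_prop)),
    integral_sub (integrable_cellVol (by fun_prop)) (integrable_cellVol (by fun_prop)),
    integral_const_mul, h5, hT, integral_norm_sq_trig] at h3
  linarith

lemma ofReal_fderiv {g : E d → ℝ} {x : E d} (hg : DifferentiableAt ℝ g x) (v : E d) :
    fderiv ℝ (fun x => (g x : ℂ)) x v = (fderiv ℝ g x v : ℂ) := by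
  have := (Complex.ofRealCLM.hasFDerivAt.comp x hg.hasFDerivAt).fderiv
  change fderiv ℝ (fun x => (g x : ℂ)) x = _ at this
  rw [this]; rfl

/-- The derivative of the periodic product g(x) e^{-iξ·x} has mean zero. -/
lemma coeff_fderiv {g : E d → ℝ} (hg : Per g) (hc : ContDiff ℝ 1 g) (v : E d) (ξ : Fin d → ℤ) :
    coeff (fun x => fderiv ℝ g x v) ξ = Complex.I * (pair ξ v : ℂ) * coeff g ξ := by
  have hper : Per fun x => (g x : ℂ) * expo (-ξ) x := fun j x => by
    have h1 := hg j x
    have h2 := per_expo (-ξ) j x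
    simp only [h1, h2]
  have h0 := integral_fderiv_eq_zero hper
    ((Complex.ofRealCLM.contDiff.comp hc).mul (contDiff_expo (-ξ))) v
  have h1 : ∀ x, fderiv ℝ (fun x => (g x : ℂ) * expo (-ξ) x) x v =
      (fderiv ℝ g x v : ℂ) * expo (-ξ) x +
        (-(Complex.I * (pair ξ v : ℂ))) * ((g x : ℂ) * expo (-ξ) x) := by
    intro x
    have hgd : DifferentiableAt ℝ g x := hc.differentiable one_ne_zero x
    have hgd' : DifferentiableAt ℝ (fun x => (g x : ℂ)) x :=
      Complex.ofRealCLM.differentiableAt.comp x hgd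
    rw [fderiv_fun_mul hgd' (hasFDerivAt_expo _ x).differentiableAt]
    simp only [add_apply, smul_apply, smul_eq_mul,
      (hasFDerivAt_expo _ x).fderiv, ofReal_fderiv hgd, ContinuousLinearMap.comp_apply,
      pairL_apply, Complex.ofRealCLM_apply, pair_neg_freq]
    push_cast
    ring
  simp only [h1] at h0
  have hcf : Continuous (fun x => fderiv ℝ g x v) := by
    have := hc.continuous_fderiv one_ne_zero
    fun_prop
  have hcg : Continuous g := hc.continuous
  rw [integral_add (integrable_cellVol (by fun_prop)) (integrable_cellVol (by fun_prop)),
    integral_const_mul] at h0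
  rw [coeff_eq, coeff_eq, eq_neg_of_add_eq_zero_left h0]
  ring

/-- Fourier inversion for continuous periodic functions with summable coefficients. -/
lemma hasSum_coeff {g : E d → ℝ} (hg : Per g) (hc : Continuous g) (hs : Summable (coeff g))
    (x : E d) : HasSum (fun ξ => coeff g ξ * expo ξ x) (g x : ℂ) := by
  have hpi : (0 : ℝ) < 2 * Real.pi := by positivity
  obtain ⟨G, hG⟩ := (hg.comp fun r : ℝ => (r : ℂ)).exists_lift
  -- The covering of the torus is a quotient map, so the lift of g is continuous and equals the sum
  -- of its Fourier series.
  have hq : IsQuotientMap (fun (y : Fin d → ℝ) => (fun i => (y i : UnitAddCircle))) :=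
    (IsOpenQuotientMap.piMap (f := fun (_ : Fin d) (y : ℝ) => (y : UnitAddCircle))
      fun _ => QuotientAddGroup.isOpenQuotientMap_mk).isQuotientMap
  have hGc : Continuous G := by
    rw [hq.continuous_iff]
    have : G ∘ (fun (y : Fin d → ℝ) => (fun i => (y i : UnitAddCircle))) =
      fun y => (g (WithLp.toLp 2 ((2 * Real.pi) • y)) : ℂ) := funext hG
    rw [this]
    have := PiLp.continuous_toLp 2 (fun _ : Fin d => ℝ)
    fun_prop
  have hf : ∀ (ξ : Fin d → ℤ) (y : Fin d → ℝ), UnitAddTorus.mFourier ξ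
      (fun i => (y i : UnitAddCircle)) = expo ξ (WithLp.toLp 2 ((2 * Real.pi) • y) : E d) := by
    intro ξ y
    simp only [UnitAddTorus.mFourier, ContinuousMap.coe_mk, fourier_coe_apply, expo, pair,
      ← Complex.exp_sum]
    congr 1
    push_cast
    rw [Finset.mul_sum]
    refine Finset.sum_congr rfl fun i _ => ?_
    simp
    ring
  have hcoef : ∀ ξ, UnitAddTorus.mFourierCoeff G ξ = coeff g ξ := by
    intro ξ
    rw [UnitAddTorus.mFourierCoeff_eq_integral G ξ 0, coeff_eq, integral_cellVol, integral_cube]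
    simp only [hf, hG, smul_eq_mul, Complex.real_smul]
    rw [← mul_assoc]
    push_cast
    rw [inv_mul_cancel₀ two_pi_pow_ne, one_mul]
    simp only [mul_comm]
  have := UnitAddTorus.hasSum_mFourier_series_apply_of_summable (f := ⟨G, hGc⟩)
    (by simpa [hcoef, funext hcoef] using hs)
    (fun i => (((2 * Real.pi)⁻¹ * x i : ℝ) : UnitAddCircle))
  simp only [ContinuousMap.coe_mk, hcoef, hf, hG, smul_eq_mul] at this
  have hx : WithLp.toLp 2 ((2 * Real.pi) • fun i => (2 * Real.pi)⁻¹ * x i) = x := by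
    ext i
    simp only [Pi.smul_apply, smul_eq_mul]
    field_simp
  rwa [hx] at this

end SVV

end

noncomputable section
namespace SVV

variable {d : ℕ}

/-! ### Real trigonometric polynomials -/

section RealTrig

variable {φ : E d → ℝ} {S : Finset (Fin d → ℤ)} {c : (Fin d → ℤ) → ℂ}

lemma contDiff_of_eq_trig (h : ∀ x, (φ x : ℂ) = trig S c x) {n : WithTop ℕ∞} :
    ContDiff ℝ n φ := by
  have : φ = fun x => (trig S c x).re := funext fun x => by rw [← h x, Complex.ofReal_re]
  rw [this]
  exact Complex.reCLM.contDiff.comp (contDiff_trig S c)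

lemma per_of_eq_trig (h : ∀ x, (φ x : ℂ) = trig S c x) : Per φ := fun j x => by
  have := per_trig S c j x
  rw [← h, ← h] at this
  exact_mod_cast this

lemma fderiv_of_eq_trig (h : ∀ x, (φ x : ℂ) = trig S c x) (x v : E d) :
    (fderiv ℝ φ x v : ℂ) = trig S (fun ξ => Complex.I * (pair ξ v : ℂ) * c ξ) x := by
  rw [← fderiv_trig, ← ofReal_fderiv ((contDiff_of_eq_trig h (n := 1)).differentiable one_ne_zero x)]
  simp only [h]

lemma integral_sq_of_eq_trig (h : ∀ x, (φ x : ℂ) = trig S c x) :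
    ∫ x, φ x ^ 2 ∂(cellVol d) = (2 * Real.pi) ^ d * ∑ ξ ∈ S, ‖c ξ‖ ^ 2 := by
  rw [← integral_norm_sq_trig]
  simp only [← h, Complex.norm_real, Real.norm_eq_abs, sq_abs]

end RealTrig

/-- The Laplacian. -/
def lap (φ : E d → ℝ) (x : E d) : ℝ :=
  ∑ j, fderiv ℝ (fun y => fderiv ℝ φ y (dir j)) x (dir j)

lemma lap_of_eq_trig {φ : E d → ℝ} {S : Finset (Fin d → ℤ)} {c : (Fin d → ℤ) → ℂ}
    (h : ∀ x, (φ x : ℂ) = trig S c x) (x : E d) :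
    (lap φ x : ℂ) = trig S (fun ξ => -((∑ j, (ξ j : ℝ) ^ 2 : ℝ) : ℂ) * c ξ) x := by
  have h1 := fun j => fderiv_of_eq_trig (fun x => fderiv_of_eq_trig h x (dir j)) x (dir j)
  simp only [lap, Complex.ofReal_sum, h1]
  simp only [trig]
  rw [Finset.sum_comm]
  refine Finset.sum_congr rfl fun ξ _ => ?_
  rw [← Finset.sum_mul]
  congr 1
  rw [neg_mul, Finset.sum_mul, ← Finset.sum_neg_distrib]
  refine Finset.sum_congr rfl fun j _ => ?_
  rw [pair_dir]
  push_cast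
  linear_combination ((ξ j : ℂ) ^ 2 * c ξ) * Complex.I_sq

/-! ### Convex entropies -/

/-- A convex `C²` function with its first two derivatives. -/
structure Entropy (η η' η'' : ℝ → ℝ) : Prop where
  deriv₁ : ∀ v, HasDerivAt η (η' v) v
  deriv₂ : ∀ v, HasDerivAt η' (η'' v) v
  cont : Continuous η''
  nonneg : ∀ v, 0 ≤ η'' v

namespace Entropy

variable {η η' η'' : ℝ → ℝ} (H : Entropy η η' η'')
include H

lemma contDiff' : ContDiff ℝ 1 η' :=
  contDiff_one_iff_deriv.2 ⟨fun v => (H.deriv₂ v).differentiableAt, by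
    rw [funext fun v => (H.deriv₂ v).deriv]; exact H.cont⟩

lemma continuous' : Continuous η' := H.contDiff'.continuous

lemma contDiff : ContDiff ℝ 1 η :=
  contDiff_one_iff_deriv.2 ⟨fun v => (H.deriv₁ v).differentiableAt, by
    rw [funext fun v => (H.deriv₁ v).deriv]; exact H.continuous'⟩

lemma continuous : Continuous η := H.contDiff.continuous

/-- Convexity in the form that meets the jumps of the Lévy operator: a = φ(x), b = φ(x + z). -/
lemma tangent (a b : ℝ) : η' a * (b - a) ≤ η b - η a := by
  have hm : Monotone η' := monotone_of_deriv_nonneg (fun v => (H.deriv₂ v).differentiableAt)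
    fun v => by rw [(H.deriv₂ v).deriv]; exact H.nonneg v
  rcases lt_trichotomy a b with h | rfl | h
  · obtain ⟨c, hc, h1⟩ := exists_hasDerivAt_eq_slope η η' h H.continuous.continuousOn
      fun v _ => H.deriv₁ v
    rw [eq_div_iff (sub_pos.2 h).ne'] at h1
    rw [← h1]
    exact mul_le_mul_of_nonneg_right (hm hc.1.le) (sub_pos.2 h).le
  · simp
  · obtain ⟨c, hc, h1⟩ := exists_hasDerivAt_eq_slope η η' h H.continuous.continuousOn
      fun v _ => H.deriv₁ v
    rw [eq_div_iff (sub_pos.2 h).ne'] at h1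
    nlinarith [hm hc.2.le]

/-- Diffusion dissipates convex entropies. -/
lemma integral_lap_le {φ : E d → ℝ} (hp : Per φ) (hc : ContDiff ℝ 2 φ) :
    ∫ x, η' (φ x) * lap φ x ∂(cellVol d) ≤ 0 := by
  have hc1 : ∀ v : E d, ContDiff ℝ 1 fun x => fderiv ℝ φ x v := fun v =>
    (hc.fderiv_right (m := 1) (by norm_num)).clm_apply contDiff_const
  have hφ : ContDiff ℝ 1 φ := hc.of_le (by norm_num)
  have hη : ContDiff ℝ 1 fun x => η' (φ x) := H.contDiff'.comp hφ
  have hη0 := H.cont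
  have hφ0 := hφ.continuous
  have hη0' := hη.continuous
  have key : ∀ j : Fin d, ∫ x, η' (φ x) * fderiv ℝ (fun y => fderiv ℝ φ y (dir j)) x (dir j)
      ∂(cellVol d) ≤ 0 := by
    intro j
    have hper : Per fun x => η' (φ x) * fderiv ℝ φ x (dir j) := fun k x => by
      simp only [hp k x, hp.fderiv k x]
    have h0 := integral_fderiv_eq_zero hper (hη.mul (hc1 (dir j))) (dir j)
    have h1 : ∀ x, fderiv ℝ (fun x => η' (φ x) * fderiv ℝ φ x (dir j)) x (dir j) =
        η' (φ x) * fderiv ℝ (fun y => fderiv ℝ φ y (dir j)) x (dir j) +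
          η'' (φ x) * (fderiv ℝ φ x (dir j)) ^ 2 := by
      intro x
      have h2 : HasFDerivAt (fun x => η' (φ x)) (η'' (φ x) • fderiv ℝ φ x) x :=
        (H.deriv₂ (φ x)).comp_hasFDerivAt x (hφ.differentiable one_ne_zero x).hasFDerivAt
      have h3 := ((hc1 (dir j)).differentiable one_ne_zero x).hasFDerivAt
      rw [(h2.fun_mul h3).fderiv]
      simp only [add_apply, smul_apply, smul_eq_mul]
      ring
    simp only [h1] at h0
    have hd1 := (hc1 (dir j)).continuous
    have hd2 : Continuous fun x => fderiv ℝ (fun y => fderiv ℝ φ y (dir j)) x (dir j) :=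
      ((hc1 (dir j)).continuous_fderiv one_ne_zero).clm_apply continuous_const
    have hd3 : Continuous fun x =>
        η' (φ x) * fderiv ℝ (fun y => fderiv ℝ φ y (dir j)) x (dir j) := hη0'.mul hd2
    rw [integral_add (integrable_cellVol hd3) (integrable_cellVol (by fun_prop))] at h0
    have h4 : 0 ≤ ∫ x, η'' (φ x) * (fderiv ℝ φ x (dir j)) ^ 2 ∂(cellVol d) :=
      integral_nonneg fun x => mul_nonneg (H.nonneg _) (sq_nonneg _)
    linarith
  simp only [lap, Finset.mul_sum]
  have hd2 : ∀ j : Fin d, Continuous fun x => fderiv ℝ (fun y => fderiv ℝ φ y (dir j)) x (dir j) :=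
    fun j => ((hc1 (dir j)).continuous_fderiv one_ne_zero).clm_apply continuous_const
  have hd3 : ∀ j : Fin d, Continuous fun x =>
      η' (φ x) * fderiv ℝ (fun y => fderiv ℝ φ y (dir j)) x (dir j) := fun j => hη0'.mul (hd2 j)
  rw [integral_finsetSum _ fun j _ => integrable_cellVol (hd3 j)]
  exact Finset.sum_nonpos fun j _ => key j

end Entropy

/-! ### The Lévy operator -/

/-- The integrand of the symbol of the Lévy operator. -/
def levyKer (ξ : Fin d → ℤ) (z : E d) : ℂ :=
  expo ξ z - 1 - Set.indicator (Metric.ball 0 1) (fun z => Complex.I * (pair ξ z : ℂ)) z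

/-- The symbol of the Lévy operator. -/
def levySymbol (μ : Measure (E d)) (ξ : Fin d → ℤ) : ℂ := ∫ z in ({0}ᶜ : Set (E d)), levyKer ξ z ∂μ

/-- Inside the unit ball the compensator leaves a second-order Taylor remainder (crude bounds
suffice if |ξ·z| ≥ 1); outside it the kernel is at most 2. Integrability against a Lévy measure
follows. -/
lemma norm_levyKer_le (ξ : Fin d → ℤ) (z : E d) :
    ‖levyKer ξ z‖ ≤ (2 * ‖pairL (d := d) ξ‖ ^ 2 + 2) * min (‖z‖ ^ 2) 1 := by
  have hp : |pair ξ z| ≤ ‖pairL (d := d) ξ‖ * ‖z‖ := (pairL ξ).le_opNorm z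
  rw [levyKer]
  by_cases hz : z ∈ Metric.ball (0 : E d) 1
  · have hz1 : ‖z‖ < 1 := by simpa using hz
    have hmin : min (‖z‖ ^ 2) 1 = ‖z‖ ^ 2 := min_eq_left (by nlinarith [norm_nonneg z])
    rw [Set.indicator_of_mem hz, hmin]
    have h1 : ‖expo ξ z - 1 - Complex.I * (pair ξ z : ℂ)‖ ≤ 2 * |pair ξ z| ^ 2 := by
      rcases le_total |pair ξ z| 1 with h | h
      · have := Complex.norm_exp_sub_one_sub_id_le (x := Complex.I * (pair ξ z : ℂ)) (by simpa using h)
        have h2 : ‖expo ξ z - 1 - Complex.I * (pair ξ z : ℂ)‖ ≤ |pair ξ z| ^ 2 := by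
          simpa [expo] using this
        nlinarith [sq_nonneg (pair ξ z), sq_abs (pair ξ z)]
      · have h2 := norm_sub_le (expo ξ z - 1) (Complex.I * (pair ξ z : ℂ))
        have h3 : ‖expo ξ z - 1‖ ≤ |pair ξ z| := Real.norm_exp_I_mul_ofReal_sub_one_le
        have h4 : ‖Complex.I * (pair ξ z : ℂ)‖ = |pair ξ z| := by simp
        nlinarith
    have h5 : |pair ξ z| ^ 2 ≤ ‖pairL (d := d) ξ‖ ^ 2 * ‖z‖ ^ 2 := by
      rw [← mul_pow]; gcongr
    nlinarith [sq_nonneg ‖z‖]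
  · have hz1 : 1 ≤ ‖z‖ := by simpa using hz
    have hmin : min (‖z‖ ^ 2) 1 = 1 := min_eq_right (by nlinarith [norm_nonneg z])
    rw [Set.indicator_of_notMem hz, hmin, sub_zero, mul_one]
    have := norm_sub_le (expo ξ z) 1
    rw [norm_expo, norm_one] at this
    nlinarith [sq_nonneg ‖pairL (d := d) ξ‖]

lemma measurable_levyKer (ξ : Fin d → ℤ) : Measurable (levyKer ξ : E d → ℂ) := by
  have h1 : Measurable (pair ξ : E d → ℝ) := (pairL ξ).continuous.measurable
  refine ((continuous_expo ξ).measurable.sub_const 1).sub (Measurable.indicator ?_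
    Metric.isOpen_ball.measurableSet)
  exact measurable_const.mul (Complex.measurable_ofReal.comp h1)

variable {μ : Measure (E d)}

lemma IsLevy.integrable (hμ : IsLevy μ) (ξ : Fin d → ℤ) :
    Integrable (levyKer ξ) (μ.restrict {0}ᶜ) :=
  (hμ.const_mul _).mono' (measurable_levyKer ξ).aestronglyMeasurable
    (Eventually.of_forall fun z => norm_levyKer_le ξ z)

/-- Off the origin min(|z|², 1) is integrable and strictly positive, so its superlevel sets exhaust
the space by sets of finite measure. Fubini in the Lévy entropy inequality rests on this. -/
lemma IsLevy.sigmaFinite (hμ : IsLevy μ) : SigmaFinite (μ.restrict ({0}ᶜ : Set (E d))) := by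
  have h1 : AEFinStronglyMeasurable (fun z : E d => min (‖z‖ ^ 2) 1) (μ.restrict {0}ᶜ) :=
    Integrable.aefinStronglyMeasurable hμ
  obtain ⟨t, ht, h2, h3⟩ := h1.exists_set_sigmaFinite
  have h4 : ∀ᵐ z ∂(μ.restrict ({0}ᶜ : Set (E d))), z ∈ t := by
    have h5 := (ae_restrict_iff' ht.compl).1 h2
    have h6 : ∀ᵐ z ∂(μ.restrict ({0}ᶜ : Set (E d))), z ∈ ({0}ᶜ : Set (E d)) :=
      ae_restrict_mem (measurableSet_singleton 0).compl
    filter_upwards [h5, h6] with z h5 h6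
    by_contra hz
    have h7 := h5 hz
    have h8 : 0 < ‖z‖ := norm_pos_iff.2 h6
    have h9 : 0 < min (‖z‖ ^ 2) 1 := lt_min (by positivity) one_pos
    exact h9.ne' h7
  rwa [Measure.restrict_eq_self_of_ae_mem h4] at h3

/-- The compensator is purely imaginary, so the real part of the kernel is cos(ξ·z) - 1. -/
lemma re_levySymbol_nonpos (hμ : IsLevy μ) (ξ : Fin d → ℤ) : (levySymbol μ ξ).re ≤ 0 := by
  have h1 := integral_re (𝕜 := ℂ) (hμ.integrable ξ)
  have h2 : (levySymbol μ ξ).re = ∫ z in ({0}ᶜ : Set (E d)), (levyKer ξ z).re ∂μ := by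
    simpa [levySymbol] using h1.symm
  rw [h2]
  refine integral_nonpos fun z => ?_
  have h3 : (levyKer ξ z).re = (expo ξ z).re - 1 := by
    by_cases hz : z ∈ Metric.ball (0 : E d) 1
    · simp [levyKer, Set.indicator_of_mem hz]
    · simp [levyKer, Set.indicator_of_notMem hz]
  have h4 : (expo ξ z).re ≤ 1 := (Complex.re_le_norm _).trans_eq (norm_expo ξ z)
  simp only [h3, Pi.zero_apply]
  linarith

section

variable {φ : E d → ℝ} {S : Finset (Fin d → ℤ)} {c : (Fin d → ℤ) → ℂ}

lemma levy_integrand (h : ∀ x, (φ x : ℂ) = trig S c x) (x z : E d) :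
    ((φ (x + z) - φ x - Set.indicator (Metric.ball 0 1) (fun z => fderiv ℝ φ x z) z : ℝ) : ℂ) =
      ∑ ξ ∈ S, c ξ * expo ξ x * levyKer ξ z := by
  have h1 : ((Set.indicator (Metric.ball 0 1) (fun z => fderiv ℝ φ x z) z : ℝ) : ℂ) =
      ∑ ξ ∈ S, c ξ * expo ξ x *
        Set.indicator (Metric.ball 0 1) (fun z => Complex.I * (pair ξ z : ℂ)) z := by
    by_cases hz : z ∈ Metric.ball (0 : E d) 1
    · simp only [Set.indicator_of_mem hz]
      rw [fderiv_of_eq_trig h, trig]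
      exact Finset.sum_congr rfl fun ξ _ => by ring
    · simp only [Set.indicator_of_notMem hz]
      simp
  rw [Complex.ofReal_sub, Complex.ofReal_sub, h, h, h1]
  simp only [levyKer, trig, expo_add, ← Finset.sum_sub_distrib]
  exact Finset.sum_congr rfl fun ξ _ => by ring

/-- On trigonometric polynomials the Lévy operator is a Fourier multiplier. -/
lemma levy_of_eq_trig (hμ : IsLevy μ) (h : ∀ x, (φ x : ℂ) = trig S c x) (x : E d) :
    (levy μ φ x : ℂ) = trig S (fun ξ => levySymbol μ ξ * c ξ) x := by
  rw [levy, ← integral_complex_ofReal]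
  simp only [levy_integrand h]
  rw [integral_finsetSum _ fun ξ _ => (hμ.integrable ξ).const_mul _]
  simp only [integral_const_mul, trig, levySymbol]
  exact Finset.sum_congr rfl fun ξ _ => by ring

/-- The Lévy operator dissipates convex entropies. -/
lemma Entropy.integral_levy_le {η η' η'' : ℝ → ℝ} (H : Entropy η η' η'') (hμ : IsLevy μ)
    (h : ∀ x, (φ x : ℂ) = trig S c x) : ∫ x, η' (φ x) * levy μ φ x ∂(cellVol d) ≤ 0 := by
  have hsf := hμ.sigmaFinite
  have hφ : ContDiff ℝ 1 φ := contDiff_of_eq_trig h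
  have hφ0 := hφ.continuous
  have hp := per_of_eq_trig h
  have hη := H.continuous'
  have hη0 := H.continuous
  set f : E d → E d → ℝ := fun x z => η' (φ x) *
    (φ (x + z) - φ x - Set.indicator (Metric.ball 0 1) (fun z => fderiv ℝ φ x z) z) with hf
  have hfe : Function.uncurry f =
      fun p => (∑ ξ ∈ S, (η' (φ p.1) * (c ξ * expo ξ p.1)) * levyKer ξ p.2).re := by
    ext p
    rw [← Complex.ofReal_re (Function.uncurry f p)]
    congr 1
    simp only [Function.uncurry, hf]
    rw [Complex.ofReal_mul, levy_integrand h, Finset.mul_sum]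
    exact Finset.sum_congr rfl fun ξ _ => by ring
  have hint : Integrable (Function.uncurry f) ((cellVol d).prod (μ.restrict {0}ᶜ)) := by
    rw [hfe]
    exact (integrable_finsetSum S fun ξ _ => Integrable.mul_prod
      (f := fun x => (η' (φ x) : ℂ) * (c ξ * expo ξ x))
      (integrable_cellVol (by fun_prop)) (hμ.integrable ξ)).re
  have hsw := integral_integral_swap hint
  have h1 : ∫ x, η' (φ x) * levy μ φ x ∂(cellVol d) =
      ∫ x, ∫ z, f x z ∂(μ.restrict {0}ᶜ) ∂(cellVol d) := by
    simp only [hf, integral_const_mul, levy]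
  rw [h1, hsw]
  refine integral_nonpos fun z => ?_
  -- After Fubini z is fixed. The tangent inequality bounds the integrand by an increment of η∘φ
  -- minus a directional derivative of η∘φ, and both have mean zero by periodicity.
  have hs : ∀ x, f x z ≤ (η (φ (x + z)) - η (φ x)) -
      Set.indicator (Metric.ball (0 : E d) 1) (fun _ => (1 : ℝ)) z *
        fderiv ℝ (fun x => η (φ x)) x z := by
    intro x
    have h2 : HasFDerivAt (fun x => η (φ x)) (η' (φ x) • fderiv ℝ φ x) x :=
      (H.deriv₁ (φ x)).comp_hasFDerivAt x (hφ.differentiable one_ne_zero x).hasFDerivAt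
    have h3 := H.tangent (φ x) (φ (x + z))
    rw [h2.fderiv]
    by_cases hz : z ∈ Metric.ball (0 : E d) 1
    · simp only [hf, Set.indicator_of_mem hz, smul_apply, smul_eq_mul]
      linarith
    · simp only [hf, Set.indicator_of_notMem hz]
      linarith
  have hηφ : ContDiff ℝ 1 fun x => η (φ x) := H.contDiff.comp hφ
  have hdc : Continuous fun x => fderiv ℝ (fun x => η (φ x)) x z :=
    (hηφ.continuous_fderiv one_ne_zero).clm_apply continuous_const
  have hdc' : Continuous fun x => fderiv ℝ φ x z :=
    (hφ.continuous_fderiv one_ne_zero).clm_apply continuous_const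
  have hfc : Continuous fun x => f x z := by
    simp only [hf]
    by_cases hz : z ∈ Metric.ball (0 : E d) 1
    · simp only [Set.indicator_of_mem hz]; fun_prop
    · simp only [Set.indicator_of_notMem hz]; fun_prop
  have hper : Per fun x => η (φ x) := hp.comp η
  have h4 := integral_mono (integrable_cellVol hfc) (integrable_cellVol (by fun_prop)) hs
  rw [integral_sub (integrable_cellVol (by fun_prop)) (integrable_cellVol (by fun_prop)),
    integral_sub (integrable_cellVol (by fun_prop)) (integrable_cellVol (by fun_prop)),
    integral_const_mul, integral_cellVol_add hper, integral_fderiv_eq_zero hper hηφ] at h4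
  simpa using h4

end

end SVV

end

noncomputable section
namespace SVV

variable {d : ℕ}

/-! ### Iterated directional derivatives and interpolation inequalities -/

/-- The derivative in the direction `dir j`. -/
def dD (j : Fin d) (g : E d → ℝ) (x : E d) : ℝ := fderiv ℝ g x (dir j)

lemma contDiff_dD (j : Fin d) {g : E d → ℝ} {n : ℕ} (hg : ContDiff ℝ (n + 1 : ℕ) g) :
    ContDiff ℝ n (dD j g) :=
  (hg.fderiv_right (m := n) (by norm_cast)).clm_apply contDiff_const

lemma contDiff_dD_iterate (j : Fin d) (i : ℕ) : ∀ {g : E d → ℝ} {n : ℕ},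
    ContDiff ℝ (n + i : ℕ) g → ContDiff ℝ n ((dD j)^[i] g) := by
  induction i with
  | zero => intro g n hg; exact hg
  | succ i ih => intro g n hg; exact ih (contDiff_dD j (by exact_mod_cast hg))

lemma per_dD_iterate (j : Fin d) (i : ℕ) : ∀ {g : E d → ℝ}, Per g → Per ((dD j)^[i] g) := by
  induction i with
  | zero => intro g hg; exact hg
  | succ i ih =>
    intro g hg
    exact ih (hg.fderiv.comp fun L : E d →L[ℝ] ℝ => L (dir j))

lemma dD_iterate_succ (j : Fin d) (i : ℕ) (g : E d → ℝ) (x : E d) :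
    (dD j)^[i + 1] g x = fderiv ℝ ((dD j)^[i] g) x (dir j) := by
  rw [Function.iterate_succ_apply']; rfl

lemma dD_iterate_const_mul (j : Fin d) (i : ℕ) (a : ℝ) {g : E d → ℝ} (hg : ContDiff ℝ (⊤ : ℕ∞) g)
    (x : E d) : (dD j)^[i] (fun x => a * g x) x = a * (dD j)^[i] g x := by
  induction i generalizing x with
  | zero => rfl
  | succ i ih =>
    rw [dD_iterate_succ, dD_iterate_succ, funext ih, fderiv_const_mul]
    · rfl
    · have : ContDiff ℝ 1 ((dD j)^[i] g) :=
        contDiff_dD_iterate (n := 1) j i (hg.of_le (by exact_mod_cast le_top))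
      exact this.differentiable one_ne_zero x

/-- Reduces directional derivatives to one variable, where the bound for iterated derivatives of a
composition is applied. -/
lemma iteratedDeriv_line (j : Fin d) {g : E d → ℝ} (x : E d) (i : ℕ) (hg : ContDiff ℝ i g) (τ : ℝ) :
    iteratedDeriv i (fun τ : ℝ => g (x + τ • dir j)) τ = (dD j)^[i] g (x + τ • dir j) := by
  induction i generalizing τ with
  | zero => simp
  | succ i ih =>
    rw [iteratedDeriv_succ, funext fun τ => ih (hg.of_le (by norm_cast; omega)) τ,
      dD_iterate_succ]
    have h1 : HasDerivAt (fun τ : ℝ => x + τ • (dir j : E d)) (dir j) τ := by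
      simpa using ((hasDerivAt_id τ).smul_const (dir j : E d)).const_add x
    have h2 : ContDiff ℝ 1 ((dD j)^[i] g) :=
      contDiff_dD_iterate (n := 1) j i (by rw [add_comm]; exact hg)
    exact (((h2.differentiable one_ne_zero _).hasFDerivAt).comp_hasDerivAt τ h1).deriv

/-! ### Gagliardo–Nirenberg interpolation and the Moser estimate -/

lemma hasDerivAt_abs_rpow_mul_self {q : ℝ} (hq : 0 < q) (v : ℝ) :
    HasDerivAt (fun v : ℝ => |v| ^ q * v) ((q + 1) * |v| ^ q) v := by
  rcases lt_trichotomy v 0 with hv | rfl | hv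
  · have h1 : HasDerivAt (fun v : ℝ => -(-v) ^ (q + 1)) ((q + 1) * |v| ^ q) v := by
      have := ((hasDerivAt_id v).neg.rpow_const (p := q + 1) (Or.inl (by simpa using hv.ne))).neg
      refine this.congr_deriv ?_
      rw [abs_of_neg hv, add_sub_cancel_right]
      simp
      ring
    refine h1.congr_of_eventuallyEq ?_
    filter_upwards [eventually_lt_nhds hv] with w hw
    rw [abs_of_neg hw, Real.rpow_add (by linarith), Real.rpow_one]
    ring
  · rw [hasDerivAt_iff_tendsto_slope_zero]
    have h1 : Tendsto (fun t : ℝ => |t| ^ q) (𝓝[≠] 0) (𝓝 ((q + 1) * |(0 : ℝ)| ^ q)) := by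
      have h2 : Continuous fun t : ℝ => |t| ^ q := continuous_abs.rpow_const fun _ => Or.inr hq.le
      have := h2.tendsto 0
      simp only [abs_zero, Real.zero_rpow hq.ne', mul_zero] at this ⊢
      exact this.mono_left nhdsWithin_le_nhds
    refine h1.congr' ?_
    filter_upwards [self_mem_nhdsWithin] with t ht
    have ht : t ≠ 0 := ht
    simp
    field_simp
  · have h1 : HasDerivAt (fun v : ℝ => v ^ (q + 1)) ((q + 1) * |v| ^ q) v := by
      have := (hasDerivAt_id v).rpow_const (p := q + 1) (Or.inl hv.ne')
      refine this.congr_deriv ?_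
      rw [abs_of_pos hv, add_sub_cancel_right]
      simp
    refine h1.congr_of_eventuallyEq ?_
    filter_upwards [eventually_gt_nhds hv] with w hw
    rw [abs_of_pos hw, Real.rpow_add hw, Real.rpow_one]

/-- Compare z with l·max(x, y). If z is smaller, each of the c ≥ 1 factors of z gains a factor l;
otherwise x and y are both at most z/l. -/
lemma young_pow {x y z l : ℝ} (hx : 0 ≤ x) (hy : 0 ≤ y) (hz : 0 ≤ z) (hl : 0 < l) (hl1 : l ≤ 1)
    {a b c n : ℕ} (hc : c ≠ 0) (hn : a + b + c = n) :
    x ^ a * y ^ b * z ^ c ≤ l * (x ^ n + y ^ n) + (l⁻¹ * z) ^ n := by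
  set M := max x y with hM
  have hM0 : 0 ≤ M := le_max_of_le_left hx
  have h1 : x ^ a * y ^ b ≤ M ^ (a + b) := by
    rw [pow_add]
    gcongr
    · exact le_max_left _ _
    · exact le_max_right _ _
  have h2 : M ^ n ≤ x ^ n + y ^ n := by
    rcases max_cases x y with h | h
    · rw [hM, h.1]; exact le_add_of_nonneg_right (by positivity)
    · rw [hM, h.1]; exact le_add_of_nonneg_left (by positivity)
  rcases le_total z (l * M) with h | h
  · calc x ^ a * y ^ b * z ^ c ≤ M ^ (a + b) * (l * M) ^ c := by gcongr
      _ = l ^ c * M ^ n := by rw [← hn]; ring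
      _ ≤ l * M ^ n := by gcongr; exact pow_le_of_le_one hl.le hl1 hc
      _ ≤ l * (x ^ n + y ^ n) := by gcongr
      _ ≤ _ := le_add_of_nonneg_right (by positivity)
  · have h3 : M ≤ l⁻¹ * z := by rw [le_inv_mul_iff₀ hl]; exact h
    have h4 : z ≤ l⁻¹ * z := le_mul_of_one_le_left hz ((one_le_inv₀ hl).2 hl1)
    calc x ^ a * y ^ b * z ^ c ≤ (l⁻¹ * z) ^ (a + b) * (l⁻¹ * z) ^ c := by
          gcongr; exact h1.trans (by gcongr)
      _ = (l⁻¹ * z) ^ n := by rw [← hn]; ring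
      _ ≤ _ := le_add_of_nonneg_left (by positivity)

/-- `|∂_j^i φ|^{1/i}`, and `0` for `i = 0`. -/
def rootD (j : Fin d) (φ : E d → ℝ) (i : ℕ) (x : E d) : ℝ :=
  if i = 0 then 0 else |(dD j)^[i] φ x| ^ ((i : ℝ)⁻¹)

lemma rootD_nonneg (j : Fin d) (φ : E d → ℝ) (i : ℕ) (x : E d) : 0 ≤ rootD j φ i x := by
  unfold rootD; split_ifs <;> positivity

lemma rootD_pow (j : Fin d) (φ : E d → ℝ) {i : ℕ} (hi : i ≠ 0) (x : E d) :
    rootD j φ i x ^ i = |(dD j)^[i] φ x| := by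
  rw [rootD, if_neg hi, Real.rpow_inv_natCast_pow (abs_nonneg _) hi]

lemma continuous_rootD (j : Fin d) {φ : E d → ℝ} (hφ : ContDiff ℝ (⊤ : ℕ∞) φ) (i : ℕ) :
    Continuous (rootD j φ i) := by
  unfold rootD
  split_ifs with h
  · exact continuous_const
  · have : ContDiff ℝ 0 ((dD j)^[i] φ) :=
      contDiff_dD_iterate (n := 0) j i (hφ.of_le (by exact_mod_cast le_top))
    exact this.continuous.abs.rpow_const fun _ => Or.inr (by positivity)

/-- With r_i = |∂_j^i φ|^{1/i}, integrating ∂_j(∂^{i-1}φ |∂^iφ|^q ∂^iφ) gives ∫ r_i^{2s} = -(q+1) ∫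
∂^{i-1}φ |∂^iφ|^q ∂^{i+1}φ. The last integrand has total degree (i-1) + (2s-2i) + (i+1) = 2s in the
r's, so Young's inequality applies; q + 1 ≤ 2s explains the constant. -/
lemma integral_rootD_step (j : Fin d) {φ : E d → ℝ} (hp : Per φ) (hφ : ContDiff ℝ (⊤ : ℕ∞) φ)
    (h1 : ∀ x, |φ x| ≤ 1) {s i : ℕ} (hi : 1 ≤ i) (his : i < s) {l : ℝ} (hl : 0 < l) (hl1 : l ≤ 1) :
    ∫ x, rootD j φ i x ^ (2 * s) ∂(cellVol d) ≤
      2 * s * (l * (∫ x, rootD j φ (i - 1) x ^ (2 * s) ∂(cellVol d) +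
        ∫ x, rootD j φ i x ^ (2 * s) ∂(cellVol d)) +
        (l⁻¹) ^ (2 * s) * ∫ x, rootD j φ (i + 1) x ^ (2 * s) ∂(cellVol d)) := by
  obtain ⟨k, rfl⟩ : ∃ k, i = k + 1 := ⟨i - 1, by omega⟩
  simp only [Nat.add_sub_cancel]
  have hs0 : 0 < s := by omega
  have hkpos : (0 : ℝ) < (k + 1 : ℕ) := by positivity
  -- Chosen so that |∂^{k+1}φ|^{q+2} is the power 2s of the root; k + 1 < s makes it positive.
  set q : ℝ := 2 * s / (k + 1 : ℕ) - 2 with hq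
  have hks : ((k + 1 : ℕ) : ℝ) < s := by exact_mod_cast his
  have hq0 : 0 < q := by
    rw [hq, sub_pos, lt_div_iff₀ hkpos]; linarith
  have hqs : q + 1 ≤ 2 * s := by
    have : 2 * (s : ℝ) / (k + 1 : ℕ) ≤ 2 * s := div_le_self (by positivity) (by
      exact_mod_cast Nat.succ_le_succ (Nat.zero_le k))
    linarith
  have hcd : ∀ n, ContDiff ℝ 1 ((dD j)^[n] φ) := fun n =>
    contDiff_dD_iterate (n := 1) j n (hφ.of_le (by exact_mod_cast le_top))
  have hcc : ∀ n, Continuous ((dD j)^[n] φ) := fun n => (hcd n).continuous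
  have hpow : ∀ x, |(dD j)^[k + 1] φ x| ^ q = rootD j φ (k + 1) x ^ (2 * s - 2 * (k + 1)) := by
    intro x
    rw [rootD, if_neg (by omega), ← Real.rpow_mul_natCast (abs_nonneg _)]
    congr 1
    rw [hq, Nat.cast_sub (by omega)]
    push_cast
    field_simp
  have hψ : ContDiff ℝ 1 fun v : ℝ => |v| ^ q * v := by
    rw [contDiff_one_iff_deriv]
    refine ⟨fun v => (hasDerivAt_abs_rpow_mul_self hq0 v).differentiableAt, ?_⟩
    rw [funext fun v => (hasDerivAt_abs_rpow_mul_self hq0 v).deriv]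
    exact continuous_const.mul (continuous_abs.rpow_const fun _ => Or.inr hq0.le)
  have hψc : ContDiff ℝ 1 fun x => |(dD j)^[k + 1] φ x| ^ q * (dD j)^[k + 1] φ x :=
    hψ.comp (hcd (k + 1))
  have hper : Per fun x => (dD j)^[k] φ x * (|(dD j)^[k + 1] φ x| ^ q * (dD j)^[k + 1] φ x) :=
    fun m x => by simp only [per_dD_iterate j _ hp m x]
  have hder : ∀ x, fderiv ℝ (fun x => (dD j)^[k] φ x *
      (|(dD j)^[k + 1] φ x| ^ q * (dD j)^[k + 1] φ x)) x (dir j) =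
      rootD j φ (k + 1) x ^ (2 * s) +
        (q + 1) * ((dD j)^[k] φ x * |(dD j)^[k + 1] φ x| ^ q * (dD j)^[k + 2] φ x) := by
    intro x
    have h2 := ((hcd k).differentiable one_ne_zero x).hasFDerivAt
    have h3 := (hasDerivAt_abs_rpow_mul_self hq0 ((dD j)^[k + 1] φ x)).comp_hasFDerivAt x
      ((hcd (k + 1)).differentiable one_ne_zero x).hasFDerivAt
    have h4 := (h2.fun_mul h3).fderiv
    simp only [Function.comp_def] at h4
    rw [h4]
    simp only [add_apply, smul_apply, smul_eq_mul, ← dD_iterate_succ]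
    have h5 : rootD j φ (k + 1) x ^ (2 * s) =
        |(dD j)^[k + 1] φ x| ^ q * ((dD j)^[k + 1] φ x * (dD j)^[k + 1] φ x) := by
      rw [hpow, ← abs_mul_abs_self, ← rootD_pow j φ (Nat.succ_ne_zero k) x, ← pow_add, ← pow_add]
      congr 1
      omega
    rw [h5]
    ring
  have h0 := integral_fderiv_eq_zero hper ((hcd k).mul hψc) (dir j)
  simp only [hder] at h0
  have hr := fun n => continuous_rootD j hφ n
  have hqc : Continuous fun x => |(dD j)^[k + 1] φ x| ^ q :=
    (hcc (k + 1)).abs.rpow_const fun _ => Or.inr hq0.le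
  have hmc : Continuous fun x =>
      (dD j)^[k] φ x * |(dD j)^[k + 1] φ x| ^ q * (dD j)^[k + 2] φ x :=
    ((hcc k).mul hqc).mul (hcc (k + 2))
  have hrp : ∀ n, Continuous fun x => rootD j φ n x ^ (2 * s) := fun n => (hr n).pow _
  rw [integral_add (integrable_cellVol (hrp (k + 1))) (integrable_cellVol (by fun_prop)),
    integral_const_mul] at h0
  have hpt : ∀ x, -((dD j)^[k] φ x * |(dD j)^[k + 1] φ x| ^ q * (dD j)^[k + 2] φ x) ≤
      l * (rootD j φ k x ^ (2 * s) + rootD j φ (k + 1) x ^ (2 * s)) +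
        (l⁻¹) ^ (2 * s) * rootD j φ (k + 2) x ^ (2 * s) := by
    intro x
    -- For k = 0 the right side is 0^0 = 1, and this is where |φ| ≤ 1 enters.
    have hk0 : |(dD j)^[k] φ x| ≤ rootD j φ k x ^ k := by
      rcases Nat.eq_zero_or_pos k with rfl | hk
      · simpa using h1 x
      · exact (rootD_pow j φ hk.ne' x).ge
    have h6 := young_pow (rootD_nonneg j φ k x) (rootD_nonneg j φ (k + 1) x)
      (rootD_nonneg j φ (k + 2) x) hl hl1 (a := k) (b := 2 * s - 2 * (k + 1)) (c := k + 2)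
      (n := 2 * s) (by omega) (by omega)
    rw [mul_pow] at h6
    refine le_trans ?_ h6
    refine (neg_le_abs _).trans ?_
    rw [abs_mul, abs_mul, ← rootD_pow j φ (by omega : k + 2 ≠ 0) x, hpow,
      abs_of_nonneg (pow_nonneg (rootD_nonneg _ _ _ _) _)]
    have := rootD_nonneg j φ (k + 1) x
    have := rootD_nonneg j φ (k + 2) x
    gcongr
  have h7 := integral_mono (integrable_cellVol (by fun_prop)) (integrable_cellVol (by fun_prop)) hpt
  rw [integral_add (integrable_cellVol (by fun_prop)) (integrable_cellVol (by fun_prop)),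
    integral_const_mul, integral_const_mul,
    integral_add (integrable_cellVol (hrp k)) (integrable_cellVol (hrp (k + 1)))] at h7
  have h8 : ∫ x, -((dD j)^[k] φ x * |(dD j)^[k + 1] φ x| ^ q * (dD j)^[k + 2] φ x) ∂(cellVol d) =
    -∫ x, ((dD j)^[k] φ x * |(dD j)^[k + 1] φ x| ^ q * (dD j)^[k + 2] φ x) ∂(cellVol d) :=
    integral_neg _
  rw [h8] at h7
  set I := ∫ x, ((dD j)^[k] φ x * |(dD j)^[k + 1] φ x| ^ q * (dD j)^[k + 2] φ x) ∂(cellVol d)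
  have hnn : ∀ n, 0 ≤ ∫ x, rootD j φ n x ^ (2 * s) ∂(cellVol d) := fun n =>
    integral_nonneg fun x => pow_nonneg (rootD_nonneg _ _ _ _) _
  have h9 : ∫ x, rootD j φ (k + 1) x ^ (2 * s) ∂(cellVol d) = (q + 1) * (-I) := by linarith
  have h10 : 0 ≤ l * (∫ x, rootD j φ k x ^ (2 * s) ∂(cellVol d) +
        ∫ x, rootD j φ (k + 1) x ^ (2 * s) ∂(cellVol d)) +
        (l⁻¹) ^ (2 * s) * ∫ x, rootD j φ (k + 2) x ^ (2 * s) ∂(cellVol d) := by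
    have := hnn k
    have := hnn (k + 1)
    have := hnn (k + 2)
    positivity
  calc _ = (q + 1) * (-I) := h9
    _ ≤ (q + 1) * (l * (∫ x, rootD j φ k x ^ (2 * s) ∂(cellVol d) +
        ∫ x, rootD j φ (k + 1) x ^ (2 * s) ∂(cellVol d)) +
        (l⁻¹) ^ (2 * s) * ∫ x, rootD j φ (k + 2) x ^ (2 * s) ∂(cellVol d)) := by gcongr
    _ ≤ _ := by gcongr

/-- Gagliardo–Nirenberg interpolation in one direction, for functions bounded by `1`. -/
lemma exists_integral_rootD_le (s : ℕ) (hs : 1 ≤ s) : ∃ C : ℝ, 0 ≤ C ∧ ∀ (d : ℕ) (j : Fin d)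
    (φ : E d → ℝ), Per φ → ContDiff ℝ (⊤ : ℕ∞) φ → (∀ x, |φ x| ≤ 1) → ∀ i, 1 ≤ i → i ≤ s →
    ∫ x, rootD j φ i x ^ (2 * s) ∂(cellVol d) ≤ C * ∫ x, ((dD j)^[s] φ x) ^ 2 ∂(cellVol d) := by
  -- Upward induction bounds level i by level i + 1, starting from level 0, which vanishes by
  -- convention; `chain` then composes these bounds up to level s.
  have step : ∀ i, i < s → ∃ C : ℝ, 0 ≤ C ∧ ∀ (d : ℕ) (j : Fin d)
    (φ : E d → ℝ), Per φ → ContDiff ℝ (⊤ : ℕ∞) φ → (∀ x, |φ x| ≤ 1) →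
    ∫ x, rootD j φ i x ^ (2 * s) ∂(cellVol d) ≤
      C * ∫ x, rootD j φ (i + 1) x ^ (2 * s) ∂(cellVol d) := by
    intro i
    induction i with
    | zero =>
      intro _
      refine ⟨0, le_rfl, fun d j φ _ _ _ => ?_⟩
      have : 2 * s ≠ 0 := by omega
      simp [rootD, this]
    | succ i ih =>
      intro hi
      obtain ⟨C, hC, h⟩ := ih (by omega)
      have hs' : (1 : ℝ) ≤ s := by exact_mod_cast hs
      -- Makes 2s·l·(C + 1) = 1/2, so that level i + 1 is absorbed on the left.
      set l : ℝ := (4 * s * (C + 1))⁻¹ with hl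
      have hl0 : 0 < l := by positivity
      have hl1 : l ≤ 1 := inv_le_one_of_one_le₀ (by nlinarith)
      refine ⟨4 * s * (l⁻¹) ^ (2 * s), by positivity, fun d j φ hp hφ h1 => ?_⟩
      have h2 := integral_rootD_step j hp hφ h1 (i := i + 1) (by omega) hi hl0 hl1
      have h3 := h d j φ hp hφ h1
      simp only [Nat.add_sub_cancel] at h2
      set J0 := ∫ x, rootD j φ i x ^ (2 * s) ∂(cellVol d)
      set J1 := ∫ x, rootD j φ (i + 1) x ^ (2 * s) ∂(cellVol d)
      set J2 := ∫ x, rootD j φ (i + 1 + 1) x ^ (2 * s) ∂(cellVol d)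
      have h4 : 2 * s * (l * (J0 + J1)) ≤ J1 / 2 := by
        have : 2 * s * (l * (J0 + J1)) ≤ 2 * s * (l * (C * J1 + J1)) := by gcongr
        refine this.trans_eq ?_
        rw [hl]; field_simp; ring
      rw [mul_add] at h2
      linarith
  have chain : ∀ k, k ≤ s - 1 → ∃ C : ℝ, 0 ≤ C ∧ ∀ (d : ℕ) (j : Fin d)
      (φ : E d → ℝ), Per φ → ContDiff ℝ (⊤ : ℕ∞) φ → (∀ x, |φ x| ≤ 1) →
      ∫ x, rootD j φ (s - k) x ^ (2 * s) ∂(cellVol d) ≤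
        C * ∫ x, rootD j φ s x ^ (2 * s) ∂(cellVol d) := by
    intro k
    induction k with
    | zero => exact fun _ => ⟨1, zero_le_one, fun d j φ _ _ _ => by simp⟩
    | succ k ih =>
      intro hk
      obtain ⟨C, hC, h⟩ := ih (by omega)
      obtain ⟨C', hC', h'⟩ := step (s - (k + 1)) (by omega)
      refine ⟨C' * C, by positivity, fun d j φ hp hφ h1 => ?_⟩
      have h2 := h d j φ hp hφ h1
      have h3 := h' d j φ hp hφ h1
      rw [show s - (k + 1) + 1 = s - k by omega] at h3
      rw [mul_assoc]
      exact h3.trans (by gcongr)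
  choose! C hC h using chain
  refine ⟨∑ k ∈ Finset.range s, C k, Finset.sum_nonneg fun k hk =>
    hC k (by have := Finset.mem_range.1 hk; omega), fun d j φ hp hφ h1 i hi his => ?_⟩
  have h2 := h (s - i) (by omega) d j φ hp hφ h1
  rw [show s - (s - i) = i by omega] at h2
  have h3 : ∀ x, rootD j φ s x ^ (2 * s) = ((dD j)^[s] φ x) ^ 2 := fun x => by
    rw [mul_comm, pow_mul, rootD_pow j φ (by omega), sq_abs]
  simp only [h3] at h2
  refine h2.trans (mul_le_mul_of_nonneg_right ?_ (integral_nonneg fun x => sq_nonneg _))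
  exact Finset.single_le_sum (f := C) (fun k hk => hC k (by have := Finset.mem_range.1 hk; omega))
    (Finset.mem_range.2 (by omega))

/-- A Moser estimate for compositions, for derivatives in one direction. -/
lemma exists_integral_dD_comp_le (s : ℕ) (hs : 1 ≤ s) : ∃ C : ℝ, 0 ≤ C ∧ ∀ (d : ℕ) (j : Fin d)
    (φ : E d → ℝ) (A M : ℝ) (f : ℝ → ℝ), Per φ → ContDiff ℝ (⊤ : ℕ∞) φ → 1 ≤ A →
    (∀ x, |φ x| ≤ A) → ContDiff ℝ s f → (∀ k ≤ s, ∀ x, |iteratedDeriv k f (φ x)| ≤ M) →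
    ∫ x, ((dD j)^[s] (fun x => f (φ x)) x) ^ 2 ∂(cellVol d) ≤
      C * M ^ 2 * A ^ (2 * s) * ∫ x, ((dD j)^[s] φ x) ^ 2 ∂(cellVol d) := by
  obtain ⟨C, hC, hGN⟩ := exists_integral_rootD_le s hs
  refine ⟨(s.factorial : ℝ) ^ 2 * (s * C), by positivity,
    fun d j φ A M f hp hφ hA hφA hf hM => ?_⟩
  have hA0 : 0 < A := by linarith
  have hr : ∀ i, Continuous fun x => rootD j φ i x ^ (2 * s) :=
    fun i => (continuous_rootD j hφ i).pow _
  have hJ : ∀ i ∈ Finset.Icc 1 s, ∫ x, rootD j φ i x ^ (2 * s) ∂(cellVol d) ≤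
      C * A ^ (2 * s) * ∫ x, ((dD j)^[s] φ x) ^ 2 ∂(cellVol d) := by
    intro i hi
    rw [Finset.mem_Icc] at hi
    -- Interpolation needs a function bounded by 1. Returning from φ/A to φ costs A^{1/i} ≤ A per
    -- factor, since A ≥ 1.
    have h1 := hGN d j (fun x => A⁻¹ * φ x) (hp.comp _) (contDiff_const.mul hφ)
      (fun x => by
        rw [abs_mul, abs_of_pos (inv_pos.2 hA0), inv_mul_le_iff₀ hA0, mul_one]; exact hφA x)
      i hi.1 hi.2
    have h2 : ∀ x, rootD j φ i x ≤ A * rootD j (fun x => A⁻¹ * φ x) i x := by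
      intro x
      simp only [rootD, if_neg (by omega : i ≠ 0), dD_iterate_const_mul j i _ hφ]
      rw [abs_mul, abs_of_pos (inv_pos.2 hA0), Real.mul_rpow (inv_pos.2 hA0).le (abs_nonneg _),
        ← mul_assoc]
      refine le_mul_of_one_le_left (by positivity) ?_
      rw [Real.inv_rpow hA0.le, ← div_eq_mul_inv, one_le_div (by positivity)]
      calc A ^ ((i : ℝ)⁻¹) ≤ A ^ (1 : ℝ) := Real.rpow_le_rpow_of_exponent_le hA
            (inv_le_one_of_one_le₀ (by exact_mod_cast hi.1))
        _ = A := Real.rpow_one A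
    have h3 : ∫ x, ((dD j)^[s] (fun x => A⁻¹ * φ x) x) ^ 2 ∂(cellVol d) ≤
        ∫ x, ((dD j)^[s] φ x) ^ 2 ∂(cellVol d) := by
      simp only [dD_iterate_const_mul j s _ hφ, mul_pow, integral_const_mul]
      refine mul_le_of_le_one_left (integral_nonneg fun x => sq_nonneg _) ?_
      exact pow_le_one₀ (inv_pos.2 hA0).le (inv_le_one_of_one_le₀ hA)
    calc ∫ x, rootD j φ i x ^ (2 * s) ∂(cellVol d)
        ≤ ∫ x, A ^ (2 * s) * rootD j (fun x => A⁻¹ * φ x) i x ^ (2 * s) ∂(cellVol d) := by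
          refine integral_mono (integrable_cellVol (hr i)) (integrable_cellVol
            (((continuous_rootD j (contDiff_const.mul hφ) i).pow _).const_mul _)) fun x => ?_
          simp only [← mul_pow]
          exact pow_le_pow_left₀ (rootD_nonneg _ _ _ _) (h2 x) _
      _ = A ^ (2 * s) * ∫ x, rootD j (fun x => A⁻¹ * φ x) i x ^ (2 * s) ∂(cellVol d) :=
          integral_const_mul _ _
      _ ≤ A ^ (2 * s) * (C * ∫ x, ((dD j)^[s] φ x) ^ 2 ∂(cellVol d)) := by
          gcongr
          exact h1.trans (by gcongr)
      _ = _ := by ring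
  have hcomp : ContDiff ℝ s (fun x => f (φ x)) := hf.comp (hφ.of_le (by exact_mod_cast le_top))
  have hpt : ∀ x, ((dD j)^[s] (fun x => f (φ x)) x) ^ 2 ≤
      (s.factorial : ℝ) ^ 2 * M ^ 2 * ∑ i ∈ Finset.Icc 1 s, rootD j φ i x ^ (2 * s) := by
    intro x
    -- At each point let D be the largest root. Every derivative of order i is then at most D^i, so
    -- the composition bound reads s!·M·D^s, and D^{2s} is dominated by the sum over all i.
    obtain ⟨i0, hi0, hmax⟩ := Finset.exists_max_image (Finset.Icc 1 s) (fun i => rootD j φ i x)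
      ⟨1, by simpa using hs⟩
    have hline : ContDiff ℝ (s : ℕ∞) fun τ : ℝ => φ (x + τ • dir j) :=
      (hφ.of_le (by exact_mod_cast le_top)).comp (by fun_prop)
    have h1 := norm_iteratedFDeriv_comp_le (𝕜 := ℝ) (g := f) (f := fun τ : ℝ => φ (x + τ • dir j))
      (n := s) (N := s) hf hline le_rfl 0 (C := M) (D := rootD j φ i0 x)
      (fun i hi => by
        rw [norm_iteratedFDeriv_eq_norm_iteratedDeriv]
        simpa using hM i hi x)
      (fun i hi1 his => by
        rw [norm_iteratedFDeriv_eq_norm_iteratedDeriv,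
          iteratedDeriv_line j x i (hφ.of_le (by exact_mod_cast le_top))]
        simp only [zero_smul, add_zero, Real.norm_eq_abs]
        rw [← rootD_pow j φ (by omega)]
        exact pow_le_pow_left₀ (rootD_nonneg _ _ _ _) (hmax i (Finset.mem_Icc.2 ⟨hi1, his⟩)) _)
    rw [norm_iteratedFDeriv_eq_norm_iteratedDeriv] at h1
    have h2 := iteratedDeriv_line j x s hcomp 0
    simp only [zero_smul, add_zero] at h2
    have h3 : (f ∘ fun τ : ℝ => φ (x + τ • dir j)) = fun τ : ℝ => f (φ (x + τ • dir j)) := rfl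
    rw [h3, h2, Real.norm_eq_abs] at h1
    calc ((dD j)^[s] (fun x => f (φ x)) x) ^ 2 = |(dD j)^[s] (fun x => f (φ x)) x| ^ 2 :=
          (sq_abs _).symm
      _ ≤ (s.factorial * M * rootD j φ i0 x ^ s) ^ 2 := by gcongr
      _ = (s.factorial : ℝ) ^ 2 * M ^ 2 * rootD j φ i0 x ^ (2 * s) := by ring
      _ ≤ _ := by
          gcongr
          exact Finset.single_le_sum (f := fun i => rootD j φ i x ^ (2 * s))
            (fun i _ => pow_nonneg (rootD_nonneg _ _ _ _) _) hi0
  have hcs : Continuous ((dD j)^[s] fun x => f (φ x)) :=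
    (contDiff_dD_iterate (n := 0) j s (by simpa using hcomp)).continuous
  calc ∫ x, ((dD j)^[s] (fun x => f (φ x)) x) ^ 2 ∂(cellVol d)
      ≤ ∫ x, (s.factorial : ℝ) ^ 2 * M ^ 2 * ∑ i ∈ Finset.Icc 1 s, rootD j φ i x ^ (2 * s)
        ∂(cellVol d) := integral_mono (integrable_cellVol (hcs.pow 2)) (integrable_cellVol
          ((continuous_finsetSum _ fun i _ => hr i).const_mul _)) hpt
    _ = (s.factorial : ℝ) ^ 2 * M ^ 2 *
        ∑ i ∈ Finset.Icc 1 s, ∫ x, rootD j φ i x ^ (2 * s) ∂(cellVol d) := by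
        rw [integral_const_mul, integral_finsetSum _ fun i _ => integrable_cellVol (hr i)]
    _ ≤ (s.factorial : ℝ) ^ 2 * M ^ 2 * ∑ i ∈ Finset.Icc 1 s,
        (C * A ^ (2 * s) * ∫ x, ((dD j)^[s] φ x) ^ 2 ∂(cellVol d)) := by
        gcongr with i hi
        exact hJ i hi
    _ = _ := by
        rw [Finset.sum_const, Nat.card_Icc, nsmul_eq_mul, Nat.add_sub_cancel]; ring

end SVV

end

noncomputable section
namespace SVV

variable {d : ℕ}

/-! ### Fourier multipliers on `L^{2k}` -/

/-- The `L^{2k}` norm on the cell. -/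
def nrm (k : ℕ) (g : E d → ℂ) : ℝ := lpNorm g ((2 * k : ℕ) : ENNReal) (cellVol d)

lemma nrm_nonneg (k : ℕ) (g : E d → ℂ) : 0 ≤ nrm k g := lpNorm_nonneg

lemma nrm_pow {k : ℕ} (hk : 1 ≤ k) {g : E d → ℂ} (hg : Continuous g) :
    nrm k g ^ (2 * k) = ∫ x, ‖g x‖ ^ (2 * k) ∂(cellVol d) := by
  have h2 : ((2 * k : ℕ) : ENNReal) ≠ 0 := by norm_cast; omega
  rw [nrm, lpNorm_eq_integral_norm_rpow_toReal h2 (ENNReal.natCast_ne_top _)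
    (integrable_cellVol hg).aestronglyMeasurable, ENNReal.toReal_natCast,
    Real.rpow_inv_natCast_pow (integral_nonneg fun x => by positivity) (by omega)]
  simp only [Real.rpow_natCast]

lemma memLp_cellVol {F : Type*} [NormedAddCommGroup F] {g : E d → F} (hg : Continuous g)
    (p : ENNReal) : MemLp g p (cellVol d) := by
  obtain ⟨C, hC⟩ := isCompact_closedCube.exists_bound_of_continuousOn (hg.continuousOn)
  refine MemLp.of_bound (integrable_cellVol hg).aestronglyMeasurable C ?_
  rw [cellVol, ae_restrict_iff' isOpen_cell.measurableSet]
  exact Eventually.of_forall fun x hx => hC x (cell_subset hx)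

lemma one_le_two_mul {k : ℕ} (hk : 1 ≤ k) : (1 : ENNReal) ≤ ((2 * k : ℕ) : ENNReal) := by
  norm_cast; omega

lemma nrm_le_of_integral_le {k : ℕ} (hk : 1 ≤ k) {g h : E d → ℂ} (hg : Continuous g)
    (hh : Continuous h) {C : ℝ} (hC : 1 ≤ C)
    (h1 : ∫ x, ‖g x‖ ^ (2 * k) ∂(cellVol d) ≤ C * ∫ x, ‖h x‖ ^ (2 * k) ∂(cellVol d)) :
    nrm k g ≤ C * nrm k h := by
  rw [← nrm_pow hk hg, ← nrm_pow hk hh] at h1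
  refine le_of_pow_le_pow_left₀ (n := 2 * k) (by omega) (mul_nonneg (by linarith) (nrm_nonneg _ _)) ?_
  rw [mul_pow]
  refine h1.trans ?_
  have := nrm_nonneg k h
  gcongr
  exact le_self_pow₀ hC (by omega)

/-- If |Re z| ≤ |z|/(8k), then z is nearly imaginary and (-1)^k Re z^{2k} differs from |z|^{2k} by
at most two errors of |z|^{2k}/4. Otherwise |z| ≤ 8k|Re z|, and the coefficient 3 also pays for a
negative first term. This is the pointwise inequality behind the Riesz projection bound. -/
lemma norm_pow_le_re (k : ℕ) (hk : 1 ≤ k) (z : ℂ) :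
    ‖z‖ ^ (2 * k) ≤ 2 * ((-1) ^ k * (z ^ (2 * k)).re) + 3 * (8 * k) ^ (2 * k) * |z.re| ^ (2 * k) := by
  have hk1 : (1 : ℝ) ≤ k := by exact_mod_cast hk
  have hre : |(-1) ^ k * (z ^ (2 * k)).re| ≤ ‖z‖ ^ (2 * k) := by
    rw [abs_mul, abs_pow, abs_neg, abs_one, one_pow, one_mul, ← norm_pow]
    exact Complex.abs_re_le_norm _
  rcases le_total (8 * k * |z.re|) ‖z‖ with h | h
  · have h1 : ‖z ^ (2 * k) - (Complex.I * z.im) ^ (2 * k)‖ ≤ 2 * k * |z.re| * ‖z‖ ^ (2 * k - 1) := by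
      rw [← (Commute.all z (Complex.I * z.im)).mul_geom_sum₂]
      have h2 : z - Complex.I * z.im = (z.re : ℂ) := by
        rw [mul_comm]; nth_rewrite 1 [← Complex.re_add_im z]; ring
      have h3 : ‖Complex.I * (z.im : ℂ)‖ ≤ ‖z‖ := by
        simpa using Complex.abs_im_le_norm z
      rw [norm_mul, h2, Complex.norm_real, Real.norm_eq_abs]
      have h4 : ‖∑ i ∈ Finset.range (2 * k), z ^ i * (Complex.I * z.im) ^ (2 * k - 1 - i)‖ ≤
          ∑ i ∈ Finset.range (2 * k), ‖z‖ ^ (2 * k - 1) := by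
        refine norm_sum_le_of_le _ fun i hi => ?_
        rw [norm_mul, norm_pow, norm_pow]
        have hi' := Finset.mem_range.1 hi
        calc ‖z‖ ^ i * ‖Complex.I * (z.im : ℂ)‖ ^ (2 * k - 1 - i)
            ≤ ‖z‖ ^ i * ‖z‖ ^ (2 * k - 1 - i) := by gcongr
          _ = ‖z‖ ^ (2 * k - 1) := by rw [← pow_add]; congr 1; omega
      rw [Finset.sum_const, Finset.card_range, nsmul_eq_mul] at h4
      push_cast at h4
      calc |z.re| * _ ≤ |z.re| * (2 * k * ‖z‖ ^ (2 * k - 1)) := by gcongr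
        _ = _ := by ring
    have h5 : (Complex.I * (z.im : ℂ)) ^ (2 * k) = (((-1) ^ k * z.im ^ (2 * k) : ℝ) : ℂ) := by
      rw [mul_pow, pow_mul Complex.I, Complex.I_sq]; push_cast; ring
    have h6 : ‖z‖ ^ (2 * k) - z.im ^ (2 * k) ≤ 2 * k * |z.re| * ‖z‖ ^ (2 * k - 1) := by
      have h7 : ‖z‖ - |z.im| ≤ |z.re| := by
        have := Complex.norm_le_abs_re_add_abs_im z; linarith
      have h8 : ‖z‖ ^ (2 * k) - |z.im| ^ (2 * k) ≤ 2 * k * |z.re| * ‖z‖ ^ (2 * k - 1) := by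
        rw [← (Commute.all ‖z‖ |z.im|).mul_geom_sum₂]
        have h4 : ∑ i ∈ Finset.range (2 * k), ‖z‖ ^ i * |z.im| ^ (2 * k - 1 - i) ≤
            ∑ i ∈ Finset.range (2 * k), ‖z‖ ^ (2 * k - 1) := by
          refine Finset.sum_le_sum fun i hi => ?_
          have hi' := Finset.mem_range.1 hi
          calc ‖z‖ ^ i * |z.im| ^ (2 * k - 1 - i)
              ≤ ‖z‖ ^ i * ‖z‖ ^ (2 * k - 1 - i) := by gcongr; exact Complex.abs_im_le_norm z
            _ = ‖z‖ ^ (2 * k - 1) := by rw [← pow_add]; congr 1; omega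
        rw [Finset.sum_const, Finset.card_range, nsmul_eq_mul] at h4
        push_cast at h4
        have h9 : 0 ≤ ∑ i ∈ Finset.range (2 * k), ‖z‖ ^ i * |z.im| ^ (2 * k - 1 - i) :=
          Finset.sum_nonneg fun i _ => by positivity
        calc (‖z‖ - |z.im|) * _ ≤ |z.re| * (2 * k * ‖z‖ ^ (2 * k - 1)) := by gcongr
          _ = _ := by ring
      have h10 : |z.im| ^ (2 * k) = z.im ^ (2 * k) := (even_two_mul k).pow_abs _
      rwa [h10] at h8
    have h11 : z.im ^ (2 * k) - (-1) ^ k * (z ^ (2 * k)).re ≤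
        2 * k * |z.re| * ‖z‖ ^ (2 * k - 1) := by
      refine le_trans ?_ h1
      rw [h5]
      refine le_trans ?_ (Complex.abs_re_le_norm _)
      rw [Complex.sub_re, Complex.ofReal_re]
      rcases neg_one_pow_eq_or ℝ k with hh | hh <;> rw [hh]
      · rw [abs_sub_comm]; refine le_trans (le_of_eq (by ring)) (le_abs_self _)
      · refine le_trans (le_of_eq (by ring)) (le_abs_self _)
    have h12 : 8 * k * |z.re| * ‖z‖ ^ (2 * k - 1) ≤ ‖z‖ ^ (2 * k) := by
      calc 8 * k * |z.re| * ‖z‖ ^ (2 * k - 1) ≤ ‖z‖ * ‖z‖ ^ (2 * k - 1) := by gcongr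
        _ = ‖z‖ ^ (2 * k) := by rw [← pow_succ']; congr 1; omega
    have h13 : 0 ≤ 3 * (8 * k : ℝ) ^ (2 * k) * |z.re| ^ (2 * k) := by positivity
    linarith
  · have h1 : ‖z‖ ^ (2 * k) ≤ (8 * k) ^ (2 * k) * |z.re| ^ (2 * k) := by
      rw [← mul_pow]; gcongr
    have := neg_le_of_abs_le hre
    linarith

/-- Every frequency in the expansion has j-th component at least k ≥ 1, so there is no constant
term. -/
lemma integral_expo_mul_pow_eq_zero {ι : Type*} [DecidableEq ι] (j : Fin d) (S : Finset ι) (c : ι → ℂ)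
    (φ : ι → Fin d → ℤ) (hφ : ∀ i ∈ S, 0 ≤ φ i j) {k : ℕ} (hk : 1 ≤ k) (n : ℕ) :
    ∫ x, expo (Pi.single j (k : ℤ)) x * (∑ i ∈ S, c i * expo (φ i) x) ^ n ∂(cellVol d) = 0 := by
  have hprod : ∀ (p : Fin n → ι) (x : E d), ∏ i, expo (φ (p i)) x = expo (∑ i, φ (p i)) x := by
    intro p x
    induction (Finset.univ : Finset (Fin n)) using Finset.induction_on with
    | empty => simp [expo_zero_freq]
    | insert a s ha ih => rw [Finset.prod_insert ha, Finset.sum_insert ha, expo_add_freq, ih]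
  have h1 : ∀ x : E d, expo (Pi.single j (k : ℤ)) x * (∑ i ∈ S, c i * expo (φ i) x) ^ n =
      ∑ p ∈ Fintype.piFinset fun _ : Fin n => S,
        (∏ i, c (p i)) * expo (Pi.single j (k : ℤ) + ∑ i, φ (p i)) x := by
    intro x
    rw [Finset.sum_pow', Finset.mul_sum]
    refine Finset.sum_congr rfl fun p _ => ?_
    rw [Finset.prod_mul_distrib, hprod, expo_add_freq]
    ring
  simp only [h1]
  rw [integral_finsetSum _ fun p _ => integrable_cellVol (by fun_prop)]
  refine Finset.sum_eq_zero fun p hp => ?_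
  rw [integral_const_mul, integral_expo, if_neg, mul_zero]
  intro h
  have h2 := congrFun h j
  simp only [Pi.add_apply, Pi.single_eq_same, Finset.sum_apply, Pi.zero_apply] at h2
  have h3 : 0 ≤ ∑ i, φ (p i) j :=
    Finset.sum_nonneg fun i _ => hφ _ (Fintype.mem_piFinset.1 hp i)
  have : (1 : ℤ) ≤ k := by exact_mod_cast hk
  omega

/-- M. Riesz: projections on half-spaces of frequencies are bounded on `L^{2k}`. -/
lemma integral_halfSpace_le (k : ℕ) (hk : 1 ≤ k) (j : Fin d) (a : ℤ) (S : Finset (Fin d → ℤ))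
    (c : (Fin d → ℤ) → ℂ) :
    ∫ x, ‖trig S (fun ξ => (if a ≤ ξ j then 1 else 0) * c ξ) x‖ ^ (2 * k) ∂(cellVol d) ≤
      6 * (8 * k) ^ (2 * k) * ∫ x, ‖trig S c x‖ ^ (2 * k) ∂(cellVol d) := by
  -- Frequencies with ξ j ≥ a are shifted by -a; the others are reflected by complex conjugation and
  -- shifted by a - 1. Both then have nonnegative j-th component.
  set φ : (Fin d → ℤ) → Fin d → ℤ := fun ξ =>
    if a ≤ ξ j then ξ + Pi.single j (-a) else -ξ + Pi.single j (a - 1) with hφ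
  have hφ0 : ∀ ξ ∈ S, 0 ≤ φ ξ j := by
    intro ξ _
    simp only [hφ]
    split_ifs with h
    · simp; omega
    · simp; omega
  set cc : ℂ → (Fin d → ℤ) → ℂ := fun σ ξ =>
    if a ≤ ξ j then c ξ else σ * (starRingEnd ℂ) (c ξ) with hcc
  set H : ℂ → E d → ℂ := fun σ x => ∑ ξ ∈ S, cc σ ξ * expo (φ ξ) x with hH
  -- The half-integer factor e^{i x_j/2} balances the shifts -a and a - 1, so that they become the
  -- unimodular w and its conjugate; its power 2k is again a genuine exponential.
  set hf : E d → ℂ := fun x => Complex.exp (Complex.I * (x j / 2 : ℝ)) with hhf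
  have hhf1 : ∀ x, ‖hf x‖ = 1 := fun x => by
    rw [hhf]; simp only; rw [mul_comm]; exact Complex.norm_exp_ofReal_mul_I _
  have hhfpow : ∀ x, hf x ^ (2 * k) = expo (Pi.single j (k : ℤ)) x := by
    intro x
    simp only [hhf, expo, ← Complex.exp_nat_mul]
    congr 1
    simp [pair, Pi.single_apply]
    ring
  set P : E d → ℂ := trig S (fun ξ => (if a ≤ ξ j then 1 else 0) * c ξ) with hP
  set M : E d → ℂ := trig S (fun ξ => (if a ≤ ξ j then 0 else 1) * c ξ) with hM
  have hPM : ∀ x, trig S c x = P x + M x := by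
    intro x
    simp only [hP, hM, trig, ← Finset.sum_add_distrib]
    refine Finset.sum_congr rfl fun ξ _ => ?_
    split_ifs <;> ring
  set w : E d → ℂ := fun x => expo (Pi.single j (-a)) x * hf x with hw
  have hw1 : ∀ x, ‖w x‖ = 1 := fun x => by rw [hw]; simp only; rw [norm_mul, norm_expo, hhf1, one_mul]
  have hconj : ∀ x, (starRingEnd ℂ) (w x) = expo (Pi.single j (a - 1)) x * hf x := by
    intro x
    simp only [hw, hhf, expo, ← Complex.exp_add, ← Complex.exp_conj]
    congr 1
    have h2 : (starRingEnd ℂ) 2 = 2 := map_ofNat _ 2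
    simp [pair, Pi.single_apply, h2]
    ring
  have hHw : ∀ σ x, hf x * H σ x = w x * P x + σ * (starRingEnd ℂ) (w x * M x) := by
    intro σ x
    rw [map_mul, hconj]
    simp only [hH, hP, hM, hw, trig, map_sum, Finset.mul_sum, ← Finset.sum_add_distrib]
    refine Finset.sum_congr rfl fun ξ _ => ?_
    simp only [hcc, hφ]
    split_ifs with h
    · rw [expo_add_freq]; simp; ring
    · rw [expo_add_freq]; simp [conj_expo]; ring
  have hHc : ∀ σ, Continuous (H σ) := fun σ => by simp only [hH]; fun_prop
  have hhc : Continuous hf := by simp only [hhf]; fun_prop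
  have hPc : Continuous P := continuous_trig _ _
  -- Integrate the pointwise inequality for z = τ·hf·H σ. The term with z^{2k} has mean zero because
  -- all its j-frequencies are positive, and Re z is dominated by the full polynomial.
  have key : ∀ (σ τ : ℂ), ‖τ‖ = 1 → (∀ x, |(τ * (hf x * H σ x)).re| ≤ ‖trig S c x‖) →
      ∫ x, ‖H σ x‖ ^ (2 * k) ∂(cellVol d) ≤
        3 * (8 * k) ^ (2 * k) * ∫ x, ‖trig S c x‖ ^ (2 * k) ∂(cellVol d) := by
    intro σ τ hτ hre
    have h1 : ∀ x, ‖H σ x‖ ^ (2 * k) ≤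
        (2 * (-1) ^ k * τ ^ (2 * k) * (expo (Pi.single j (k : ℤ)) x * H σ x ^ (2 * k))).re +
          3 * (8 * k) ^ (2 * k) * ‖trig S c x‖ ^ (2 * k) := by
      intro x
      have h2 := norm_pow_le_re k hk (τ * (hf x * H σ x))
      rw [norm_mul, norm_mul, hτ, hhf1, one_mul, one_mul] at h2
      have h3 : (τ * (hf x * H σ x)) ^ (2 * k) =
          τ ^ (2 * k) * (expo (Pi.single j (k : ℤ)) x * H σ x ^ (2 * k)) := by
        rw [mul_pow, mul_pow, hhfpow]
      rw [h3] at h2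
      have h4 : (2 * (-1) ^ k * τ ^ (2 * k) * (expo (Pi.single j (k : ℤ)) x * H σ x ^ (2 * k))).re =
          2 * ((-1) ^ k *
            (τ ^ (2 * k) * (expo (Pi.single j (k : ℤ)) x * H σ x ^ (2 * k))).re) := by
        have : (2 * (-1) ^ k * τ ^ (2 * k) * (expo (Pi.single j (k : ℤ)) x * H σ x ^ (2 * k))) =
          ((2 * (-1) ^ k : ℝ) : ℂ) *
            (τ ^ (2 * k) * (expo (Pi.single j (k : ℤ)) x * H σ x ^ (2 * k))) := by
          push_cast; ring
        rw [this, Complex.re_ofReal_mul]; ring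
      rw [h4]
      refine h2.trans ?_
      gcongr
      exact hre x
    have hHσ := hHc σ
    have hc1 : Continuous fun x => 2 * (-1) ^ k * τ ^ (2 * k) *
      (expo (Pi.single j (k : ℤ)) x * H σ x ^ (2 * k)) := by fun_prop
    have h5 := integral_mono (integrable_cellVol (by fun_prop)) (integrable_cellVol (by fun_prop)) h1
    rw [integral_add (integrable_cellVol (by fun_prop)) (integrable_cellVol (by fun_prop)),
      integral_const_mul] at h5
    have h6 := integral_re (𝕜 := ℂ) (integrable_cellVol hc1)
    simp only [RCLike.re_to_complex] at h6
    rw [h6, integral_const_mul] at h5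
    have h7 := integral_expo_mul_pow_eq_zero j S (cc σ) φ hφ0 hk (2 * k)
    simp only [hH] at h5 ⊢
    rw [h7, mul_zero, Complex.zero_re, zero_add] at h5
    exact h5
  have hψ : ∀ x, ‖w x * P x + w x * M x‖ = ‖trig S c x‖ := fun x => by
    rw [← mul_add, ← hPM, norm_mul, hw1, one_mul]
  -- σ = τ = 1 tests the real part of w(P + M); σ = -1, τ = -i tests its imaginary part. Up to
  -- unimodular factors P is the mean of H 1 and H (-1).
  have h1 := key 1 1 (by simp) fun x => by
    rw [one_mul, hHw, one_mul, ← hψ]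
    have : (w x * P x + (starRingEnd ℂ) (w x * M x)).re = (w x * P x + w x * M x).re := by simp
    rw [this]; exact Complex.abs_re_le_norm _
  have h2 := key (-1) (-Complex.I) (by simp) fun x => by
    rw [hHw, ← hψ]
    have : (-Complex.I * (w x * P x + -1 * (starRingEnd ℂ) (w x * M x))).re =
        (w x * P x + w x * M x).im := by
      simp
      ring
    rw [this]; exact Complex.abs_im_le_norm _
  have h3 : ∀ x, ‖P x‖ ^ (2 * k) ≤ ‖H 1 x‖ ^ (2 * k) + ‖H (-1) x‖ ^ (2 * k) := by
    intro x
    have h4 : 2 * (w x * P x) = hf x * H 1 x + hf x * H (-1) x := by rw [hHw, hHw]; ring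
    have h5 : 2 * ‖P x‖ ≤ ‖H 1 x‖ + ‖H (-1) x‖ := by
      have := congrArg norm h4
      rw [norm_mul, norm_mul, hw1, one_mul] at this
      simp only [Complex.norm_ofNat] at this
      rw [this]
      refine (norm_add_le _ _).trans ?_
      rw [norm_mul, norm_mul, hhf1, one_mul, one_mul]
    rcases le_total ‖H 1 x‖ ‖H (-1) x‖ with h | h
    · have : ‖P x‖ ^ (2 * k) ≤ ‖H (-1) x‖ ^ (2 * k) := by gcongr; linarith
      have h6 : 0 ≤ ‖H 1 x‖ ^ (2 * k) := by positivity
      linarith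
    · have : ‖P x‖ ^ (2 * k) ≤ ‖H 1 x‖ ^ (2 * k) := by gcongr; linarith
      have h6 : 0 ≤ ‖H (-1) x‖ ^ (2 * k) := by positivity
      linarith
  have hc1 := hHc 1
  have hc2 := hHc (-1)
  have h4 := integral_mono (integrable_cellVol (by fun_prop)) (integrable_cellVol (by fun_prop)) h3
  rw [integral_add (integrable_cellVol (by fun_prop)) (integrable_cellVol (by fun_prop))] at h4
  linarith

/-- Fourier multipliers bounded on `L^{2k}`. -/
structure MulBound (k : ℕ) (m : (Fin d → ℤ) → ℂ) (K : ℝ) : Prop where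
  nonneg : 0 ≤ K
  bound : ∀ (S : Finset (Fin d → ℤ)) (c : (Fin d → ℤ) → ℂ),
    nrm k (trig S fun ξ => m ξ * c ξ) ≤ K * nrm k (trig S c)

namespace MulBound

variable {k : ℕ} {m m' : (Fin d → ℤ) → ℂ} {K K' : ℝ}

lemma congr (h : MulBound k m K) (hm : ∀ ξ, m ξ = m' ξ) : MulBound k m' K := by
  rwa [← funext hm]

lemma mono (h : MulBound k m K) (hK : K ≤ K') : MulBound k m K' :=
  ⟨h.nonneg.trans hK, fun S c => (h.bound S c).trans
    (mul_le_mul_of_nonneg_right hK (nrm_nonneg _ _))⟩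

lemma mul (h : MulBound k m K) (h' : MulBound k m' K') :
    MulBound k (fun ξ => m ξ * m' ξ) (K * K') := by
  refine ⟨mul_nonneg h.nonneg h'.nonneg, fun S c => ?_⟩
  have h1 := h.bound S fun ξ => m' ξ * c ξ
  have h2 := h'.bound S c
  simp only [← mul_assoc] at h1
  rw [mul_assoc]
  exact h1.trans (mul_le_mul_of_nonneg_left h2 h.nonneg)

lemma add (hk : 1 ≤ k) (h : MulBound k m K) (h' : MulBound k m' K') :
    MulBound k (fun ξ => m ξ + m' ξ) (K + K') := by
  refine ⟨add_nonneg h.nonneg h'.nonneg, fun S c => ?_⟩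
  have h1 : (trig S fun ξ => (m ξ + m' ξ) * c ξ) =
      (trig S fun ξ => m ξ * c ξ) + trig S fun ξ => m' ξ * c ξ := by
    ext x; simp [trig, add_mul, Finset.sum_add_distrib]
  rw [h1, add_mul]
  exact (lpNorm_add_le (memLp_cellVol (continuous_trig _ _) _) (one_le_two_mul hk)).trans
    (add_le_add (h.bound S c) (h'.bound S c))

lemma const (a : ℂ) : MulBound k (fun _ : Fin d → ℤ => a) ‖a‖ := by
  refine ⟨norm_nonneg _, fun S c => ?_⟩
  have h1 : (trig S fun ξ => a * c ξ) = a • trig S c := by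
    ext x; simp [trig, Finset.mul_sum, mul_assoc]
  rw [h1, nrm, lpNorm_const_smul]
  rfl

lemma sum (hk : 1 ≤ k) {ι : Type*} (s : Finset ι) {m : ι → (Fin d → ℤ) → ℂ} {K : ι → ℝ}
    (h : ∀ i ∈ s, MulBound k (m i) (K i)) :
    MulBound k (fun ξ => ∑ i ∈ s, m i ξ) (∑ i ∈ s, K i) := by
  classical
  induction s using Finset.induction_on with
  | empty => simpa using const (d := d) (k := k) 0
  | insert a s ha ih =>
    simp only [Finset.sum_insert ha]
    exact (h a (Finset.mem_insert_self _ _)).add hk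
      (ih fun i hi => h i (Finset.mem_insert_of_mem hi))

lemma prod {ι : Type*} (s : Finset ι) {m : ι → (Fin d → ℤ) → ℂ} {K : ℝ}
    (h : ∀ i ∈ s, MulBound k (m i) K) :
    MulBound k (fun ξ => ∏ i ∈ s, m i ξ) (K ^ s.card) := by
  classical
  induction s using Finset.induction_on with
  | empty => simpa using const (d := d) (k := k) 1
  | insert a s ha ih =>
    simp only [Finset.prod_insert ha, Finset.card_insert_of_notMem ha, pow_succ']
    exact (h a (Finset.mem_insert_self _ _)).mul
      (ih fun i hi => h i (Finset.mem_insert_of_mem hi))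

end MulBound

/-! ### Multipliers localized to cubes of frequencies -/

lemma mem_freqs {N : ℕ} {ξ : Fin d → ℤ} : ξ ∈ freqs d N ↔ ∀ j, -(N : ℤ) ≤ ξ j ∧ ξ j ≤ N := by
  simp [freqs]

lemma mem_freqs_iff {N : ℕ} {ξ : Fin d → ℤ} : ξ ∈ freqs d N ↔ freqSize ξ ≤ N := by
  rw [mem_freqs, freqSize, Finset.sup_le_iff]
  refine ⟨fun h j _ => ?_, fun h j => ?_⟩
  · have := h j; omega
  · have := h j (Finset.mem_univ j); omega

lemma natAbs_le_freqSize (ξ : Fin d → ℤ) (j : Fin d) : (ξ j).natAbs ≤ freqSize ξ :=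
  Finset.le_sup (f := fun j => (ξ j).natAbs) (Finset.mem_univ j)

/-- The indicator of the cube |ξ| ≤ p is a product over coordinates of half-space projections, with
norm independent of p. On the cube, ξ_j = Σ_{-p<a≤p} 1_{a≤ξ_j} - p is a sum of 2p half-space
projections and a constant, hence of norm O(p). -/
lemma exists_mulBound_freqs (d : ℕ) (k : ℕ) (hk : 1 ≤ k) : ∃ C : ℝ, 0 ≤ C ∧ ∀ (p : ℕ) (i j : Fin d),
    MulBound k (fun ξ : Fin d → ℤ => (ξ i : ℂ) * (ξ j : ℂ) * if ξ ∈ freqs d p then 1 else 0)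
      (C * (p : ℝ) ^ 2) := by
  have hk1 : (1 : ℝ) ≤ k := by exact_mod_cast hk
  set K : ℝ := 6 * (8 * k) ^ (2 * k) with hK
  have hK1 : 1 ≤ K := by
    have : (1 : ℝ) ≤ (8 * k) ^ (2 * k) := one_le_pow₀ (by linarith)
    linarith
  have h0 : ∀ (j : Fin d) (a : ℤ),
      MulBound k (fun ξ : Fin d → ℤ => if a ≤ ξ j then (1 : ℂ) else 0) K := fun j a =>
    ⟨by positivity, fun S c => nrm_le_of_integral_le hk (continuous_trig _ _) (continuous_trig _ _)
      hK1 (integral_halfSpace_le k hk j a S c)⟩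
  have h1 : ∀ p : ℕ, MulBound k (fun ξ : Fin d → ℤ => if ξ ∈ freqs d p then (1 : ℂ) else 0)
      ((K * (1 + K)) ^ d) := by
    intro p
    have h2 := fun j : Fin d => (h0 j (-(p : ℤ))).mul
      (((MulBound.const 1).add hk ((MulBound.const (-1)).mul (h0 j (p + 1)))))
    simp only [norm_one, norm_neg, one_mul] at h2
    have h3 := MulBound.prod (k := k) Finset.univ (fun j _ => h2 j)
    rw [Finset.card_univ, Fintype.card_fin] at h3
    refine h3.congr fun ξ => ?_
    split_ifs with h
    · rw [mem_freqs] at h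
      refine Finset.prod_eq_one fun j _ => ?_
      rw [if_pos (h j).1, if_neg (by have := (h j).2; omega)]
      simp
    · rw [mem_freqs] at h
      push Not at h
      obtain ⟨j, hj⟩ := h
      refine Finset.prod_eq_zero (Finset.mem_univ j) ?_
      by_cases h4 : -(p : ℤ) ≤ ξ j
      · rw [if_pos (show (p : ℤ) + 1 ≤ ξ j from hj h4)]; simp
      · rw [if_neg h4, zero_mul]
  set K1 := (K * (1 + K)) ^ d with hK1
  have hK10 : 0 ≤ K1 := by positivity
  have h2 : ∀ (p : ℕ) (j : Fin d), MulBound k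
      (fun ξ : Fin d → ℤ => (ξ j : ℂ) * if ξ ∈ freqs d p then 1 else 0)
      ((2 * K + 1) * K1 * p) := by
    intro p j
    have h3 := ((MulBound.sum hk (Finset.Ioc (-(p : ℤ)) p) (fun a _ => h0 j a)).add hk
      (MulBound.const (-(p : ℂ)))).mul (h1 p)
    refine (h3.mono ?_).congr fun ξ => ?_
    · rw [Finset.sum_const, Int.card_Ioc, nsmul_eq_mul, norm_neg, Complex.norm_natCast]
      have : ((((p : ℤ) - -(p : ℤ)).toNat : ℕ) : ℝ) = 2 * p := by
        have : (((p : ℤ) - -(p : ℤ)).toNat : ℕ) = 2 * p := by omega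
        rw [this]; push_cast; ring
      rw [this]
      apply le_of_eq; ring
    · by_cases h : ξ ∈ freqs d p
      · simp only [if_pos h, mul_one]
        rw [mem_freqs] at h
        have hj := h j
        rw [Finset.sum_boole]
        have : (Finset.Ioc (-(p : ℤ)) p).filter (fun a => a ≤ ξ j) = Finset.Ioc (-(p : ℤ)) (ξ j) := by
          ext a; simp; omega
        rw [this, Int.card_Ioc]
        have h5 : (((ξ j - -(p : ℤ)).toNat : ℕ) : ℂ) = (ξ j : ℂ) + p := by
          have h6 : (((ξ j - -(p : ℤ)).toNat : ℕ) : ℤ) = ξ j + p := by omega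
          exact_mod_cast h6
        rw [h5]; ring
      · simp [if_neg h]
  refine ⟨((2 * K + 1) * K1) ^ 2, by positivity, fun p i j => ?_⟩
  refine (((h2 p i).mul (h2 p j)).mono (le_of_eq (by ring))).congr fun ξ => ?_
  split_ifs <;> ring

/-- Radial (in the sense of `freqSize`) perturbations of second derivatives, by Abel summation. -/
lemma exists_nrm_radial_le (d : ℕ) (k : ℕ) (hk : 1 ≤ k) : ∃ C : ℝ, 0 ≤ C ∧ ∀ (N : ℕ) (r : ℕ → ℝ)
    (i j : Fin d) (c : (Fin d → ℤ) → ℂ),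
    nrm k (trig (freqs d N) fun ξ => ((r (freqSize ξ) * ξ i * ξ j : ℝ) : ℂ) * c ξ) ≤
      C * (|r N| * (N : ℝ) ^ 2 + ∑ p ∈ Finset.range N, |r p - r (p + 1)| * (p : ℝ) ^ 2) *
        nrm k (trig (freqs d N) c) := by
  obtain ⟨C, hC, h⟩ := exists_mulBound_freqs d k hk
  refine ⟨C, hC, fun N r i j c => ?_⟩
  have h1 := ((MulBound.const (r N : ℂ)).mul (h N i j)).add hk
    (MulBound.sum hk (Finset.range N) fun p _ =>
      (MulBound.const ((r p - r (p + 1) : ℝ) : ℂ)).mul (h p i j))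
  have h2 := h1.bound (freqs d N) c
  have h3 : (trig (freqs d N) fun ξ => ((r (freqSize ξ) * ξ i * ξ j : ℝ) : ℂ) * c ξ) =
      trig (freqs d N) fun ξ => ((r N : ℂ) * ((ξ i : ℂ) * (ξ j : ℂ) *
        if ξ ∈ freqs d N then 1 else 0) + ∑ p ∈ Finset.range N, ((r p - r (p + 1) : ℝ) : ℂ) *
          ((ξ i : ℂ) * (ξ j : ℂ) * if ξ ∈ freqs d p then 1 else 0)) * c ξ := by
    ext x
    refine trig_congr (fun ξ hξ => ?_) x
    congr 1
    rw [if_pos hξ, mul_one]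
    simp only [mem_freqs_iff]
    rw [mem_freqs_iff] at hξ
    -- Telescoping, r(q) = r(N) + Σ_{q≤p<N} (r(p) - r(p+1)), which writes a function of |ξ| through
    -- indicators of cubes.
    have h4 : ∀ q ≤ N, ∑ p ∈ Finset.range N, ((r p - r (p + 1) : ℝ) : ℂ) *
        ((ξ i : ℂ) * (ξ j : ℂ) * if q ≤ p then 1 else 0) =
        ((r q - r N : ℝ) : ℂ) * ((ξ i : ℂ) * (ξ j : ℂ)) := by
      intro q hq
      have h5 : ∑ p ∈ Finset.range N, (if q ≤ p then (r p - r (p + 1)) else 0) = r q - r N := by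
        clear h2 h1 hξ
        induction N, hq using Nat.le_induction with
        | base =>
          rw [sub_self]
          exact Finset.sum_eq_zero fun p hp => if_neg (by have := Finset.mem_range.1 hp; omega)
        | succ n hn ih => rw [Finset.sum_range_succ, ih, if_pos hn]; ring
      rw [← h5, Complex.ofReal_sum, Finset.sum_mul]
      refine Finset.sum_congr rfl fun p _ => ?_
      split_ifs <;> simp
    rw [h4 _ hξ]
    push_cast
    ring
  rw [h3]
  refine h2.trans (mul_le_mul_of_nonneg_right ?_ (nrm_nonneg _ _))
  simp only [Complex.norm_real, Real.norm_eq_abs]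
  rw [mul_add, Finset.mul_sum]
  refine le_of_eq ?_
  congr 1
  · ring
  · exact Finset.sum_congr rfl fun p _ => by ring

end SVV

end

noncomputable section
namespace SVV

variable {d : ℕ}

/-! ### Scalar differential inequalities -/

lemma gronwall_le {g g' : ℝ → ℝ} {T a b : ℝ} (hb : 0 ≤ b) (ha : 0 ≤ a)
    (hc : ContinuousOn g (Set.Icc 0 T)) (hd : ∀ t ∈ Set.Ioo 0 T, HasDerivAt g (g' t) t)
    (hle : ∀ t ∈ Set.Ioo 0 T, g' t ≤ a * g t + b) :
    ∀ t ∈ Set.Icc 0 T, g t ≤ Real.exp (a * t) * (g 0 + b * t) := by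
  intro t ht
  have hder : ∀ t ∈ Set.Ioo 0 T, HasDerivAt (fun t => Real.exp (-(a * t)) * g t - b * t)
      (-a * Real.exp (-(a * t)) * g t + Real.exp (-(a * t)) * g' t - b) t := by
    intro t ht
    have h1 : HasDerivAt (fun t => Real.exp (-(a * t))) (-a * Real.exp (-(a * t))) t := by
      have := ((hasDerivAt_id t).const_mul a).neg.exp
      refine this.congr_deriv ?_
      simp; ring
    exact ((h1.fun_mul (hd t ht)).sub ((hasDerivAt_id t).const_mul b)).congr_deriv (by simp)
  have hanti : AntitoneOn (fun t => Real.exp (-(a * t)) * g t - b * t) (Set.Icc 0 T) := by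
    refine antitoneOn_of_deriv_nonpos (convex_Icc 0 T) ?_ ?_ ?_
    · exact ((Continuous.continuousOn (by fun_prop)).mul hc).sub
        (Continuous.continuousOn (by fun_prop))
    · rw [interior_Icc]
      exact fun t ht => (hder t ht).differentiableAt.differentiableWithinAt
    · rw [interior_Icc]
      intro t ht
      rw [(hder t ht).deriv]
      have h1 := hle t ht
      have h2 : 0 < Real.exp (-(a * t)) := Real.exp_pos _
      have h3 : Real.exp (-(a * t)) ≤ 1 := by
        rw [Real.exp_le_one_iff, neg_nonpos]; exact mul_nonneg ha ht.1.le
      have h4 : Real.exp (-(a * t)) * g' t ≤ Real.exp (-(a * t)) * (a * g t + b) := by gcongr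
      nlinarith
  have h0 := hanti ⟨le_rfl, ht.1.trans ht.2⟩ ht ht.1
  simp only [mul_zero, neg_zero, Real.exp_zero, one_mul, sub_zero] at h0
  have h1 : Real.exp (a * t) * (Real.exp (-(a * t)) * g t) = g t := by
    rw [← mul_assoc, ← Real.exp_add]; simp
  rw [← h1]
  gcongr
  linarith

/-- After the last time at which g lies below the level, g exceeds Y, hence is nonincreasing and
cannot have risen above the level. -/
lemma le_max_of_deriv_nonpos {g g' : ℝ → ℝ} {T Y : ℝ}
    (hc : ContinuousOn g (Set.Icc 0 T)) (hd : ∀ t ∈ Set.Ioo 0 T, HasDerivAt g (g' t) t)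
    (hle : ∀ t ∈ Set.Ioo 0 T, Y < g t → g' t ≤ 0) :
    ∀ t ∈ Set.Icc 0 T, g t ≤ max (g 0) Y := by
  intro t ht
  by_contra! hgt
  set B := max (g 0) Y with hB
  have hsub : Set.Icc 0 t ⊆ Set.Icc 0 T := Set.Icc_subset_Icc_right ht.2
  have hcomp : IsCompact (Set.Icc 0 t ∩ g ⁻¹' Set.Iic B) :=
    isCompact_Icc.of_isClosed_subset
      ((hc.mono hsub).preimage_isClosed_of_isClosed isClosed_Icc isClosed_Iic)
      Set.inter_subset_left
  obtain ⟨t0, ht0, hmax⟩ := hcomp.exists_isGreatest ⟨0, ⟨le_rfl, ht.1⟩, (show g 0 ≤ B from le_max_left _ _)⟩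
  have hlt : t0 < t := lt_of_le_of_ne ht0.1.2 fun h => by
    have := ht0.2
    rw [h] at this
    exact absurd hgt (not_lt.2 this)
  have habove : ∀ τ ∈ Set.Ioo t0 t, B < g τ := by
    intro τ hτ
    by_contra! h
    exact absurd (hmax ⟨⟨ht0.1.1.trans hτ.1.le, hτ.2.le⟩, h⟩) (not_le.2 hτ.1)
  have hanti : AntitoneOn g (Set.Icc t0 t) := by
    have hin : ∀ τ ∈ Set.Ioo t0 t, τ ∈ Set.Ioo 0 T := fun τ hτ =>
      ⟨ht0.1.1.trans_lt hτ.1, hτ.2.trans_le ht.2⟩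
    refine antitoneOn_of_deriv_nonpos (convex_Icc t0 t)
      (hc.mono (Set.Icc_subset_Icc ht0.1.1 ht.2)) ?_ ?_
    · rw [interior_Icc]
      exact fun τ hτ => (hd τ (hin τ hτ)).differentiableAt.differentiableWithinAt
    · rw [interior_Icc]
      intro τ hτ
      rw [(hd τ (hin τ hτ)).deriv]
      exact hle τ (hin τ hτ) ((le_max_right _ _).trans_lt (habove τ hτ))
  have h1 := hanti ⟨le_rfl, hlt.le⟩ ⟨hlt.le, le_rfl⟩ hlt.le
  have h2 : g t0 ≤ B := ht0.2
  linarith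

/-- Look at the first time with g ≥ B; the hypothesis applies there and contradicts it. -/
lemma lt_of_bootstrap {g : ℝ → ℝ} {T B : ℝ} (hc : ContinuousOn g (Set.Icc 0 T))
    (h : ∀ t ∈ Set.Icc 0 T, (∀ τ ∈ Set.Ico 0 t, g τ < B) → g t < B) :
    ∀ t ∈ Set.Icc 0 T, g t < B := by
  intro t ht
  by_contra! hge
  have hcomp : IsCompact (Set.Icc 0 T ∩ g ⁻¹' Set.Ici B) :=
    isCompact_Icc.of_isClosed_subset
      (hc.preimage_isClosed_of_isClosed isClosed_Icc isClosed_Ici) Set.inter_subset_left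
  obtain ⟨t0, ht0, hmin⟩ := hcomp.exists_isLeast ⟨t, ht, hge⟩
  refine absurd (h t0 ht0.1 fun τ hτ => ?_) (not_lt.2 ht0.2)
  by_contra! h2
  exact absurd (hmin ⟨⟨hτ.1, hτ.2.le.trans ht0.1.2⟩, h2⟩) (not_le.2 hτ.2)

/-! ### Coefficients as linear functionals of point values -/

/-- The exponentials are linearly independent, so point evaluations span the dual of the coefficient
space and each coefficient is a finite combination of point values. Regularity in time at each fixed
x thereby passes to the coefficients. -/
lemma exists_interp (d N : ℕ) : ∃ a : (Fin d → ℤ) → (E d →₀ ℂ), ∀ ξ ∈ freqs d N,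
    ∀ c : (Fin d → ℤ) → ℂ, (a ξ).sum (fun x w => w * trig (freqs d N) c x) = c ξ := by
  classical
  have hli : LinearIndependent ℂ (fun ξ : freqs d N => (expo ξ.1 : E d → ℂ)) := by
    rw [Fintype.linearIndependent_iff]
    intro g hg ξ
    set c : (Fin d → ℤ) → ℂ := fun η => if h : η ∈ freqs d N then g ⟨η, h⟩ else 0 with hc
    have h0 : ∀ x, trig (freqs d N) c x = 0 := by
      intro x
      have := congrFun hg x
      simp only [Finset.sum_apply, Pi.smul_apply, smul_eq_mul, Pi.zero_apply] at this
      rw [← this, trig, ← Finset.sum_coe_sort]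
      refine Finset.sum_congr rfl fun η _ => ?_
      rw [hc]; simp
    have h1 := integral_trig_mul_expo (freqs d N) c ξ.1
    simp only [h0, zero_mul, integral_zero, if_pos ξ.2] at h1
    have h2 : c ξ.1 = 0 := by
      rcases mul_eq_zero.1 h1.symm with h | h
      · exact absurd h two_pi_pow_ne
      · exact h
    simpa [hc] using h2
  have hspan := span_flip_eq_top_iff_linearIndependent.2 hli
  have hex : ∀ ξ : Fin d → ℤ, ∃ a : E d →₀ ℂ, ξ ∈ freqs d N →
      ∀ c : (Fin d → ℤ) → ℂ, a.sum (fun x w => w * trig (freqs d N) c x) = c ξ := by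
    intro ξ
    by_cases hξ : ξ ∈ freqs d N
    · have h1 : (Pi.single ⟨ξ, hξ⟩ 1 : freqs d N → ℂ) ∈
          Submodule.span ℂ (Set.range (flip fun ξ : freqs d N => (expo ξ.1 : E d → ℂ))) := by
        rw [hspan]; trivial
      obtain ⟨a, ha⟩ := (Finsupp.mem_span_range_iff_exists_finsupp).1 h1
      refine ⟨a, fun _ c => ?_⟩
      have h2 : ∀ η : freqs d N, a.sum (fun x w => w * expo η.1 x) =
          (Pi.single ⟨ξ, hξ⟩ 1 : freqs d N → ℂ) η := by
        intro η
        rw [← ha, Finsupp.sum, Finsupp.sum, Finset.sum_apply]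
        rfl
      simp only [Finsupp.sum] at h2 ⊢
      simp only [trig, Finset.mul_sum]
      rw [Finset.sum_comm, ← Finset.sum_coe_sort (freqs d N)]
      have h3 : ∀ η : freqs d N, ∑ x ∈ a.support, a x * (c η.1 * expo η.1 x) =
          c η.1 * (Pi.single ⟨ξ, hξ⟩ 1 : freqs d N → ℂ) η := by
        intro η
        rw [← h2, Finset.mul_sum]
        exact Finset.sum_congr rfl fun x _ => by ring
      simp only [h3, Pi.single_apply]
      simp
    · exact ⟨0, fun h => absurd h hξ⟩
  choose a ha using hex
  exact ⟨a, ha⟩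

/-! ### Time dependent trigonometric polynomials -/

lemma norm_trig_le (S : Finset (Fin d → ℤ)) (c : (Fin d → ℤ) → ℂ) (x : E d) :
    ‖trig S c x‖ ≤ ∑ ξ ∈ S, ‖c ξ‖ :=
  (norm_sum_le _ _).trans (Finset.sum_le_sum fun ξ _ => by rw [norm_mul, norm_expo, mul_one])

lemma continuousOn_integral_comp {S : Finset (Fin d → ℤ)} {c : ℝ → (Fin d → ℤ) → ℂ}
    {w : ℝ → E d → ℝ} {η : ℝ → ℝ} {T : ℝ} (hη : Continuous η)
    (hw : ∀ t ∈ Set.Icc 0 T, ∀ x, (w t x : ℂ) = trig S (c t) x)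
    (hc : ∀ ξ ∈ S, ContinuousOn (fun t => c t ξ) (Set.Icc 0 T)) :
    ContinuousOn (fun t => ∫ x, η (w t x) ∂(cellVol d)) (Set.Icc 0 T) := by
  have hsum : ContinuousOn (fun t => ∑ ξ ∈ S, ‖c t ξ‖) (Set.Icc 0 T) :=
    continuousOn_finsetSum _ fun ξ hξ => (hc ξ hξ).norm
  obtain ⟨R, hR⟩ := isCompact_Icc.exists_bound_of_continuousOn hsum
  have hwR : ∀ t ∈ Set.Icc 0 T, ∀ x, |w t x| ≤ R := by
    intro t ht x
    rw [← Real.norm_eq_abs, ← Complex.norm_real, hw t ht]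
    exact ((norm_trig_le _ _ _).trans (le_abs_self _)).trans (hR t ht)
  obtain ⟨M, hM⟩ := (isCompact_Icc (a := -R) (b := R)).exists_bound_of_continuousOn hη.continuousOn
  refine continuousOn_of_dominated (bound := fun _ => M) ?_ ?_ (integrable_const _) ?_
  · intro t ht
    have := (contDiff_of_eq_trig (hw t ht) (n := 0)).continuous
    exact (integrable_cellVol (by fun_prop)).aestronglyMeasurable
  · intro t ht
    exact Eventually.of_forall fun x => hM _ (abs_le.1 (hwR t ht x))
  · refine Eventually.of_forall fun x => hη.comp_continuousOn ?_
    have h1 : ContinuousOn (fun t => (trig S (c t) x).re) (Set.Icc 0 T) := by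
      refine Complex.continuous_re.comp_continuousOn ?_
      exact continuousOn_finsetSum _ fun ξ hξ => (hc ξ hξ).mul continuousOn_const
    refine h1.congr fun t ht => ?_
    change w t x = (trig S (c t) x).re
    rw [← hw t ht x, Complex.ofReal_re]

/-- The coefficients are differentiable at the single time t only, so the difference quotients
themselves are dominated: near t the coefficients move at most linearly, and η is Lipschitz on the
bounded range of values. -/
lemma hasDerivAt_integral_comp {S : Finset (Fin d → ℤ)} {c : ℝ → (Fin d → ℤ) → ℂ}
    {c' : (Fin d → ℤ) → ℂ} {w : ℝ → E d → ℝ} {v : E d → ℝ} {η η' : ℝ → ℝ} {t : ℝ}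
    (hη : ∀ r, HasDerivAt η (η' r) r) (hη' : Continuous η')
    (hw : ∀ᶠ τ in 𝓝 t, ∀ x, (w τ x : ℂ) = trig S (c τ) x)
    (hc : ∀ ξ ∈ S, HasDerivAt (fun τ => c τ ξ) (c' ξ) t) (hv : ∀ x, (v x : ℂ) = trig S c' x) :
    HasDerivAt (fun τ => ∫ x, η (w τ x) ∂(cellVol d))
      (∫ x, η' (w t x) * v x ∂(cellVol d)) t := by
  have hηc : Continuous η := continuous_iff_continuousAt.2 fun r => (hη r).continuousAt
  have hwt := hw.self_of_nhds
  have hwd : ∀ x, HasDerivAt (fun τ => w τ x) (v x) t := by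
    intro x
    have h1 : HasDerivAt (fun τ => trig S (c τ) x) (trig S c' x) t := by
      unfold trig
      exact HasDerivAt.fun_sum fun ξ hξ => (hc ξ hξ).mul_const _
    have h2 : HasDerivAt (fun τ => (w τ x : ℂ)) (v x : ℂ) t := by
      rw [hv]
      exact h1.congr_of_eventuallyEq (hw.mono fun τ hτ => hτ x)
    have := Complex.reCLM.hasFDerivAt.comp_hasDerivAt t h2
    simpa using! this
  have hcsum : Tendsto (fun τ => ∑ ξ ∈ S, ‖c τ ξ‖) (𝓝 t) (𝓝 (∑ ξ ∈ S, ‖c t ξ‖)) :=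
    tendsto_finsetSum _ fun ξ hξ => ((hc ξ hξ).continuousAt.tendsto).norm
  set R : ℝ := ∑ ξ ∈ S, ‖c t ξ‖ + 1 with hR
  have hbR : ∀ᶠ τ in 𝓝 t, ∀ x, |w τ x| ≤ R := by
    filter_upwards [hw, hcsum.eventually_lt_const (lt_add_one _)] with τ h1 h2 x
    rw [← Real.norm_eq_abs, ← Complex.norm_real, h1]
    exact (norm_trig_le _ _ _).trans h2.le
  obtain ⟨L, hL⟩ := (isCompact_Icc (a := -R) (b := R)).exists_bound_of_continuousOn
    hη'.continuousOn
  have hL0 : 0 ≤ L := by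
    have hR0 : 0 ≤ R := add_nonneg (Finset.sum_nonneg fun ξ _ => norm_nonneg _) zero_le_one
    exact (norm_nonneg _).trans (hL 0 ⟨by linarith, hR0⟩)
  have hslope : ∀ ξ ∈ S, ∀ᶠ τ in 𝓝[≠] t, ‖c τ ξ - c t ξ‖ ≤ (‖c' ξ‖ + 1) * |τ - t| := by
    intro ξ hξ
    have h1 := ((hasDerivAt_iff_tendsto_slope.1 (hc ξ hξ)).norm).eventually_lt_const
      (lt_add_one _)
    filter_upwards [h1, self_mem_nhdsWithin] with τ h2 h3
    have h4 : 0 < |τ - t| := abs_pos.2 (sub_ne_zero.2 h3)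
    rw [slope_def_module, norm_smul, norm_inv, Real.norm_eq_abs, inv_mul_lt_iff₀ h4] at h2
    linarith
  rw [hasDerivAt_iff_tendsto_slope]
  have hall : ∀ᶠ τ in 𝓝[≠] t, ∀ ξ ∈ S, ‖c τ ξ - c t ξ‖ ≤ (‖c' ξ‖ + 1) * |τ - t| :=
    (Filter.eventually_all_finset S).2 hslope
  set D : ℝ := ∑ ξ ∈ S, (‖c' ξ‖ + 1) with hD
  have hcont : ∀ τ, (∀ x, (w τ x : ℂ) = trig S (c τ) x) → Continuous fun x => η (w τ x) :=
    fun τ h => hηc.comp (contDiff_of_eq_trig h (n := 0)).continuous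
  have key := tendsto_integral_filter_of_dominated_convergence (μ := cellVol d)
    (F := fun τ x => slope (fun τ => η (w τ x)) t τ) (f := fun x => η' (w t x) * v x)
    (l := 𝓝[≠] t) (fun _ => L * D) ?_ ?_ (integrable_const _) ?_
  · refine key.congr' ?_
    filter_upwards [hw.filter_mono nhdsWithin_le_nhds] with τ hτ
    simp only [slope_def_module, integral_smul]
    rw [integral_sub (integrable_cellVol (hcont τ hτ)) (integrable_cellVol (hcont t hwt))]
  · filter_upwards [hw.filter_mono nhdsWithin_le_nhds] with τ hτ
    have h1 := hcont τ hτ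
    have h2 := hcont t hwt
    have h3 : Continuous fun x => η (w τ x) - η (w t x) := h1.sub h2
    simp only [slope_def_module]
    exact ((integrable_cellVol h3).smul (τ - t)⁻¹).aestronglyMeasurable
  · filter_upwards [hall, hw.filter_mono nhdsWithin_le_nhds, hbR.filter_mono nhdsWithin_le_nhds,
      self_mem_nhdsWithin] with τ h1 h2 h3 h4
    refine Eventually.of_forall fun x => ?_
    have h5 : 0 < |τ - t| := abs_pos.2 (sub_ne_zero.2 h4)
    rw [slope_def_module, norm_smul, norm_inv, Real.norm_eq_abs, inv_mul_le_iff₀ h5]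
    have h6 : ‖η (w τ x) - η (w t x)‖ ≤ L * ‖w τ x - w t x‖ :=
      (convex_Icc (-R) R).norm_image_sub_le_of_norm_hasDerivWithin_le
        (fun r _ => (hη r).hasDerivWithinAt) (fun r hr => hL r hr)
        (abs_le.1 (hbR.self_of_nhds x)) (abs_le.1 (h3 x))
    have h7 : ‖w τ x - w t x‖ ≤ D * |τ - t| := by
      rw [← Complex.norm_real, Complex.ofReal_sub, h2, hwt, trig_sub]
      refine (norm_trig_le _ _ _).trans ?_
      rw [hD, Finset.sum_mul]
      exact Finset.sum_le_sum h1
    calc _ ≤ L * ‖w τ x - w t x‖ := h6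
      _ ≤ L * (D * |τ - t|) := by gcongr
      _ = _ := by ring
  · refine Eventually.of_forall fun x => ?_
    exact hasDerivAt_iff_tendsto_slope.1 ((hη (w t x)).comp t (hwd x))

/-! ### The equations for the Fourier coefficients -/

/-- The symbol of the spectral viscosity. -/
def viscSymbol (m : ℕ) (q : Fin d → Fin d → ℕ → ℝ) (ξ : Fin d → ℤ) : ℝ :=
  if m ≤ freqSize ξ then ∑ j, ∑ k, q j k (freqSize ξ) * (ξ j : ℝ) * (ξ k : ℝ) else 0

/-- The time derivative of the Fourier coefficients of a solution. -/
def rhs (f : Fin d → ℝ → ℝ) (μ : Measure (E d)) (m : ℕ) (ε : ℝ) (q : Fin d → Fin d → ℕ → ℝ)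
    (φ : E d → ℝ) (ξ : Fin d → ℤ) : ℂ :=
  -(∑ j, Complex.I * (ξ j : ℂ) * coeff (fun y => f j (φ y)) ξ) + levySymbol μ ξ * coeff φ ξ
    - ((ε * viscSymbol m q ξ : ℝ) : ℂ) * coeff φ ξ

lemma partialD_trig (S : Finset (Fin d → ℤ)) (c : (Fin d → ℤ) → ℂ) (j : Fin d) (x : E d) :
    partialD j (trig S c) x = trig S (fun ξ => Complex.I * (ξ j : ℂ) * c ξ) x := by
  have h := (contDiff_trig S c (n := 1)).differentiable one_ne_zero x
  rw [partialD, h.lineDeriv_eq_fderiv, fderiv_trig]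
  simp

lemma viscTerm_eq (N m : ℕ) (q : Fin d → Fin d → ℕ → ℝ) (φ : E d → ℝ) (x : E d) :
    viscTerm N m q φ x = trig (freqs d N) (fun ξ => -((viscSymbol m q ξ : ℂ) * coeff φ ξ)) x := by
  rw [viscTerm, trig, Finset.sum_filter, ← Finset.sum_neg_distrib]
  refine Finset.sum_congr rfl fun ξ _ => ?_
  unfold viscSymbol
  split_ifs <;> simp

variable {T : ℝ} {f : Fin d → ℝ → ℝ} {μ : Measure (E d)} {u₀ : E d → ℝ} {N m : ℕ} {ε : ℝ}
  {q : Fin d → Fin d → ℕ → ℝ → ℝ} {u : ℝ → E d → ℝ}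

lemma IsSVVSolution.eq_trig (h : IsSVVSolution T f μ u₀ N m ε q u) {t : ℝ} (ht : t ∈ Set.Icc 0 T) (x : E d) :
    (u t x : ℂ) = SVV.trig (freqs d N) (coeff (u t)) x := (h.trig t ht).eq_trig x

lemma IsSVVSolution.continuousOn_coeff (h : IsSVVSolution T f μ u₀ N m ε q u) {ξ : Fin d → ℤ}
    (hξ : ξ ∈ freqs d N) : ContinuousOn (fun t => coeff (u t) ξ) (Set.Icc 0 T) := by
  obtain ⟨a, ha⟩ := exists_interp d N
  have h1 : ContinuousOn (fun t => (a ξ).sum fun x w => w * (u t x : ℂ)) (Set.Icc 0 T) := by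
    simp only [Finsupp.sum]
    exact continuousOn_finsetSum _ fun x _ => continuousOn_const.mul
      (Complex.continuous_ofReal.comp_continuousOn (h.cont x))
  refine h1.congr fun t ht => ?_
  rw [← ha ξ hξ (coeff (u t))]
  exact Finsupp.sum_congr fun x _ => by rw [h.eq_trig ht]

lemma IsSVVSolution.eqn_trig (h : IsSVVSolution T f μ u₀ N m ε q u) (hμ : IsLevy μ) {t : ℝ}
    (ht : t ∈ Set.Ioo 0 T) (x : E d) : HasDerivAt (fun τ => (u τ x : ℂ))
      (SVV.trig (freqs d N) (rhs f μ m ε (fun j k p => q j k p t) (u t)) x) t := by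
  refine (h.eqn t ht x).congr_deriv ?_
  have h1 : ∀ j, proj N (fun y => f j (u t y)) =
      SVV.trig (freqs d N) (coeff fun y => f j (u t y)) := fun j => rfl
  simp only [h1, partialD_trig, viscTerm_eq, levy_of_eq_trig hμ (h.eq_trig ⟨ht.1.le, ht.2.le⟩)]
  simp only [SVV.trig]
  rw [Finset.sum_comm, Finset.mul_sum, ← Finset.sum_neg_distrib, ← Finset.sum_add_distrib,
    ← Finset.sum_add_distrib]
  refine Finset.sum_congr rfl fun ξ _ => ?_
  rw [rhs, ← Finset.sum_mul]
  push_cast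
  ring

/-- The equation is given pointwise in x; finitely many points determine the coefficient. -/
lemma IsSVVSolution.hasDerivAt_coeff (h : IsSVVSolution T f μ u₀ N m ε q u) (hμ : IsLevy μ) {t : ℝ}
    (ht : t ∈ Set.Ioo 0 T) {ξ : Fin d → ℤ} (hξ : ξ ∈ freqs d N) :
    HasDerivAt (fun τ => coeff (u τ) ξ) (rhs f μ m ε (fun j k p => q j k p t) (u t) ξ) t := by
  obtain ⟨a, ha⟩ := exists_interp d N
  have h1 : HasDerivAt (fun τ => (a ξ).sum fun x w => w * (u τ x : ℂ))
      ((a ξ).sum fun x w => w * SVV.trig (freqs d N) (rhs f μ m ε (fun j k p => q j k p t) (u t)) x)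
      t := by
    simp only [Finsupp.sum]
    exact HasDerivAt.fun_sum fun x _ => (h.eqn_trig hμ ht x).const_mul _
  rw [ha ξ hξ] at h1
  refine h1.congr_of_eventuallyEq ?_
  filter_upwards [Ioo_mem_nhds ht.1 ht.2] with τ hτ
  rw [← ha ξ hξ (coeff (u τ))]
  exact Finsupp.sum_congr fun x _ => by rw [h.eq_trig ⟨hτ.1.le, hτ.2.le⟩]

end SVV

end

noncomputable section
namespace SVV

variable {d : ℕ}

/-! ### The defect of the spectral viscosity -/

/-- `δ_{jk} - Q̂_p^{jk}`, with `Q̂_p = 0` for `p < m`. -/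
def resid (m : ℕ) (q : Fin d → Fin d → ℕ → ℝ) (j k : Fin d) (p : ℕ) : ℝ :=
  (if j = k then 1 else 0) - if m ≤ p then q j k p else 0

lemma sum_sq_sub_viscSymbol (m : ℕ) (q : Fin d → Fin d → ℕ → ℝ) (ξ : Fin d → ℤ) :
    ∑ j, (ξ j : ℝ) ^ 2 - viscSymbol m q ξ =
      ∑ j, ∑ k, resid m q j k (freqSize ξ) * ξ j * ξ k := by
  have h1 : viscSymbol m q ξ = ∑ j, ∑ k, (if m ≤ freqSize ξ then q j k (freqSize ξ) else 0) *
      (ξ j : ℝ) * ξ k := by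
    unfold viscSymbol
    split_ifs <;> simp
  rw [h1, ← Finset.sum_sub_distrib]
  refine Finset.sum_congr rfl fun j _ => ?_
  simp only [resid, sub_mul, Finset.sum_sub_distrib]
  simp [pow_two]

section Resid

variable {N m : ℕ} {q : Fin d → Fin d → ℕ → ℝ} {C : ℝ}

lemma abs_resid_le (hC : 0 ≤ C)
    (hq : ∀ j k p, m ≤ p → p ≤ N → |q j k p - (if j = k then 1 else 0)| * (p : ℝ) ^ 2 ≤
      C * (m : ℝ) ^ 2) (j k : Fin d) {p : ℕ} (hp : p ≤ N) :
    |resid m q j k p| * (p : ℝ) ^ 2 ≤ (C + 1) * (m : ℝ) ^ 2 := by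
  unfold resid
  split_ifs with h1 h2 h2
  · have := hq j k p h2 hp
    rw [if_pos h1, abs_sub_comm] at this
    nlinarith [sq_nonneg (m : ℝ)]
  -- Below the threshold the residual is δ_jk ≤ 1 and p ≤ m, which accounts for the 1 in C + 1.
  · have : (p : ℝ) ≤ m := by exact_mod_cast (not_le.1 h2).le
    have : (p : ℝ) ^ 2 ≤ (m : ℝ) ^ 2 := by gcongr
    norm_num
    nlinarith [sq_nonneg (m : ℝ)]
  · have := hq j k p h2 hp
    rw [if_neg h1, abs_sub_comm] at this
    nlinarith [sq_nonneg (m : ℝ)]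
  · simp; positivity

lemma abs_sum_sq_sub_viscSymbol_le (hC : 0 ≤ C)
    (hq : ∀ j k p, m ≤ p → p ≤ N → |q j k p - (if j = k then 1 else 0)| * (p : ℝ) ^ 2 ≤
      C * (m : ℝ) ^ 2) {ξ : Fin d → ℤ} (hξ : ξ ∈ freqs d N) :
    |∑ j, (ξ j : ℝ) ^ 2 - viscSymbol m q ξ| ≤ d ^ 2 * (C + 1) * (m : ℝ) ^ 2 := by
  rw [sum_sq_sub_viscSymbol]
  have habs : ∀ j, |(ξ j : ℝ)| ≤ freqSize ξ := fun j => by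
    rw [← Int.cast_abs, Int.abs_eq_natAbs]
    exact_mod_cast natAbs_le_freqSize ξ j
  have h1 : ∀ j k, |resid m q j k (freqSize ξ) * ξ j * ξ k| ≤ (C + 1) * (m : ℝ) ^ 2 := by
    intro j k
    refine le_trans ?_ (abs_resid_le hC hq j k (mem_freqs_iff.1 hξ))
    rw [abs_mul, abs_mul, mul_assoc, pow_two]
    gcongr <;> exact habs _
  refine (Finset.abs_sum_le_sum_abs _ _).trans ?_
  refine (Finset.sum_le_sum fun j _ => (Finset.abs_sum_le_sum_abs _ _).trans
    (Finset.sum_le_sum fun k _ => h1 j k)).trans (le_of_eq ?_)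
  simp; ring

/-- From m on the residual is nonincreasing in p, so the absolute values open and summation by parts
leaves Σ r(p+1)(2p+1). As |r(p)| ≤ const·m²/p², this is m² times a harmonic sum, the source of the
logarithm. -/
lemma sum_abs_resid_sub_le (hC : 0 ≤ C)
    (hq : ∀ j k p, m ≤ p → p ≤ N → |q j k p - (if j = k then 1 else 0)| * (p : ℝ) ^ 2 ≤
      C * (m : ℝ) ^ 2) (j k : Fin d) (hmono : MonotoneOn (fun p => q j k p) (Set.Icc m N)) :
    ∑ p ∈ Finset.range N, |resid m q j k p - resid m q j k (p + 1)| * (p : ℝ) ^ 2 ≤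
      7 * ((C + 1) * (m : ℝ) ^ 2) * (1 + Real.log N) := by
  set r := resid m q j k with hr
  have hm0 : (0 : ℝ) ≤ (m : ℝ) ^ 2 := by positivity
  have hres : ∀ p ≤ N, |r p| * (p : ℝ) ^ 2 ≤ (C + 1) * (m : ℝ) ^ 2 := fun p hp =>
    abs_resid_le hC hq j k hp
  -- The inductive bound carries the boundary term -r(n) n², so passing to n + 1 costs only
  -- |r(n+1)|(2n+1), at most twice the new harmonic term.
  have key : ∀ n ≤ N, (n < m → ∑ p ∈ Finset.range n, |r p - r (p + 1)| * (p : ℝ) ^ 2 = 0) ∧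
      (m ≤ n → ∑ p ∈ Finset.range n, |r p - r (p + 1)| * (p : ℝ) ^ 2 ≤
        4 * ((C + 1) * (m : ℝ) ^ 2) - r n * (n : ℝ) ^ 2 +
          2 * ((C + 1) * (m : ℝ) ^ 2) * (harmonic n : ℝ)) := by
    intro n
    induction n with
    | zero => intro _; simp; intro; positivity
    | succ n ih =>
      intro hn
      obtain ⟨h1, h2⟩ := ih (by omega)
      have hcast : ((n + 1 : ℕ) : ℝ) = n + 1 := by push_cast; ring
      refine ⟨fun h => ?_, fun h => ?_⟩
      · rw [Finset.sum_range_succ, h1 (by omega)]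
        simp only [hr, resid, if_neg (show ¬ m ≤ n by omega), if_neg (show ¬ m ≤ n + 1 by omega)]
        simp
      · rw [Finset.sum_range_succ, harmonic_succ]
        push_cast
        have hh : (0 : ℝ) ≤ (harmonic n : ℝ) := by
          unfold harmonic; push_cast; positivity
        have hb := hres (n + 1) hn
        rw [hcast] at hb
        have hn1 : (0 : ℝ) < (n : ℝ) + 1 := by positivity
        rcases Nat.lt_or_ge n m with h3 | h3
        -- The jump across the threshold is not monotone and is estimated directly.
        · have hm : m = n + 1 := by omega
          rw [h1 h3]
          have h4 : |r n - r (n + 1)| * (n : ℝ) ^ 2 ≤ (C + 2) * (m : ℝ) ^ 2 := by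
            have h5 : r n = if j = k then 1 else 0 := by
              simp [hr, resid, show ¬ m ≤ n by omega]
            have h6 : |r n| ≤ 1 := by rw [h5]; split_ifs <;> simp
            have h7 : (n : ℝ) ^ 2 ≤ (m : ℝ) ^ 2 := by
              have : (n : ℝ) ≤ m := by exact_mod_cast h3.le
              gcongr
            have h8 : |r (n + 1)| * (n : ℝ) ^ 2 ≤ (C + 1) * (m : ℝ) ^ 2 := by
              refine le_trans ?_ hb
              gcongr
              linarith
            calc _ ≤ (|r n| + |r (n + 1)|) * (n : ℝ) ^ 2 := by gcongr; exact abs_sub _ _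
              _ ≤ 1 * (m : ℝ) ^ 2 + (C + 1) * (m : ℝ) ^ 2 := by
                rw [add_mul]; gcongr
              _ = _ := by ring
          have h6 : 0 ≤ 2 * ((C + 1) * (m : ℝ) ^ 2) * ((harmonic n : ℝ) + ((n : ℝ) + 1)⁻¹) := by
            positivity
          have h7 : r (n + 1) * ((n : ℝ) + 1) ^ 2 ≤ |r (n + 1)| * ((n : ℝ) + 1) ^ 2 := by
            gcongr; exact le_abs_self _
          nlinarith
        · have h4 : 0 ≤ r n - r (n + 1) := by
            have := hmono ⟨h3, by omega⟩ ⟨h, hn⟩ (Nat.le_succ n)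
            simp only [hr, resid, if_pos h3, if_pos h]
            simpa using this
          rw [abs_of_nonneg h4]
          have h5 : |r (n + 1)| * (2 * (n : ℝ) + 1) ≤ 2 * ((C + 1) * (m : ℝ) ^ 2) * ((n : ℝ) + 1)⁻¹ := by
            rw [← div_eq_mul_inv, le_div_iff₀ hn1]
            nlinarith [abs_nonneg (r (n + 1))]
          have h6 := le_abs_self (r (n + 1))
          nlinarith [h2 h3]
  have hlog : 0 ≤ Real.log N := Real.log_natCast_nonneg N
  have hX : 0 ≤ (C + 1) * (m : ℝ) ^ 2 := by positivity
  rcases Nat.lt_or_ge N m with h | h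
  · rw [(key N le_rfl).1 h]; positivity
  · have h1 := (key N le_rfl).2 h
    have h2 := hres N le_rfl
    have h3 : -(|r N| * (N : ℝ) ^ 2) ≤ r N * (N : ℝ) ^ 2 := by
      rw [← neg_mul]; gcongr; exact neg_abs_le _
    have h4 := mul_le_mul_of_nonneg_left (harmonic_le_one_add_log N) hX
    nlinarith [mul_nonneg hX hlog]

end Resid

lemma nrm_sum_le {k : ℕ} (hk : 1 ≤ k) {ι : Type*} (s : Finset ι) {g : ι → E d → ℂ} {K : ι → ℝ}
    (hg : ∀ i ∈ s, Continuous (g i)) (h : ∀ i ∈ s, nrm k (g i) ≤ K i) :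
    nrm k (fun x => ∑ i ∈ s, g i x) ≤ ∑ i ∈ s, K i := by
  classical
  induction s using Finset.induction_on with
  | empty => simp [nrm]
  | insert a s ha ih =>
    simp only [Finset.sum_insert ha]
    have h1 : Continuous fun x => ∑ i ∈ s, g i x :=
      continuous_finsetSum _ fun i hi => hg i (Finset.mem_insert_of_mem hi)
    refine (lpNorm_add_le (memLp_cellVol (hg a (Finset.mem_insert_self _ _)) _)
      (one_le_two_mul hk) (g := fun x => ∑ i ∈ s, g i x)).trans (add_le_add ?_ ?_)
    · exact h a (Finset.mem_insert_self _ _)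
    · exact ih (fun i hi => hg i (Finset.mem_insert_of_mem hi))
        fun i hi => h i (Finset.mem_insert_of_mem hi)

/-- Riesz projections and Abel summation for each of the d² entries. The loss of log N is the price
of leaving L². -/
lemma exists_nrm_viscDefect_le (d k : ℕ) (hk : 1 ≤ k) : ∃ K : ℝ, 0 ≤ K ∧ ∀ (N m : ℕ)
    (q : Fin d → Fin d → ℕ → ℝ) (C : ℝ), 0 ≤ C →
    (∀ j k p, m ≤ p → p ≤ N → |q j k p - (if j = k then 1 else 0)| * (p : ℝ) ^ 2 ≤
      C * (m : ℝ) ^ 2) → (∀ j k, MonotoneOn (fun p => q j k p) (Set.Icc m N)) →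
    ∀ c : (Fin d → ℤ) → ℂ,
      nrm k (trig (freqs d N) fun ξ => ((∑ j, (ξ j : ℝ) ^ 2 - viscSymbol m q ξ : ℝ) : ℂ) * c ξ) ≤
        K * ((C + 1) * (m : ℝ) ^ 2) * (1 + Real.log N) * nrm k (trig (freqs d N) c) := by
  obtain ⟨K, hK, h⟩ := exists_nrm_radial_le d k hk
  refine ⟨d ^ 2 * (8 * K), by positivity, fun N m q C hC hq hmono c => ?_⟩
  have hlog : 0 ≤ Real.log N := Real.log_natCast_nonneg N
  have hX : 0 ≤ (C + 1) * (m : ℝ) ^ 2 := by positivity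
  have h1 : (trig (freqs d N) fun ξ =>
      ((∑ j, (ξ j : ℝ) ^ 2 - viscSymbol m q ξ : ℝ) : ℂ) * c ξ) = fun x =>
      ∑ p : Fin d × Fin d, trig (freqs d N) (fun ξ =>
        ((resid m q p.1 p.2 (freqSize ξ) * ξ p.1 * ξ p.2 : ℝ) : ℂ) * c ξ) x := by
    ext x
    simp only [trig, sum_sq_sub_viscSymbol]
    rw [Finset.sum_comm]
    refine Finset.sum_congr rfl fun ξ _ => ?_
    rw [Fintype.sum_prod_type]
    simp only [Complex.ofReal_sum, Finset.sum_mul]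
  have h2 : ∀ p : Fin d × Fin d, K * (|resid m q p.1 p.2 N| * (N : ℝ) ^ 2 +
      ∑ n ∈ Finset.range N, |resid m q p.1 p.2 n - resid m q p.1 p.2 (n + 1)| * (n : ℝ) ^ 2) *
      nrm k (trig (freqs d N) c) ≤
      K * (8 * ((C + 1) * (m : ℝ) ^ 2) * (1 + Real.log N)) * nrm k (trig (freqs d N) c) := by
    intro p
    have := nrm_nonneg k (trig (freqs d N) c)
    gcongr
    have h3 := abs_resid_le hC hq p.1 p.2 le_rfl
    have h4 := sum_abs_resid_sub_le hC hq p.1 p.2 (hmono _ _)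
    nlinarith [mul_nonneg hX hlog]
  have h5 : ∀ p : Fin d × Fin d, nrm k (trig (freqs d N) fun ξ =>
      ((resid m q p.1 p.2 (freqSize ξ) * ξ p.1 * ξ p.2 : ℝ) : ℂ) * c ξ) ≤
      K * (8 * ((C + 1) * (m : ℝ) ^ 2) * (1 + Real.log N)) * nrm k (trig (freqs d N) c) :=
    fun p => (h N (resid m q p.1 p.2) p.1 p.2 c).trans (h2 p)
  have h6 := nrm_sum_le hk Finset.univ (g := fun p : Fin d × Fin d => trig (freqs d N) fun ξ =>
      ((resid m q p.1 p.2 (freqSize ξ) * ξ p.1 * ξ p.2 : ℝ) : ℂ) * c ξ)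
    (fun p _ => continuous_trig _ _) (fun p _ => h5 p)
  rw [h1]
  refine h6.trans (le_of_eq ?_)
  rw [Finset.sum_const, Finset.card_univ, Fintype.card_prod, Fintype.card_fin, nsmul_eq_mul]
  push_cast
  ring

end SVV

end

noncomputable section
namespace SVV

variable {d : ℕ}

/-! ### Sobolev seminorms and Fourier coefficients -/

lemma coeff_dD_iterate (j : Fin d) (ξ : Fin d → ℤ) (s : ℕ) : ∀ {g : E d → ℝ}, Per g →
    ContDiff ℝ s g → coeff ((dD j)^[s] g) ξ = (Complex.I * (ξ j : ℂ)) ^ s * coeff g ξ := by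
  induction s with
  | zero => intro g _ _; simp
  | succ s ih =>
    intro g hp hg
    have h1 : Per (dD j g) := hp.fderiv.comp fun L : E d →L[ℝ] ℝ => L (dir j)
    have h2 := coeff_fderiv hp (hg.of_le (by norm_cast; omega)) (dir j) ξ
    rw [Function.iterate_succ_apply, ih h1 (contDiff_dD j hg)]
    change _ * coeff (fun x => fderiv ℝ g x (dir j)) ξ = _
    rw [h2, pair_dir]
    push_cast
    ring

lemma norm_coeff_dD_iterate_sq (j : Fin d) (ξ : Fin d → ℤ) {s : ℕ} {g : E d → ℝ} (hp : Per g)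
    (hg : ContDiff ℝ s g) :
    ‖coeff ((dD j)^[s] g) ξ‖ ^ 2 = (ξ j : ℝ) ^ (2 * s) * ‖coeff g ξ‖ ^ 2 := by
  rw [coeff_dD_iterate j ξ s hp hg, norm_mul, mul_pow, norm_pow, norm_mul, Complex.norm_I, one_mul,
    Complex.norm_intCast, ← pow_mul, mul_comm s, pow_mul, sq_abs, ← pow_mul]

lemma sum_pow_mul_norm_coeff_sq_le (j : Fin d) {s : ℕ} {g : E d → ℝ} (hp : Per g)
    (hg : ContDiff ℝ s g) (S : Finset (Fin d → ℤ)) :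
    (2 * Real.pi) ^ d * ∑ ξ ∈ S, (ξ j : ℝ) ^ (2 * s) * ‖coeff g ξ‖ ^ 2 ≤
      ∫ x, ((dD j)^[s] g x) ^ 2 ∂(cellVol d) := by
  have h : ContDiff ℝ (0 : ℕ) ((dD j)^[s] g) := contDiff_dD_iterate j s (by simpa using hg)
  have := sum_norm_coeff_sq_le h.continuous S
  simpa only [norm_coeff_dD_iterate_sq j _ hp hg] using this

lemma dD_iterate_of_eq_trig (j : Fin d) (S : Finset (Fin d → ℤ)) (s : ℕ) :
    ∀ {φ : E d → ℝ} {c : (Fin d → ℤ) → ℂ}, (∀ x, (φ x : ℂ) = trig S c x) → ∀ x,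
      ((dD j)^[s] φ x : ℂ) = trig S (fun ξ => (Complex.I * (ξ j : ℂ)) ^ s * c ξ) x := by
  induction s with
  | zero => intro φ c h x; simpa using h x
  | succ s ih =>
    intro φ c h x
    rw [Function.iterate_succ_apply]
    refine (ih (φ := dD j φ) (fun x => fderiv_of_eq_trig h x (dir j)) x).trans ?_
    refine trig_congr (fun ξ _ => ?_) x
    rw [pair_dir]
    push_cast
    ring

lemma integral_dD_iterate_sq (j : Fin d) {S : Finset (Fin d → ℤ)} (s : ℕ) {φ : E d → ℝ}
    {c : (Fin d → ℤ) → ℂ} (h : ∀ x, (φ x : ℂ) = trig S c x) :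
    ∫ x, ((dD j)^[s] φ x) ^ 2 ∂(cellVol d) =
      (2 * Real.pi) ^ d * ∑ ξ ∈ S, (ξ j : ℝ) ^ (2 * s) * ‖c ξ‖ ^ 2 := by
  rw [integral_sq_of_eq_trig (dD_iterate_of_eq_trig j S s h)]
  congr 1
  refine Finset.sum_congr rfl fun ξ _ => ?_
  rw [norm_mul, mul_pow, norm_pow, norm_mul, Complex.norm_I, one_mul,
    Complex.norm_intCast, ← pow_mul, mul_comm s, pow_mul, sq_abs, ← pow_mul]

lemma integral_one_cellVol : ∫ _ : E d, (1 : ℝ) ∂(cellVol d) = (2 * Real.pi) ^ d := by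
  have h := integral_expo (d := d) 0
  simp only [expo_zero_freq, if_pos] at h
  have h2 : ((∫ _ : E d, (1 : ℝ) ∂(cellVol d) : ℝ) : ℂ) = ((2 * Real.pi) ^ d : ℝ) := by
    rw [← integral_complex_ofReal]; push_cast; exact h
  exact_mod_cast h2

lemma integral_const_cellVol (a : ℝ) : ∫ _ : E d, a ∂(cellVol d) = a * (2 * Real.pi) ^ d := by
  rw [← integral_one_cellVol, ← integral_const_mul]; simp

lemma sum_norm_coeff_sq_le_of_abs_le {φ : E d → ℝ} (hφ : Continuous φ) {A : ℝ}
    (h : ∀ x, |φ x| ≤ A) (S : Finset (Fin d → ℤ)) : ∑ ξ ∈ S, ‖coeff φ ξ‖ ^ 2 ≤ A ^ 2 := by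
  have h1 := sum_norm_coeff_sq_le hφ S
  have h2 : Continuous fun x => φ x ^ 2 := hφ.pow 2
  have h3 : ∫ x, φ x ^ 2 ∂(cellVol d) ≤ ∫ _ : E d, A ^ 2 ∂(cellVol d) :=
    integral_mono (integrable_cellVol h2) (integrable_const _) fun x => by
      simpa using pow_le_pow_left₀ (abs_nonneg _) (h x) 2
  rw [integral_const_cellVol] at h3
  have : (0 : ℝ) < (2 * Real.pi) ^ d := by positivity
  nlinarith

/-! ### Polynomial growth of functions with a bounded derivative -/

/-- Integrate downward from order s, starting from the values at 0; each integration over an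
interval of length at most a costs a factor 1 + a. The constant does not depend on a, which for the
scheme is an uncontrolled sup norm. -/
lemma exists_abs_iteratedDeriv_le {s : ℕ} {f : ℝ → ℝ} (hf : ContDiff ℝ s f) {B : ℝ} (hB : 0 ≤ B) :
    ∃ M : ℝ, 0 ≤ M ∧ ∀ a : ℝ, 0 ≤ a → (∀ v, |v| ≤ a → |iteratedDeriv s f v| ≤ B) →
      ∀ k ≤ s, ∀ v, |v| ≤ a → |iteratedDeriv k f v| ≤ M * (1 + a) ^ s := by
  have step : ∀ i ≤ s, ∃ M : ℝ, 0 ≤ M ∧ ∀ a : ℝ, 0 ≤ a →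
      (∀ v, |v| ≤ a → |iteratedDeriv s f v| ≤ B) →
      ∀ v, |v| ≤ a → |iteratedDeriv (s - i) f v| ≤ M * (1 + a) ^ i := by
    intro i
    induction i with
    | zero => exact fun _ => ⟨B, hB, fun a _ h v hv => by simpa using h v hv⟩
    | succ i ih =>
      intro hi
      obtain ⟨M, hM, h⟩ := ih (by omega)
      refine ⟨|iteratedDeriv (s - (i + 1)) f 0| + M, by positivity, fun a ha hb v hv => ?_⟩
      have hk : s - i = s - (i + 1) + 1 := by omega
      have hd : Differentiable ℝ (iteratedDeriv (s - (i + 1)) f) :=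
        hf.differentiable_iteratedDeriv _ (by norm_cast; omega)
      have h1 : |iteratedDeriv (s - (i + 1)) f v - iteratedDeriv (s - (i + 1)) f 0| ≤
          M * (1 + a) ^ i * |v - 0| := by
        refine (convex_Icc (-a) a).norm_image_sub_le_of_norm_deriv_le (fun w _ => hd w)
          (fun w hw => ?_) (abs_le.1 (by simpa using ha)) (abs_le.1 hv)
        rw [← iteratedDeriv_succ, ← hk]
        exact h a ha hb w (abs_le.2 hw)
      have h2 : 1 ≤ (1 + a) ^ (i + 1) := one_le_pow₀ (by linarith)
      have h3 := abs_sub_abs_le_abs_sub (iteratedDeriv (s - (i + 1)) f v)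
        (iteratedDeriv (s - (i + 1)) f 0)
      have h4 : M * (1 + a) ^ i * |v - 0| ≤ M * (1 + a) ^ (i + 1) := by
        rw [pow_succ, sub_zero, mul_assoc]
        gcongr
        linarith
      nlinarith [abs_nonneg (iteratedDeriv (s - (i + 1)) f 0)]
  choose! M hM h using step
  refine ⟨∑ i ∈ Finset.range (s + 1), M i, Finset.sum_nonneg fun i hi =>
    hM i (by simpa [Nat.lt_succ_iff] using hi), fun a ha hb k hk v hv => ?_⟩
  have h1 := h (s - k) (by omega) a ha hb v hv
  rw [show s - (s - k) = k by omega] at h1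
  have h2 : M (s - k) ≤ ∑ i ∈ Finset.range (s + 1), M i :=
    Finset.single_le_sum (f := M) (fun i hi => hM i (by simpa [Nat.lt_succ_iff] using hi))
      (by simp)
  refine h1.trans ?_
  have h3 : (1 + a) ^ (s - k) ≤ (1 + a) ^ s := pow_le_pow_right₀ (by linarith) (by omega)
  have h4 := (hM (s - k) (by omega)).trans h2
  gcongr

/-! ### The energy estimate for the highest derivatives -/

/-- Young's inequality spends half of the full dissipation 2ε|ξ|² on the flux, at the price ε⁻¹|F|²;
the missing viscosity costs 2εD, and the Lévy symbol has nonpositive real part. -/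
lemma two_inner_rhs_le {f : Fin d → ℝ → ℝ} {μ : Measure (E d)} (hμ : IsLevy μ) {m : ℕ} {ε D : ℝ}
    (hε : 0 < ε) {q : Fin d → Fin d → ℕ → ℝ} (φ : E d → ℝ) (ξ : Fin d → ℤ)
    (hD : |∑ j, (ξ j : ℝ) ^ 2 - viscSymbol m q ξ| ≤ D) :
    2 * inner ℝ (coeff φ ξ) (rhs f μ m ε q φ ξ) ≤
      -(ε * ∑ j, (ξ j : ℝ) ^ 2) * ‖coeff φ ξ‖ ^ 2 + 2 * (ε * D) * ‖coeff φ ξ‖ ^ 2 +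
        ε⁻¹ * ∑ k, ‖coeff (fun y => f k (φ y)) ξ‖ ^ 2 := by
  set c := coeff φ ξ
  have hscal : ∀ z : ℂ, inner ℝ c (z * c) = z.re * ‖c‖ ^ 2 := by
    intro z
    rw [Complex.inner, ← Complex.normSq_eq_norm_sq]
    simp [Complex.normSq_apply]
    ring
  have hterm : ∀ k, -(2 * inner ℝ c (Complex.I * (ξ k : ℂ) * coeff (fun y => f k (φ y)) ξ)) ≤
      ε * (ξ k : ℝ) ^ 2 * ‖c‖ ^ 2 + ε⁻¹ * ‖coeff (fun y => f k (φ y)) ξ‖ ^ 2 := by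
    intro k
    set F := coeff (fun y => f k (φ y)) ξ
    have h1 := abs_real_inner_le_norm c (Complex.I * (ξ k : ℂ) * F)
    rw [norm_mul, norm_mul, Complex.norm_I, one_mul, Complex.norm_intCast] at h1
    have h2 := (abs_le.1 h1).1
    have h3 : 2 * (‖c‖ * (|(ξ k : ℝ)| * ‖F‖)) ≤
        ε * (ξ k : ℝ) ^ 2 * ‖c‖ ^ 2 + ε⁻¹ * ‖F‖ ^ 2 := by
      have h4 : 0 ≤ ε⁻¹ * (ε * |(ξ k : ℝ)| * ‖c‖ - ‖F‖) ^ 2 := by positivity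
      have h5 : ε⁻¹ * (ε * |(ξ k : ℝ)| * ‖c‖ - ‖F‖) ^ 2 =
          ε * |(ξ k : ℝ)| ^ 2 * ‖c‖ ^ 2 + ε⁻¹ * ‖F‖ ^ 2 - 2 * (‖c‖ * (|(ξ k : ℝ)| * ‖F‖)) := by
        field_simp; ring
      rw [sq_abs] at h5
      linarith
    linarith
  have hre := re_levySymbol_nonpos hμ ξ
  have hsum := Finset.sum_le_sum fun k (_ : k ∈ Finset.univ) => hterm k
  rw [Finset.sum_neg_distrib, ← Finset.mul_sum, ← inner_sum, Finset.sum_add_distrib,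
    ← Finset.mul_sum, ← Finset.sum_mul, ← Finset.mul_sum] at hsum
  rw [rhs, inner_sub_right, inner_add_right, inner_neg_right, hscal, hscal, Complex.ofReal_re]
  have h6 := (abs_le.1 hD).2
  have h7 : ε * (∑ j, (ξ j : ℝ) ^ 2 - viscSymbol m q ξ) * ‖c‖ ^ 2 ≤ ε * D * ‖c‖ ^ 2 := by gcongr
  have h8 : (levySymbol μ ξ).re * ‖c‖ ^ 2 ≤ 0 := mul_nonpos_of_nonpos_of_nonneg hre (by positivity)
  nlinarith

/-- The square of the `s`-th Sobolev seminorm of a function with frequencies in `|ξ| ≤ N`. -/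
def sob (N s : ℕ) (φ : E d → ℝ) : ℝ :=
  ∑ j, ∑ ξ ∈ freqs d N, (ξ j : ℝ) ^ (2 * s) * ‖coeff φ ξ‖ ^ 2

/-- With y the seminorm of order s and z that of order s + 1, the energy inequality is y' ≤ -εz +
κε⁻¹y. Frequencies with ξ_j² ≥ R give z ≥ R y up to a low-frequency remainder controlled by R^s E₀,
so y decreases whenever it exceeds the stated level. -/
lemma sob_le_max {T : ℝ} {f : Fin d → ℝ → ℝ} {μ : Measure (E d)} {u₀ : E d → ℝ} {N m s : ℕ}
    {ε D L E₀ t₀ : ℝ} {q : Fin d → Fin d → ℕ → ℝ → ℝ} {u : ℝ → E d → ℝ}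
    (h : IsSVVSolution T f μ u₀ N m ε q u) (hμ : IsLevy μ) (hε : 0 < ε) (ht₀ : t₀ ≤ T)
    (hD : 0 < D) (hL : 0 ≤ L)
    (hV : ∀ t ∈ Set.Ioo 0 t₀, ∀ ξ ∈ freqs d N,
      |∑ j, (ξ j : ℝ) ^ 2 - viscSymbol m (fun j k p => q j k p t) ξ| ≤ D)
    (hE : ∀ t ∈ Set.Ioo 0 t₀, ∑ ξ ∈ freqs d N, ‖coeff (u t) ξ‖ ^ 2 ≤ E₀)
    (hF : ∀ t ∈ Set.Ioo 0 t₀, ∀ j k, ∑ ξ ∈ freqs d N, (ξ j : ℝ) ^ (2 * s) *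
      ‖coeff (fun y => f k (u t y)) ξ‖ ^ 2 ≤
        L * ∑ ξ ∈ freqs d N, (ξ j : ℝ) ^ (2 * s) * ‖coeff (u t) ξ‖ ^ 2) :
    ∀ t ∈ Set.Icc 0 t₀, sob N s (u t) ≤ max (sob N s (u 0))
      (2 * d * (2 * (2 * ε ^ 2 * D + d * L) / ε ^ 2) ^ s * E₀) := by
  set κ : ℝ := 2 * ε ^ 2 * D + d * L with hκ
  have hκ0 : 0 < κ := by positivity
  have hsub : Set.Icc 0 t₀ ⊆ Set.Icc 0 T := Set.Icc_subset_Icc_right ht₀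
  refine le_max_of_deriv_nonpos (g' := fun t => ∑ j, ∑ ξ ∈ freqs d N, (ξ j : ℝ) ^ (2 * s) *
    (2 * inner ℝ (coeff (u t) ξ) (rhs f μ m ε (fun j k p => q j k p t) (u t) ξ))) ?_ ?_ ?_
  · refine continuousOn_finsetSum _ fun j _ => continuousOn_finsetSum _ fun ξ hξ =>
      continuousOn_const.mul ((((h.continuousOn_coeff hξ).mono hsub).norm).pow 2)
  · intro t ht
    unfold sob
    exact HasDerivAt.fun_sum fun j _ => HasDerivAt.fun_sum fun ξ hξ =>
      ((h.hasDerivAt_coeff hμ ⟨ht.1, ht.2.trans_le ht₀⟩ hξ).norm_sq).const_mul _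
  · intro t ht hY
    have hpow : ∀ (ξ : Fin d → ℤ) (j : Fin d), 0 ≤ (ξ j : ℝ) ^ (2 * s) := fun ξ j => by
      rw [pow_mul]; positivity
    set c := coeff (u t) with hc
    set y := sob N s (u t) with hy
    set z : ℝ := ∑ j, ∑ ξ ∈ freqs d N, (ξ j : ℝ) ^ (2 * s) * ((∑ k, (ξ k : ℝ) ^ 2) * ‖c ξ‖ ^ 2)
      with hz
    have h1 : ∑ j, ∑ ξ ∈ freqs d N, (ξ j : ℝ) ^ (2 * s) *
        (2 * inner ℝ (c ξ) (rhs f μ m ε (fun j k p => q j k p t) (u t) ξ)) ≤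
        -ε * z + 2 * (ε * D) * y + ε⁻¹ * ∑ j, ∑ ξ ∈ freqs d N, (ξ j : ℝ) ^ (2 * s) *
          ∑ k, ‖coeff (fun y => f k (u t y)) ξ‖ ^ 2 := by
      rw [hz, hy, sob]
      simp only [Finset.mul_sum]
      simp only [← Finset.sum_add_distrib]
      refine Finset.sum_le_sum fun j _ => Finset.sum_le_sum fun ξ hξ => ?_
      refine (mul_le_mul_of_nonneg_left (two_inner_rhs_le hμ hε (u t) ξ (hV t ht ξ hξ))
        (hpow ξ j)).trans (le_of_eq ?_)
      simp only [← Finset.mul_sum, ← hc]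
      ring
    have h2 : ∑ j, ∑ ξ ∈ freqs d N, (ξ j : ℝ) ^ (2 * s) *
          ∑ k, ‖coeff (fun y => f k (u t y)) ξ‖ ^ 2 ≤ d * L * y := by
      rw [hy, sob, Finset.mul_sum]
      refine Finset.sum_le_sum fun j _ => ?_
      simp only [Finset.mul_sum]
      rw [Finset.sum_comm]
      simp only [← Finset.mul_sum]
      refine (Finset.sum_le_sum fun k _ => hF t ht j k).trans (le_of_eq ?_)
      simp; ring
    -- Then εR = 2κ/ε is twice the growth rate: half absorbs the growth, the other half the low
    -- frequencies.
    set R : ℝ := 2 * κ / ε ^ 2 with hR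
    have hR0 : 0 < R := by positivity
    have h3 : R * (y - d * R ^ s * E₀) ≤ z := by
      have h4 : R * y ≤ z + R * (d * R ^ s * ∑ ξ ∈ freqs d N, ‖c ξ‖ ^ 2) := by
        have h5 : ∀ j : Fin d, ∀ ξ : Fin d → ℤ, R * ((ξ j : ℝ) ^ (2 * s) * ‖c ξ‖ ^ 2) ≤
            (ξ j : ℝ) ^ (2 * s) * ((∑ k, (ξ k : ℝ) ^ 2) * ‖c ξ‖ ^ 2) +
              R * (R ^ s * ‖c ξ‖ ^ 2) := by
          intro j ξ
          have h6 : (ξ j : ℝ) ^ 2 ≤ ∑ k, (ξ k : ℝ) ^ 2 :=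
            Finset.single_le_sum (f := fun k => (ξ k : ℝ) ^ 2) (fun k _ => by positivity)
              (Finset.mem_univ j)
          have h8 : R * (ξ j : ℝ) ^ (2 * s) ≤
              (ξ j : ℝ) ^ (2 * s) * (∑ k, (ξ k : ℝ) ^ 2) + R * R ^ s := by
            rcases le_total R ((ξ j : ℝ) ^ 2) with h7 | h7
            · have := mul_le_mul_of_nonneg_left (h7.trans h6) (hpow ξ j)
              have : 0 ≤ R * R ^ s := by positivity
              linarith
            · have h9 : (ξ j : ℝ) ^ (2 * s) ≤ R ^ s := by rw [pow_mul]; gcongr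
              have := mul_le_mul_of_nonneg_left h9 hR0.le
              have : 0 ≤ (ξ j : ℝ) ^ (2 * s) * ∑ k, (ξ k : ℝ) ^ 2 :=
                mul_nonneg (hpow ξ j) (Finset.sum_nonneg fun k _ => by positivity)
              linarith
          nlinarith [sq_nonneg ‖c ξ‖]
        have h6 := Finset.sum_le_sum fun j (_ : j ∈ (Finset.univ : Finset (Fin d))) =>
          Finset.sum_le_sum fun ξ (_ : ξ ∈ freqs d N) => h5 j ξ
        simp only [Finset.sum_add_distrib, ← Finset.mul_sum] at h6
        simp only [Finset.sum_const, Finset.card_univ, Fintype.card_fin, nsmul_eq_mul] at h6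
        calc R * y ≤ _ := h6
          _ = _ := by rw [hz]; ring
      have h5 : R * (d * R ^ s * ∑ ξ ∈ freqs d N, ‖c ξ‖ ^ 2) ≤ R * (d * R ^ s * E₀) := by
        have := hE t ht
        gcongr
      linarith
    have h4 : ε * R = 2 * κ * ε⁻¹ := by rw [hR]; field_simp
    have h5 : 2 * (ε * D) * y + ε⁻¹ * (d * L * y) = κ * ε⁻¹ * y := by
      rw [hκ]; field_simp
    have h6 : 0 < κ * ε⁻¹ := by positivity
    have h7 : ε * (R * (y - d * R ^ s * E₀)) ≤ ε * z := by gcongr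
    have h8 : ε * (R * (y - d * R ^ s * E₀)) = κ * ε⁻¹ * (2 * y - 2 * d * R ^ s * E₀) := by
      rw [← mul_assoc, h4]; ring
    have h9 : ε⁻¹ * (∑ j, ∑ ξ ∈ freqs d N, (ξ j : ℝ) ^ (2 * s) *
          ∑ k, ‖coeff (fun y => f k (u t y)) ξ‖ ^ 2) ≤ ε⁻¹ * (d * L * y) := by gcongr
    have h10 : 0 ≤ κ * ε⁻¹ * (y - 2 * d * R ^ s * E₀) := by
      have : 0 ≤ y - 2 * d * R ^ s * E₀ := by linarith
      positivity
    nlinarith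

end SVV

end

noncomputable section
namespace SVV

variable {d : ℕ}

/-! ### Truncation of Fourier series -/

lemma abs_le_freqSize (ξ : Fin d → ℤ) (j : Fin d) : |(ξ j : ℝ)| ≤ freqSize ξ := by
  rw [← Int.cast_abs, Int.abs_eq_natAbs]
  exact_mod_cast natAbs_le_freqSize ξ j

lemma exists_freqSize_eq (ξ : Fin d → ℤ) (h : freqSize ξ ≠ 0) :
    ∃ j, (freqSize ξ : ℝ) = |(ξ j : ℝ)| := by
  have hne : (Finset.univ : Finset (Fin d)).Nonempty := by
    by_contra hne
    rw [Finset.not_nonempty_iff_eq_empty] at hne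
    exact h (by simp [freqSize, hne])
  obtain ⟨j, -, hj⟩ := Finset.exists_mem_eq_sup Finset.univ hne fun j => (ξ j).natAbs
  refine ⟨j, ?_⟩
  rw [← Int.cast_abs, Int.abs_eq_natAbs]
  exact_mod_cast hj

lemma freqSize_pow_le_sum (ξ : Fin d → ℤ) {s : ℕ} (hs : 1 ≤ s) :
    (freqSize ξ : ℝ) ^ (2 * s) ≤ ∑ j, (ξ j : ℝ) ^ (2 * s) := by
  have hnn : ∀ j ∈ (Finset.univ : Finset (Fin d)), (0 : ℝ) ≤ (ξ j : ℝ) ^ (2 * s) := fun j _ => by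
    rw [pow_mul]; positivity
  by_cases h : freqSize ξ = 0
  · rw [h, Nat.cast_zero, zero_pow (by omega)]
    exact Finset.sum_nonneg hnn
  · obtain ⟨j, hj⟩ := exists_freqSize_eq ξ h
    rw [hj, pow_mul, sq_abs, ← pow_mul]
    exact Finset.single_le_sum hnn (Finset.mem_univ j)

/-- The integer vectors form a lattice of rank d, so the exponent d + 1 is summable; the zero
frequency contributes 0⁻¹ = 0. -/
lemma exists_sum_freqSize_le (d : ℕ) : ∃ Z : ℝ, 0 ≤ Z ∧ ∀ S : Finset (Fin d → ℤ),
    ∑ ξ ∈ S, ((freqSize ξ : ℝ) ^ (d + 1))⁻¹ ≤ Z := by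
  set L : Submodule ℤ (Fin d → ℝ) := Submodule.span ℤ (Set.range (Pi.basisFun ℝ (Fin d))) with hL
  have hmem : ∀ ξ : Fin d → ℤ, (fun j => (ξ j : ℝ)) ∈ L := by
    intro ξ
    have h1 : (fun j => (ξ j : ℝ)) = ∑ j, ξ j • (Pi.basisFun ℝ (Fin d)) j := by
      ext i
      simp [Finset.sum_apply, Pi.single_apply]
    rw [h1]
    exact Submodule.sum_mem _ fun j _ => Submodule.smul_mem _ _
      (Submodule.subset_span (Set.mem_range_self j))
  have hrank : Module.finrank ℤ L < d + 1 := by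
    rw [hL, ZLattice.rank ℝ]
    simp
  have h := ZLattice.summable_norm_pow_inv L (d + 1) hrank
  have hinj : Function.Injective fun ξ : Fin d → ℤ => (⟨fun j => (ξ j : ℝ), hmem ξ⟩ : L) := by
    intro ξ ζ h
    ext j
    have : (ξ j : ℝ) = ζ j := congrFun (congrArg Subtype.val h) j
    exact_mod_cast this
  have h2 := h.comp_injective hinj
  have h3 : ∀ ξ : Fin d → ℤ, ((freqSize ξ : ℝ) ^ (d + 1))⁻¹ ≤
      ((fun z : L => ‖z‖⁻¹ ^ (d + 1)) ∘ fun ξ => ⟨fun j => (ξ j : ℝ), hmem ξ⟩) ξ := by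
    intro ξ
    by_cases h : freqSize ξ = 0
    · rw [h]; simp
    · have h4 : ‖(fun j => (ξ j : ℝ))‖ ≤ freqSize ξ :=
        (pi_norm_le_iff_of_nonneg (by positivity)).2 fun j => abs_le_freqSize ξ j
      have h5 : 0 < ‖(fun j => (ξ j : ℝ))‖ := by
        obtain ⟨j, hj⟩ := exists_freqSize_eq ξ h
        refine lt_of_lt_of_le ?_ (norm_le_pi_norm _ j)
        rw [Real.norm_eq_abs, ← hj]
        positivity
      simp only [Function.comp_apply, Submodule.coe_norm]
      rw [inv_pow]
      gcongr
  exact ⟨_, tsum_nonneg fun ξ => by simp only [Function.comp_apply]; positivity,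
    fun S => (Finset.sum_le_sum fun ξ _ => h3 ξ).trans
      (h2.sum_le_tsum S fun ξ _ => by simp only [Function.comp_apply]; positivity)⟩

/-- Cauchy–Schwarz with |ξ| a = |ξ|^{-(d+1)/2} · |ξ|^{(d+3)/2} a, then |ξ| ≥ R trades the surplus 2s
- (d+3) for powers of R. The inequality is kept multiplied out to avoid negative exponents. -/
lemma sum_freqSize_mul_sq_le {Z W : ℝ} (hZ : 0 ≤ Z) {a : (Fin d → ℤ) → ℝ} {S : Finset (Fin d → ℤ)}
    (hSZ : ∑ ξ ∈ S, ((freqSize ξ : ℝ) ^ (d + 1))⁻¹ ≤ Z) {s R : ℕ} (hs : d + 3 ≤ 2 * s) (hR : 1 ≤ R)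
    (hS : ∀ ξ ∈ S, R ≤ freqSize ξ)
    (hW : ∑ ξ ∈ S, (freqSize ξ : ℝ) ^ (2 * s) * a ξ ^ 2 ≤ W) :
    (R : ℝ) ^ (2 * s) * (∑ ξ ∈ S, freqSize ξ * a ξ) ^ 2 ≤ Z * ((R : ℝ) ^ (d + 3) * W) := by
  have hR0 : (0 : ℝ) < R := by exact_mod_cast hR
  have hpos : ∀ ξ ∈ S, (R : ℝ) ≤ freqSize ξ := fun ξ hξ => by exact_mod_cast hS ξ hξ
  have h1 : (∑ ξ ∈ S, freqSize ξ * a ξ) ^ 2 ≤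
      (∑ ξ ∈ S, ((freqSize ξ : ℝ) ^ (d + 1))⁻¹) *
        ∑ ξ ∈ S, (freqSize ξ : ℝ) ^ (d + 3) * a ξ ^ 2 := by
    refine Finset.sum_sq_le_sum_mul_sum_of_sq_le_mul _ (fun ξ _ => by positivity)
      (fun ξ _ => by positivity) fun ξ hξ => ?_
    have : (0 : ℝ) < freqSize ξ := hR0.trans_le (hpos ξ hξ)
    refine le_of_eq ?_
    field_simp
    ring
  have h2 : (R : ℝ) ^ (2 * s) * ∑ ξ ∈ S, (freqSize ξ : ℝ) ^ (d + 3) * a ξ ^ 2 ≤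
      (R : ℝ) ^ (d + 3) * W := by
    refine le_trans ?_ (mul_le_mul_of_nonneg_left hW (by positivity))
    rw [Finset.mul_sum, Finset.mul_sum]
    refine Finset.sum_le_sum fun ξ hξ => ?_
    obtain ⟨e, he⟩ := Nat.exists_eq_add_of_le hs
    have h3 : (R : ℝ) ^ e ≤ (freqSize ξ : ℝ) ^ e := pow_le_pow_left₀ hR0.le (hpos ξ hξ) e
    rw [he, pow_add, pow_add]
    calc _ = (R : ℝ) ^ (d + 3) * (freqSize ξ : ℝ) ^ (d + 3) * a ξ ^ 2 * (R : ℝ) ^ e := by ring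
      _ ≤ (R : ℝ) ^ (d + 3) * (freqSize ξ : ℝ) ^ (d + 3) * a ξ ^ 2 * (freqSize ξ : ℝ) ^ e := by
        gcongr
      _ = _ := by ring
  have h3 : 0 ≤ ∑ ξ ∈ S, (freqSize ξ : ℝ) ^ (d + 3) * a ξ ^ 2 :=
    Finset.sum_nonneg fun ξ _ => by positivity
  calc _ ≤ (R : ℝ) ^ (2 * s) * (Z * ∑ ξ ∈ S, (freqSize ξ : ℝ) ^ (d + 3) * a ξ ^ 2) := by
        gcongr
        exact h1.trans (mul_le_mul_of_nonneg_right hSZ h3)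
    _ = Z * ((R : ℝ) ^ (2 * s) * ∑ ξ ∈ S, (freqSize ξ : ℝ) ^ (d + 3) * a ξ ^ 2) := by ring
    _ ≤ _ := by gcongr

/-- The previous bound with R = 1 makes the coefficients of ∂_j g summable, so g's derivative equals
its Fourier series; with R = N it bounds the tail outside the cube. -/
lemma norm_fderiv_sub_trig_sq_le {Z W : ℝ} (hZ : 0 ≤ Z)
    (hSZ : ∀ S : Finset (Fin d → ℤ), ∑ ξ ∈ S, ((freqSize ξ : ℝ) ^ (d + 1))⁻¹ ≤ Z) {s N : ℕ}
    (hs : d + 3 ≤ 2 * s) (hN : 1 ≤ N) {g : E d → ℝ} (hp : Per g) (hg : ContDiff ℝ s g)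
    (hW : ∀ S : Finset (Fin d → ℤ), ∑ ξ ∈ S, (freqSize ξ : ℝ) ^ (2 * s) * ‖coeff g ξ‖ ^ 2 ≤ W)
    (j : Fin d) (x : E d) :
    (N : ℝ) ^ (2 * s) * ‖(fderiv ℝ g x (dir j) : ℂ) -
      trig (freqs d N) (fun ξ => Complex.I * (ξ j : ℂ) * coeff g ξ) x‖ ^ 2 ≤
        Z * ((N : ℝ) ^ (d + 3) * W) := by
  classical
  have hg1 : ContDiff ℝ 1 g := hg.of_le (by norm_cast; omega)
  have hW0 : 0 ≤ W := by simpa using hW ∅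
  set b : (Fin d → ℤ) → ℂ := coeff fun x => fderiv ℝ g x (dir j) with hb
  have hbξ : ∀ ξ, b ξ = Complex.I * (ξ j : ℂ) * coeff g ξ := fun ξ => by
    rw [hb, coeff_fderiv hp hg1, pair_dir]; push_cast; rfl
  have hbn : ∀ ξ, ‖b ξ‖ ≤ freqSize ξ * ‖coeff g ξ‖ := fun ξ => by
    rw [hbξ, norm_mul, norm_mul, Complex.norm_I, one_mul, Complex.norm_intCast]
    gcongr
    exact abs_le_freqSize ξ j
  have hsumm : Summable b := by
    refine Summable.of_norm (Summable.of_nonneg_of_le (fun _ => norm_nonneg _) hbn ?_)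
    refine summable_of_sum_le (c := Real.sqrt (Z * W)) (fun ξ => by positivity) fun S => ?_
    have h1 := sum_freqSize_mul_sq_le (S := S.filter fun ξ => 1 ≤ freqSize ξ)
      (a := fun ξ => ‖coeff g ξ‖) hZ (hSZ _) hs le_rfl (fun ξ hξ => (Finset.mem_filter.1 hξ).2)
      (hW _)
    simp only [Nat.cast_one, one_pow, one_mul] at h1
    refine le_trans (le_of_eq ?_) (Real.le_sqrt_of_sq_le h1)
    rw [Finset.sum_filter]
    refine Finset.sum_congr rfl fun ξ _ => ?_
    split_ifs with h
    · rfl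
    · rw [show freqSize ξ = 0 by omega]; simp
  have hcont : Continuous fun x => fderiv ℝ g x (dir j) :=
    (hg1.continuous_fderiv one_ne_zero).clm_apply continuous_const
  have hper : Per fun x => fderiv ℝ g x (dir j) := hp.fderiv.comp fun L : E d →L[ℝ] ℝ => L (dir j)
  have hsum := hasSum_coeff hper hcont hsumm x
  have hlim : Tendsto (fun S : Finset (Fin d → ℤ) => (N : ℝ) ^ (2 * s) *
      ‖∑ ξ ∈ S, b ξ * expo ξ x - trig (freqs d N) (fun ξ => Complex.I * (ξ j : ℂ) * coeff g ξ) x‖ ^ 2)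
      atTop (𝓝 ((N : ℝ) ^ (2 * s) * ‖(fderiv ℝ g x (dir j) : ℂ) -
      trig (freqs d N) (fun ξ => Complex.I * (ξ j : ℂ) * coeff g ξ) x‖ ^ 2)) :=
    (((Tendsto.sub_const hsum _).norm).pow 2).const_mul _
  -- Bound the finite partial sums that contain the whole cube; the remainder then lives on |ξ| > N.
  refine le_of_tendsto hlim ?_
  filter_upwards [eventually_ge_atTop (freqs d N)] with S hS
  have h1 : ∑ ξ ∈ S, b ξ * expo ξ x -
      trig (freqs d N) (fun ξ => Complex.I * (ξ j : ℂ) * coeff g ξ) x =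
      trig (S \ freqs d N) b x := by
    rw [sub_eq_iff_eq_add, ← Finset.sum_sdiff hS]
    congr 1
    exact Finset.sum_congr rfl fun ξ _ => by rw [hbξ]
  rw [h1]
  have h2 := sum_freqSize_mul_sq_le (S := S \ freqs d N) (a := fun ξ => ‖coeff g ξ‖) hZ (hSZ _) hs hN
    (fun ξ hξ => by
      have := (Finset.mem_sdiff.1 hξ).2
      rw [mem_freqs_iff] at this
      omega) (hW _)
  refine le_trans ?_ h2
  gcongr
  exact (norm_trig_le _ _ _).trans (Finset.sum_le_sum fun ξ _ => hbn ξ)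

end SVV

end

noncomputable section
namespace SVV

variable {d : ℕ}

/-! ### The equation as a perturbed viscous conservation law -/

/-- The time derivative of a solution. -/
def dt (f : Fin d → ℝ → ℝ) (μ : Measure (E d)) (N m : ℕ) (ε : ℝ) (q : Fin d → Fin d → ℕ → ℝ)
    (φ : E d → ℝ) (x : E d) : ℝ := (trig (freqs d N) (rhs f μ m ε q φ) x).re

/-- The error made by projecting the flux. -/
def projErr (f : Fin d → ℝ → ℝ) (N : ℕ) (φ : E d → ℝ) (x : E d) : ℝ :=
  (∑ j, ((fderiv ℝ (fun y => f j (φ y)) x (dir j) : ℂ) -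
    trig (freqs d N) (fun ξ => Complex.I * (ξ j : ℂ) * coeff (fun y => f j (φ y)) ξ) x)).re

/-- The difference between the spectral viscosity and `ε Δ`, up to sign. -/
def viscErr (N m : ℕ) (ε : ℝ) (q : Fin d → Fin d → ℕ → ℝ) (φ : E d → ℝ) (x : E d) : ℝ :=
  (trig (freqs d N) (fun ξ => ((∑ j, (ξ j : ℝ) ^ 2 - viscSymbol m q ξ : ℝ) : ℂ) *
    ((ε : ℂ) * coeff φ ξ)) x).re

lemma continuous_viscErr (N m : ℕ) (ε : ℝ) (q : Fin d → Fin d → ℕ → ℝ) (φ : E d → ℝ) :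
    Continuous (viscErr N m ε q φ) :=
  Complex.continuous_re.comp (continuous_trig _ _)

lemma continuous_projErr {f : Fin d → ℝ → ℝ} (hf : ∀ j, ContDiff ℝ 1 (f j)) (N : ℕ) {φ : E d → ℝ}
    (hφ : ContDiff ℝ 1 φ) : Continuous (projErr f N φ) := by
  refine Complex.continuous_re.comp (continuous_finsetSum _ fun j _ => ?_)
  have h1 : ContDiff ℝ 1 fun y => f j (φ y) := (hf j).comp hφ
  have h2 : Continuous fun x => fderiv ℝ (fun y => f j (φ y)) x (dir j) :=
    (h1.continuous_fderiv one_ne_zero).clm_apply continuous_const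
  exact (Complex.continuous_ofReal.comp h2).sub (continuous_trig _ _)

/-- Add and subtract the unprojected flux and the full Laplacian; on the Fourier side this is an
identity coefficient by coefficient. -/
lemma dt_eq {f : Fin d → ℝ → ℝ} {μ : Measure (E d)} (hμ : IsLevy μ) {N m : ℕ} {ε : ℝ}
    {q : Fin d → Fin d → ℕ → ℝ} {φ : E d → ℝ}
    (hφ : ∀ x, (φ x : ℂ) = trig (freqs d N) (coeff φ) x) (x : E d) :
    dt f μ N m ε q φ x = -∑ j, fderiv ℝ (fun y => f j (φ y)) x (dir j) + levy μ φ x +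
      ε * lap φ x + projErr f N φ x + viscErr N m ε q φ x := by
  have h1 := levy_of_eq_trig hμ hφ x
  have h2 := lap_of_eq_trig hφ x
  have h3 : trig (freqs d N) (rhs f μ m ε q φ) x =
      -∑ j, trig (freqs d N) (fun ξ => Complex.I * (ξ j : ℂ) * coeff (fun y => f j (φ y)) ξ) x +
      (levy μ φ x : ℂ) + (ε : ℂ) * (lap φ x : ℂ) +
      trig (freqs d N) (fun ξ => ((∑ j, (ξ j : ℝ) ^ 2 - viscSymbol m q ξ : ℝ) : ℂ) *
        ((ε : ℂ) * coeff φ ξ)) x := by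
    rw [h1, h2]
    simp only [trig]
    rw [Finset.sum_comm, Finset.mul_sum, ← Finset.sum_neg_distrib, ← Finset.sum_add_distrib,
      ← Finset.sum_add_distrib, ← Finset.sum_add_distrib]
    refine Finset.sum_congr rfl fun ξ _ => ?_
    rw [rhs, ← Finset.sum_mul]
    push_cast
    ring
  rw [dt, projErr, viscErr, h3]
  simp only [Complex.add_re, Complex.neg_re, Complex.re_sum, Complex.sub_re, Complex.ofReal_re,
    Complex.re_ofReal_mul, Finset.sum_sub_distrib]
  ring

section

variable {T : ℝ} {f : Fin d → ℝ → ℝ} {μ : Measure (E d)} {u₀ : E d → ℝ} {N m : ℕ} {ε : ℝ}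
  {q : Fin d → Fin d → ℕ → ℝ → ℝ} {u : ℝ → E d → ℝ}

/-- The solution is real, so the derivative of its imaginary part, which is zero, shows that the
right side is real too. -/
lemma IsSVVSolution.dt_eq_trig (h : IsSVVSolution T f μ u₀ N m ε q u) (hμ : IsLevy μ) {t : ℝ}
    (ht : t ∈ Set.Ioo 0 T) (x : E d) : (dt f μ N m ε (fun j k p => q j k p t) (u t) x : ℂ) =
      SVV.trig (freqs d N) (rhs f μ m ε (fun j k p => q j k p t) (u t)) x := by
  have h1 := h.eqn_trig hμ ht x
  have h2 : HasDerivAt (fun _ : ℝ => (0 : ℝ))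
      (SVV.trig (freqs d N) (rhs f μ m ε (fun j k p => q j k p t) (u t)) x).im t := by
    have := Complex.imCLM.hasFDerivAt.comp_hasDerivAt t h1
    simpa [Function.comp_def] using! this
  have h3 := h2.unique (hasDerivAt_const t (0 : ℝ))
  apply Complex.ext
  · simp [dt]
  · simp [h3]

end

/-! ### Entropy inequalities -/

/-- Existence of an entropy flux: g(φ) ∂f(φ) = ∂(H(φ)) with H' = g f', and derivatives of periodic
functions have mean zero. -/
lemma integral_comp_mul_fderiv_comp_eq_zero {φ : E d → ℝ} (hp : Per φ) (hφ : ContDiff ℝ 1 φ)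
    {g f : ℝ → ℝ} (hg : Continuous g) (hf : ContDiff ℝ 1 f) (v : E d) :
    ∫ x, g (φ x) * fderiv ℝ (fun y => f (φ y)) x v ∂(cellVol d) = 0 := by
  have hc : Continuous fun r => g r * deriv f r := hg.mul (hf.continuous_deriv le_rfl)
  set H : ℝ → ℝ := fun r => ∫ ρ in (0 : ℝ)..r, g ρ * deriv f ρ with hH
  have hHd : ∀ r, HasDerivAt H (g r * deriv f r) r := fun r => hc.integral_hasStrictDerivAt 0 r
    |>.hasDerivAt
  have hH1 : ContDiff ℝ 1 H := contDiff_one_iff_deriv.2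
    ⟨fun r => (hHd r).differentiableAt, by rw [funext fun r => (hHd r).deriv]; exact hc⟩
  rw [← integral_fderiv_eq_zero (hp.comp H) (hH1.comp hφ) v]
  refine integral_congr_ae (Eventually.of_forall fun x => ?_)
  have h1 := hφ.differentiable one_ne_zero x
  have h2 := ((hHd (φ x)).hasFDerivAt.comp x h1.hasFDerivAt).fderiv
  have h3 := ((hf.differentiable one_ne_zero (φ x)).hasDerivAt.hasFDerivAt.comp x
    h1.hasFDerivAt).fderiv
  change fderiv ℝ (fun y => H (φ y)) x = _ at h2
  change fderiv ℝ (fun y => f (φ y)) x = _ at h3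
  simp only [h2, h3]
  simp
  ring

/-- Source of the moment bounds and of the almost maximum principle: flux zero, diffusion and jumps
dissipative, so only the errors can create entropy. -/
lemma Entropy.integral_dt_le {η η' η'' : ℝ → ℝ} (H : Entropy η η' η'') {f : Fin d → ℝ → ℝ}
    (hf : ∀ j, ContDiff ℝ 1 (f j)) {μ : Measure (E d)} (hμ : IsLevy μ) {N m : ℕ} {ε : ℝ}
    (hε : 0 < ε) {q : Fin d → Fin d → ℕ → ℝ} {φ : E d → ℝ}
    (hφ : ∀ x, (φ x : ℂ) = trig (freqs d N) (coeff φ) x) :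
    ∫ x, η' (φ x) * dt f μ N m ε q φ x ∂(cellVol d) ≤
      ∫ x, η' (φ x) * (projErr f N φ x + viscErr N m ε q φ x) ∂(cellVol d) := by
  have hp := per_of_eq_trig hφ
  have hc : ∀ n : ℕ, ContDiff ℝ n φ := fun n => contDiff_of_eq_trig hφ
  have hη : Continuous fun x => η' (φ x) := H.continuous'.comp (hc 0).continuous
  have hlap : Continuous fun x => lap φ x := by
    have : (fun x => lap φ x) = fun x => (trig (freqs d N)
        (fun ξ => -((∑ j, (ξ j : ℝ) ^ 2 : ℝ) : ℂ) * coeff φ ξ) x).re :=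
      funext fun x => by rw [← lap_of_eq_trig hφ, Complex.ofReal_re]
    rw [this]
    exact Complex.continuous_re.comp (continuous_trig _ _)
  have hlevy : Continuous fun x => levy μ φ x := by
    have : (fun x => levy μ φ x) = fun x => (trig (freqs d N)
        (fun ξ => levySymbol μ ξ * coeff φ ξ) x).re :=
      funext fun x => by rw [← levy_of_eq_trig hμ hφ, Complex.ofReal_re]
    rw [this]
    exact Complex.continuous_re.comp (continuous_trig _ _)
  have hflux : ∀ j, Continuous fun x => fderiv ℝ (fun y => f j (φ y)) x (dir j) := fun j =>
    (((hf j).comp (hc 1)).continuous_fderiv one_ne_zero).clm_apply continuous_const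
  have hr : Continuous fun x => projErr f N φ x + viscErr N m ε q φ x :=
    (continuous_projErr hf N (hc 1)).add (continuous_viscErr N m ε q φ)
  have i1 : ∀ j ∈ (Finset.univ : Finset (Fin d)), Integrable
      (fun x => η' (φ x) * fderiv ℝ (fun y => f j (φ y)) x (dir j)) (cellVol d) :=
    fun j _ => integrable_cellVol (hη.mul (hflux j))
  have i2 : Integrable (fun x => η' (φ x) * levy μ φ x) (cellVol d) :=
    integrable_cellVol (hη.mul hlevy)
  have i3 : Integrable (fun x => ε * (η' (φ x) * lap φ x)) (cellVol d) :=
    (integrable_cellVol (hη.mul hlap)).const_mul ε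
  have i4 : Integrable (fun x => η' (φ x) * (projErr f N φ x + viscErr N m ε q φ x))
    (cellVol d) := integrable_cellVol (hη.mul hr)
  have h1 : ∀ x, η' (φ x) * dt f μ N m ε q φ x =
      -(∑ j, η' (φ x) * fderiv ℝ (fun y => f j (φ y)) x (dir j)) + η' (φ x) * levy μ φ x +
        ε * (η' (φ x) * lap φ x) +
        η' (φ x) * (projErr f N φ x + viscErr N m ε q φ x) := by
    intro x
    rw [dt_eq hμ hφ, ← Finset.mul_sum]
    ring
  simp only [h1]
  have j1 : Integrable (fun x => -(∑ j, η' (φ x) * fderiv ℝ (fun y => f j (φ y)) x (dir j)))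
    (cellVol d) := (integrable_finsetSum _ i1).neg
  have j2 : Integrable (fun x => -(∑ j, η' (φ x) * fderiv ℝ (fun y => f j (φ y)) x (dir j)) +
    η' (φ x) * levy μ φ x) (cellVol d) := j1.add i2
  have j3 : Integrable (fun x => -(∑ j, η' (φ x) * fderiv ℝ (fun y => f j (φ y)) x (dir j)) +
    η' (φ x) * levy μ φ x + ε * (η' (φ x) * lap φ x)) (cellVol d) := j2.add i3
  rw [integral_add j3 i4, integral_add j2 i3, integral_add j1 i2,
    integral_neg, integral_finsetSum _ i1, integral_const_mul]
  have h2 : ∑ j, ∫ x, η' (φ x) * fderiv ℝ (fun y => f j (φ y)) x (dir j) ∂(cellVol d) = 0 :=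
    Finset.sum_eq_zero fun j _ =>
      integral_comp_mul_fderiv_comp_eq_zero hp (hc 1) H.continuous' (hf j) _
  have h3 := H.integral_levy_le hμ hφ
  have h4 := H.integral_lap_le hp (hc 2)
  have h5 := mul_nonpos_of_nonneg_of_nonpos hε.le h4
  linarith

lemma entropy_pow {k : ℕ} (hk : 1 ≤ k) : Entropy (fun v => v ^ (2 * k))
    (fun v => (2 * k : ℕ) * v ^ (2 * k - 1))
    (fun v => (2 * k : ℕ) * ((2 * k - 1 : ℕ) * v ^ (2 * k - 2))) where
  deriv₁ v := hasDerivAt_pow (2 * k) v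
  deriv₂ v := by
    have := (hasDerivAt_pow (2 * k - 1) v).const_mul ((2 * k : ℕ) : ℝ)
    rwa [show 2 * k - 1 - 1 = 2 * k - 2 by omega] at this
  cont := by fun_prop
  nonneg v := by
    rw [show 2 * k - 2 = 2 * (k - 1) by omega, pow_mul]
    positivity

/-! ### Nikolskii's inequality -/

lemma exists_trig_mul_eq (N M : ℕ) (c c' : (Fin d → ℤ) → ℂ) :
    ∃ c'' : (Fin d → ℤ) → ℂ, ∀ x, trig (freqs d N) c x * trig (freqs d M) c' x =
      trig (freqs d (N + M)) c'' x := by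
  classical
  refine ⟨fun η => ∑ ξ ∈ freqs d N, ∑ ζ ∈ freqs d M, if ξ + ζ = η then c ξ * c' ζ else 0,
    fun x => ?_⟩
  simp only [trig]
  rw [Finset.sum_mul_sum]
  simp only [Finset.sum_mul]
  rw [Finset.sum_comm (s := freqs d (N + M))]
  refine Finset.sum_congr rfl fun ξ hξ => ?_
  rw [Finset.sum_comm (s := freqs d (N + M))]
  refine Finset.sum_congr rfl fun ζ hζ => ?_
  have hmem : ξ + ζ ∈ freqs d (N + M) := by
    rw [mem_freqs] at *
    intro j
    have := hξ j
    have := hζ j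
    simp only [Pi.add_apply]
    push_cast
    omega
  simp only [ite_mul, zero_mul]
  rw [Finset.sum_ite_eq, if_pos hmem, expo_add_freq]
  ring

lemma exists_trig_pow_eq (N : ℕ) (c : (Fin d → ℤ) → ℂ) (k : ℕ) :
    ∃ c' : (Fin d → ℤ) → ℂ, ∀ x, trig (freqs d N) c x ^ k = trig (freqs d (k * N)) c' x := by
  induction k with
  | zero =>
    refine ⟨fun _ => 1, fun x => ?_⟩
    have h : freqs d (0 * N) = {0} := by
      ext ξ
      rw [zero_mul, mem_freqs, Finset.mem_singleton, funext_iff]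
      exact forall_congr' fun j => by simp; omega
    rw [h, pow_zero]
    simp [trig, expo_zero_freq]
  | succ k ih =>
    obtain ⟨c', h⟩ := ih
    obtain ⟨c'', h'⟩ := exists_trig_mul_eq (k * N) N c' c
    exact ⟨c'', fun x => by rw [pow_succ, h, h', Nat.succ_mul]⟩

/-- φ^k is a trigonometric polynomial of degree kN. Cauchy–Schwarz over its (2kN + 1)^d ≤ (3kN)^d
frequencies and Parseval bound its square pointwise. -/
lemma pow_le_of_eq_trig {N : ℕ} (hN : 1 ≤ N) {φ : E d → ℝ} {c : (Fin d → ℤ) → ℂ}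
    (h : ∀ x, (φ x : ℂ) = trig (freqs d N) c x) {k : ℕ} (hk : 1 ≤ k) (x : E d) :
    φ x ^ (2 * k) ≤ (3 * k : ℝ) ^ d * (N : ℝ) ^ d * ∫ y, φ y ^ (2 * k) ∂(cellVol d) := by
  obtain ⟨c', h'⟩ := exists_trig_pow_eq N c k
  have h1 : ∀ y, ((φ y ^ k : ℝ) : ℂ) = trig (freqs d (k * N)) c' y := fun y => by
    rw [← h', Complex.ofReal_pow, h]
  have h2 := integral_sq_of_eq_trig h1
  have h3 : ∀ y, (φ y ^ k) ^ 2 = φ y ^ (2 * k) := fun y => by rw [← pow_mul, mul_comm]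
  simp only [h3] at h2
  have hcard : ((freqs d (k * N)).card : ℝ) ≤ (3 * k : ℝ) ^ d * (N : ℝ) ^ d := by
    have h4 : (freqs d (k * N)).card = (2 * (k * N) + 1) ^ d := by
      rw [freqs, Fintype.card_piFinset]
      simp only [Int.card_Icc, Finset.prod_const, Finset.card_univ, Fintype.card_fin]
      congr 1
      omega
    rw [h4, ← mul_pow]
    push_cast
    have h5 : (1 : ℝ) ≤ k * N := by exact_mod_cast Nat.mul_pos hk hN
    gcongr
    linarith
  have h4 : φ x ^ (2 * k) ≤ (freqs d (k * N)).card * ∑ ξ ∈ freqs d (k * N), ‖c' ξ‖ ^ 2 := by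
    rw [← h3, ← sq_abs, ← Real.norm_eq_abs, ← Complex.norm_real, h1]
    exact (pow_le_pow_left₀ (norm_nonneg _) (norm_trig_le _ _ _) 2).trans sq_sum_le_card_mul_sum_sq
  have h5 : ∑ ξ ∈ freqs d (k * N), ‖c' ξ‖ ^ 2 ≤ ∫ y, φ y ^ (2 * k) ∂(cellVol d) := by
    rw [h2]
    have h6 : (1 : ℝ) ≤ (2 * Real.pi) ^ d := one_le_pow₀ (by linarith [Real.pi_gt_three])
    exact le_mul_of_one_le_left (Finset.sum_nonneg fun ξ _ => by positivity) h6
  calc _ ≤ _ := h4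
    _ ≤ _ := by gcongr

end SVV

end

noncomputable section
namespace SVV

variable {d : ℕ}

/-! ### A priori estimates -/

/-- A spectral viscosity solution whose parameters are controlled by the constant `C₀`. -/
structure Admissible (s : ℕ) (C₀ T : ℝ) (f : Fin d → ℝ → ℝ) (μ : Measure (E d)) (u₀ : E d → ℝ)
    (N m : ℕ) (ε : ℝ) (q : Fin d → Fin d → ℕ → ℝ → ℝ) (u : ℝ → E d → ℝ) : Prop where
  sol : IsSVVSolution T f μ u₀ N m ε q u
  levy : IsLevy μ
  smooth : ∀ j, ContDiff ℝ s (f j)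
  two_s : d + 3 ≤ 2 * s
  one_le : 1 ≤ C₀
  one_le_N : 1 ≤ N
  eps_pos : 0 < ε
  eps_le : ε ≤ C₀
  visc_le : ε * (m : ℝ) ^ 2 * (1 + Real.log N) ≤ C₀
  decay : (N : ℝ) ^ (d + 7) ≤ C₀ * (N * ε) ^ (2 * s)
  symbol_bound : ∀ t ∈ Set.Icc 0 T, ∀ j k p, m ≤ p → p ≤ N →
    |q j k p t - (if j = k then 1 else 0)| * (p : ℝ) ^ 2 ≤ C₀ * (m : ℝ) ^ 2
  symbol_mono : ∀ t ∈ Set.Icc 0 T, ∀ j k, MonotoneOn (fun p => q j k p t) (Set.Icc m N)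
  growth : ∀ t ∈ Set.Icc 0 T, ∀ j, ∀ k ≤ s, ∀ x,
    |iteratedDeriv k (f j) (u t x)| ≤ C₀ * (1 + |u t x|) ^ s
  sob_init : ε ^ (2 * s) * sob N s (u 0) ≤ C₀
  sup_init : ∀ x, |u 0 x| ≤ C₀

namespace Admissible

variable {s : ℕ} {C₀ T : ℝ} {f : Fin d → ℝ → ℝ} {μ : Measure (E d)} {u₀ : E d → ℝ}
    {N m : ℕ} {ε : ℝ} {q : Fin d → Fin d → ℕ → ℝ → ℝ} {u : ℝ → E d → ℝ}

lemma smooth_one (h : Admissible s C₀ T f μ u₀ N m ε q u) (j : Fin d) : ContDiff ℝ 1 (f j) :=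
  (h.smooth j).of_le (by have := h.two_s; norm_cast; omega)

lemma contDiff (h : Admissible s C₀ T f μ u₀ N m ε q u) {t : ℝ} (ht : t ∈ Set.Icc 0 T)
    {n : WithTop ℕ∞} : ContDiff ℝ n (u t) := contDiff_of_eq_trig (h.sol.eq_trig ht)

lemma per (h : Admissible s C₀ T f μ u₀ N m ε q u) {t : ℝ} (ht : t ∈ Set.Icc 0 T) :
    Per (u t) := per_of_eq_trig (h.sol.eq_trig ht)

lemma visc_le' (h : Admissible s C₀ T f μ u₀ N m ε q u) : ε * (m : ℝ) ^ 2 ≤ C₀ := by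
  refine le_trans ?_ h.visc_le
  have h1 : 0 ≤ Real.log N := Real.log_natCast_nonneg N
  have h2 : 0 ≤ ε * (m : ℝ) ^ 2 := mul_nonneg h.eps_pos.le (sq_nonneg _)
  nlinarith

end Admissible

/-- Bessel for ∂^s f_k(u), then Moser. The growth of f contributes (2A)^{2s} and interpolation
A^{2s}, together A^{4s}. -/
lemma exists_sum_flux_le (d s : ℕ) (hs : 1 ≤ s) (C₀ : ℝ) : ∃ C : ℝ, 0 ≤ C ∧
    ∀ {T : ℝ} {f : Fin d → ℝ → ℝ} {μ : Measure (E d)} {u₀ : E d → ℝ} {N m : ℕ} {ε : ℝ}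
      {q : Fin d → Fin d → ℕ → ℝ → ℝ} {u : ℝ → E d → ℝ}, Admissible s C₀ T f μ u₀ N m ε q u →
    ∀ t ∈ Set.Icc 0 T, ∀ A : ℝ, 1 ≤ A → (∀ x, |u t x| ≤ A) → ∀ j k (S : Finset (Fin d → ℤ)),
      ∑ ξ ∈ S, (ξ j : ℝ) ^ (2 * s) * ‖coeff (fun y => f k (u t y)) ξ‖ ^ 2 ≤
        C * A ^ (4 * s) * ∑ ξ ∈ freqs d N, (ξ j : ℝ) ^ (2 * s) * ‖coeff (u t) ξ‖ ^ 2 := by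
  obtain ⟨C, hC, hM⟩ := exists_integral_dD_comp_le s hs
  refine ⟨C * C₀ ^ 2 * 4 ^ s, by positivity, ?_⟩
  intro T f μ u₀ N m ε q u h t ht A hA hu j k S
  have hC₀ : 0 ≤ C₀ := zero_le_one.trans h.one_le
  have hπ : (0 : ℝ) < (2 * Real.pi) ^ d := by positivity
  have h1 := hM d j (u t) A (C₀ * (2 * A) ^ s) (f k) (h.per ht) (h.contDiff ht) hA hu (h.smooth k)
    fun i hi x => (h.growth t ht k i hi x).trans (by gcongr; linarith [hu x])
  rw [integral_dD_iterate_sq j s (h.sol.eq_trig ht)] at h1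
  have h2 := sum_pow_mul_norm_coeff_sq_le j (g := fun y => f k (u t y)) ((h.per ht).comp (f k))
    ((h.smooth k).comp (h.contDiff ht)) S
  have h3 : C * (C₀ * (2 * A) ^ s) ^ 2 * A ^ (2 * s) = C * C₀ ^ 2 * 4 ^ s * A ^ (4 * s) := by
    rw [mul_pow, ← pow_mul, mul_comm s 2, mul_pow, pow_mul 2 2 s,
      show 4 * s = 2 * s + 2 * s by ring, pow_add]
    norm_num
    ring
  rw [h3] at h1
  refine le_of_mul_le_mul_left ?_ hπ
  calc _ ≤ _ := h2.trans h1
    _ = _ := by ring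

/-- In the energy threshold the rate is of order A^{4s} and the low frequencies carry A², giving
A^{4s·s+2}; the factor ε^{-2s} in the threshold is cancelled by the weight. -/
lemma exists_sob_le (d s : ℕ) (hs : 1 ≤ s) (C₀ : ℝ) : ∃ C : ℝ, 0 ≤ C ∧
    ∀ {T : ℝ} {f : Fin d → ℝ → ℝ} {μ : Measure (E d)} {u₀ : E d → ℝ} {N m : ℕ} {ε : ℝ}
      {q : Fin d → Fin d → ℕ → ℝ → ℝ} {u : ℝ → E d → ℝ}, Admissible s C₀ T f μ u₀ N m ε q u →
    ∀ t₀ ≤ T, ∀ A : ℝ, 1 ≤ A → (∀ t ∈ Set.Ioo 0 t₀, ∀ x, |u t x| ≤ A) → ∀ t ∈ Set.Icc 0 t₀,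
      ε ^ (2 * s) * sob N s (u t) ≤ C * A ^ (4 * s ^ 2 + 2) := by
  obtain ⟨L, hL, hF⟩ := exists_sum_flux_le d s hs C₀
  set C₁ : ℝ := 2 * C₀ ^ 2 + 2 * C₀ ^ 2 * (d ^ 2 * (C₀ + 1)) + d * L with hC₁
  refine ⟨|C₀| + 2 * d * (2 * |C₁|) ^ s, by positivity, ?_⟩
  intro T f μ u₀ N m ε q u h t₀ ht₀ A hA hu t ht
  have hC₀ : 0 ≤ C₀ := zero_le_one.trans h.one_le
  have hε := h.eps_pos
  have hA0 : 0 < A := by linarith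
  have hC₁0 : 0 ≤ C₁ := by positivity
  have hin : ∀ t ∈ Set.Ioo 0 t₀, t ∈ Set.Icc 0 T := fun t ht => ⟨ht.1.le, ht.2.le.trans ht₀⟩
  rw [abs_of_nonneg hC₀, abs_of_nonneg hC₁0]
  -- The added 1 keeps D positive when m = 0.
  set D : ℝ := d ^ 2 * (C₀ + 1) * (m : ℝ) ^ 2 + 1 with hD
  have h1 := sob_le_max (L := L * A ^ (4 * s)) (E₀ := A ^ 2) (D := D) h.sol h.levy hε ht₀
    (by positivity) (by positivity)
    (fun t ht ξ hξ => (abs_sum_sq_sub_viscSymbol_le hC₀ (h.symbol_bound t (hin t ht)) hξ).trans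
      (by rw [hD]; linarith))
    (fun t ht => sum_norm_coeff_sq_le_of_abs_le (h.contDiff (hin t ht) (n := 0)).continuous
      (hu t ht) _)
    (fun t ht j k => hF h t (hin t ht) A hA (hu t ht) j k _) t ht
  have hA1 : ∀ n : ℕ, 1 ≤ A ^ n := fun n => one_le_pow₀ hA
  have hκ : 2 * ε ^ 2 * D + d * (L * A ^ (4 * s)) ≤ C₁ * A ^ (4 * s) := by
    have h2 := h.visc_le'
    have h3 : ε ^ 2 ≤ C₀ ^ 2 := pow_le_pow_left₀ hε.le h.eps_le 2
    have h4 : ε ^ 2 * (m : ℝ) ^ 2 ≤ C₀ ^ 2 := by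
      calc ε ^ 2 * (m : ℝ) ^ 2 = ε * (ε * (m : ℝ) ^ 2) := by ring
        _ ≤ C₀ * C₀ := by
          have := h.eps_le
          gcongr
        _ = _ := by ring
    have h5 : 2 * ε ^ 2 * D ≤ 2 * C₀ ^ 2 + 2 * C₀ ^ 2 * (d ^ 2 * (C₀ + 1)) := by
      rw [hD]
      have h6 : 0 ≤ (d : ℝ) ^ 2 * (C₀ + 1) := by positivity
      nlinarith
    have h7 : 0 ≤ 2 * C₀ ^ 2 + 2 * C₀ ^ 2 * (d ^ 2 * (C₀ + 1)) := by positivity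
    rw [hC₁, add_mul]
    nlinarith [hA1 (4 * s)]
  have h2 : ε ^ (2 * s) * (2 * d * (2 * (2 * ε ^ 2 * D + d * (L * A ^ (4 * s))) / ε ^ 2) ^ s * A ^ 2) ≤
      2 * d * (2 * C₁) ^ s * A ^ (4 * s ^ 2 + 2) := by
    rw [div_pow, ← pow_mul]
    calc _ = 2 * d * (2 * (2 * ε ^ 2 * D + d * (L * A ^ (4 * s)))) ^ s * A ^ 2 := by
          field_simp
      _ ≤ 2 * d * (2 * (C₁ * A ^ (4 * s))) ^ s * A ^ 2 := by gcongr
      _ = _ := by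
        rw [← mul_assoc 2 C₁, mul_pow (2 * C₁), ← pow_mul, pow_add,
          show 4 * s * s = 4 * s ^ 2 by ring]
        ring
  have h3 := h.sob_init
  have h4 : C₀ ≤ C₀ * A ^ (4 * s ^ 2 + 2) := le_mul_of_one_le_right hC₀ (hA1 _)
  have h5 : 0 ≤ 2 * d * (2 * C₁) ^ s * A ^ (4 * s ^ 2 + 2) := by positivity
  calc _ ≤ ε ^ (2 * s) * max (sob N s (u 0)) _ := mul_le_mul_of_nonneg_left h1 (by positivity)
    _ ≤ _ := by
      rw [mul_max_of_nonneg _ _ (by positivity), add_mul]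
      refine max_le ?_ ?_
      · linarith
      · have : 0 ≤ C₀ * A ^ (4 * s ^ 2 + 2) := by positivity
        linarith

/-- The tail bound with W of order A^{4s}·ε^{-2s} A^{4s²+2}; its square root in A is the exponent
2s² + 2s + 1. -/
lemma exists_projErr_le (d s : ℕ) (hs : 1 ≤ s) (C₀ : ℝ) : ∃ C : ℝ, 0 ≤ C ∧
    ∀ {T : ℝ} {f : Fin d → ℝ → ℝ} {μ : Measure (E d)} {u₀ : E d → ℝ} {N m : ℕ} {ε : ℝ}
      {q : Fin d → Fin d → ℕ → ℝ → ℝ} {u : ℝ → E d → ℝ}, Admissible s C₀ T f μ u₀ N m ε q u →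
    ∀ t₀ ≤ T, ∀ A : ℝ, 1 ≤ A → (∀ t ∈ Set.Ioo 0 t₀, ∀ x, |u t x| ≤ A) → ∀ t ∈ Set.Ioo 0 t₀, ∀ x,
      (N : ℝ) ^ 2 * |projErr f N (u t) x| ≤ C * A ^ (2 * s ^ 2 + 2 * s + 1) := by
  obtain ⟨L, hL, hF⟩ := exists_sum_flux_le d s hs C₀
  obtain ⟨K, hK, hsob⟩ := exists_sob_le d s hs C₀
  obtain ⟨Z, hZ, hSZ⟩ := exists_sum_freqSize_le d
  set C₁ : ℝ := |C₀| * Z * (L * K) with hC₁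
  have hC₁0 : 0 ≤ C₁ := by positivity
  refine ⟨d * Real.sqrt C₁, by positivity, ?_⟩
  intro T f μ u₀ N m ε q u h t₀ ht₀ A hA hu t ht x
  have hC₀ : 0 ≤ C₀ := zero_le_one.trans h.one_le
  rw [abs_of_nonneg hC₀] at hC₁
  have hε := h.eps_pos
  have hA0 : 0 < A := by linarith
  have ht' : t ∈ Set.Icc 0 T := ⟨ht.1.le, ht.2.le.trans ht₀⟩
  have hN : (0 : ℝ) < N := by exact_mod_cast h.one_le_N
  have hW : ∀ k, ∀ S : Finset (Fin d → ℤ), ∑ ξ ∈ S, (freqSize ξ : ℝ) ^ (2 * s) *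
      ‖coeff (fun y => f k (u t y)) ξ‖ ^ 2 ≤ L * A ^ (4 * s) * sob N s (u t) := by
    intro k S
    rw [sob, Finset.mul_sum]
    refine le_trans ?_ (Finset.sum_le_sum fun j _ => hF h t ht' A hA (hu t ht) j k S)
    rw [Finset.sum_comm]
    refine Finset.sum_le_sum fun ξ _ => ?_
    rw [← Finset.sum_mul]
    gcongr
    exact freqSize_pow_le_sum ξ hs
  have hone : ∀ k, (N : ℝ) ^ 2 * ‖(fderiv ℝ (fun y => f k (u t y)) x (dir k) : ℂ) -
      trig (freqs d N) (fun ξ => Complex.I * (ξ k : ℂ) * coeff (fun y => f k (u t y)) ξ) x‖ ≤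
      Real.sqrt C₁ * A ^ (2 * s ^ 2 + 2 * s + 1) := by
    intro k
    set X := ‖(fderiv ℝ (fun y => f k (u t y)) x (dir k) : ℂ) -
      trig (freqs d N) (fun ξ => Complex.I * (ξ k : ℂ) * coeff (fun y => f k (u t y)) ξ) x‖
      with hX
    have h1 := norm_fderiv_sub_trig_sq_le hZ hSZ h.two_s h.one_le_N
      (g := fun y => f k (u t y)) ((h.per ht').comp (f k))
      ((h.smooth k).comp (h.contDiff ht')) (hW k) k x
    rw [← hX] at h1
    have h2 := hsob h t₀ ht₀ A hA hu t ⟨ht.1.le, ht.2.le⟩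
    have h3 : ((N : ℝ) * ε) ^ (2 * s) * X ^ 2 ≤
        Z * ((N : ℝ) ^ (d + 3) * (L * A ^ (4 * s) * (K * A ^ (4 * s ^ 2 + 2)))) := by
      calc _ = ε ^ (2 * s) * ((N : ℝ) ^ (2 * s) * X ^ 2) := by rw [mul_pow]; ring
        _ ≤ ε ^ (2 * s) * (Z * ((N : ℝ) ^ (d + 3) * (L * A ^ (4 * s) * sob N s (u t)))) := by
          gcongr
        _ = Z * ((N : ℝ) ^ (d + 3) * (L * A ^ (4 * s) * (ε ^ (2 * s) * sob N s (u t)))) := by ring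
        _ ≤ _ := by gcongr
    -- d + 7 = (d + 3) + 4: the tail sum costs N^{d+3}, and the remaining N⁴ is the square of the
    -- desired gain N².
    have h4 : (N : ℝ) ^ (d + 7) * X ^ 2 ≤ (N : ℝ) ^ (d + 3) *
        (C₁ * A ^ (2 * (2 * s ^ 2 + 2 * s + 1))) := by
      calc _ ≤ C₀ * ((N : ℝ) * ε) ^ (2 * s) * X ^ 2 := by gcongr; exact h.decay
        _ = C₀ * (((N : ℝ) * ε) ^ (2 * s) * X ^ 2) := by ring
        _ ≤ C₀ * (Z * ((N : ℝ) ^ (d + 3) * (L * A ^ (4 * s) * (K * A ^ (4 * s ^ 2 + 2))))) := by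
          gcongr
        _ = _ := by
          rw [hC₁, show 2 * (2 * s ^ 2 + 2 * s + 1) = 4 * s + (4 * s ^ 2 + 2) by ring, pow_add A]
          ring
    have h5 : ((N : ℝ) ^ 2 * X) ^ 2 ≤ C₁ * A ^ (2 * (2 * s ^ 2 + 2 * s + 1)) := by
      refine le_of_mul_le_mul_left ?_ (show (0 : ℝ) < (N : ℝ) ^ (d + 3) by positivity)
      calc _ = (N : ℝ) ^ (d + 7) * X ^ 2 := by ring
        _ ≤ _ := h4
    refine le_of_sq_le_sq ?_ (by positivity)
    refine h5.trans (le_of_eq ?_)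
    rw [mul_pow, Real.sq_sqrt hC₁0, ← pow_mul, mul_comm 2]
  rw [projErr]
  calc _ ≤ (N : ℝ) ^ 2 * ∑ k, ‖(fderiv ℝ (fun y => f k (u t y)) x (dir k) : ℂ) -
      trig (freqs d N) (fun ξ => Complex.I * (ξ k : ℂ) * coeff (fun y => f k (u t y)) ξ) x‖ := by
        gcongr
        exact (Complex.abs_re_le_norm _).trans (norm_sum_le _ _)
    _ ≤ ∑ _k : Fin d, Real.sqrt C₁ * A ^ (2 * s ^ 2 + 2 * s + 1) := by
      rw [Finset.mul_sum]
      exact Finset.sum_le_sum fun k _ => hone k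
    _ = _ := by simp; ring

end SVV

end

/-! ### The viscosity error and the moment bootstrap -/

noncomputable section
namespace SVV

variable {d : ℕ}

/-- Parseval needs only the size of the symbol, so no logarithm is lost; this is the bound that
tends to zero. -/
lemma integral_viscErr_sq_le {s : ℕ} {C₀ T : ℝ} {f : Fin d → ℝ → ℝ} {μ : Measure (E d)}
    {u₀ : E d → ℝ} {N m : ℕ} {ε : ℝ} {q : Fin d → Fin d → ℕ → ℝ → ℝ} {u : ℝ → E d → ℝ}
    (h : Admissible s C₀ T f μ u₀ N m ε q u) {t : ℝ} (ht : t ∈ Set.Icc 0 T) :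
    ∫ x, viscErr N m ε (fun j k p => q j k p t) (u t) x ^ 2 ∂(cellVol d) ≤
      (d ^ 2 * (C₀ + 1) * (ε * (m : ℝ) ^ 2)) ^ 2 * ∫ x, u t x ^ 2 ∂(cellVol d) := by
  have hC₀ : 0 ≤ C₀ := zero_le_one.trans h.one_le
  have hε := h.eps_pos
  set b : (Fin d → ℤ) → ℂ := fun ξ => ((∑ j, (ξ j : ℝ) ^ 2 -
    viscSymbol m (fun j k p => q j k p t) ξ : ℝ) : ℂ) * ((ε : ℂ) * coeff (u t) ξ) with hb
  have h1 : ∫ x, viscErr N m ε (fun j k p => q j k p t) (u t) x ^ 2 ∂(cellVol d) ≤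
      ∫ x, ‖trig (freqs d N) b x‖ ^ 2 ∂(cellVol d) := by
    refine integral_mono (integrable_cellVol ((continuous_viscErr N m ε _ _).pow 2))
      (integrable_cellVol ((continuous_trig _ _).norm.pow 2)) fun x => ?_
    change viscErr N m ε _ _ x ^ 2 ≤ _
    rw [← sq_abs]
    exact pow_le_pow_left₀ (abs_nonneg _) (Complex.abs_re_le_norm _) 2
  refine h1.trans ?_
  rw [integral_norm_sq_trig, integral_sq_of_eq_trig (h.sol.eq_trig ht), ← mul_assoc,
    mul_comm (_ ^ 2) ((2 * Real.pi) ^ d), mul_assoc]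
  gcongr
  rw [Finset.mul_sum]
  refine Finset.sum_le_sum fun ξ hξ => ?_
  have h2 := abs_sum_sq_sub_viscSymbol_le hC₀ (h.symbol_bound t ht) hξ
  have h3 : ‖b ξ‖ ≤ d ^ 2 * (C₀ + 1) * (ε * (m : ℝ) ^ 2) * ‖coeff (u t) ξ‖ := by
    rw [hb, norm_mul, norm_mul, Complex.norm_real, Complex.norm_real, Real.norm_eq_abs,
      Real.norm_eq_abs, abs_of_pos hε]
    calc _ ≤ d ^ 2 * (C₀ + 1) * (m : ℝ) ^ 2 * (ε * ‖coeff (u t) ξ‖) := by gcongr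
      _ = _ := by ring
  rw [← mul_pow]
  exact pow_le_pow_left₀ (norm_nonneg _) h3 2

/-- Here the factor ε m² (1 + log N) is merely bounded, which is all that Gronwall for the moment
requires. -/
lemma exists_integral_viscErr_pow_le (d s k : ℕ) (hk : 1 ≤ k) (C₀ : ℝ) : ∃ C : ℝ, 0 ≤ C ∧
    ∀ {T : ℝ} {f : Fin d → ℝ → ℝ} {μ : Measure (E d)} {u₀ : E d → ℝ} {N m : ℕ} {ε : ℝ}
      {q : Fin d → Fin d → ℕ → ℝ → ℝ} {u : ℝ → E d → ℝ}, Admissible s C₀ T f μ u₀ N m ε q u →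
    ∀ t ∈ Set.Icc 0 T, ∫ x, viscErr N m ε (fun j k p => q j k p t) (u t) x ^ (2 * k) ∂(cellVol d) ≤
      C * ∫ x, u t x ^ (2 * k) ∂(cellVol d) := by
  obtain ⟨K, hK, hnrm⟩ := exists_nrm_viscDefect_le d k hk
  refine ⟨(K * (|C₀| + 1) * |C₀|) ^ (2 * k), by positivity, ?_⟩
  intro T f μ u₀ N m ε q u h t ht
  have hC₀ : 0 ≤ C₀ := zero_le_one.trans h.one_le
  rw [abs_of_nonneg hC₀]
  have hε := h.eps_pos
  set b : (Fin d → ℤ) → ℂ := fun ξ => ((∑ j, (ξ j : ℝ) ^ 2 -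
    viscSymbol m (fun j k p => q j k p t) ξ : ℝ) : ℂ) * ((ε : ℂ) * coeff (u t) ξ) with hb
  have h1 := hnrm N m (fun j k p => q j k p t) C₀ hC₀ (h.symbol_bound t ht) (h.symbol_mono t ht)
    fun ξ => (ε : ℂ) * coeff (u t) ξ
  have h2 := (MulBound.const (d := d) (k := k) (ε : ℂ)).bound (freqs d N) (coeff (u t))
  rw [Complex.norm_real, Real.norm_eq_abs, abs_of_pos hε] at h2
  have hlog : 0 ≤ Real.log N := Real.log_natCast_nonneg N
  have h3 : nrm k (trig (freqs d N) b) ≤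
      K * (C₀ + 1) * C₀ * nrm k (trig (freqs d N) (coeff (u t))) := by
    calc _ ≤ _ := h1
      _ ≤ K * ((C₀ + 1) * (m : ℝ) ^ 2) * (1 + Real.log N) *
          (ε * nrm k (trig (freqs d N) (coeff (u t)))) := by gcongr
      _ = K * (C₀ + 1) * (ε * (m : ℝ) ^ 2 * (1 + Real.log N)) *
          nrm k (trig (freqs d N) (coeff (u t))) := by ring
      _ ≤ _ := by
        have := nrm_nonneg k (trig (freqs d N) (coeff (u t)))
        gcongr
        exact h.visc_le
  have h4 := pow_le_pow_left₀ (nrm_nonneg _ _) h3 (2 * k)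
  rw [mul_pow, nrm_pow hk (continuous_trig _ _), nrm_pow hk (continuous_trig _ _)] at h4
  have h5 : ∫ x, ‖trig (freqs d N) (coeff (u t)) x‖ ^ (2 * k) ∂(cellVol d) =
      ∫ x, u t x ^ (2 * k) ∂(cellVol d) := by
    refine integral_congr_ae (Eventually.of_forall fun x => ?_)
    simp only [← h.sol.eq_trig ht x, Complex.norm_real, Real.norm_eq_abs, pow_mul, sq_abs]
  rw [h5] at h4
  refine le_trans ?_ h4
  refine integral_mono (integrable_cellVol ((continuous_viscErr N m ε _ _).pow _))
    (integrable_cellVol ((continuous_trig _ _).norm.pow _)) fun x => ?_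
  change viscErr N m ε _ _ x ^ (2 * k) ≤ _
  rw [pow_mul, ← sq_abs, ← pow_mul]
  exact pow_le_pow_left₀ (abs_nonneg _) (Complex.abs_re_le_norm _) _

lemma Admissible.hasDerivAt_integral {s : ℕ} {C₀ T : ℝ} {f : Fin d → ℝ → ℝ} {μ : Measure (E d)}
    {u₀ : E d → ℝ} {N m : ℕ} {ε : ℝ} {q : Fin d → Fin d → ℕ → ℝ → ℝ} {u : ℝ → E d → ℝ}
    (h : Admissible s C₀ T f μ u₀ N m ε q u) {η η' η'' : ℝ → ℝ} (H : Entropy η η' η'') {t : ℝ}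
    (ht : t ∈ Set.Ioo 0 T) : HasDerivAt (fun τ => ∫ x, η (u τ x) ∂(cellVol d))
      (∫ x, η' (u t x) * dt f μ N m ε (fun j k p => q j k p t) (u t) x ∂(cellVol d)) t := by
  refine hasDerivAt_integral_comp (S := freqs d N) (c := fun τ => coeff (u τ)) H.deriv₁ H.continuous' ?_
    (fun ξ hξ => h.sol.hasDerivAt_coeff h.levy ht hξ) (h.sol.dt_eq_trig h.levy ht)
  filter_upwards [Ioo_mem_nhds ht.1 ht.2] with τ hτ
  exact h.sol.eq_trig ⟨hτ.1.le, hτ.2.le⟩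

lemma pow_mul_le_add {k : ℕ} (hk : 1 ≤ k) {a b : ℝ} (ha : 0 ≤ a) (hb : 0 ≤ b) :
    a ^ (2 * k - 1) * b ≤ a ^ (2 * k) + b ^ (2 * k) := by
  obtain ⟨n, hn⟩ : ∃ n, 2 * k = n + 1 := ⟨2 * k - 1, by omega⟩
  rw [hn, Nat.add_sub_cancel, pow_succ, pow_succ]
  rcases le_total a b with h | h
  · have : a ^ n * b ≤ b ^ n * b := by gcongr
    have : 0 ≤ a ^ n * a := by positivity
    linarith
  · have : a ^ n * b ≤ a ^ n * a := by gcongr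
    have : 0 ≤ b ^ n * b := by positivity
    linarith

/-- The bootstrap that replaces an a priori sup bound. The moment bound B gives a sup bound growing
slowly in N, that makes the projection error O(1/N), and Gronwall then returns the moment strictly
below B. -/
lemma exists_integral_pow_le (d s : ℕ) (hd : 1 ≤ d) (hs : 1 ≤ s) (C₀ T : ℝ) :
    ∃ (B C : ℝ) (N₀ : ℕ), 0 ≤ B ∧ 0 ≤ C ∧
    ∀ {f : Fin d → ℝ → ℝ} {μ : Measure (E d)} {u₀ : E d → ℝ} {N m : ℕ} {ε : ℝ}
      {q : Fin d → Fin d → ℕ → ℝ → ℝ} {u : ℝ → E d → ℝ}, Admissible s C₀ T f μ u₀ N m ε q u →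
    N₀ ≤ N → (∀ t ∈ Set.Icc 0 T,
      ∫ x, u t x ^ (2 * (d * (2 * s ^ 2 + 2 * s + 1))) ∂(cellVol d) ≤ B) ∧
      ∀ t ∈ Set.Ioo 0 T, ∀ x, |projErr f N (u t) x| ≤ C / N := by
  set p := 2 * s ^ 2 + 2 * s + 1 with hp
  have hp1 : 1 ≤ p := by omega
  -- Nikolskii bounds u^{2k} by const·N^d, and A^{2k} = (A^p)^{2d}; so A^p may be taken of order N,
  -- while the error bound A^p/N² still decays.
  set k := d * p with hk
  have hk1 : 1 ≤ k := Nat.mul_pos hd hp1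
  obtain ⟨K, hK, hproj⟩ := exists_projErr_le d s hs C₀
  obtain ⟨V, hV, hvisc⟩ := exists_integral_viscErr_pow_le d s k hk1 C₀
  have hπ : (0 : ℝ) < (2 * Real.pi) ^ d := by positivity
  set a : ℝ := (2 * k : ℕ) * (2 + V) with ha
  set b : ℝ := (2 * k : ℕ) * (2 * Real.pi) ^ d with hb
  have ha0 : 0 ≤ a := by positivity
  have hb0 : 0 ≤ b := by positivity
  -- The Gronwall bound plus 1, for a strict inequality at the end of the bootstrap.
  set B : ℝ := Real.exp (a * |T|) * (C₀ ^ (2 * k) * (2 * Real.pi) ^ d + b * |T|) + 1 with hB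
  have hC0 : 0 ≤ C₀ ^ (2 * k) := by rw [pow_mul]; positivity
  have hB0 : 0 ≤ B := by positivity
  set D : ℝ := max 1 ((3 * k : ℝ) ^ d * B) with hD
  have hD1 : 1 ≤ D := le_max_left _ _
  -- From N₀ on the projection error is at most 1.
  obtain ⟨N₀, hN₀⟩ := exists_nat_ge (K * D)
  refine ⟨B, K * D, N₀, hB0, by positivity, ?_⟩
  intro f μ u₀ N m ε q u h hN
  have hN1 : (1 : ℝ) ≤ N := by exact_mod_cast h.one_le_N
  have hN0 : (0 : ℝ) < N := by linarith
  have hC₀ : 0 ≤ C₀ := zero_le_one.trans h.one_le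
  have hε := h.eps_pos
  set G : ℝ → ℝ := fun t => ∫ x, u t x ^ (2 * k) ∂(cellVol d) with hG
  have hsmall : ∀ t₀ ≤ T, (∀ t ∈ Set.Ioo 0 t₀, G t ≤ B) → ∀ t ∈ Set.Ioo 0 t₀, ∀ x,
      |projErr f N (u t) x| ≤ K * D / N := by
    intro t₀ ht₀ hGB t ht x
    set A : ℝ := (D * N) ^ ((p : ℝ)⁻¹) with hA
    have hDN : 1 ≤ D * N := one_le_mul_of_one_le_of_one_le hD1 hN1
    have hA1 : 1 ≤ A := Real.one_le_rpow hDN (by positivity)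
    have hAp : A ^ p = D * N := Real.rpow_inv_natCast_pow (by positivity) (by omega)
    have hsup : ∀ t ∈ Set.Ioo 0 t₀, ∀ x, |u t x| ≤ A := by
      intro t ht x
      have h1 := pow_le_of_eq_trig h.one_le_N (h.sol.eq_trig ⟨ht.1.le, ht.2.le.trans ht₀⟩) hk1 x
      have h2 : u t x ^ (2 * k) ≤ (A ^ p) ^ (2 * d) := by
        calc _ ≤ (3 * k : ℝ) ^ d * (N : ℝ) ^ d * B := h1.trans (by gcongr; exact hGB t ht)
          _ = (3 * k : ℝ) ^ d * B * (N : ℝ) ^ d := by ring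
          _ ≤ D * (N : ℝ) ^ d := by gcongr; exact le_max_right _ _
          _ ≤ D ^ (2 * d) * (N : ℝ) ^ (2 * d) := by
            gcongr
            · exact le_self_pow₀ hD1 (by omega)
            · omega
          _ = _ := by rw [hAp, mul_pow]
      refine le_of_pow_le_pow_left₀ (n := 2 * k) (by omega) (by linarith) ?_
      rw [pow_mul, sq_abs, ← pow_mul]
      refine h2.trans (le_of_eq ?_)
      rw [← pow_mul, hk]
      congr 1
      ring
    have h1 := hproj h t₀ ht₀ A hA1 hsup t ht x
    rw [← hp, hAp] at h1
    rw [le_div_iff₀ hN0]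
    have h2 : 0 ≤ |projErr f N (u t) x| := abs_nonneg _
    refine le_of_mul_le_mul_right ?_ hN0
    calc _ = (N : ℝ) ^ 2 * |projErr f N (u t) x| := by ring
      _ ≤ _ := h1
      _ = _ := by ring
  have hGc : ContinuousOn G (Set.Icc 0 T) :=
    continuousOn_integral_comp (η := fun v => v ^ (2 * k)) (c := fun t => coeff (u t)) (by fun_prop)
      (fun t ht => h.sol.eq_trig ht) fun ξ hξ => h.sol.continuousOn_coeff hξ
  have hboot : ∀ t ∈ Set.Icc 0 T, G t < B := by
    refine lt_of_bootstrap hGc fun t₀ ht₀ hlt => ?_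
    have herr := hsmall t₀ ht₀.2 fun t ht => (hlt t ⟨ht.1.le, ht.2⟩).le
    have h1 := gronwall_le (g := G) (a := a) (b := b)
      (g' := fun t => ∫ x, (2 * k : ℕ) * u t x ^ (2 * k - 1) *
        dt f μ N m ε (fun j k p => q j k p t) (u t) x ∂(cellVol d)) hb0 ha0
      (hGc.mono (Set.Icc_subset_Icc_right ht₀.2))
      (fun t ht => h.hasDerivAt_integral (entropy_pow hk1) ⟨ht.1, ht.2.trans_le ht₀.2⟩)
      (fun t ht => ?_) t₀ ⟨ht₀.1, le_rfl⟩
    · have h2 : G 0 ≤ C₀ ^ (2 * k) * (2 * Real.pi) ^ d := by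
        have h3 : Continuous (u 0) := (h.contDiff ⟨le_rfl, ht₀.1.trans ht₀.2⟩ (n := 0)).continuous
        rw [← integral_const_cellVol]
        refine integral_mono (integrable_cellVol (h3.pow _)) (integrable_const _) fun x => ?_
        change u 0 x ^ (2 * k) ≤ C₀ ^ (2 * k)
        rw [pow_mul, ← sq_abs, ← pow_mul]
        exact pow_le_pow_left₀ (abs_nonneg _) (h.sup_init x) _
      have h3 : t₀ ≤ |T| := ht₀.2.trans (le_abs_self T)
      have h4 := ht₀.1
      calc G t₀ ≤ _ := h1
        _ ≤ Real.exp (a * t₀) * (C₀ ^ (2 * k) * (2 * Real.pi) ^ d + b * |T|) := by gcongr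
        _ ≤ Real.exp (a * |T|) * (C₀ ^ (2 * k) * (2 * Real.pi) ^ d + b * |T|) := by gcongr
        _ < B := by rw [hB]; linarith
    · have ht' : t ∈ Set.Icc 0 T := ⟨ht.1.le, ht.2.le.trans ht₀.2⟩
      have huc : Continuous (u t) := (h.contDiff ht' (n := 0)).continuous
      have h2 := (entropy_pow hk1).integral_dt_le (f := f) (N := N) (m := m)
        (q := fun j k p => q j k p t) h.smooth_one h.levy hε (h.sol.eq_trig ht')
      refine h2.trans ?_
      have hvc := continuous_viscErr N m ε (fun j k p => q j k p t) (u t)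
      have hpc := continuous_projErr h.smooth_one N (h.contDiff ht')
      have hpow : ∀ {g : E d → ℝ}, Continuous g → Integrable (fun x => g x ^ (2 * k)) (cellVol d) :=
        fun hg => integrable_cellVol (hg.pow _)
      have i1 : Integrable (fun x => 1 + 2 * u t x ^ (2 * k)) (cellVol d) :=
        (integrable_const _).add ((hpow huc).const_mul _)
      have i2 : Integrable (fun x => 1 + 2 * u t x ^ (2 * k) +
        viscErr N m ε (fun j k p => q j k p t) (u t) x ^ (2 * k)) (cellVol d) := i1.add (hpow hvc)
      have h3 : ∫ x, (2 * k : ℕ) * u t x ^ (2 * k - 1) * (projErr f N (u t) x +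
          viscErr N m ε (fun j k p => q j k p t) (u t) x) ∂(cellVol d) ≤
          ∫ x, ((2 * k : ℕ) : ℝ) * (1 + 2 * u t x ^ (2 * k) +
            viscErr N m ε (fun j k p => q j k p t) (u t) x ^ (2 * k)) ∂(cellVol d) := by
        have hc : Continuous fun x => (2 * k : ℕ) * u t x ^ (2 * k - 1) * (projErr f N (u t) x +
          viscErr N m ε (fun j k p => q j k p t) (u t) x) := by fun_prop
        refine integral_mono (integrable_cellVol hc) (i2.const_mul _) fun x => ?_
        set e₁ := projErr f N (u t) x
        set e₂ := viscErr N m ε (fun j k p => q j k p t) (u t) x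
        have he : |e₁| ≤ 1 := by
          refine (herr t ht x).trans ?_
          rw [div_le_one hN0]
          exact hN₀.trans (by exact_mod_cast hN)
        have hpe : ∀ r : ℝ, |r| ^ (2 * k) = r ^ (2 * k) := fun r => by
          rw [pow_mul, sq_abs, ← pow_mul]
        have h4 : u t x ^ (2 * k - 1) * (e₁ + e₂) ≤
            |u t x| ^ (2 * k - 1) * 1 + |u t x| ^ (2 * k - 1) * |e₂| := by
          rw [← mul_add]
          refine (le_abs_self _).trans ?_
          rw [abs_mul, abs_pow]
          gcongr
          exact (abs_add_le _ _).trans (by gcongr)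
        have h5 := pow_mul_le_add hk1 (abs_nonneg (u t x)) zero_le_one
        have h6 := pow_mul_le_add hk1 (abs_nonneg (u t x)) (abs_nonneg e₂)
        rw [hpe, one_pow] at h5
        rw [hpe, hpe] at h6
        simp only [mul_assoc]
        gcongr
        linarith
      refine h3.trans ?_
      rw [integral_const_mul, integral_add i1 (hpow hvc), integral_add (integrable_const _)
        ((hpow huc).const_mul _), integral_const_mul, integral_one_cellVol]
      have h4 := hvisc h t ht'
      rw [ha, hb]
      calc _ ≤ ((2 * k : ℕ) : ℝ) * ((2 * Real.pi) ^ d + 2 * G t + V * G t) := by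
            rw [hG]; gcongr
        _ = _ := by ring
  exact ⟨fun t ht => (hboot t ht).le,
    hsmall T le_rfl fun t ht => (hboot t ⟨ht.1.le, ht.2.le⟩).le⟩

end SVV

end

noncomputable section
namespace SVV

variable {d : ℕ}

/-! ### A smooth approximation of the absolute value -/

/-- A convex function close to `|v|` whose second derivative is at most `(n |v|)⁻¹`. -/
def absApprox (n v : ℝ) : ℝ :=
  n⁻¹ * (v * Real.arsinh (Real.exp n * v) - (Real.exp n)⁻¹ * (√(1 + (Real.exp n * v) ^ 2) - 1))

lemma hasDerivAt_arsinh_exp_mul (n v : ℝ) : HasDerivAt (fun v => Real.arsinh (Real.exp n * v))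
    ((√(1 + (Real.exp n * v) ^ 2))⁻¹ * Real.exp n) v := by
  have h1 : HasDerivAt (fun v : ℝ => Real.exp n * v) (Real.exp n) v := by
    simpa using (hasDerivAt_id v).const_mul (Real.exp n)
  exact (Real.hasDerivAt_arsinh (Real.exp n * v)).comp v h1

lemma entropy_absApprox {n : ℝ} (hn : 0 < n) : Entropy (absApprox n)
    (fun v => n⁻¹ * Real.arsinh (Real.exp n * v))
    (fun v => n⁻¹ * ((√(1 + (Real.exp n * v) ^ 2))⁻¹ * Real.exp n)) where
  deriv₁ v := by
    have h0 : (0 : ℝ) < 1 + (Real.exp n * v) ^ 2 := by positivity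
    have h1 : HasDerivAt (fun v : ℝ => 1 + (Real.exp n * v) ^ 2)
        (2 * (Real.exp n * v) * Real.exp n) v := by
      have h2 : HasDerivAt (fun v : ℝ => Real.exp n * v) (Real.exp n) v := by
        simpa using (hasDerivAt_id v).const_mul (Real.exp n)
      refine ((h2.fun_pow 2).const_add 1).congr_deriv ?_
      simp
    have h2 := ((h1.sqrt h0.ne').sub_const 1).const_mul (Real.exp n)⁻¹
    have h3 := ((hasDerivAt_id v).mul (hasDerivAt_arsinh_exp_mul n v)).sub h2
    refine (h3.const_mul n⁻¹).congr_deriv ?_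
    have := Real.exp_pos n
    have h4 : 0 < √(1 + (Real.exp n * v) ^ 2) := Real.sqrt_pos.2 h0
    simp only [id_eq]
    field_simp
    ring
  deriv₂ v := (hasDerivAt_arsinh_exp_mul n v).const_mul n⁻¹
  cont := by
    refine continuous_const.mul ((Continuous.inv₀ (by fun_prop) fun v => ?_).mul continuous_const)
    exact (Real.sqrt_pos.2 (by positivity)).ne'
  nonneg v := by positivity

lemma abs_mul_absApprox_deriv₂_le {n : ℝ} (hn : 0 < n) (v : ℝ) :
    n⁻¹ * ((√(1 + (Real.exp n * v) ^ 2))⁻¹ * Real.exp n) * |v| ≤ n⁻¹ := by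
  have h1 : Real.exp n * |v| ≤ √(1 + (Real.exp n * v) ^ 2) := by
    refine Real.le_sqrt_of_sq_le ?_
    rw [mul_pow, sq_abs, ← mul_pow]
    linarith
  have h0 : 0 < √(1 + (Real.exp n * v) ^ 2) := Real.sqrt_pos.2 (by positivity)
  rw [mul_assoc]
  refine mul_le_of_le_one_right (by positivity) ?_
  rw [mul_assoc, inv_mul_le_iff₀ h0, mul_one]
  exact h1

lemma abs_arsinh_exp_mul_le {n v a : ℝ} (hn : 0 ≤ n) (hv : |v| ≤ a) :
    |Real.arsinh (Real.exp n * v)| ≤ n + Real.log (1 + 2 * a) := by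
  have ha : 0 ≤ a := (abs_nonneg v).trans hv
  have h1 : ∀ y : ℝ, 0 ≤ y → y ≤ Real.exp n * a → |Real.arsinh y| ≤ n + Real.log (1 + 2 * a) := by
    intro y hy hya
    have h2 : √(1 + y ^ 2) ≤ 1 + y := Real.sqrt_le_iff.2 ⟨by linarith, by nlinarith⟩
    rw [abs_of_nonneg (Real.arsinh_nonneg_iff.2 hy), ← Real.log_exp n,
      ← Real.log_mul (Real.exp_pos n).ne' (by positivity), Real.arsinh]
    refine Real.log_le_log (by positivity) ?_
    have h3 : 1 ≤ Real.exp n := Real.one_le_exp hn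
    nlinarith
  have h4 : |Real.exp n * v| ≤ Real.exp n * a := by
    rw [abs_mul, abs_of_pos (Real.exp_pos n)]; gcongr
  rcases le_total 0 (Real.exp n * v) with h | h
  · exact h1 _ h ((le_abs_self _).trans h4)
  · rw [← abs_neg, ← Real.arsinh_neg]
    exact h1 _ (by linarith) ((neg_le_abs _).trans h4)

lemma absApprox_neg (n v : ℝ) : absApprox n (-v) = absApprox n v := by
  simp [absApprox]

lemma absApprox_le {n v a : ℝ} (hn : 0 < n) (hv : |v| ≤ a) :
    absApprox n v ≤ |v| * (1 + n⁻¹ * Real.log (1 + 2 * a)) := by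
  have h1 : (0 : ℝ) ≤ (Real.exp n)⁻¹ * (√(1 + (Real.exp n * v) ^ 2) - 1) := by
    have : (1 : ℝ) ≤ √(1 + (Real.exp n * v) ^ 2) := Real.le_sqrt_of_sq_le (by nlinarith)
    have : 0 ≤ √(1 + (Real.exp n * v) ^ 2) - 1 := by linarith
    positivity
  have h2 : v * Real.arsinh (Real.exp n * v) ≤ |v| * (n + Real.log (1 + 2 * a)) := by
    refine (le_abs_self _).trans ?_
    rw [abs_mul]
    gcongr
    exact abs_arsinh_exp_mul_le hn.le hv
  calc absApprox n v ≤ n⁻¹ * (|v| * (n + Real.log (1 + 2 * a))) := by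
        unfold absApprox; gcongr; linarith
    _ = _ := by field_simp

/-- For v > 0, arsinh(e^n v) ≥ n + log v, and v log v ≥ v - 1 keeps the loss below 1/n down to v =
0. -/
lemma le_absApprox {n : ℝ} (hn : 0 < n) (v : ℝ) : |v| - n⁻¹ ≤ absApprox n v := by
  wlog hv : 0 ≤ v generalizing v
  · have := this (-v) (by linarith)
    rwa [abs_neg, absApprox_neg] at this
  rw [abs_of_nonneg hv]
  rcases hv.eq_or_lt with rfl | hv0
  · simp [absApprox, hn.le]
  have he := Real.exp_pos n
  have h1 : v - 1 ≤ v * Real.log v := by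
    have := Real.one_sub_inv_le_log_of_pos hv0
    have h2 := mul_le_mul_of_nonneg_left this hv
    rwa [mul_sub, mul_one, mul_inv_cancel₀ hv0.ne'] at h2
  have h2 : n + Real.log v ≤ Real.arsinh (Real.exp n * v) := by
    rw [← Real.log_exp n, ← Real.log_mul he.ne' hv0.ne', Real.log_exp, Real.arsinh]
    exact Real.log_le_log (by positivity) (by linarith [Real.sqrt_nonneg (1 + (Real.exp n * v) ^ 2)])
  have h3 : (Real.exp n)⁻¹ * (√(1 + (Real.exp n * v) ^ 2) - 1) ≤ v := by
    rw [inv_mul_le_iff₀ he]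
    have : √(1 + (Real.exp n * v) ^ 2) ≤ 1 + Real.exp n * v :=
      Real.sqrt_le_iff.2 ⟨by positivity, by nlinarith [mul_pos he hv0]⟩
    linarith
  have h4 := mul_le_mul_of_nonneg_left h2 hv
  rw [absApprox]
  calc v - n⁻¹ = n⁻¹ * (v * n - 1) := by field_simp
    _ ≤ _ := by
      rw [mul_add] at h4
      exact mul_le_mul_of_nonneg_left (by linarith) (inv_nonneg.2 hn.le)

/-! ### Stability in `L¹` of differences of translates -/

/-- Integration by parts turns the flux term into ∫ η''(w) ∂w F. With |F| ≤ L|w| the weight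
η''(r)|r| ≤ K appears: Kruzhkov's cancellation, with K = 1/n for the approximate modulus. -/
lemma integral_abs_mul_fderiv_le {w F : E d → ℝ} (hw : Per w) (hwc : ContDiff ℝ 1 w) (hF : Per F)
    (hFc : ContDiff ℝ 1 F) {η η' η'' : ℝ → ℝ} (H : Entropy η η' η'') {K D L : ℝ} (v : E d)
    (hK : ∀ r, η'' r * |r| ≤ K) (hD : ∀ x, |fderiv ℝ w x v| ≤ D) (hL : ∀ x, |F x| ≤ L * |w x|)
    (hL0 : 0 ≤ L) :
    -∫ x, η' (w x) * fderiv ℝ F x v ∂(cellVol d) ≤ K * D * L * (2 * Real.pi) ^ d := by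
  have hη : ContDiff ℝ 1 fun x => η' (w x) := H.contDiff'.comp hwc
  have hper : Per fun x => η' (w x) * F x := fun j x => by
    have h1 := hw j x
    have h2 := hF j x
    simp only [h1, h2]
  have h0 := integral_fderiv_eq_zero hper (hη.mul hFc) v
  have c1 : Continuous fun x => fderiv ℝ F x v :=
    (hFc.continuous_fderiv one_ne_zero).clm_apply continuous_const
  have c2 : Continuous fun x => fderiv ℝ w x v :=
    (hwc.continuous_fderiv one_ne_zero).clm_apply continuous_const
  have c3 : Continuous fun x => η'' (w x) := H.cont.comp hwc.continuous
  have h1 : ∀ x, fderiv ℝ (fun x => η' (w x) * F x) x v =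
      η' (w x) * fderiv ℝ F x v + η'' (w x) * fderiv ℝ w x v * F x := by
    intro x
    have a1 := hwc.differentiable one_ne_zero x
    have a2 := ((H.deriv₂ (w x)).hasFDerivAt.comp x a1.hasFDerivAt)
    have a3 := (a2.mul (hFc.differentiable one_ne_zero x).hasFDerivAt).fderiv
    change fderiv ℝ (fun x => η' (w x) * F x) x = _ at a3
    rw [a3]
    simp
    ring
  have i1 : Continuous fun x => η' (w x) * fderiv ℝ F x v := hη.continuous.mul c1
  have i2 : Continuous fun x => η'' (w x) * fderiv ℝ w x v * F x := (c3.mul c2).mul hFc.continuous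
  simp only [h1] at h0
  rw [integral_add (integrable_cellVol i1) (integrable_cellVol i2)] at h0
  have h2 : ∫ x, η'' (w x) * fderiv ℝ w x v * F x ∂(cellVol d) ≤
      ∫ _ : E d, K * D * L ∂(cellVol d) := by
    refine integral_mono (integrable_cellVol i2) (integrable_const _) fun x => ?_
    have a1 := H.nonneg (w x)
    have a2 := hK (w x)
    have a3 : 0 ≤ K := le_trans (by positivity) a2
    have a4 := hD x
    have a5 : 0 ≤ D := (abs_nonneg _).trans a4
    calc η'' (w x) * fderiv ℝ w x v * F x ≤ η'' (w x) * |fderiv ℝ w x v| * |F x| := by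
          rw [mul_assoc, mul_assoc, ← abs_mul]
          gcongr
          exact le_abs_self _
      _ ≤ η'' (w x) * D * (L * |w x|) := by
          have := hL x
          gcongr
      _ = η'' (w x) * |w x| * (D * L) := by ring
      _ ≤ K * (D * L) := by gcongr
      _ = _ := by ring
  rw [integral_const_cellVol] at h2
  linarith

namespace Admissible

variable {s : ℕ} {C₀ T : ℝ} {f : Fin d → ℝ → ℝ} {μ : Measure (E d)} {u₀ : E d → ℝ}
    {N m : ℕ} {ε : ℝ} {q : Fin d → Fin d → ℕ → ℝ → ℝ} {u : ℝ → E d → ℝ}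

/-- The sum of the two errors. -/
def err (f : Fin d → ℝ → ℝ) (N m : ℕ) (ε : ℝ) (q : Fin d → Fin d → ℕ → ℝ → ℝ) (u : ℝ → E d → ℝ)
    (t : ℝ) (x : E d) : ℝ := projErr f N (u t) x + viscErr N m ε (fun j k p => q j k p t) (u t) x

lemma continuous_err (h : Admissible s C₀ T f μ u₀ N m ε q u) {t : ℝ} (ht : t ∈ Set.Icc 0 T) :
    Continuous (err f N m ε q u t) :=
  (continuous_projErr h.smooth_one N (h.contDiff ht)).add (continuous_viscErr N m ε _ _)

lemma per_err (h : Admissible s C₀ T f μ u₀ N m ε q u) {t : ℝ} (ht : t ∈ Set.Icc 0 T) :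
    Per (err f N m ε q u t) := by
  intro j x
  have h1 : ∀ k, fderiv ℝ (fun y => f k (u t y)) (x + (2 * Real.pi) • dir j) =
    fderiv ℝ (fun y => f k (u t y)) x := fun k => ((h.per ht).comp (f k)).fderiv j x
  have h2 : ∀ c : (Fin d → ℤ) → ℂ, trig (freqs d N) c (x + (2 * Real.pi) • dir j) =
    trig (freqs d N) c x := fun c => per_trig _ c j x
  simp only [err, projErr, viscErr, h1, h2]

/-- This R is not uniform in N; it only has to be finite, since it meets a factor 1/n with n → ∞ at
fixed N. -/
lemma exists_bound (h : Admissible s C₀ T f μ u₀ N m ε q u) : ∃ R : ℝ, 0 ≤ R ∧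
    ∀ t ∈ Set.Icc 0 T, ∀ x, |u t x| ≤ R ∧ ∀ j, |fderiv ℝ (u t) x (dir j)| ≤ R := by
  have h1 : ContinuousOn (fun t => ∑ ξ ∈ freqs d N, (1 + freqSize ξ) * ‖coeff (u t) ξ‖)
      (Set.Icc 0 T) := continuousOn_finsetSum _ fun ξ hξ =>
    continuousOn_const.mul (h.sol.continuousOn_coeff hξ).norm
  obtain ⟨R, hR⟩ := isCompact_Icc.exists_bound_of_continuousOn h1
  refine ⟨|R|, abs_nonneg R, fun t ht x => ?_⟩
  have h2 : ∑ ξ ∈ freqs d N, (1 + freqSize ξ) * ‖coeff (u t) ξ‖ ≤ |R| :=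
    (le_abs_self _).trans ((hR t ht).trans (le_abs_self R))
  have h3 := h.sol.eq_trig ht
  refine ⟨?_, fun j => ?_⟩
  · rw [← Real.norm_eq_abs, ← Complex.norm_real, h3]
    refine (norm_trig_le _ _ _).trans (le_trans (Finset.sum_le_sum fun ξ _ => ?_) h2)
    exact le_mul_of_one_le_left (norm_nonneg _) (by simp)
  · rw [← Real.norm_eq_abs, ← Complex.norm_real, fderiv_of_eq_trig h3]
    refine (norm_trig_le _ _ _).trans (le_trans (Finset.sum_le_sum fun ξ _ => ?_) h2)
    rw [norm_mul, norm_mul, Complex.norm_I, one_mul, Complex.norm_real, pair_dir, Real.norm_eq_abs]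
    gcongr
    linarith [abs_le_freqSize ξ j]

lemma exists_lipschitz (h : Admissible s C₀ T f μ u₀ N m ε q u) (R : ℝ) : ∃ L : ℝ, 0 ≤ L ∧
    ∀ j a b, |a| ≤ R → |b| ≤ R → |f j a - f j b| ≤ L * |a - b| := by
  have h1 : ContinuousOn (fun r => ∑ j, |deriv (f j) r|) (Set.Icc (-R) R) :=
    continuousOn_finsetSum _ fun j _ =>
      ((h.smooth_one j).continuous_deriv le_rfl).abs.continuousOn
  obtain ⟨L, hL⟩ := isCompact_Icc.exists_bound_of_continuousOn h1
  refine ⟨|L|, abs_nonneg L, fun j a b ha hb => ?_⟩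
  refine (convex_Icc (-R) R).norm_image_sub_le_of_norm_deriv_le
    (fun r _ => (h.smooth_one j).differentiable one_ne_zero r) (fun r hr => ?_)
    (abs_le.1 hb) (abs_le.1 ha)
  refine le_trans ?_ ((le_abs_self _).trans ((hL r hr).trans (le_abs_self L)))
  exact Finset.single_le_sum (f := fun j => |deriv (f j) r|) (fun j _ => abs_nonneg _)
    (Finset.mem_univ j)

/-- Lévy and Laplace operators commute with translations, so w = u(·+y) - u satisfies the difference
of two equations, and each approximate modulus is dissipated up to the flux term and the two errors.
The error is counted at x + y and at x, whence 2K. -/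
lemma integral_abs_translate_sub_le (h : Admissible s C₀ T f μ u₀ N m ε q u) {K : ℝ} (hK : 0 ≤ K)
    (herr : ∀ t ∈ Set.Ioo 0 T, ∫ x, |err f N m ε q u t x| ∂(cellVol d) ≤ K) (y : E d) :
    ∀ t ∈ Set.Icc 0 T, ∫ x, |u t (x + y) - u t x| ∂(cellVol d) ≤
      ∫ x, |u 0 (x + y) - u 0 x| ∂(cellVol d) + 2 * K * T := by
  intro t₀ ht₀
  have h0 : (0 : ℝ) ∈ Set.Icc 0 T := ⟨le_rfl, ht₀.1.trans ht₀.2⟩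
  obtain ⟨R, hR0, hR⟩ := h.exists_bound
  obtain ⟨L, hL0, hL⟩ := h.exists_lipschitz R
  have hε := h.eps_pos
  set w : ℝ → E d → ℝ := fun t x => u t (x + y) - u t x with hw
  set c : ℝ → (Fin d → ℤ) → ℂ := fun t ξ => coeff (u t) ξ * expo ξ y - coeff (u t) ξ with hc
  have hwc : ∀ t ∈ Set.Icc 0 T, ∀ x, (w t x : ℂ) = trig (freqs d N) (c t) x := by
    intro t ht x
    rw [hw, hc, Complex.ofReal_sub, h.sol.eq_trig ht, h.sol.eq_trig ht, trig_add_right, trig_sub]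
  have hwb : ∀ t ∈ Set.Icc 0 T, ∀ x, |w t x| ≤ 2 * R := fun t ht x => by
    have h1 := (hR t ht (x + y)).1
    have h2 := (hR t ht x).1
    refine (abs_sub _ _).trans ?_
    linarith
  have hcc : ∀ ξ ∈ freqs d N, ContinuousOn (fun t => c t ξ) (Set.Icc 0 T) := fun ξ hξ =>
    ((h.sol.continuousOn_coeff hξ).mul continuousOn_const).sub (h.sol.continuousOn_coeff hξ)
  set δ : ℝ → E d → ℝ := fun t x => dt f μ N m ε (fun j k p => q j k p t) (u t) (x + y) -
    dt f μ N m ε (fun j k p => q j k p t) (u t) x with hδ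
  have hwi : ∀ t ∈ Set.Icc 0 T, Continuous (w t) := fun t ht =>
    (contDiff_of_eq_trig (hwc t ht) (n := 0)).continuous
  set M : ℝ := Real.log (1 + 2 * (2 * R)) with hM
  have hM0 : 0 ≤ M := Real.log_nonneg (by linarith)
  have key : ∀ n : ℝ, 0 < n → ∫ x, |w t₀ x| ∂(cellVol d) - n⁻¹ * (2 * Real.pi) ^ d ≤
      (1 + n⁻¹ * M) * ∫ x, |w 0 x| ∂(cellVol d) +
        (d * (n⁻¹ * (2 * R) * L * (2 * Real.pi) ^ d) + (1 + n⁻¹ * M) * (2 * K)) * t₀ := by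
    intro n hn
    have H := entropy_absApprox hn
    have hn' : 0 < n⁻¹ := inv_pos.2 hn
    set b : ℝ := d * (n⁻¹ * (2 * R) * L * (2 * Real.pi) ^ d) + (1 + n⁻¹ * M) * (2 * K) with hb
    have hb0 : 0 ≤ b := by positivity
    have h1 := gronwall_le (g := fun t => ∫ x, absApprox n (w t x) ∂(cellVol d)) (T := T) (a := 0)
      (b := b) (g' := fun t => ∫ x, n⁻¹ * Real.arsinh (Real.exp n * w t x) * δ t x ∂(cellVol d))
      hb0 le_rfl (continuousOn_integral_comp H.continuous hwc hcc) (fun t ht => ?_)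
      (fun t ht => ?_) t₀ ht₀
    · simp only [zero_mul, Real.exp_zero, one_mul] at h1
      have h2 : ∫ x, |w t₀ x| ∂(cellVol d) - n⁻¹ * (2 * Real.pi) ^ d ≤
          ∫ x, absApprox n (w t₀ x) ∂(cellVol d) := by
        rw [← integral_const_cellVol, ← integral_sub (integrable_cellVol (hwi t₀ ht₀).abs)
          (integrable_const _)]
        exact integral_mono ((integrable_cellVol (hwi t₀ ht₀).abs).sub (integrable_const _))
          (integrable_cellVol (H.continuous.comp (hwi t₀ ht₀))) fun x => le_absApprox hn _
      have h3 : ∫ x, absApprox n (w 0 x) ∂(cellVol d) ≤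
          (1 + n⁻¹ * M) * ∫ x, |w 0 x| ∂(cellVol d) := by
        rw [← integral_const_mul]
        refine integral_mono (integrable_cellVol (H.continuous.comp (hwi 0 h0)))
          ((integrable_cellVol (hwi 0 h0).abs).const_mul _) fun x => ?_
        change absApprox n (w 0 x) ≤ (1 + n⁻¹ * M) * |w 0 x|
        rw [mul_comm]
        exact absApprox_le hn (hwb 0 h0 x)
      linarith
    · have ht' : t ∈ Set.Icc 0 T := ⟨ht.1.le, ht.2.le⟩
      refine hasDerivAt_integral_comp (S := freqs d N) (c := c) (c' := fun ξ =>
        rhs f μ m ε (fun j k p => q j k p t) (u t) ξ * expo ξ y -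
          rhs f μ m ε (fun j k p => q j k p t) (u t) ξ) H.deriv₁ H.continuous' ?_ ?_ ?_
      · filter_upwards [Ioo_mem_nhds ht.1 ht.2] with τ hτ
        exact hwc τ ⟨hτ.1.le, hτ.2.le⟩
      · intro ξ hξ
        have h2 := h.sol.hasDerivAt_coeff h.levy ht hξ
        exact (h2.mul_const _).sub h2
      · intro x
        rw [hδ, Complex.ofReal_sub, h.sol.dt_eq_trig h.levy ht, h.sol.dt_eq_trig h.levy ht,
          trig_add_right, trig_sub]
    · have ht' : t ∈ Set.Icc 0 T := ⟨ht.1.le, ht.2.le⟩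
      rw [zero_mul, zero_add]
      set F : Fin d → E d → ℝ := fun j x => f j (u t (x + y)) - f j (u t x) with hF
      have hfu : ∀ j, ContDiff ℝ 1 fun x => f j (u t x) := fun j =>
        (h.smooth_one j).comp (h.contDiff ht')
      have hfuy : ∀ j, ContDiff ℝ 1 fun x => f j (u t (x + y)) := fun j =>
        (hfu j).comp (contDiff_id.add contDiff_const)
      have hFc : ∀ j, ContDiff ℝ 1 (F j) := fun j => (hfuy j).sub (hfu j)
      have hFp : ∀ j, Per (F j) := fun j => by
        intro i x
        have h2 : f j (u t (x + (2 * Real.pi) • dir i)) = f j (u t x) :=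
          ((h.per ht').comp (f j)) i x
        have h3 : f j (u t (x + (2 * Real.pi) • dir i + y)) = f j (u t (x + y)) :=
          (((h.per ht').comp (f j)).add_right y) i x
        simp only [hF]
        rw [h3, h2]
      have hFd : ∀ j x, fderiv ℝ (F j) x (dir j) = fderiv ℝ (fun x => f j (u t x)) (x + y) (dir j) -
          fderiv ℝ (fun x => f j (u t x)) x (dir j) := by
        intro j x
        have h2 := fderiv_fun_sub ((hfuy j).differentiable one_ne_zero x)
          ((hfu j).differentiable one_ne_zero x)
        have h3 : fderiv ℝ (fun x => f j (u t (x + y))) x =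
          fderiv ℝ (fun x => f j (u t x)) (x + y) :=
          fderiv_comp_add_right (f := fun x => f j (u t x)) y
        rw [hF, h2, h3]
        rfl
      have htw := hwc t ht'
      have htu := h.sol.eq_trig ht'
      have hlap : ∀ x, lap (w t) x = lap (u t) (x + y) - lap (u t) x := by
        intro x
        have : ((lap (w t) x : ℝ) : ℂ) = ((lap (u t) (x + y) - lap (u t) x : ℝ) : ℂ) := by
          rw [Complex.ofReal_sub, lap_of_eq_trig htw, lap_of_eq_trig htu, lap_of_eq_trig htu,
            trig_add_right, trig_sub]
          exact trig_congr (fun ξ _ => by rw [hc]; ring) x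
        exact_mod_cast this
      have hlev : ∀ x, SVV.levy μ (w t) x = SVV.levy μ (u t) (x + y) - SVV.levy μ (u t) x := by
        intro x
        have : ((SVV.levy μ (w t) x : ℝ) : ℂ) =
            ((SVV.levy μ (u t) (x + y) - SVV.levy μ (u t) x : ℝ) : ℂ) := by
          rw [Complex.ofReal_sub, levy_of_eq_trig h.levy htw, levy_of_eq_trig h.levy htu,
            levy_of_eq_trig h.levy htu, trig_add_right, trig_sub]
          exact trig_congr (fun ξ _ => by rw [hc]; ring) x
        exact_mod_cast this
      set g : ℝ → ℝ := fun r => n⁻¹ * Real.arsinh (Real.exp n * r) with hg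
      have hgw : Continuous fun x => g (w t x) := H.continuous'.comp (hwi t ht')
      have hgb : ∀ x, |g (w t x)| ≤ 1 + n⁻¹ * M := by
        intro x
        rw [hg, abs_mul, abs_of_pos hn']
        have h2 := abs_arsinh_exp_mul_le hn.le (hwb t ht' x)
        calc _ ≤ n⁻¹ * (n + M) := by gcongr
          _ = _ := by field_simp
      have hec := h.continuous_err ht'
      have hecy : Continuous fun x => err f N m ε q u t (x + y) := by fun_prop
      have hδx : ∀ x, g (w t x) * δ t x = -(∑ j, g (w t x) * fderiv ℝ (F j) x (dir j)) +
          g (w t x) * SVV.levy μ (w t) x + ε * (g (w t x) * lap (w t) x) +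
          g (w t x) * (err f N m ε q u t (x + y) - err f N m ε q u t x) := by
        intro x
        simp only [hδ, dt_eq h.levy htu, hlap, hlev, hFd, err, ← Finset.mul_sum,
          Finset.sum_sub_distrib]
        ring
      have clap : Continuous fun x => lap (w t) x := by
        have : (fun x => lap (w t) x) = fun x => (trig (freqs d N)
            (fun ξ => -((∑ j, (ξ j : ℝ) ^ 2 : ℝ) : ℂ) * c t ξ) x).re :=
          funext fun x => by rw [← lap_of_eq_trig htw, Complex.ofReal_re]
        rw [this]
        exact Complex.continuous_re.comp (continuous_trig _ _)
      have clev : Continuous fun x => SVV.levy μ (w t) x := by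
        have : (fun x => SVV.levy μ (w t) x) = fun x => (trig (freqs d N)
            (fun ξ => levySymbol μ ξ * c t ξ) x).re :=
          funext fun x => by rw [← levy_of_eq_trig h.levy htw, Complex.ofReal_re]
        rw [this]
        exact Complex.continuous_re.comp (continuous_trig _ _)
      have i1 : ∀ j ∈ (Finset.univ : Finset (Fin d)), Integrable
          (fun x => g (w t x) * fderiv ℝ (F j) x (dir j)) (cellVol d) := fun j _ =>
        integrable_cellVol (hgw.mul (((hFc j).continuous_fderiv one_ne_zero).clm_apply
          continuous_const))
      have j1 : Integrable (fun x => -(∑ j, g (w t x) * fderiv ℝ (F j) x (dir j))) (cellVol d) :=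
        (integrable_finsetSum _ i1).neg
      have i2 : Integrable (fun x => g (w t x) * SVV.levy μ (w t) x) (cellVol d) :=
        integrable_cellVol (hgw.mul clev)
      have i3 : Integrable (fun x => ε * (g (w t x) * lap (w t) x)) (cellVol d) :=
        (integrable_cellVol (hgw.mul clap)).const_mul ε
      have i4 : Integrable (fun x => g (w t x) * (err f N m ε q u t (x + y) -
        err f N m ε q u t x)) (cellVol d) := integrable_cellVol (hgw.mul (hecy.sub hec))
      have j2 : Integrable (fun x => -(∑ j, g (w t x) * fderiv ℝ (F j) x (dir j)) +
        g (w t x) * SVV.levy μ (w t) x) (cellVol d) := j1.add i2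
      have j3 : Integrable (fun x => -(∑ j, g (w t x) * fderiv ℝ (F j) x (dir j)) +
        g (w t x) * SVV.levy μ (w t) x + ε * (g (w t x) * lap (w t) x)) (cellVol d) := j2.add i3
      change ∫ x, g (w t x) * δ t x ∂(cellVol d) ≤ b
      simp only [hδx]
      rw [integral_add j3 i4, integral_add j2 i3, integral_add j1 i2, integral_neg,
        integral_finsetSum _ i1, integral_const_mul, ← Finset.sum_neg_distrib]
      have a1 : ∑ j, -∫ x, g (w t x) * fderiv ℝ (F j) x (dir j) ∂(cellVol d) ≤
          ∑ _j : Fin d, n⁻¹ * (2 * R) * L * (2 * Real.pi) ^ d := by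
        refine Finset.sum_le_sum fun j _ => ?_
        refine integral_abs_mul_fderiv_le (per_of_eq_trig htw) (contDiff_of_eq_trig htw) (hFp j)
          (hFc j) H (dir j) (abs_mul_absApprox_deriv₂_le hn) (fun x => ?_) (fun x => ?_) hL0
        · have b1 := (h.contDiff ht' (n := 1)).differentiable one_ne_zero
          have b2 : fderiv ℝ (fun x => u t (x + y)) x = fderiv ℝ (u t) (x + y) :=
            fderiv_comp_add_right y
          have b3 := fderiv_fun_sub (f := fun x => u t (x + y)) (g := u t)
            (((h.contDiff ht' (n := 1)).comp
            (contDiff_id.add contDiff_const)).differentiable one_ne_zero x) (b1 x)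
          change |fderiv ℝ (fun x => u t (x + y) - u t x) x (dir j)| ≤ _
          rw [b3, b2]
          change |fderiv ℝ (u t) (x + y) (dir j) - fderiv ℝ (u t) x (dir j)| ≤ _
          refine (abs_sub _ _).trans ?_
          linarith [(hR t ht' (x + y)).2 j, (hR t ht' x).2 j]
        · exact hL j _ _ (hR t ht' _).1 (hR t ht' _).1
      have a2 := H.integral_levy_le h.levy htw
      have a3 := mul_nonpos_of_nonneg_of_nonpos hε.le
        (H.integral_lap_le (per_of_eq_trig htw) (contDiff_of_eq_trig htw))
      have a4 : ∫ x, g (w t x) * (err f N m ε q u t (x + y) - err f N m ε q u t x) ∂(cellVol d) ≤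
          (1 + n⁻¹ * M) * (2 * K) := by
        have b1 : ∫ x, |err f N m ε q u t (x + y)| ∂(cellVol d) ≤ K := by
          have := integral_cellVol_add ((h.per_err ht').comp fun r => |r|) y
          rw [this]
          exact herr t ht
        calc _ ≤ ∫ x, (1 + n⁻¹ * M) * (|err f N m ε q u t (x + y)| + |err f N m ε q u t x|)
              ∂(cellVol d) := by
              refine integral_mono i4 (((integrable_cellVol hecy.abs).add
                (integrable_cellVol hec.abs)).const_mul _) fun x => ?_
              refine (le_abs_self _).trans ?_
              rw [abs_mul]
              have := hgb x
              gcongr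
              exact abs_sub _ _
          _ = (1 + n⁻¹ * M) * (∫ x, |err f N m ε q u t (x + y)| ∂(cellVol d) +
              ∫ x, |err f N m ε q u t x| ∂(cellVol d)) := by
              rw [integral_const_mul, integral_add (integrable_cellVol hecy.abs)
                (integrable_cellVol hec.abs)]
          _ ≤ _ := by
              have := herr t ht
              gcongr
              linarith
      rw [Finset.sum_const, Finset.card_univ, Fintype.card_fin, nsmul_eq_mul] at a1
      rw [hb]
      linarith
  -- Let n → ∞ with the solution fixed: all terms containing R, L or M vanish.
  have hlim : Tendsto (fun n : ℝ => n⁻¹) atTop (𝓝 0) := tendsto_inv_atTop_zero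
  have l1 : Tendsto (fun n : ℝ => ∫ x, |w t₀ x| ∂(cellVol d) - n⁻¹ * (2 * Real.pi) ^ d) atTop
      (𝓝 (∫ x, |w t₀ x| ∂(cellVol d) - 0 * (2 * Real.pi) ^ d)) :=
    tendsto_const_nhds.sub (hlim.mul_const _)
  have l2 : Tendsto (fun n : ℝ => (1 + n⁻¹ * M) * ∫ x, |w 0 x| ∂(cellVol d) +
        (d * (n⁻¹ * (2 * R) * L * (2 * Real.pi) ^ d) + (1 + n⁻¹ * M) * (2 * K)) * t₀) atTop
      (𝓝 ((1 + 0 * M) * ∫ x, |w 0 x| ∂(cellVol d) +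
        (d * (0 * (2 * R) * L * (2 * Real.pi) ^ d) + (1 + 0 * M) * (2 * K)) * t₀)) := by
    have e1 : Tendsto (fun n : ℝ => 1 + n⁻¹ * M) atTop (𝓝 (1 + 0 * M)) :=
      tendsto_const_nhds.add (hlim.mul_const _)
    exact (e1.mul_const _).add (((((((hlim.mul_const _).mul_const _).mul_const _)).const_mul _).add
      (e1.mul_const _)).mul_const _)
  have h1 := le_of_tendsto_of_tendsto l1 l2 ((eventually_gt_atTop 0).mono key)
  simp only [zero_mul, sub_zero, add_zero, one_mul, mul_zero, zero_add] at h1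
  have h2 : 2 * K * t₀ ≤ 2 * K * T := by
    have := ht₀.2
    gcongr
  linarith

end Admissible

end SVV

end

noncomputable section
namespace SVV

variable {d : ℕ}

/-! ### Uniform estimates -/

lemma pow_le_one_add_pow {a : ℝ} (ha : 0 ≤ a) {i n : ℕ} (h : i ≤ n) : a ^ i ≤ 1 + a ^ n := by
  rcases le_total a 1 with h1 | h1
  · have := pow_le_one₀ (n := i) ha h1
    have : 0 ≤ a ^ n := by positivity
    linarith
  · have := pow_le_pow_right₀ h1 h
    linarith

lemma one_le_two_pi_pow (d : ℕ) : (1 : ℝ) ≤ (2 * Real.pi) ^ d :=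
  one_le_pow₀ (by linarith [Real.pi_gt_three])

lemma sq_add_sq_le_sq {V K a b D W : ℝ} (hV : 1 ≤ V) (hK : 0 ≤ K) (ha : 0 ≤ a) (hb : 0 ≤ b)
    (hD : 0 ≤ D) (hW : V ≤ W) : 2 * ((K * a) ^ 2 * V) + 2 * ((D * b) ^ 2 * W) ≤
      ((1 + 2 * V * K + 2 * D * W) * (a + b)) ^ 2 := by
  have hW0 : 0 ≤ W := by linarith
  have hV0 : 0 ≤ V := by linarith
  have hV' : V ≤ V ^ 2 := by nlinarith
  have hW' : W ≤ W ^ 2 := by nlinarith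
  have e1 : 2 * ((K * a) ^ 2 * V) ≤ (2 * V * K * a) ^ 2 := by
    have : (K * a) ^ 2 * V ≤ (K * a) ^ 2 * V ^ 2 := by gcongr
    have : 0 ≤ (K * a) ^ 2 * V ^ 2 := by positivity
    linarith [show (2 * V * K * a) ^ 2 = 4 * ((K * a) ^ 2 * V ^ 2) by ring]
  have e2 : 2 * ((D * b) ^ 2 * W) ≤ (2 * D * W * b) ^ 2 := by
    have : (D * b) ^ 2 * W ≤ (D * b) ^ 2 * W ^ 2 := by gcongr
    have : 0 ≤ (D * b) ^ 2 * W ^ 2 := by positivity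
    linarith [show (2 * D * W * b) ^ 2 = 4 * ((D * b) ^ 2 * W ^ 2) by ring]
  have p1 : 0 ≤ 2 * V * K * a := by positivity
  have p2 : 0 ≤ 2 * D * W * b := by positivity
  have p3 : 0 ≤ 2 * V * K * b := by positivity
  have p4 : 0 ≤ 2 * D * W * a := by positivity
  have e3 : (2 * V * K * a + 2 * D * W * b) ^ 2 ≤ ((1 + 2 * V * K + 2 * D * W) * (a + b)) ^ 2 := by
    refine pow_le_pow_left₀ (by positivity) ?_ 2
    linarith [show (1 + 2 * V * K + 2 * D * W) * (a + b) = a + b + 2 * V * K * a + 2 * V * K * b +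
      2 * D * W * a + 2 * D * W * b by ring]
  have e4 : 0 ≤ (2 * V * K * a) * (2 * D * W * b) := by positivity
  linarith [show (2 * V * K * a + 2 * D * W * b) ^ 2 = (2 * V * K * a) ^ 2 + (2 * D * W * b) ^ 2 +
    2 * ((2 * V * K * a) * (2 * D * W * b)) by ring]

/-- Bounds that hold for admissible solutions with large `N`: a moment bound, and an `L²` bound for
the error. -/
structure Controlled (s : ℕ) (B E₁ T : ℝ) (f : Fin d → ℝ → ℝ) (N m : ℕ) (ε : ℝ)
    (q : Fin d → Fin d → ℕ → ℝ → ℝ) (u : ℝ → E d → ℝ) : Prop where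
  moment : ∀ t ∈ Set.Icc 0 T, ∀ i ≤ 4 + s, ∫ x, |u t x| ^ i ∂(cellVol d) ≤ B
  pos : 0 < E₁
  err_sq : ∀ t ∈ Set.Ioo 0 T, ∫ x, Admissible.err f N m ε q u t x ^ 2 ∂(cellVol d) ≤ E₁ ^ 2

/-- The bootstrapped moment dominates all lower ones. Up to order 4 they serve interpolation and the
cubic entropy, up to order s the growth of the flux. The term N⁻¹ also keeps the error bound
positive. -/
lemma exists_controlled (d s : ℕ) (hd : 1 ≤ d) (hs : 2 ≤ s) (C₀ T : ℝ) :
    ∃ (B C : ℝ) (N₀ : ℕ), 0 ≤ B ∧ 0 < C ∧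
    ∀ {f : Fin d → ℝ → ℝ} {μ : Measure (E d)} {u₀ : E d → ℝ} {N m : ℕ} {ε : ℝ}
      {q : Fin d → Fin d → ℕ → ℝ → ℝ} {u : ℝ → E d → ℝ}, Admissible s C₀ T f μ u₀ N m ε q u →
    N₀ ≤ N → Controlled s B (C * ((N : ℝ)⁻¹ + ε * (m : ℝ) ^ 2)) T f N m ε q u := by
  obtain ⟨B, K, N₀, hB, hK, h0⟩ := exists_integral_pow_le d s hd (by omega) C₀ T
  set k := d * (2 * s ^ 2 + 2 * s + 1) with hk
  have hk4 : 4 + s ≤ 2 * k := by nlinarith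
  have hV := one_le_two_pi_pow d
  set V : ℝ := (2 * Real.pi) ^ d with hVdef
  refine ⟨V + B, 1 + 2 * V * K + 2 * (d ^ 2 * (|C₀| + 1)) * (V + B), N₀, by positivity,
    by positivity, ?_⟩
  intro f μ u₀ N m ε q u h hN
  obtain ⟨h1, h2⟩ := h0 h hN
  have hN0 : (0 : ℝ) < N := by exact_mod_cast h.one_le_N
  have hC₀ : 0 ≤ C₀ := zero_le_one.trans h.one_le
  have hε := h.eps_pos
  rw [abs_of_nonneg hC₀]
  have hmom : ∀ t ∈ Set.Icc 0 T, ∀ i ≤ 4 + s, ∫ x, |u t x| ^ i ∂(cellVol d) ≤ V + B := by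
    intro t ht i hi
    have hc := (h.contDiff ht (n := 0)).continuous
    have i1 : Integrable (fun x => u t x ^ (2 * k)) (cellVol d) := integrable_cellVol (hc.pow _)
    calc _ ≤ ∫ x, (1 + u t x ^ (2 * k)) ∂(cellVol d) := by
          refine integral_mono (integrable_cellVol (hc.abs.pow _))
            ((integrable_const _).add i1) fun x => ?_
          have := pow_le_one_add_pow (abs_nonneg (u t x)) (hi.trans hk4)
          rwa [pow_mul |u t x|, sq_abs, ← pow_mul] at this
      _ = V + ∫ x, u t x ^ (2 * k) ∂(cellVol d) := by
          rw [integral_add (integrable_const _) i1, integral_one_cellVol]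
      _ ≤ _ := by linarith [h1 t ht]
  refine ⟨hmom, by positivity, fun t ht => ?_⟩
  have ht' : t ∈ Set.Icc 0 T := ⟨ht.1.le, ht.2.le⟩
  have c1 := continuous_projErr h.smooth_one N (h.contDiff ht' (n := 1))
  have c2 := continuous_viscErr N m ε (fun j k p => q j k p t) (u t)
  have i1 : Integrable (fun x => projErr f N (u t) x ^ 2) (cellVol d) := integrable_cellVol (c1.pow 2)
  have i2 : Integrable (fun x => viscErr N m ε (fun j k p => q j k p t) (u t) x ^ 2) (cellVol d) :=
    integrable_cellVol (c2.pow 2)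
  have h3 : ∫ x, projErr f N (u t) x ^ 2 ∂(cellVol d) ≤ (K / N) ^ 2 * V := by
    rw [← integral_const_cellVol]
    refine integral_mono i1 (integrable_const _) fun x => ?_
    change projErr f N (u t) x ^ 2 ≤ _
    rw [← sq_abs]
    exact pow_le_pow_left₀ (abs_nonneg _) (h2 t ht x) 2
  have h4 := integral_viscErr_sq_le h ht'
  have h5 : ∫ x, u t x ^ 2 ∂(cellVol d) ≤ V + B := by
    have := hmom t ht' 2 (by omega)
    simpa only [sq_abs] using this
  have h6 : ∫ x, Admissible.err f N m ε q u t x ^ 2 ∂(cellVol d) ≤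
      2 * ((K / N) ^ 2 * V) + 2 * ((d ^ 2 * (C₀ + 1) * (ε * (m : ℝ) ^ 2)) ^ 2 * (V + B)) := by
    calc _ ≤ ∫ x, (2 * projErr f N (u t) x ^ 2 +
          2 * viscErr N m ε (fun j k p => q j k p t) (u t) x ^ 2) ∂(cellVol d) := by
          refine integral_mono (integrable_cellVol ((h.continuous_err ht').pow 2))
            ((i1.const_mul 2).add (i2.const_mul 2)) fun x => ?_
          change (projErr f N (u t) x + viscErr N m ε _ (u t) x) ^ 2 ≤ _
          nlinarith [sq_nonneg (projErr f N (u t) x - viscErr N m ε (fun j k p => q j k p t) (u t) x)]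
      _ = 2 * ∫ x, projErr f N (u t) x ^ 2 ∂(cellVol d) +
          2 * ∫ x, viscErr N m ε (fun j k p => q j k p t) (u t) x ^ 2 ∂(cellVol d) := by
          rw [integral_add (i1.const_mul 2) (i2.const_mul 2), integral_const_mul, integral_const_mul]
      _ ≤ _ := by
          have : (d ^ 2 * (C₀ + 1) * (ε * (m : ℝ) ^ 2)) ^ 2 * ∫ x, u t x ^ 2 ∂(cellVol d) ≤
            (d ^ 2 * (C₀ + 1) * (ε * (m : ℝ) ^ 2)) ^ 2 * (V + B) := by gcongr
          linarith
  rw [div_eq_mul_inv] at h6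
  exact h6.trans (sq_add_sq_le_sq hV hK (by positivity) (by positivity) (by positivity)
    (by linarith))

namespace Controlled

variable {s : ℕ} {B E₁ C₀ T : ℝ} {f : Fin d → ℝ → ℝ} {μ : Measure (E d)} {u₀ : E d → ℝ}
    {N m : ℕ} {ε : ℝ} {q : Fin d → Fin d → ℕ → ℝ → ℝ} {u : ℝ → E d → ℝ}

/-- g|e| ≤ E₁ g² + E₁⁻¹ e²: weighting by the size of the error keeps the result linear in E₁. -/
lemma integral_mul_abs_err_le (hc : Controlled s B E₁ T f N m ε q u)
    (h : Admissible s C₀ T f μ u₀ N m ε q u) {t : ℝ} (ht : t ∈ Set.Ioo 0 T) {g : E d → ℝ}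
    (hg : Continuous g) {K : ℝ} (hK : ∫ x, g x ^ 2 ∂(cellVol d) ≤ K) :
    ∫ x, g x * |Admissible.err f N m ε q u t x| ∂(cellVol d) ≤ (K + 1) * E₁ := by
  have hE := hc.pos
  have c1 := h.continuous_err ⟨ht.1.le, ht.2.le⟩
  have i1 : Integrable (fun x => g x ^ 2) (cellVol d) := integrable_cellVol (hg.pow 2)
  have i2 : Integrable (fun x => Admissible.err f N m ε q u t x ^ 2) (cellVol d) :=
    integrable_cellVol (c1.pow 2)
  have h1 := hc.err_sq t ht
  have h0 : 0 ≤ ∫ x, g x ^ 2 ∂(cellVol d) := integral_nonneg fun x => by positivity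
  calc _ ≤ ∫ x, (E₁ * g x ^ 2 + E₁⁻¹ * Admissible.err f N m ε q u t x ^ 2) ∂(cellVol d) := by
        refine integral_mono (integrable_cellVol (hg.mul c1.abs))
          ((i1.const_mul _).add (i2.const_mul _)) fun x => ?_
        set e := Admissible.err f N m ε q u t x
        have h2 : E₁⁻¹ * (E₁ * g x - |e|) ^ 2 = E₁ * g x ^ 2 + E₁⁻¹ * |e| ^ 2 - 2 * (g x * |e|) := by
          field_simp; ring
        have h3 : 0 ≤ E₁⁻¹ * (E₁ * g x - |e|) ^ 2 := by positivity
        have h4 : 0 ≤ E₁ * g x ^ 2 + E₁⁻¹ * |e| ^ 2 := by positivity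
        rw [h2] at h3
        rw [sq_abs] at h3 h4
        change g x * |e| ≤ E₁ * g x ^ 2 + E₁⁻¹ * e ^ 2
        linarith
    _ = E₁ * ∫ x, g x ^ 2 ∂(cellVol d) +
        E₁⁻¹ * ∫ x, Admissible.err f N m ε q u t x ^ 2 ∂(cellVol d) := by
        rw [integral_add (i1.const_mul _) (i2.const_mul _), integral_const_mul, integral_const_mul]
    _ ≤ E₁ * K + E₁⁻¹ * E₁ ^ 2 := by gcongr
    _ = _ := by field_simp

lemma integral_abs_translate_sub_le (hc : Controlled s B E₁ T f N m ε q u)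
    (h : Admissible s C₀ T f μ u₀ N m ε q u) (y : E d) {t : ℝ} (ht : t ∈ Set.Icc 0 T) :
    ∫ x, |u t (x + y) - u t x| ∂(cellVol d) ≤
      ∫ x, |u 0 (x + y) - u 0 x| ∂(cellVol d) + 2 * (((2 * Real.pi) ^ d + 1) * E₁) * T := by
  have hE := hc.pos
  refine h.integral_abs_translate_sub_le (by positivity) (fun τ hτ => ?_) y t ht
  have h1 := hc.integral_mul_abs_err_le h hτ (g := fun _ => 1) continuous_const
    (K := (2 * Real.pi) ^ d) (by simp only [one_pow]; exact integral_one_cellVol.le)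
  simpa using h1

end Controlled

/-! ### Almost maximum principle -/

/-- The cube of the positive part of `σ v - M`. -/
def cubePos (σ M v : ℝ) : ℝ := ((σ * v - M) ^ 3 + |σ * v - M| ^ (3 : ℝ)) / 2

lemma cubePos_eq (σ M v : ℝ) : cubePos σ M v = max (σ * v - M) 0 ^ 3 := by
  have h : |σ * v - M| ^ (3 : ℝ) = |σ * v - M| ^ 3 := by
    rw [← Real.rpow_natCast]; norm_num
  rw [cubePos, h]
  rcases le_total (σ * v - M) 0 with h1 | h1
  · rw [max_eq_right h1, abs_of_nonpos h1]; ring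
  · rw [max_eq_left h1, abs_of_nonneg h1]; ring

/-- The cube is the lowest integer power of a positive part with continuous second derivative, as an
entropy needs. -/
lemma entropy_cubePos (σ M : ℝ) : Entropy (cubePos σ M)
    (fun v => σ * (3 * (σ * v - M) ^ 2 + 3 * (|σ * v - M| ^ (1 : ℝ) * (σ * v - M))) / 2)
    (fun v => σ ^ 2 * (3 * (σ * v - M + |σ * v - M|))) where
  deriv₁ v := by
    have h1 : HasDerivAt (fun v : ℝ => σ * v - M) σ v := by
      simpa using ((hasDerivAt_id v).const_mul σ).sub_const M
    have h2 : HasDerivAt (fun r : ℝ => r ^ 3 + |r| ^ (3 : ℝ))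
        (3 * (σ * v - M) ^ 2 + 3 * |σ * v - M| ^ ((3 : ℝ) - 2) * (σ * v - M)) (σ * v - M) := by
      have := (hasDerivAt_pow 3 (σ * v - M)).add
        (hasDerivAt_abs_rpow (σ * v - M) (p := 3) (by norm_num))
      simpa using! this
    refine ((h2.comp v h1).div_const 2).congr_deriv ?_
    norm_num
    ring
  deriv₂ v := by
    have h1 : HasDerivAt (fun v : ℝ => σ * v - M) σ v := by
      simpa using ((hasDerivAt_id v).const_mul σ).sub_const M
    have h2 : HasDerivAt (fun r : ℝ => 3 * r ^ 2 + 3 * (|r| ^ (1 : ℝ) * r))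
        (3 * (2 * (σ * v - M)) + 3 * ((1 + 1) * |σ * v - M| ^ (1 : ℝ))) (σ * v - M) := by
      have := ((hasDerivAt_pow 2 (σ * v - M)).const_mul 3).add
        ((hasDerivAt_abs_rpow_mul_self one_pos (σ * v - M)).const_mul 3)
      simpa using! this
    refine (((h2.comp v h1).const_mul σ).div_const 2).congr_deriv ?_
    rw [Real.rpow_one]
    ring
  cont := by fun_prop
  nonneg v := by
    have := neg_abs_le (σ * v - M)
    have h2 : 0 ≤ σ * v - M + |σ * v - M| := by linarith
    positivity

lemma abs_cubePos_deriv_le {σ M : ℝ} (hσ : |σ| = 1) (hM : 0 ≤ M) (v : ℝ) :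
    |σ * (3 * (σ * v - M) ^ 2 + 3 * (|σ * v - M| ^ (1 : ℝ) * (σ * v - M))) / 2| ≤ 3 * v ^ 2 := by
  rw [Real.rpow_one, abs_div, abs_mul, hσ, one_mul, abs_two, div_le_iff₀ two_pos]
  rcases le_total (σ * v - M) 0 with h1 | h1
  · rw [abs_of_nonpos h1]
    have : 3 * (σ * v - M) ^ 2 + 3 * (-(σ * v - M) * (σ * v - M)) = 0 := by ring
    rw [this, abs_zero]
    positivity
  · rw [abs_of_nonneg h1]
    have h2 : σ * v ≤ |v| := by
      have := le_abs_self (σ * v)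
      rwa [abs_mul, hσ, one_mul] at this
    have h3 : (σ * v - M) ^ 2 ≤ |v| ^ 2 := pow_le_pow_left₀ h1 (by linarith) 2
    rw [sq_abs] at h3
    rw [abs_of_nonneg (by positivity)]
    nlinarith

/-- The functional starts at 0 because the data are bounded by C₀, and it is fed only by ∫ 3u²|err|,
which the fourth moment and the L² error control. -/
lemma Controlled.integral_cubePos_le {s : ℕ} {B E₁ C₀ T : ℝ} {f : Fin d → ℝ → ℝ}
    {μ : Measure (E d)} {u₀ : E d → ℝ} {N m : ℕ} {ε : ℝ} {q : Fin d → Fin d → ℕ → ℝ → ℝ}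
    {u : ℝ → E d → ℝ} (hc : Controlled s B E₁ T f N m ε q u)
    (h : Admissible s C₀ T f μ u₀ N m ε q u) {σ : ℝ} (hσ : |σ| = 1) {t : ℝ}
    (ht : t ∈ Set.Icc 0 T) :
    ∫ x, max (σ * u t x - C₀) 0 ^ 3 ∂(cellVol d) ≤ (9 * B + 1) * E₁ * T := by
  have hC₀ : 0 ≤ C₀ := zero_le_one.trans h.one_le
  have h0 : (0 : ℝ) ∈ Set.Icc 0 T := ⟨le_rfl, ht.1.trans ht.2⟩
  have H := entropy_cubePos σ C₀
  have hE := hc.pos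
  have hB : 0 ≤ B := le_trans (integral_nonneg fun x => by positivity) (hc.moment t ht 0 (by omega))
  have h1 := gronwall_le (g := fun t => ∫ x, cubePos σ C₀ (u t x) ∂(cellVol d)) (T := T) (a := 0)
    (b := (9 * B + 1) * E₁) (by positivity) le_rfl
    (continuousOn_integral_comp H.continuous (fun t ht => h.sol.eq_trig ht)
      fun ξ hξ => h.sol.continuousOn_coeff hξ)
    (fun t ht => h.hasDerivAt_integral H ht) (fun t ht => ?_) t ht
  · have h2 : ∫ x, cubePos σ C₀ (u 0 x) ∂(cellVol d) = 0 := by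
      have : ∀ x, cubePos σ C₀ (u 0 x) = 0 := by
        intro x
        have h3 := le_abs_self (σ * u 0 x)
        rw [abs_mul, hσ, one_mul] at h3
        rw [cubePos_eq, max_eq_right (by linarith [h.sup_init x])]
        norm_num
      simp [this]
    simp only [zero_mul, Real.exp_zero, one_mul, h2, zero_add] at h1
    simp only [cubePos_eq] at h1
    refine h1.trans ?_
    have := ht.2
    gcongr
  · rw [zero_mul, zero_add]
    have ht' : t ∈ Set.Icc 0 T := ⟨ht.1.le, ht.2.le⟩
    have huc := (h.contDiff ht' (n := 0)).continuous
    have hec := h.continuous_err ht'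
    refine (H.integral_dt_le h.smooth_one h.levy h.eps_pos (h.sol.eq_trig ht')).trans ?_
    have c1 : Continuous fun x => 3 * u t x ^ 2 := by fun_prop
    have h2 : ∫ x, (3 * u t x ^ 2) ^ 2 ∂(cellVol d) ≤ 9 * B := by
      have h3 : ∀ x, (3 * u t x ^ 2) ^ 2 = 9 * |u t x| ^ 4 := fun x => by
        rw [mul_pow, ← sq_abs (u t x), ← pow_mul]; norm_num
      simp only [h3]
      rw [integral_const_mul]
      have := hc.moment t ht' 4 (by omega)
      gcongr
    refine le_trans ?_ (hc.integral_mul_abs_err_le h ht c1 h2)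
    refine integral_mono (integrable_cellVol ((H.continuous'.comp huc).mul hec))
      (integrable_cellVol (c1.mul hec.abs)) fun x => ?_
    refine (le_abs_self _).trans ?_
    rw [abs_mul]
    exact mul_le_mul_of_nonneg_right (abs_cubePos_deriv_le hσ hC₀ _) (abs_nonneg _)

end SVV

end

noncomputable section
namespace SVV

variable {d : ℕ}

/-! ### Equicontinuity in time of the Fourier coefficients -/

lemma norm_coeff_le {g : E d → ℝ} (ξ : Fin d → ℤ) : ‖coeff g ξ‖ ≤ ∫ x, |g x| ∂(cellVol d) := by
  rw [coeff_eq, norm_mul]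
  have h1 : ‖(((2 * Real.pi) ^ d : ℂ))⁻¹‖ ≤ 1 := by
    have : ((2 * Real.pi) ^ d : ℂ) = (((2 * Real.pi) ^ d : ℝ) : ℂ) := by push_cast; rfl
    rw [this, norm_inv, Complex.norm_real, Real.norm_eq_abs, abs_of_pos (by positivity)]
    exact inv_le_one_of_one_le₀ (one_le_two_pi_pow d)
  have h2 : ‖∫ x, (g x : ℂ) * expo (-ξ) x ∂(cellVol d)‖ ≤ ∫ x, |g x| ∂(cellVol d) := by
    refine (norm_integral_le_integral_norm _).trans (le_of_eq ?_)
    simp only [norm_mul, norm_expo, mul_one, Complex.norm_real, Real.norm_eq_abs]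
  calc _ ≤ 1 * ∫ x, |g x| ∂(cellVol d) := by gcongr
    _ = _ := one_mul _

/-- At a fixed frequency every term of the coefficient equation is bounded independently of N, the
flux through the moment of order s. The bound on the open interval extends by continuity, and
frequencies outside the cube have zero coefficient. -/
lemma exists_coeff_lipschitz (s : ℕ) (C₀ B : ℝ) (μ : Measure (E d)) (ξ : Fin d → ℤ) :
    ∃ Λ : NNReal, ∀ {T E₁ : ℝ} {f : Fin d → ℝ → ℝ} {u₀ : E d → ℝ} {N m : ℕ} {ε : ℝ}
      {q : Fin d → Fin d → ℕ → ℝ → ℝ} {u : ℝ → E d → ℝ},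
      Admissible s C₀ T f μ u₀ N m ε q u → Controlled s B E₁ T f N m ε q u → 0 < T →
      LipschitzOnWith Λ (fun t => coeff (u t) ξ) (Set.Icc 0 T) := by
  set Λ : ℝ := ∑ j, |(ξ j : ℝ)| * (C₀ * (2 ^ s * (B + B))) + ‖levySymbol μ ξ‖ * B +
    (C₀ * ∑ j, (ξ j : ℝ) ^ 2 + d ^ 2 * (C₀ + 1) * C₀) * B with hΛ
  refine ⟨Λ.toNNReal, ?_⟩
  intro T E₁ f u₀ N m ε q u h hc hT
  have hC₀ : 0 ≤ C₀ := zero_le_one.trans h.one_le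
  have hε := h.eps_pos
  have hB : 0 ≤ B := le_trans (integral_nonneg fun x => by positivity)
    (hc.moment 0 ⟨le_rfl, hT.le⟩ 0 (by omega))
  have hΛ0 : 0 ≤ Λ := by positivity
  by_cases hξ : ξ ∈ freqs d N
  · have hbound : ∀ t ∈ Set.Ioo 0 T, ‖rhs f μ m ε (fun j k p => q j k p t) (u t) ξ‖ ≤ Λ := by
      intro t ht
      have ht' : t ∈ Set.Icc 0 T := ⟨ht.1.le, ht.2.le⟩
      have huc := (h.contDiff ht' (n := 0)).continuous
      have hu1 : ‖coeff (u t) ξ‖ ≤ B :=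
        (norm_coeff_le ξ).trans (by simpa using hc.moment t ht' 1 (by omega))
      have hF : ∀ j, ‖coeff (fun y => f j (u t y)) ξ‖ ≤ C₀ * (2 ^ s * (B + B)) := by
        intro j
        have i1 : ∀ i : ℕ, Integrable (fun x => |u t x| ^ i) (cellVol d) := fun i =>
          integrable_cellVol (huc.abs.pow i)
        have hfc : Continuous fun x => f j (u t x) := (h.smooth_one j).continuous.comp huc
        refine (norm_coeff_le ξ).trans ?_
        calc _ ≤ ∫ x, C₀ * (2 ^ s * (|u t x| ^ 0 + |u t x| ^ s)) ∂(cellVol d) := by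
              refine integral_mono (integrable_cellVol hfc.abs)
                ((((i1 0).add (i1 s)).const_mul _).const_mul _) fun x => ?_
              have h1 := h.growth t ht' j 0 (by omega) x
              rw [iteratedDeriv_zero] at h1
              refine h1.trans ?_
              have h2 : (1 + |u t x|) ^ s ≤ 2 ^ s * (|u t x| ^ 0 + |u t x| ^ s) := by
                have h3 := abs_nonneg (u t x)
                rw [pow_zero]
                rcases le_total |u t x| 1 with h4 | h4
                · calc (1 + |u t x|) ^ s ≤ 2 ^ s := by gcongr; linarith
                    _ ≤ _ := le_mul_of_one_le_right (by positivity) (by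
                      have : 0 ≤ |u t x| ^ s := by positivity
                      linarith)
                · calc (1 + |u t x|) ^ s ≤ (2 * |u t x|) ^ s := by gcongr; linarith
                    _ = 2 ^ s * |u t x| ^ s := mul_pow _ _ _
                    _ ≤ _ := by gcongr; linarith
              gcongr
          _ = C₀ * (2 ^ s * (∫ x, |u t x| ^ 0 ∂(cellVol d) + ∫ x, |u t x| ^ s ∂(cellVol d))) := by
              rw [integral_const_mul, integral_const_mul, integral_add (i1 0) (i1 s)]
          _ ≤ _ := by
              have := hc.moment t ht' 0 (by omega)
              have := hc.moment t ht' s (by omega)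
              gcongr
      have hV : |ε * viscSymbol m (fun j k p => q j k p t) ξ| ≤
          C₀ * ∑ j, (ξ j : ℝ) ^ 2 + d ^ 2 * (C₀ + 1) * C₀ := by
        have h1 := abs_sum_sq_sub_viscSymbol_le hC₀ (h.symbol_bound t ht') hξ
        have h2 : 0 ≤ ∑ j, (ξ j : ℝ) ^ 2 := Finset.sum_nonneg fun j _ => by positivity
        have h3 : |viscSymbol m (fun j k p => q j k p t) ξ| ≤
            ∑ j, (ξ j : ℝ) ^ 2 + d ^ 2 * (C₀ + 1) * (m : ℝ) ^ 2 := by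
          rw [abs_le] at h1 ⊢
          constructor <;> linarith [h1.1, h1.2]
        rw [abs_mul, abs_of_pos hε]
        calc _ ≤ ε * (∑ j, (ξ j : ℝ) ^ 2 + d ^ 2 * (C₀ + 1) * (m : ℝ) ^ 2) := by gcongr
          _ = ε * ∑ j, (ξ j : ℝ) ^ 2 + d ^ 2 * (C₀ + 1) * (ε * (m : ℝ) ^ 2) := by ring
          _ ≤ _ := by
            have := h.eps_le
            have := h.visc_le'
            gcongr
      rw [rhs, hΛ]
      refine (norm_sub_le _ _).trans (add_le_add ((norm_add_le _ _).trans (add_le_add ?_ ?_)) ?_)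
      · rw [norm_neg]
        refine (norm_sum_le _ _).trans (Finset.sum_le_sum fun j _ => ?_)
        rw [norm_mul, norm_mul, Complex.norm_I, one_mul, Complex.norm_intCast]
        gcongr
        exact hF j
      · rw [norm_mul]; gcongr
      · rw [norm_mul, Complex.norm_real, Real.norm_eq_abs]
        have : 0 ≤ ∑ j, (ξ j : ℝ) ^ 2 := Finset.sum_nonneg fun j _ => by positivity
        gcongr
    have h1 : LipschitzOnWith Λ.toNNReal (fun t => coeff (u t) ξ) (Set.Ioo 0 T) := by
      refine (convex_Ioo 0 T).lipschitzOnWith_of_nnnorm_hasDerivWithin_le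
        (fun t ht => (h.sol.hasDerivAt_coeff h.levy ht hξ).hasDerivWithinAt) fun t ht => ?_
      rw [← NNReal.coe_le_coe, Real.coe_toNNReal _ hΛ0]
      exact hbound t ht
    rw [← closure_Ioo hT.ne] at *
    refine (lipschitzOnWith_closure_iff ?_).2 h1
    rw [closure_Ioo hT.ne]
    exact h.sol.continuousOn_coeff hξ
  · refine LipschitzOnWith.of_dist_le_mul fun t ht t' ht' => ?_
    have h1 : ∀ r ∈ Set.Icc 0 T, coeff (u r) ξ = 0 := fun r hr => by
      rw [coeff_of_eq_trig (h.sol.eq_trig hr), if_neg hξ]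
    simp only [h1 t ht, h1 t' ht', dist_self]
    positivity

/-! ### High frequencies and translations -/

/-- The integral is 2ρ - 2 sin(aρ)/a, and the oscillating part is at most 2/|a| ≤ ρ. -/
lemma integral_two_sub_two_cos_ge {a ρ : ℝ} (ha : 2 ≤ |a| * ρ) :
    ρ ≤ ∫ τ in (0 : ℝ)..ρ, (2 - 2 * Real.cos (a * τ)) := by
  have ha0 : a ≠ 0 := by rintro rfl; norm_num at ha
  have h1 : ∫ τ in (0 : ℝ)..ρ, (2 - 2 * Real.cos (a * τ)) = 2 * ρ - 2 * (a⁻¹ * Real.sin (a * ρ)) := by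
    rw [intervalIntegral.integral_sub (by simp) (Continuous.intervalIntegrable (by fun_prop) _ _),
      intervalIntegral.integral_const_mul, intervalIntegral.integral_comp_mul_left _ ha0]
    simp
    ring
  rw [h1]
  have h2 : a⁻¹ * Real.sin (a * ρ) ≤ |a|⁻¹ := by
    refine (le_abs_self _).trans ?_
    rw [abs_mul, abs_inv]
    exact mul_le_of_le_one_right (by positivity) (Real.abs_sin_le_one _)
  have h3 : 2 * |a|⁻¹ ≤ ρ := by
    rw [← div_eq_mul_inv, div_le_iff₀ (abs_pos.2 ha0)]; linarith
  linarith

lemma norm_expo_sub_one_sq (ξ : Fin d → ℤ) (y : E d) :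
    ‖expo ξ y - 1‖ ^ 2 = 2 - 2 * Real.cos (pair ξ y) := by
  have h1 : (expo ξ y).re = Real.cos (pair ξ y) := by
    rw [expo, mul_comm, Complex.exp_ofReal_mul_I_re]
  have h2 : (expo ξ y).im = Real.sin (pair ξ y) := by
    rw [expo, mul_comm, Complex.exp_ofReal_mul_I_im]
  rw [← Complex.normSq_eq_norm_sq, Complex.normSq_apply, Complex.sub_re, Complex.sub_im, h1, h2]
  simp only [Complex.one_re, Complex.one_im, sub_zero]
  nlinarith [Real.sin_sq_add_cos_sq (pair ξ y)]

/-- By Parseval a translation by τ weights |c_ξ|² with 2 - 2cos(ξ_j τ). Averaged over [0, ρ] this is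
at least 1 for |ξ_j| ρ ≥ 2, so smallness of translations controls high frequencies. -/
lemma sum_high_frequency_le {φ : E d → ℝ} {S : Finset (Fin d → ℤ)} {c : (Fin d → ℤ) → ℂ}
    (h : ∀ x, (φ x : ℂ) = trig S c x) (j : Fin d) {ρ X : ℝ} (hρ : 0 < ρ)
    (hX : ∀ τ ∈ Set.Icc 0 ρ, ∫ x, (φ (x + τ • dir j) - φ x) ^ 2 ∂(cellVol d) ≤ X) :
    ∑ ξ ∈ S.filter (fun ξ => 2 ≤ |(ξ j : ℝ)| * ρ), ‖c ξ‖ ^ 2 ≤ X := by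
  have h1 : ∀ τ ∈ Set.Icc 0 ρ, ∑ ξ ∈ S, ‖c ξ‖ ^ 2 * (2 - 2 * Real.cos (ξ j * τ)) ≤ X := by
    intro τ hτ
    have h2 : ∀ x, ((φ (x + τ • dir j) - φ x : ℝ) : ℂ) =
        trig S (fun ξ => c ξ * expo ξ (τ • dir j) - c ξ) x := by
      intro x
      rw [Complex.ofReal_sub, h, h, trig_add_right, trig_sub]
    have h3 := hX τ hτ
    rw [integral_sq_of_eq_trig h2] at h3
    have h4 : ∀ ξ, ‖c ξ * expo ξ (τ • dir j) - c ξ‖ ^ 2 =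
        ‖c ξ‖ ^ 2 * (2 - 2 * Real.cos (ξ j * τ)) := by
      intro ξ
      rw [show c ξ * expo ξ (τ • dir j) - c ξ = c ξ * (expo ξ (τ • dir j) - 1) by ring, norm_mul,
        mul_pow, norm_expo_sub_one_sq, pair_smul, pair_dir, mul_comm τ]
    simp only [h4] at h3
    refine le_trans (le_mul_of_one_le_left (Finset.sum_nonneg fun ξ _ => ?_)
      (one_le_two_pi_pow d)) h3
    have := Real.cos_le_one (ξ j * τ)
    have : 0 ≤ 2 - 2 * Real.cos (ξ j * τ) := by linarith
    positivity
  have hii : ∀ ξ : Fin d → ℤ, IntervalIntegrable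
      (fun τ : ℝ => ‖c ξ‖ ^ 2 * (2 - 2 * Real.cos (ξ j * τ))) volume 0 ρ := fun ξ =>
    Continuous.intervalIntegrable (by fun_prop) _ _
  have h2 : ∫ τ in (0 : ℝ)..ρ, ∑ ξ ∈ S, ‖c ξ‖ ^ 2 * (2 - 2 * Real.cos (ξ j * τ)) ≤ ρ * X := by
    have := intervalIntegral.integral_mono_on (μ := volume) hρ.le
      (Continuous.intervalIntegrable (by fun_prop) _ _)
      (g := fun _ => X) (Continuous.intervalIntegrable continuous_const 0 ρ) h1
    simpa using this
  rw [intervalIntegral.integral_finsetSum fun ξ _ => hii ξ] at h2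
  have h3 : ρ * ∑ ξ ∈ S.filter (fun ξ => 2 ≤ |(ξ j : ℝ)| * ρ), ‖c ξ‖ ^ 2 ≤
      ∑ ξ ∈ S, ∫ τ in (0 : ℝ)..ρ, ‖c ξ‖ ^ 2 * (2 - 2 * Real.cos (ξ j * τ)) := by
    rw [Finset.mul_sum, Finset.sum_filter]
    refine Finset.sum_le_sum fun ξ _ => ?_
    rw [intervalIntegral.integral_const_mul]
    split_ifs with h4
    · rw [mul_comm]
      gcongr
      exact integral_two_sub_two_cos_ge h4
    · refine mul_nonneg (by positivity) (intervalIntegral.integral_nonneg hρ.le fun τ _ => ?_)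
      linarith [Real.cos_le_one (ξ j * τ)]
  exact le_of_mul_le_mul_left (h3.trans h2) hρ

/-- Split at |z| = lam; the L⁴ bound pays for the large values and turns L¹ smallness into L²
smallness. -/
lemma integral_sq_le_of_integral_abs {z : E d → ℝ} (hz : Continuous z) {lam : ℝ} (hl : 0 < lam) :
    ∫ x, z x ^ 2 ∂(cellVol d) ≤
      lam * ∫ x, |z x| ∂(cellVol d) + (lam ^ 2)⁻¹ * ∫ x, z x ^ 4 ∂(cellVol d) := by
  have i1 : Integrable (fun x => |z x|) (cellVol d) := integrable_cellVol hz.abs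
  have i2 : Integrable (fun x => z x ^ 4) (cellVol d) := integrable_cellVol (hz.pow 4)
  rw [← integral_const_mul, ← integral_const_mul, ← integral_add (i1.const_mul _) (i2.const_mul _)]
  refine integral_mono (integrable_cellVol (hz.pow 2)) ((i1.const_mul _).add (i2.const_mul _))
    fun x => ?_
  change z x ^ 2 ≤ lam * |z x| + (lam ^ 2)⁻¹ * z x ^ 4
  have h4 : 0 ≤ (lam ^ 2)⁻¹ * z x ^ 4 := by positivity
  rcases le_total |z x| lam with h | h
  · have : |z x| ^ 2 ≤ lam * |z x| := by rw [pow_two]; gcongr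
    rw [sq_abs] at this
    linarith
  · have h1 : lam ^ 2 ≤ z x ^ 2 := by rw [← sq_abs (z x)]; gcongr
    have h2 : z x ^ 2 ≤ (lam ^ 2)⁻¹ * z x ^ 4 := by
      rw [le_inv_mul_iff₀ (by positivity), show z x ^ 4 = z x ^ 2 * z x ^ 2 by ring]
      gcongr
    have : 0 ≤ lam * |z x| := by positivity
    linarith

lemma integral_abs_le_of_integral_sq {z : E d → ℝ} (hz : Continuous z) {lam : ℝ} (hl : 0 < lam)
    (h : ∫ x, z x ^ 2 ∂(cellVol d) ≤ lam ^ 2) :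
    ∫ x, |z x| ∂(cellVol d) ≤ ((2 * Real.pi) ^ d + 1) * lam := by
  have i2 : Integrable (fun x => z x ^ 2) (cellVol d) := integrable_cellVol (hz.pow 2)
  calc _ ≤ ∫ x, (lam + lam⁻¹ * z x ^ 2) ∂(cellVol d) := by
        refine integral_mono (integrable_cellVol hz.abs)
          ((integrable_const _).add (i2.const_mul _)) fun x => ?_
        change |z x| ≤ lam + lam⁻¹ * z x ^ 2
        have h1 : 0 ≤ lam⁻¹ * (|z x| - lam) ^ 2 := by positivity
        have h2 : lam⁻¹ * (|z x| - lam) ^ 2 = lam⁻¹ * |z x| ^ 2 + lam - 2 * |z x| := by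
          field_simp; ring
        have h3 := abs_nonneg (z x)
        rw [h2, sq_abs] at h1
        linarith
    _ = lam * (2 * Real.pi) ^ d + lam⁻¹ * ∫ x, z x ^ 2 ∂(cellVol d) := by
        rw [integral_add (integrable_const _) (i2.const_mul _), integral_const_cellVol,
          integral_const_mul]
    _ ≤ lam * (2 * Real.pi) ^ d + lam⁻¹ * lam ^ 2 := by gcongr
    _ = _ := by field_simp

end SVV

end

noncomputable section
namespace SVV

variable {d : ℕ}

/-! ### Compactness -/

/-- Arzelà–Ascoli for each index; compactness of the countable product takes the place of a diagonal
extraction. -/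
lemma exists_subseq_uniformCauchy {ι : Type*} [Countable ι] (c : ℕ → ι → ℝ → ℂ) {T B : ℝ}
    (hlip : ∀ i, ∃ Λ : NNReal, ∀ n, LipschitzOnWith Λ (c n i) (Set.Icc 0 T))
    (hB : ∀ n i, ∀ t ∈ Set.Icc 0 T, ‖c n i t‖ ≤ B) :
    ∃ φ : ℕ → ℕ, StrictMono φ ∧ ∀ i, ∀ κ > 0, ∃ n₀, ∀ a ≥ n₀, ∀ b ≥ n₀, ∀ t ∈ Set.Icc 0 T,
      ‖c (φ a) i t - c (φ b) i t‖ ≤ κ := by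
  have hc : ∀ n i, Continuous fun t : Set.Icc 0 T => c n i t := fun n i => by
    obtain ⟨Λ, hΛ⟩ := hlip i
    exact continuousOn_iff_continuous_domRestrict.1 (hΛ n).continuousOn
  set g : ℕ → ι → BoundedContinuousFunction (Set.Icc 0 T) ℂ := fun n i =>
    BoundedContinuousFunction.mkOfCompact ⟨fun t => c n i t, hc n i⟩ with hg
  have hcomp : ∀ i, IsCompact (closure (Set.range fun n => g n i)) := by
    intro i
    obtain ⟨Λ, hΛ⟩ := hlip i
    refine BoundedContinuousFunction.arzela_ascoli (Metric.closedBall 0 B)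
      (isCompact_closedBall _ _) _ ?_ ?_
    · rintro _ x ⟨n, rfl⟩
      simpa [hg] using hB n i x x.2
    · refine (LipschitzWith.uniformEquicontinuous _ Λ ?_).equicontinuous
      rintro ⟨_, n, rfl⟩
      exact lipschitzOnWith_iff_restrict.1 (hΛ n)
  obtain ⟨G, -, φ, hφ, hG⟩ := (isCompact_univ_pi hcomp).tendsto_subseq (x := g)
    fun n i _ => subset_closure ⟨n, rfl⟩
  refine ⟨φ, hφ, fun i κ hκ => ?_⟩
  have h1 : CauchySeq fun n => g (φ n) i := ((tendsto_pi_nhds.1 hG) i).cauchySeq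
  obtain ⟨n₀, hn₀⟩ := Metric.cauchySeq_iff.1 h1 κ hκ
  refine ⟨n₀, fun a ha b hb t ht => ?_⟩
  have h2 := (BoundedContinuousFunction.dist_coe_le_dist (⟨t, ht⟩ : Set.Icc 0 T)).trans (hn₀ a ha b hb).le
  rwa [dist_eq_norm] at h2

lemma freqs_mono {N M : ℕ} (h : N ≤ M) : freqs d N ⊆ freqs d M := fun ξ hξ => by
  rw [mem_freqs_iff] at *
  exact hξ.trans h

lemma eq_trig_freqs_of_le {φ : E d → ℝ} {N M : ℕ} (h : ∀ x, (φ x : ℂ) = trig (freqs d N) (coeff φ) x)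
    (hNM : N ≤ M) (x : E d) : (φ x : ℂ) = trig (freqs d M) (coeff φ) x := by
  rw [h x, trig, trig]
  refine Finset.sum_subset (freqs_mono hNM) fun ξ _ hξ => ?_
  rw [coeff_of_eq_trig h, if_neg hξ, zero_mul]

lemma integral_sub_pow_four_le {g h : E d → ℝ} (hg : Continuous g) (hh : Continuous h) {B : ℝ}
    (h1 : ∫ x, g x ^ 4 ∂(cellVol d) ≤ B) (h2 : ∫ x, h x ^ 4 ∂(cellVol d) ≤ B) :
    ∫ x, (g x - h x) ^ 4 ∂(cellVol d) ≤ 16 * B := by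
  have i1 : Integrable (fun x => g x ^ 4) (cellVol d) := integrable_cellVol (hg.pow 4)
  have i2 : Integrable (fun x => h x ^ 4) (cellVol d) := integrable_cellVol (hh.pow 4)
  calc _ ≤ ∫ x, 8 * (g x ^ 4 + h x ^ 4) ∂(cellVol d) := by
        refine integral_mono (integrable_cellVol ((hg.sub hh).pow 4))
          ((i1.add i2).const_mul _) fun x => ?_
        change (g x - h x) ^ 4 ≤ 8 * (g x ^ 4 + h x ^ 4)
        nlinarith [sq_nonneg (g x + h x), sq_nonneg (g x ^ 2 - h x ^ 2),
          sq_nonneg ((g x + h x) ^ 2), sq_nonneg ((g x - h x) ^ 2 - (g x + h x) ^ 2),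
          mul_nonneg (sq_nonneg (g x + h x)) (sq_nonneg (g x - h x))]
    _ = 8 * (∫ x, g x ^ 4 ∂(cellVol d) + ∫ x, h x ^ 4 ∂(cellVol d)) := by
        rw [integral_const_mul, integral_add i1 i2]
    _ ≤ _ := by linarith

lemma sum_filter_lt_freqSize_le (S : Finset (Fin d → ℤ)) {w : (Fin d → ℤ) → ℝ} (hw : ∀ ξ, 0 ≤ w ξ)
    {R : ℕ} {ρ : ℝ} (hR : 2 ≤ R * ρ) (hρ : 0 ≤ ρ) :
    ∑ ξ ∈ S.filter (fun ξ => R < freqSize ξ), w ξ ≤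
      ∑ j, ∑ ξ ∈ S.filter (fun ξ => 2 ≤ |(ξ j : ℝ)| * ρ), w ξ := by
  simp only [Finset.sum_filter]
  rw [Finset.sum_comm]
  refine Finset.sum_le_sum fun ξ _ => ?_
  have h0 : ∀ j, 0 ≤ if 2 ≤ |(ξ j : ℝ)| * ρ then w ξ else 0 := fun j => by
    split_ifs
    exacts [hw ξ, le_rfl]
  split_ifs with h
  · obtain ⟨j, hj⟩ := exists_freqSize_eq ξ (by omega)
    refine le_trans (le_of_eq ?_) (Finset.single_le_sum (fun j _ => h0 j) (Finset.mem_univ j))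
    have h1 : (R : ℝ) ≤ |(ξ j : ℝ)| := by
      rw [← hj]; exact_mod_cast h.le
    rw [if_pos (hR.trans (by gcongr))]
  · exact Finset.sum_nonneg fun j _ => h0 j

/-- A sequence of trigonometric polynomials depending on time with uniform bounds that make it
precompact in `C([0,T]; L¹)`. -/
structure CompactFamily (T B K C₀ : ℝ) (ν : ℕ → ℕ) (δ : ℕ → ℝ) (v : ℕ → ℝ → E d → ℝ) : Prop where
  eq_trig : ∀ n, ∀ t ∈ Set.Icc 0 T, ∀ x, (v n t x : ℂ) = trig (freqs d (ν n)) (coeff (v n t)) x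
  lip : ∀ ξ, ∃ Λ : NNReal, ∀ n, LipschitzOnWith Λ (fun t => coeff (v n t) ξ) (Set.Icc 0 T)
  one : ∀ n, ∀ t ∈ Set.Icc 0 T, ∫ x, |v n t x| ∂(cellVol d) ≤ B
  four : ∀ n, ∀ t ∈ Set.Icc 0 T, ∫ x, v n t x ^ 4 ∂(cellVol d) ≤ B
  K_nonneg : 0 ≤ K
  transl : ∀ n, ∀ t ∈ Set.Icc 0 T, ∀ j, ∀ τ : ℝ, 0 ≤ τ →
    ∫ x, |v n t (x + τ • dir j) - v n t x| ∂(cellVol d) ≤ K * τ + δ n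
  cube : ∀ n, ∀ t ∈ Set.Icc 0 T, ∀ σ : ℝ, |σ| = 1 →
    ∫ x, max (σ * v n t x - C₀) 0 ^ 3 ∂(cellVol d) ≤ δ n
  lim : Tendsto δ atTop (𝓝 0)

namespace CompactFamily

variable {T B K C₀ : ℝ} {ν : ℕ → ℕ} {δ : ℕ → ℝ} {v : ℕ → ℝ → E d → ℝ}

lemma continuous (h : CompactFamily T B K C₀ ν δ v) (n : ℕ) {t : ℝ} (ht : t ∈ Set.Icc 0 T) :
    Continuous (v n t) := (contDiff_of_eq_trig (h.eq_trig n t ht) (n := 0)).continuous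

lemma per (h : CompactFamily T B K C₀ ν δ v) (n : ℕ) {t : ℝ} (ht : t ∈ Set.Icc 0 T) :
    Per (v n t) := per_of_eq_trig (h.eq_trig n t ht)

lemma comp (h : CompactFamily T B K C₀ ν δ v) {φ : ℕ → ℕ} (hφ : StrictMono φ) :
    CompactFamily T B K C₀ (ν ∘ φ) (δ ∘ φ) (fun n => v (φ n)) where
  eq_trig n := h.eq_trig (φ n)
  lip ξ := (h.lip ξ).imp fun _ hΛ n => hΛ (φ n)
  one n := h.one (φ n)
  four n := h.four (φ n)
  K_nonneg := h.K_nonneg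
  transl n := h.transl (φ n)
  cube n := h.cube (φ n)
  lim := h.lim.comp hφ.tendsto_atTop

/-- Translations small in L¹ plus the fourth moment give translations small in L², hence small
tails. Allowing every M ≥ ν n lets two members be compared on one common set of frequencies. -/
lemma exists_tail (h : CompactFamily T B K C₀ ν δ v) {κ : ℝ} (hκ : 0 < κ) :
    ∃ R n₀ : ℕ, ∀ n ≥ n₀, ∀ t ∈ Set.Icc 0 T, ∀ M ≥ ν n,
      ∑ ξ ∈ (freqs d M).filter (fun ξ => R < freqSize ξ), ‖coeff (v n t) ξ‖ ^ 2 ≤ κ := by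
  set κ' : ℝ := κ / (d + 1) with hκ'
  have hκ'0 : 0 < κ' := by positivity
  -- l is taken large so that the fourth moment costs at most κ'/2; then ρ small and n large cost
  -- κ'/4 each.
  set l : ℝ := Real.sqrt (2 * (16 * |B| + 1) / κ') with hl
  have hl0 : 0 < l := Real.sqrt_pos.2 (by positivity)
  have hl2 : (l ^ 2)⁻¹ * (16 * |B|) ≤ κ' / 2 := by
    rw [hl, Real.sq_sqrt (by positivity), inv_div, div_mul_eq_mul_div, div_le_iff₀ (by positivity)]
    have := abs_nonneg B
    nlinarith
  have hK := h.K_nonneg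
  set ρ : ℝ := κ' / (4 * l * (K + 1)) with hρ
  have hρ0 : 0 < ρ := by positivity
  have hρ1 : l * (K * ρ) ≤ κ' / 4 := by
    rw [hρ]
    have : l * (K * (κ' / (4 * l * (K + 1)))) = κ' / 4 * (K / (K + 1)) := by field_simp
    rw [this]
    exact mul_le_of_le_one_right (by positivity) ((div_le_one (by positivity)).2 (by linarith))
  have hδ : ∀ᶠ n in atTop, δ n ≤ κ' / (4 * l) := h.lim.eventually_le_const (by positivity)
  obtain ⟨n₀, hn₀⟩ := eventually_atTop.1 hδ
  obtain ⟨R, hR⟩ := exists_nat_ge (2 / ρ)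
  rw [div_le_iff₀ hρ0] at hR
  refine ⟨R, n₀, fun n hn t ht M hM => ?_⟩
  have hvc := h.continuous n ht
  have hX : ∀ j : Fin d, ∀ τ ∈ Set.Icc 0 ρ,
      ∫ x, (v n t (x + τ • dir j) - v n t x) ^ 2 ∂(cellVol d) ≤ κ' := by
    intro j τ hτ
    have hsc : Continuous fun x => v n t (x + τ • dir j) := by fun_prop
    have h1 : ∫ x, v n t (x + τ • dir j) ^ 4 ∂(cellVol d) ≤ B := by
      rw [integral_cellVol_add (g := fun x => v n t x ^ 4) ((h.per n ht).comp fun y => y ^ 4)]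
      exact h.four n t ht
    have h2 := integral_sub_pow_four_le hsc hvc h1 (h.four n t ht)
    have h3 := h.transl n t ht j τ hτ.1
    have h4 : l * δ n ≤ κ' / 4 := by
      calc l * δ n ≤ l * (κ' / (4 * l)) := by gcongr; exact hn₀ n hn
        _ = _ := by field_simp
    have h5 : l * (K * τ) ≤ l * (K * ρ) := by
      have := hτ.2
      gcongr
    calc _ ≤ _ := integral_sq_le_of_integral_abs (hsc.sub hvc) hl0
      _ ≤ l * (K * τ + δ n) + (l ^ 2)⁻¹ * (16 * |B|) := by
        exact add_le_add (mul_le_mul_of_nonneg_left h3 hl0.le)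
          (mul_le_mul_of_nonneg_left (h2.trans (by linarith [le_abs_self B])) (by positivity))
      _ ≤ κ' := by rw [mul_add]; linarith
  refine (sum_filter_lt_freqSize_le _ (fun ξ => by positivity) hR hρ0.le).trans ?_
  calc _ ≤ ∑ _j : Fin d, κ' := Finset.sum_le_sum fun j _ =>
        sum_high_frequency_le (eq_trig_freqs_of_le (h.eq_trig n t ht) hM) j hρ0 (hX j)
    _ = d * κ' := by simp
    _ ≤ κ := by
      rw [hκ', mul_div_assoc', div_le_iff₀ (by positivity)]
      nlinarith

lemma exists_cauchy (h : CompactFamily T B K C₀ ν δ v) :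
    ∃ φ : ℕ → ℕ, StrictMono φ ∧ ∀ η > 0, ∃ n₀, ∀ a ≥ n₀, ∀ b ≥ n₀, ∀ t ∈ Set.Icc 0 T,
      ∫ x, |v (φ a) t x - v (φ b) t x| ∂(cellVol d) ≤ η := by
  obtain ⟨φ, hφ, hc⟩ := exists_subseq_uniformCauchy (fun n ξ t => coeff (v n t) ξ) h.lip
    fun n ξ t ht => (norm_coeff_le ξ).trans (h.one n t ht)
  have h' := h.comp hφ
  refine ⟨φ, hφ, fun η hη => ?_⟩
  set lam : ℝ := η / ((2 * Real.pi) ^ d + 1) with hlam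
  have hlam0 : 0 < lam := by positivity
  -- Five parts: 2κ from each of the two tails and κ from the finitely many low frequencies.
  set κ : ℝ := lam ^ 2 / (5 * (2 * Real.pi) ^ d) with hκ
  have hκ0 : 0 < κ := by positivity
  obtain ⟨R, n₁, hR⟩ := h'.exists_tail hκ0
  have hlow : ∀ᶠ n₀ in atTop, ∀ ξ ∈ freqs d R, ∀ a ≥ n₀, ∀ b ≥ n₀, ∀ t ∈ Set.Icc 0 T,
      ‖coeff (v (φ a) t) ξ - coeff (v (φ b) t) ξ‖ ^ 2 ≤ κ / (freqs d R).card := by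
    refine (Finset.eventually_all _).2 fun ξ hξ => ?_
    have hcard : (0 : ℝ) < (freqs d R).card := by exact_mod_cast Finset.card_pos.2 ⟨ξ, hξ⟩
    obtain ⟨n₀, hn₀⟩ := hc ξ (Real.sqrt (κ / (freqs d R).card)) (Real.sqrt_pos.2 (by positivity))
    filter_upwards [eventually_ge_atTop n₀] with n hn a ha b hb t ht
    have h1 := hn₀ a (hn.trans ha) b (hn.trans hb) t ht
    calc _ ≤ Real.sqrt (κ / (freqs d R).card) ^ 2 := by gcongr
      _ = _ := Real.sq_sqrt (by positivity)
  obtain ⟨n₂, hn₂⟩ := eventually_atTop.1 hlow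
  refine ⟨max n₁ n₂, fun a ha b hb t ht => ?_⟩
  set M := max (ν (φ a)) (ν (φ b)) with hM
  have e : ∀ x, ((v (φ a) t x - v (φ b) t x : ℝ) : ℂ) =
      trig (freqs d M) (fun ξ => coeff (v (φ a) t) ξ - coeff (v (φ b) t) ξ) x := fun x => by
    rw [Complex.ofReal_sub, eq_trig_freqs_of_le (h.eq_trig _ t ht) (le_max_left _ _) x,
      eq_trig_freqs_of_le (h.eq_trig _ t ht) (le_max_right (ν (φ a)) _) x, trig_sub]
  have hcont : Continuous fun x => v (φ a) t x - v (φ b) t x :=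
    (h.continuous _ ht).sub (h.continuous _ ht)
  have hta := hR a ((le_max_left _ _).trans ha) t ht M (le_max_left _ _)
  have htb := hR b ((le_max_left _ _).trans hb) t ht M (le_max_right _ _)
  have hsum : ∑ ξ ∈ freqs d M, ‖coeff (v (φ a) t) ξ - coeff (v (φ b) t) ξ‖ ^ 2 ≤ 5 * κ := by
    rw [← Finset.sum_filter_add_sum_filter_not (freqs d M) (fun ξ => R < freqSize ξ)]
    have h1 : ∑ ξ ∈ (freqs d M).filter (fun ξ => R < freqSize ξ),
        ‖coeff (v (φ a) t) ξ - coeff (v (φ b) t) ξ‖ ^ 2 ≤ 2 * κ + 2 * κ := by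
      calc _ ≤ ∑ ξ ∈ (freqs d M).filter (fun ξ => R < freqSize ξ),
            (2 * ‖coeff (v (φ a) t) ξ‖ ^ 2 + 2 * ‖coeff (v (φ b) t) ξ‖ ^ 2) := by
            refine Finset.sum_le_sum fun ξ _ => ?_
            have := norm_sub_le (coeff (v (φ a) t) ξ) (coeff (v (φ b) t) ξ)
            calc _ ≤ (‖coeff (v (φ a) t) ξ‖ + ‖coeff (v (φ b) t) ξ‖) ^ 2 := by gcongr
              _ ≤ _ := by nlinarith [sq_nonneg (‖coeff (v (φ a) t) ξ‖ - ‖coeff (v (φ b) t) ξ‖)]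
        _ ≤ _ := by
          rw [Finset.sum_add_distrib, ← Finset.mul_sum, ← Finset.mul_sum]
          gcongr
    have h2 : ∑ ξ ∈ (freqs d M).filter (fun ξ => ¬R < freqSize ξ),
        ‖coeff (v (φ a) t) ξ - coeff (v (φ b) t) ξ‖ ^ 2 ≤ κ := by
      have h0 : (0 : Fin d → ℤ) ∈ freqs d R := by rw [mem_freqs]; simp
      have hcard : (0 : ℝ) < (freqs d R).card := by exact_mod_cast Finset.card_pos.2 ⟨0, h0⟩
      calc _ ≤ ∑ ξ ∈ freqs d R, ‖coeff (v (φ a) t) ξ - coeff (v (φ b) t) ξ‖ ^ 2 := by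
            refine Finset.sum_le_sum_of_subset_of_nonneg (fun ξ hξ => ?_) fun _ _ _ => by positivity
            rw [mem_freqs_iff]
            exact not_lt.1 (Finset.mem_filter.1 hξ).2
        _ ≤ ∑ _ξ ∈ freqs d R, κ / (freqs d R).card := Finset.sum_le_sum fun ξ hξ =>
            hn₂ n₂ le_rfl ξ hξ a ((le_max_right _ _).trans ha) b ((le_max_right _ _).trans hb) t ht
        _ = κ := by
            rw [Finset.sum_const, nsmul_eq_mul]; field_simp
    linarith
  have h2 : ∫ x, (v (φ a) t x - v (φ b) t x) ^ 2 ∂(cellVol d) ≤ lam ^ 2 := by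
    rw [integral_sq_of_eq_trig e]
    calc _ ≤ (2 * Real.pi) ^ d * (5 * κ) := by gcongr
      _ = lam ^ 2 := by rw [hκ]; field_simp
  refine (integral_abs_le_of_integral_sq hcont hlam0 h2).trans (le_of_eq ?_)
  rw [hlam]; field_simp

end CompactFamily

end SVV

end

noncomputable section
namespace SVV

variable {d : ℕ}

/-! ### Properties of `L¹` limits -/

lemma eLpNorm_one_eq_ofReal {α : Type*} [MeasurableSpace α] {μ : Measure α} {z : α → ℝ}
    (hz : Integrable z μ) : eLpNorm z 1 μ = ENNReal.ofReal (∫ x, |z x| ∂μ) := by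
  rw [eLpNorm_one_eq_lintegral_enorm, ← ofReal_integral_norm_eq_lintegral_enorm hz]
  rfl

lemma tendsto_integral_mul {α : Type*} [MeasurableSpace α] {μ : Measure α} {w : ℕ → α → ℝ} {g : α → ℝ}
    {D : α → ℝ} {A : ℝ} (hw : ∀ n, Integrable (w n) μ) (hg : Integrable g μ)
    (hD : AEStronglyMeasurable D μ) (hA : ∀ x, |D x| ≤ A)
    (hwg : Tendsto (fun n => ∫ x, |w n x - g x| ∂μ) atTop (𝓝 0)) :
    Tendsto (fun n => ∫ x, w n x * D x ∂μ) atTop (𝓝 (∫ x, g x * D x ∂μ)) := by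
  rw [tendsto_iff_norm_sub_tendsto_zero]
  refine squeeze_zero (fun _ => norm_nonneg _) (fun n => ?_)
    (by simpa using hwg.const_mul A : Tendsto (fun n => A * ∫ x, |w n x - g x| ∂μ) atTop (𝓝 0))
  have hi : ∀ {z : α → ℝ}, Integrable z μ → Integrable (fun x => z x * D x) μ := fun hz =>
    hz.mul_bdd hD (Eventually.of_forall fun x => hA x)
  rw [← integral_sub (hi (hw n)) (hi hg), ← integral_const_mul]
  refine (norm_integral_le_integral_norm _).trans (integral_mono ?_ ?_ fun x => ?_)
  · exact ((hi (hw n)).sub (hi hg)).norm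
  · exact ((hw n).sub hg).abs.const_mul _
  · change |w n x * D x - g x * D x| ≤ A * |w n x - g x|
    rw [← sub_mul, abs_mul, mul_comm]
    gcongr
    exact hA x

lemma integral_mul_comp_sub {w ψ : E d → ℝ} {e : E d} (h : tsupport ψ ⊆ cell d)
    (h' : ∀ x, ψ (x - e) ≠ 0 → x ∈ cell d) :
    ∫ x, w x * ψ (x - e) ∂(cellVol d) = ∫ x, w (x + e) * ψ x ∂(cellVol d) := by
  rw [cellVol, setIntegral_eq_integral_of_forall_compl_eq_zero,
    setIntegral_eq_integral_of_forall_compl_eq_zero,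
    ← integral_add_right_eq_self (fun x => w x * ψ (x - e)) e]
  · simp
  · intro x hx
    rw [image_eq_zero_of_notMem_tsupport fun hx' => hx (h hx'), mul_zero]
  · intro x hx
    rw [not_not.1 fun hx' => hx (h' x hx'), mul_zero]

/-- Move the difference quotient from the test function to w n, which for small τ stays inside the
cell. At fixed τ let n → ∞ first, so that δ n/τ disappears, and only then τ → 0. -/
lemma integral_mul_fderiv_le {g : E d → ℝ} (hg : Integrable g (cellVol d)) {w : ℕ → E d → ℝ}
    (hw : ∀ n, Continuous (w n)) (hwg : Tendsto (fun n => ∫ x, |w n x - g x| ∂(cellVol d)) atTop (𝓝 0))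
    {j : Fin d} {K : ℝ} {δ : ℕ → ℝ} (hδ : Tendsto δ atTop (𝓝 0))
    (htr : ∀ n, ∀ τ : ℝ, 0 ≤ τ → ∫ x, |w n (x + τ • dir j) - w n x| ∂(cellVol d) ≤ K * τ + δ n)
    {ψ : E d → ℝ} (hψ : ContDiff ℝ 1 ψ) (hc : HasCompactSupport ψ) (hs : tsupport ψ ⊆ cell d)
    (h1 : ∀ x, |ψ x| ≤ 1) :
    ∫ x, g x * fderiv ℝ ψ x (dir j) ∂(cellVol d) ≤ K := by
  obtain ⟨L, hL⟩ := hψ.lipschitzWith_of_hasCompactSupport hc one_ne_zero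
  set D : ℝ → E d → ℝ := fun τ x => τ⁻¹ * (ψ x - ψ (x - τ • dir j)) with hD
  have hDc : ∀ τ, Continuous (D τ) := fun τ => by
    have := hψ.continuous
    fun_prop
  have hDb : ∀ τ : ℝ, 0 < τ → ∀ x, |D τ x| ≤ L := by
    intro τ hτ x
    have := hL.dist_le_mul x (x - τ • dir j)
    rw [Real.dist_eq, dist_eq_norm, sub_sub_cancel, norm_smul, dir, PiLp.norm_single,
      norm_one, mul_one, Real.norm_eq_abs, abs_of_pos hτ] at this
    rw [hD]
    simp only
    rw [abs_mul, abs_of_pos (inv_pos.2 hτ), inv_mul_le_iff₀ hτ, mul_comm τ]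
    exact this
  have hDlim : Tendsto (fun τ => ∫ x, g x * D τ x ∂(cellVol d)) (𝓝[>] 0)
      (𝓝 (∫ x, g x * fderiv ℝ ψ x (dir j) ∂(cellVol d))) := by
    refine tendsto_integral_filter_of_dominated_convergence (fun x => L * |g x|) ?_ ?_
      (hg.abs.const_mul _) (Eventually.of_forall fun x => ?_)
    · exact Eventually.of_forall fun τ => hg.1.mul (hDc τ).aestronglyMeasurable
    · filter_upwards [self_mem_nhdsWithin] with τ hτ
      refine Eventually.of_forall fun x => ?_
      rw [norm_mul, Real.norm_eq_abs, mul_comm, Real.norm_eq_abs]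
      gcongr
      exact hDb τ hτ x
    · refine Tendsto.const_mul _ ?_
      have h2 := ((hψ.differentiable one_ne_zero x).hasFDerivAt.hasLineDerivAt
        (-dir j)).tendsto_slope_zero_right.neg
      rw [map_neg, neg_neg] at h2
      refine h2.congr fun τ => ?_
      simp only [hD, smul_neg, ← sub_eq_add_neg, smul_eq_mul]
      ring
  obtain ⟨r, hr, hrs⟩ := hc.exists_thickening_subset_open isOpen_cell hs
  refine le_of_tendsto hDlim ?_
  filter_upwards [Ioo_mem_nhdsGT hr] with τ hτ
  have hτ0 : 0 < τ := hτ.1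
  refine le_of_tendsto_of_tendsto (tendsto_integral_mul (fun n => integrable_cellVol (hw n)) hg
    (hDc τ).aestronglyMeasurable (hDb τ hτ0) hwg)
    (by simpa using (hδ.const_mul τ⁻¹).const_add K : Tendsto (fun n => K + τ⁻¹ * δ n) atTop (𝓝 K))
    (Eventually.of_forall fun n => ?_)
  have hψc := hψ.continuous
  have hwn := hw n
  have i1 : Integrable (fun x => w n x * ψ x) (cellVol d) := integrable_cellVol (by fun_prop)
  have i2 : Integrable (fun x => w n x * ψ (x - τ • dir j)) (cellVol d) :=
    integrable_cellVol (by fun_prop)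
  have i3 : Integrable (fun x => w n (x + τ • dir j) * ψ x) (cellVol d) :=
    integrable_cellVol (by fun_prop)
  have hshift := integral_mul_comp_sub (w := w n) (e := τ • dir j) hs (fun x hx => hrs (by
    refine Metric.mem_thickening_iff.2 ⟨_, subset_tsupport _ hx, ?_⟩
    rw [dist_eq_norm, sub_sub_cancel, norm_smul, dir, PiLp.norm_single, norm_one, mul_one,
      Real.norm_eq_abs, abs_of_pos hτ0]
    exact hτ.2))
  calc ∫ x, w n x * D τ x ∂(cellVol d)
      = τ⁻¹ * ∫ x, (w n x * ψ x - w n x * ψ (x - τ • dir j)) ∂(cellVol d) := by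
        rw [← integral_const_mul]
        refine integral_congr_ae (Eventually.of_forall fun x => ?_)
        simp only [hD]
        ring
    _ = τ⁻¹ * ∫ x, (w n x * ψ x - w n (x + τ • dir j) * ψ x) ∂(cellVol d) := by
        rw [integral_sub i1 i2, hshift, integral_sub i1 i3]
    _ ≤ τ⁻¹ * ∫ x, |w n (x + τ • dir j) - w n x| ∂(cellVol d) := by
        have hc4 : Continuous fun x => |w n (x + τ • dir j) - w n x| := by fun_prop
        refine mul_le_mul_of_nonneg_left ?_ (inv_pos.2 hτ0).le
        refine integral_mono (i1.sub i3) (integrable_cellVol hc4) fun x => ?_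
        change w n x * ψ x - w n (x + τ • dir j) * ψ x ≤ |w n (x + τ • dir j) - w n x|
        rw [← sub_mul, abs_sub_comm]
        refine (le_abs_self _).trans ?_
        rw [abs_mul]
        exact mul_le_of_le_one_right (abs_nonneg _) (h1 x)
    _ ≤ τ⁻¹ * (K * τ + δ n) := by
        gcongr
        exact htr n τ hτ0.le
    _ = _ := by field_simp

lemma variation_le {g : E d → ℝ} (hg : Integrable g (cellVol d)) {w : ℕ → E d → ℝ}
    (hw : ∀ n, Continuous (w n)) (hwg : Tendsto (fun n => ∫ x, |w n x - g x| ∂(cellVol d)) atTop (𝓝 0))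
    {K : ℝ} {δ : ℕ → ℝ} (hδ : Tendsto δ atTop (𝓝 0))
    (htr : ∀ n j, ∀ τ : ℝ, 0 ≤ τ → ∫ x, |w n (x + τ • dir j) - w n x| ∂(cellVol d) ≤ K * τ + δ n) :
    variation g ≤ ENNReal.ofReal (d * K) := by
  refine iSup_le fun φ => iSup_le fun hφ => iSup_le fun hc => iSup_le fun hs => iSup_le fun h1 => ?_
  refine ENNReal.ofReal_le_ofReal ?_
  have hcomp : ∀ j : Fin d, ContDiff ℝ 1 fun x => φ x j := fun j => by fun_prop
  have hcs : ∀ j : Fin d, HasCompactSupport fun x => φ x j := fun j =>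
    hc.comp_left (g := fun y : E d => y j) rfl
  have hts : ∀ j : Fin d, tsupport (fun x => φ x j) ⊆ cell d := fun j =>
    (tsupport_comp_subset (g := fun y : E d => y j) rfl φ).trans hs
  have hfd : ∀ (j : Fin d) x, (fderiv ℝ φ x (dir j)) j = fderiv ℝ (fun x => φ x j) x (dir j) := by
    intro j x
    have h2 := ((EuclideanSpace.proj (𝕜 := ℝ) j).hasFDerivAt.comp x
      (hφ.differentiable one_ne_zero x).hasFDerivAt).fderiv
    rw [show (fun x => φ x j) = (EuclideanSpace.proj (𝕜 := ℝ) j) ∘ φ from rfl, h2]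
    rfl
  have hint : ∀ j : Fin d, Integrable (fun x => g x * fderiv ℝ (fun x => φ x j) x (dir j))
      (cellVol d) := by
    intro j
    have h3 : Continuous fun x => fderiv ℝ (fun x => φ x j) x (dir j) :=
      ((hcomp j).continuous_fderiv one_ne_zero).clm_apply continuous_const
    obtain ⟨A, hA⟩ := ((hcs j).fderiv_apply (𝕜 := ℝ) (dir j)).exists_bound_of_continuous h3
    exact hg.mul_bdd h3.aestronglyMeasurable (Eventually.of_forall hA)
  calc ∫ x, g x * divergence φ x ∂(cellVol d)
      = ∫ x, ∑ j, g x * fderiv ℝ (fun x => φ x j) x (dir j) ∂(cellVol d) := by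
        simp only [divergence, hfd, Finset.mul_sum]
    _ = ∑ j, ∫ x, g x * fderiv ℝ (fun x => φ x j) x (dir j) ∂(cellVol d) :=
        integral_finsetSum _ fun j _ => hint j
    _ ≤ ∑ _j : Fin d, K := Finset.sum_le_sum fun j _ => integral_mul_fderiv_le hg hw hwg hδ
        (fun n => htr n j) (hcomp j) (hcs j) (hts j) fun x => by
          exact (PiLp.norm_apply_le (φ x) j).trans (h1 x)
    _ = d * K := by simp

/-- From p ≤ lam + p³/lam² for p ≥ 0, the positive part of σg - C₀ has integral at most lam·(2π)^d
after n → ∞; then lam → 0. -/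
lemma ae_le_of_cube {g : E d → ℝ} (hg : Integrable g (cellVol d)) {w : ℕ → E d → ℝ}
    (hw : ∀ n, Continuous (w n)) (hwg : Tendsto (fun n => ∫ x, |w n x - g x| ∂(cellVol d)) atTop (𝓝 0))
    {σ C₀ : ℝ} (hσ : |σ| = 1) {δ : ℕ → ℝ} (hδ : Tendsto δ atTop (𝓝 0))
    (hcube : ∀ n, ∫ x, max (σ * w n x - C₀) 0 ^ 3 ∂(cellVol d) ≤ δ n) :
    ∀ᵐ x ∂(cellVol d), σ * g x ≤ C₀ := by
  have ig : Integrable (fun x => max (σ * g x - C₀) 0) (cellVol d) :=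
    ((hg.const_mul σ).sub (integrable_const C₀)).pos_part
  have hle : ∀ lam : ℝ, 0 < lam → ∫ x, max (σ * g x - C₀) 0 ∂(cellVol d) ≤ lam * (2 * Real.pi) ^ d := by
    intro lam hl
    have hlim : Tendsto (fun n => lam * (2 * Real.pi) ^ d +
        (∫ x, |w n x - g x| ∂(cellVol d) + (lam ^ 2)⁻¹ * δ n)) atTop
        (𝓝 (lam * (2 * Real.pi) ^ d)) := by
      simpa using (hwg.add (hδ.const_mul (lam ^ 2)⁻¹)).const_add (lam * (2 * Real.pi) ^ d)
    refine ge_of_tendsto hlim (Eventually.of_forall fun n => ?_)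
    have hwn := hw n
    have i1 : Integrable (fun x => |w n x - g x|) (cellVol d) :=
      ((integrable_cellVol hwn).sub hg).abs
    have i2 : Integrable (fun x => (lam ^ 2)⁻¹ * max (σ * w n x - C₀) 0 ^ 3) (cellVol d) :=
      integrable_cellVol (by fun_prop)
    have i12 : Integrable (fun x => |w n x - g x| + (lam ^ 2)⁻¹ * max (σ * w n x - C₀) 0 ^ 3)
      (cellVol d) := i1.add i2
    calc _ ≤ ∫ x, (lam + (|w n x - g x| + (lam ^ 2)⁻¹ * max (σ * w n x - C₀) 0 ^ 3)) ∂(cellVol d) := by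
          refine integral_mono ig ((integrable_const lam).add i12) fun x => ?_
          change max (σ * g x - C₀) 0 ≤ lam + (|w n x - g x| + (lam ^ 2)⁻¹ * max (σ * w n x - C₀) 0 ^ 3)
          set p := max (σ * w n x - C₀) 0 with hp
          have hp0 : 0 ≤ p := le_max_right _ _
          have h1 : p ≤ lam + (lam ^ 2)⁻¹ * p ^ 3 := by
            rcases le_total p lam with h | h
            · have : 0 ≤ (lam ^ 2)⁻¹ * p ^ 3 := by positivity
              linarith
            · have : p ≤ (lam ^ 2)⁻¹ * p ^ 3 := by
                rw [le_inv_mul_iff₀ (by positivity), show p ^ 3 = p ^ 2 * p by ring]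
                gcongr
              linarith
          have h2 : σ * g x ≤ σ * w n x + |w n x - g x| := by
            have : σ * (g x - w n x) ≤ |w n x - g x| := by
              refine (le_abs_self _).trans ?_
              rw [abs_mul, hσ, one_mul, abs_sub_comm]
            linarith
          refine max_le ?_ (by have := abs_nonneg (w n x - g x); linarith)
          have := le_max_left (σ * w n x - C₀) 0
          rw [← hp] at this
          linarith
      _ = lam * (2 * Real.pi) ^ d + (∫ x, |w n x - g x| ∂(cellVol d) +
            (lam ^ 2)⁻¹ * ∫ x, max (σ * w n x - C₀) 0 ^ 3 ∂(cellVol d)) := by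
          rw [integral_add (integrable_const lam) i12, integral_add i1 i2, integral_const_cellVol,
            integral_const_mul]
      _ ≤ _ := by gcongr; exact hcube n
  have h0 : ∫ x, max (σ * g x - C₀) 0 ∂(cellVol d) = 0 := by
    refine le_antisymm ?_ (integral_nonneg fun x => le_max_right _ _)
    refine ge_of_tendsto (x := 𝓝[>] (0 : ℝ)) (f := fun lam : ℝ => lam * (2 * Real.pi) ^ d) ?_ ?_
    · have : Continuous fun lam : ℝ => lam * (2 * Real.pi) ^ d := by fun_prop
      simpa using (this.tendsto 0).mono_left nhdsWithin_le_nhds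
    · filter_upwards [self_mem_nhdsWithin] with lam hl using hle lam hl
  filter_upwards [(integral_eq_zero_iff_of_nonneg (fun x => le_max_right _ _) ig).1 h0] with x hx
  have := le_max_left (σ * g x - C₀) 0
  have hx' : max (σ * g x - C₀) 0 = 0 := hx
  linarith

namespace CompactFamily

variable {T B K C₀ : ℝ} {ν : ℕ → ℕ} {δ : ℕ → ℝ} {v : ℕ → ℝ → E d → ℝ}

lemma norm_toLp_sub {g h : E d → ℝ} (hg : Continuous g) (hh : Continuous h) :
    ‖(memLp_cellVol hg 1).toLp - (memLp_cellVol hh 1).toLp‖ = ∫ x, |g x - h x| ∂(cellVol d) := by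
  rw [← MemLp.toLp_sub, Lp.norm_toLp, eLpNorm_one_eq_ofReal (integrable_cellVol (hg.sub hh)),
    ENNReal.toReal_ofReal (integral_nonneg fun x => abs_nonneg _)]
  rfl

/-- The curve in `L¹` given by a member of the family. -/
def curve (h : CompactFamily T B K C₀ ν δ v) (n : ℕ) : C(Set.Icc (0 : ℝ) T, Lp ℝ 1 (cellVol d)) where
  toFun t := (memLp_cellVol (h.continuous n t.2) 1).toLp
  continuous_toFun := by
    choose Λ hΛ using h.lip
    refine LipschitzWith.continuous (K := (∑ ξ ∈ freqs d (ν n), Λ ξ) * Real.toNNReal ((2 * Real.pi) ^ d))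
      (LipschitzWith.of_dist_le_mul fun t t' => ?_)
    rw [dist_eq_norm, norm_toLp_sub (h.continuous n t.2) (h.continuous n t'.2), NNReal.coe_mul, NNReal.coe_sum,
      Real.coe_toNNReal _ (by positivity)]
    have hc := (h.continuous n t.2).sub (h.continuous n t'.2)
    calc _ ≤ ∫ _x, (∑ ξ ∈ freqs d (ν n), (Λ ξ : ℝ)) * dist t t' ∂(cellVol d) := by
          refine integral_mono (integrable_cellVol hc.abs) (integrable_const _) fun x => ?_
          change |v n t x - v n t' x| ≤ (∑ ξ ∈ freqs d (ν n), (Λ ξ : ℝ)) * dist t t'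
          rw [← Real.norm_eq_abs, ← Complex.norm_real, Complex.ofReal_sub, h.eq_trig n t t.2,
            h.eq_trig n t' t'.2, trig_sub, Finset.sum_mul]
          refine (norm_trig_le _ _ _).trans (Finset.sum_le_sum fun ξ _ => ?_)
          rw [← dist_eq_norm]
          exact (hΛ ξ n).dist_le_mul t t.2 t' t'.2
      _ = _ := by rw [integral_const_cellVol]; ring

/-- The Cauchy subsequence converges in the complete space of continuous curves in L¹; at each time
the sup and variation bounds pass to the limit because δ vanishes. -/
lemma exists_limit (h : CompactFamily T B K C₀ ν δ v) :
    ∃ (n : ℕ → ℕ) (U : C(Set.Icc (0 : ℝ) T, Lp ℝ 1 (cellVol d))),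
      StrictMono n ∧
      Tendsto (fun k => ⨆ t : Set.Icc (0 : ℝ) T,
        eLpNorm (fun x => v (n k) t x - U t x) 1 (cellVol d)) atTop (𝓝 0) ∧
      (∃ M : ℝ, ∀ t, ∀ᵐ x ∂(cellVol d), |U t x| ≤ M) ∧
      (∃ B : NNReal, ∀ t, bvNorm (U t) ≤ B) := by
  obtain ⟨φ, hφ, hcau⟩ := h.exists_cauchy
  have hV : CauchySeq fun k => h.curve (φ k) := by
    refine Metric.cauchySeq_iff.2 fun η hη => ?_
    obtain ⟨n₀, hn₀⟩ := hcau (η / 2) (by positivity)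
    refine ⟨n₀, fun a ha b hb => lt_of_le_of_lt ((ContinuousMap.dist_le (by positivity)).2
      fun t => ?_) (half_lt_self hη)⟩
    rw [dist_eq_norm]
    exact (norm_toLp_sub (h.continuous (φ a) t.2) (h.continuous (φ b) t.2)).trans_le (hn₀ a ha b hb t t.2)
  obtain ⟨U, hU⟩ := cauchySeq_tendsto_of_complete hV
  have hdist := tendsto_iff_dist_tendsto_zero.1 hU
  have hae : ∀ k t, (h.curve (φ k) t - U t : Lp ℝ 1 (cellVol d)) =ᵐ[cellVol d]
      fun x => v (φ k) t x - U t x := by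
    intro k t
    filter_upwards [Lp.coeFn_sub (h.curve (φ k) t) (U t),
      (memLp_cellVol (h.continuous (φ k) t.2) 1).coeFn_toLp] with x hx hx'
    rw [hx, Pi.sub_apply, ← hx']
    rfl
  have hnorm : ∀ k (t : Set.Icc (0 : ℝ) T), eLpNorm (fun x => v (φ k) t x - U t x) 1 (cellVol d) =
      ENNReal.ofReal ‖h.curve (φ k) t - U t‖ := fun k t => by
    rw [← eLpNorm_congr_ae (hae k t), Lp.norm_def, ENNReal.ofReal_toReal (Lp.eLpNorm_ne_top _)]
  have hUi : ∀ t, Integrable (U t) (cellVol d) := fun t => memLp_one_iff_integrable.1 (Lp.memLp _)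
  have hL1 : ∀ t : Set.Icc (0 : ℝ) T, Tendsto (fun k => ∫ x, |v (φ k) t x - U t x| ∂(cellVol d)) atTop (𝓝 0) := by
    intro t
    refine squeeze_zero (fun k => integral_nonneg fun x => abs_nonneg _) (fun k => ?_) hdist
    have h1 := hnorm k t
    have h2 : Integrable (fun x => v (φ k) t x - U t x) (cellVol d) :=
      (integrable_cellVol (h.continuous (φ k) t.2)).sub (hUi t)
    rw [eLpNorm_one_eq_ofReal h2,
      ENNReal.ofReal_eq_ofReal_iff (integral_nonneg fun x => abs_nonneg _) (norm_nonneg _)] at h1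
    rw [h1, ← dist_eq_norm]
    exact ContinuousMap.dist_apply_le_dist t
  have hδ : Tendsto (δ ∘ φ) atTop (𝓝 0) := h.lim.comp hφ.tendsto_atTop
  refine ⟨φ, U, hφ, ?_, ⟨C₀, fun t => ?_⟩, ⟨(‖U‖ + d * K).toNNReal, fun t => ?_⟩⟩
  · have h0 := ENNReal.tendsto_ofReal hdist
    rw [ENNReal.ofReal_zero] at h0
    refine tendsto_of_tendsto_of_tendsto_of_le_of_le tendsto_const_nhds h0 (fun _ => zero_le)
      fun k => iSup_le fun t => ?_
    rw [hnorm k t, ← dist_eq_norm]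
    exact ENNReal.ofReal_le_ofReal (ContinuousMap.dist_apply_le_dist t)
  · have hb : ∀ σ : ℝ, |σ| = 1 → ∀ᵐ x ∂(cellVol d), σ * U t x ≤ C₀ := fun σ hσ =>
      ae_le_of_cube (hUi t) (fun k => h.continuous (φ k) t.2) (hL1 t) hσ hδ
        fun k => h.cube (φ k) t t.2 σ hσ
    filter_upwards [hb 1 (by simp), hb (-1) (by simp)] with x h1 h2
    exact abs_le.2 ⟨by linarith, by linarith⟩
  · have h1 : variation (U t) ≤ ENNReal.ofReal (d * K) :=
      variation_le (hUi t) (fun k => h.continuous (φ k) t.2) (hL1 t) hδ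
        fun k j τ hτ => h.transl (φ k) t t.2 j τ hτ
    have h2 : eLpNorm (U t) 1 (cellVol d) ≤ ENNReal.ofReal ‖U‖ := by
      have : eLpNorm (U t) 1 (cellVol d) = ENNReal.ofReal ‖U t‖ := by
        rw [Lp.norm_def, ENNReal.ofReal_toReal (Lp.eLpNorm_ne_top _)]
      rw [this]
      exact ENNReal.ofReal_le_ofReal (U.norm_coe_le_norm t)
    have hK := h.K_nonneg
    refine (add_le_add h2 h1).trans (le_of_eq ?_)
    rw [← ENNReal.ofReal_add (norm_nonneg _) (by positivity)]
    rfl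

end CompactFamily

end SVV

end

noncomputable section
namespace SVV

variable {d : ℕ}

/-! ### Asymptotics of the parameters -/

/-- Nε is at least of order N^{1-θ}, and s(1-θ) ≥ r turns its power 2s into N^{2r}. -/
lemma pow_le_of_rpow {θ : ℝ} (hθ₁ : θ < 1) {r s : ℕ} (hs : (r : ℝ) / (1 - θ) ≤ s) {N : ℕ} (hN : 1 ≤ N)
    {c e : ℝ} (h : (N : ℝ) ^ (-θ) ≤ c * e) :
    (N : ℝ) ^ (2 * r) ≤ c ^ (2 * s) * (N * e) ^ (2 * s) := by
  have hN1 : (1 : ℝ) ≤ N := by exact_mod_cast hN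
  have hN0 : (0 : ℝ) < N := by linarith
  have h1 : (N : ℝ) ^ (1 - θ) ≤ c * (N * e) := by
    rw [sub_eq_add_neg, Real.rpow_add hN0, Real.rpow_one]
    calc (N : ℝ) * (N : ℝ) ^ (-θ) ≤ N * (c * e) := by gcongr
      _ = _ := by ring
  rw [div_le_iff₀ (by linarith)] at hs
  rw [← mul_pow]
  calc (N : ℝ) ^ (2 * r) = (N : ℝ) ^ ((2 * r : ℕ) : ℝ) := (Real.rpow_natCast _ _).symm
    _ ≤ (N : ℝ) ^ ((1 - θ) * (2 * s : ℕ)) := by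
      refine Real.rpow_le_rpow_of_exponent_le hN1 ?_
      push_cast
      linarith
    _ = ((N : ℝ) ^ (1 - θ)) ^ (2 * s) := Real.rpow_mul_natCast hN0.le _ _
    _ ≤ _ := by gcongr

/-- The factor N^θ in m² cancels ε and only the logarithms of m survive. -/
lemma exists_mul_sq_le {θ : ℝ} {ε : ℕ → ℝ} {m : ℕ → ℕ} (hε₀ : ∀ N, 0 < ε N)
    (hε : ε =O[atTop] fun N : ℕ => (N : ℝ) ^ (-θ))
    (hm : (fun N : ℕ => (m N : ℝ)) =O[atTop]
      fun N : ℕ => (N : ℝ) ^ (θ / 2) * Real.log N ^ (-(d : ℝ) / 2)) :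
    ∃ C : ℝ, 0 ≤ C ∧ ∀ᶠ N : ℕ in atTop,
      ε N * (m N : ℝ) ^ 2 ≤ C * (Real.log N ^ d)⁻¹ := by
  obtain ⟨a, ha, hεa⟩ := hε.exists_pos
  obtain ⟨b, hb, hmb⟩ := hm.exists_pos
  refine ⟨a * b ^ 2, by positivity, ?_⟩
  filter_upwards [hεa.bound, hmb.bound, eventually_ge_atTop 2] with N h1 h2 hN
  have hN0 : (0 : ℝ) < N := by positivity
  have hl : 0 < Real.log N := Real.log_pos (by exact_mod_cast hN)
  rw [Real.norm_of_nonneg (hε₀ N).le, Real.norm_of_nonneg (by positivity)] at h1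
  rw [Real.norm_of_nonneg (by positivity), Real.norm_of_nonneg (by positivity)] at h2
  have h3 : ((N : ℝ) ^ (θ / 2)) ^ 2 * (N : ℝ) ^ (-θ) = 1 := by
    rw [← Real.rpow_mul_natCast hN0.le, ← Real.rpow_add hN0]
    norm_num
  have h4 : (Real.log N ^ (-(d : ℝ) / 2)) ^ 2 = (Real.log N ^ d)⁻¹ := by
    rw [← Real.rpow_mul_natCast hl.le, ← Real.rpow_natCast (Real.log N) d, ← Real.rpow_neg hl.le]
    norm_num
  calc ε N * (m N : ℝ) ^ 2
      ≤ (a * (N : ℝ) ^ (-θ)) * (b * ((N : ℝ) ^ (θ / 2) * Real.log N ^ (-(d : ℝ) / 2))) ^ 2 := by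
        gcongr
    _ = a * b ^ 2 * (((N : ℝ) ^ (θ / 2)) ^ 2 * (N : ℝ) ^ (-θ)) *
          (Real.log N ^ (-(d : ℝ) / 2)) ^ 2 := by ring
    _ = _ := by rw [h3, h4, mul_one]

/-! ### The initial data -/

lemma partialD_iterate (j : Fin d) (n : ℕ) {S : Finset (Fin d → ℤ)} : ∀ {φ : E d → ℝ}
    {c : (Fin d → ℤ) → ℂ}, (∀ x, (φ x : ℂ) = trig S c x) → (partialD j)^[n] φ = (dD j)^[n] φ := by
  induction n with
  | zero => intro φ c h; rfl
  | succ n ih =>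
    intro φ c h
    have h1 : partialD j φ = dD j φ := by
      funext x
      exact ((contDiff_of_eq_trig h (n := 1)).differentiable one_ne_zero x).lineDeriv_eq_fderiv
    rw [Function.iterate_succ_apply, Function.iterate_succ_apply, h1]
    exact ih fun x => dD_iterate_of_eq_trig j S 1 h x

lemma multiD_single (j : Fin d) (n : ℕ) (φ : E d → ℝ) :
    multiD (Pi.single j n) φ = (partialD j)^[n] φ := by
  have h : ∀ l : List (Fin d), l.Nodup →
      l.foldr (fun k g => (partialD k)^[(Pi.single j n : Fin d → ℕ) k] g) φ =
        if j ∈ l then (partialD j)^[n] φ else φ := by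
    intro l
    induction l with
    | nil => intro _; simp
    | cons k l ih =>
      intro hl
      rw [List.nodup_cons] at hl
      rw [List.foldr_cons, ih hl.2]
      by_cases hk : k = j
      · subst hk
        simp [hl.1]
      · simp [hk, Ne.symm hk]
  rw [multiD, h _ (List.nodup_finRange d), if_pos (List.mem_finRange j)]

lemma sob_le_derivNorm_sq {N s : ℕ} {φ : E d → ℝ} (h : ∀ x, (φ x : ℂ) = trig (freqs d N) (coeff φ) x) :
    sob N s φ ≤ d * derivNorm s φ ^ 2 := by
  rw [derivNorm, Real.sq_sqrt (Finset.sum_nonneg fun α _ => integral_nonneg fun x => sq_nonneg _), sob]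
  calc _ ≤ ∑ _j : Fin d, ∑ α ∈ Finset.piAntidiag (Finset.univ : Finset (Fin d)) s,
        ∫ x, (multiD α φ x) ^ 2 ∂(cellVol d) := by
        refine Finset.sum_le_sum fun j _ => ?_
        have h1 : (Pi.single j s : Fin d → ℕ) ∈
            Finset.piAntidiag (Finset.univ : Finset (Fin d)) s := by
          simp
        refine le_trans ?_ (Finset.single_le_sum
          (fun α _ => integral_nonneg fun x => sq_nonneg (multiD α φ x)) h1)
        simp only [multiD_single, partialD_iterate j s h]
        rw [integral_dD_iterate_sq j s h]
        refine le_mul_of_one_le_left (Finset.sum_nonneg fun ξ _ => ?_) (one_le_two_pi_pow d)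
        rw [pow_mul]; positivity
    _ = _ := by simp

lemma IsSVVSolution.init_trig {T : ℝ} {f : Fin d → ℝ → ℝ} {μ : Measure (E d)} {u₀ : E d → ℝ}
    {N m : ℕ} {ε : ℝ} {q : Fin d → Fin d → ℕ → ℝ → ℝ} {u : ℝ → E d → ℝ}
    (h : IsSVVSolution T f μ u₀ N m ε q u) (x : E d) :
    (u 0 x : ℂ) = SVV.trig (freqs d N) (coeff u₀) x := h.init x

/-- Keep only the outermost shell of the truncation, where the weight is N^{2s}. This bounds
coefficients of g that do not depend on N. -/
lemma sum_shell_le {N s : ℕ} (hs : 1 ≤ s) {g φ : E d → ℝ}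
    (h : ∀ x, (φ x : ℂ) = trig (freqs d N) (coeff g) x) :
    (N : ℝ) ^ (2 * s) * ∑ ξ ∈ (freqs d N).filter (fun ξ => freqSize ξ = N), ‖coeff g ξ‖ ^ 2 ≤
      sob N s φ := by
  have h1 : ∀ ξ ∈ freqs d N, coeff φ ξ = coeff g ξ := fun ξ hξ => by
    rw [coeff_of_eq_trig h, if_pos hξ]
  rw [sob, Finset.sum_comm, Finset.mul_sum]
  refine (Finset.sum_le_sum fun ξ hξ => ?_).trans
    (Finset.sum_le_sum_of_subset_of_nonneg (Finset.filter_subset _ _) fun ξ _ _ =>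
      Finset.sum_nonneg fun j _ => ?_)
  · rw [Finset.mem_filter] at hξ
    rw [← Finset.sum_mul, h1 ξ hξ.1]
    gcongr
    rw [← hξ.2]
    exact freqSize_pow_le_sum ξ hs
  · rw [pow_mul]; positivity

/-- Shell masses of order n^{-2r} weighted with n^{2(r-1)} sum like Σ n^{-2}; Cauchy–Schwarz with
exponent r - 1 then needs d + 3 ≤ 2(r - 1). The finitely many shells below n₀ only enlarge the
constant. -/
lemma exists_sum_freqSize_mul_coeff_le {g : E d → ℝ} {A : ℝ} (hA : 0 ≤ A) {r n₀ : ℕ} (hr : d + 5 ≤ 2 * r)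
    (h : ∀ n ≥ n₀, (n : ℝ) ^ (2 * r) *
      ∑ ξ ∈ (freqs d n).filter (fun ξ => freqSize ξ = n), ‖coeff g ξ‖ ^ 2 ≤ A) :
    ∃ L : ℝ, 0 ≤ L ∧ ∀ N, ∑ ξ ∈ freqs d N, freqSize ξ * ‖coeff g ξ‖ ≤ L := by
  set S : ℕ → ℝ := fun n => ∑ ξ ∈ (freqs d n).filter (fun ξ => freqSize ξ = n), ‖coeff g ξ‖ ^ 2 with hS
  have hS0 : ∀ n, 0 ≤ S n := fun n => Finset.sum_nonneg fun ξ _ => by positivity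
  set A' : ℝ := A + ∑ n ∈ Finset.range n₀, (n : ℝ) ^ (2 * r) * S n with hA'
  have hpos : ∀ n : ℕ, 0 ≤ (n : ℝ) ^ (2 * r) * S n := fun n => mul_nonneg (by positivity) (hS0 n)
  have hall : ∀ n : ℕ, (n : ℝ) ^ (2 * r) * S n ≤ A' := by
    intro n
    rcases le_or_gt n₀ n with hn | hn
    · have := Finset.sum_nonneg fun n (_ : n ∈ Finset.range n₀) => hpos n
      linarith [h n hn]
    · have := Finset.single_le_sum (fun n _ => hpos n) (Finset.mem_range.2 hn)
      linarith
  have hA'0 : 0 ≤ A' := (hpos 0).trans (hall 0)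
  obtain ⟨Z, hZ, hSZ⟩ := exists_sum_freqSize_le d
  obtain ⟨Y, hY⟩ : ∃ Y : ℝ, ∀ s : Finset ℕ, ∑ n ∈ s, ((n : ℝ) ^ 2)⁻¹ ≤ Y :=
    ⟨_, fun s => (Real.summable_nat_pow_inv.2 one_lt_two).sum_le_tsum s fun n _ => by positivity⟩
  refine ⟨Real.sqrt (Z * (A' * Y)), Real.sqrt_nonneg _, fun N => Real.le_sqrt_of_sq_le ?_⟩
  set P := (freqs d N).filter (fun ξ => 1 ≤ freqSize ξ) with hP
  have hPsum : ∑ ξ ∈ freqs d N, freqSize ξ * ‖coeff g ξ‖ = ∑ ξ ∈ P, freqSize ξ * ‖coeff g ξ‖ := by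
    rw [hP, Finset.sum_filter_of_ne]
    intro ξ _ hξ
    by_contra h0
    rw [show freqSize ξ = 0 by omega] at hξ
    simp at hξ
  have hW : ∑ ξ ∈ P, (freqSize ξ : ℝ) ^ (2 * (r - 1)) * ‖coeff g ξ‖ ^ 2 ≤ A' * Y := by
    have hmaps : ∀ ξ ∈ P, freqSize ξ ∈ Finset.Icc 1 N := fun ξ hξ => by
      rw [hP, Finset.mem_filter, mem_freqs_iff] at hξ
      exact Finset.mem_Icc.2 ⟨hξ.2, hξ.1⟩
    rw [← Finset.sum_fiberwise_of_maps_to hmaps]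
    calc _ ≤ ∑ n ∈ Finset.Icc 1 N, A' * ((n : ℝ) ^ 2)⁻¹ := by
          refine Finset.sum_le_sum fun n hn => ?_
          have hn1 : (0 : ℝ) < n := by exact_mod_cast (Finset.mem_Icc.1 hn).1
          have h1 : ∑ ξ ∈ P.filter (fun ξ => freqSize ξ = n),
              (freqSize ξ : ℝ) ^ (2 * (r - 1)) * ‖coeff g ξ‖ ^ 2 ≤ (n : ℝ) ^ (2 * (r - 1)) * S n := by
            rw [hS, Finset.mul_sum]
            refine (Finset.sum_le_sum fun ξ hξ => ?_).trans
              (Finset.sum_le_sum_of_subset_of_nonneg (fun ξ hξ => ?_) fun ξ _ _ => by positivity)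
            · rw [(Finset.mem_filter.1 hξ).2]
            · rw [Finset.mem_filter] at hξ ⊢
              exact ⟨mem_freqs_iff.2 hξ.2.le, hξ.2⟩
          refine h1.trans ?_
          rw [← div_eq_mul_inv, le_div_iff₀ (by positivity)]
          refine le_trans (le_of_eq ?_) (hall n)
          rw [show 2 * r = 2 * (r - 1) + 2 by omega, pow_add]
          ring
      _ ≤ A' * Y := by
          rw [← Finset.mul_sum]
          exact mul_le_mul_of_nonneg_left (hY _) hA'0
  have h2 := sum_freqSize_mul_sq_le (d := d) (a := fun ξ => ‖coeff g ξ‖) hZ (hSZ P) (s := r - 1) (R := 1)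
    (by omega) le_rfl (fun ξ hξ => (Finset.mem_filter.1 hξ).2) hW
  rw [hPsum]
  simpa using h2

lemma abs_le_of_sum_freqSize_mul {N : ℕ} {g φ : E d → ℝ} {L : ℝ}
    (h : ∀ x, (φ x : ℂ) = trig (freqs d N) (coeff g) x)
    (hL : ∑ ξ ∈ freqs d N, freqSize ξ * ‖coeff g ξ‖ ≤ L) (x : E d) : |φ x| ≤ ‖coeff g 0‖ + L := by
  rw [← Real.norm_eq_abs, ← Complex.norm_real, h]
  refine (norm_trig_le _ _ _).trans ?_
  calc _ ≤ ∑ ξ ∈ freqs d N, ((if ξ = 0 then ‖coeff g ξ‖ else 0) + freqSize ξ * ‖coeff g ξ‖) := by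
        refine Finset.sum_le_sum fun ξ _ => ?_
        split_ifs with h0
        · have : 0 ≤ freqSize ξ * ‖coeff g ξ‖ := by positivity
          linarith
        · have h1 : (1 : ℝ) ≤ freqSize ξ := by
            have : freqSize ξ ≠ 0 := fun hz => h0 (funext fun j => by
              have := natAbs_le_freqSize ξ j
              simp only [Pi.zero_apply]
              omega)
            exact_mod_cast Nat.one_le_iff_ne_zero.2 this
          rw [zero_add]
          exact le_mul_of_one_le_left (norm_nonneg _) h1
    _ ≤ _ := by
        have h0 : (0 : Fin d → ℤ) ∈ freqs d N := by rw [mem_freqs]; simp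
        rw [Finset.sum_add_distrib, Finset.sum_ite_eq' , if_pos h0]
        gcongr

lemma abs_translate_sub_le_of_sum_freqSize_mul {N : ℕ} {g φ : E d → ℝ} {L : ℝ}
    (h : ∀ x, (φ x : ℂ) = trig (freqs d N) (coeff g) x)
    (hL : ∑ ξ ∈ freqs d N, freqSize ξ * ‖coeff g ξ‖ ≤ L) (j : Fin d) {τ : ℝ} (hτ : 0 ≤ τ) (x : E d) :
    |φ (x + τ • dir j) - φ x| ≤ L * τ := by
  rw [← Real.norm_eq_abs, ← Complex.norm_real, Complex.ofReal_sub, h, h, trig_add_right, trig_sub]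
  refine (norm_trig_le _ _ _).trans (le_trans ?_ (mul_le_mul_of_nonneg_right hL hτ))
  rw [Finset.sum_mul]
  refine Finset.sum_le_sum fun ξ _ => ?_
  rw [show coeff g ξ * expo ξ (τ • dir j) - coeff g ξ = coeff g ξ * (expo ξ (τ • dir j) - 1) by ring,
    norm_mul]
  have h1 : ‖expo ξ (τ • dir j) - 1‖ ≤ freqSize ξ * τ := by
    refine (Real.norm_exp_I_mul_ofReal_sub_one_le).trans ?_
    rw [pair_smul, pair_dir, Real.norm_eq_abs, abs_mul, abs_of_nonneg hτ, mul_comm]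
    gcongr
    exact abs_le_freqSize ξ j
  calc _ ≤ ‖coeff g ξ‖ * (freqSize ξ * τ) := by gcongr
    _ = _ := by ring

end SVV

end

noncomputable section
namespace SVV

variable {d : ℕ}

/-! ### Verification of the hypotheses -/

lemma exists_growth {s : ℕ} {f : Fin d → ℝ → ℝ} (hf : ∀ j, ContDiff ℝ s (f j)) (B : ℝ) :
    ∃ M : ℝ, 0 ≤ M ∧ ∀ a : ℝ, 0 ≤ a → (∀ v, |v| ≤ a → ∀ j, |iteratedDeriv s (f j) v| ≤ B) →
      ∀ j, ∀ k ≤ s, ∀ v, |v| ≤ a → |iteratedDeriv k (f j) v| ≤ M * (1 + a) ^ s := by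
  choose M hM0 hM using fun j => exists_abs_iteratedDeriv_le (hf j) (abs_nonneg B)
  refine ⟨∑ j, M j, Finset.sum_nonneg fun j _ => hM0 j, fun a ha h j k hk v hv => ?_⟩
  refine (hM j a ha (fun v hv => (h v hv j).trans (le_abs_self B)) k hk v hv).trans ?_
  gcongr
  exact Finset.single_le_sum (fun j _ => hM0 j) (Finset.mem_univ j)

/-- The bound on ε^s ‖∂^s P_N u₀‖ holds for every N, so it can be read on each shell |ξ| = N with
its own ε_N. The shell mass is thus O((Nε_N)^{-2s}) = O(N^{-2r}), the first-order Fourier sum of u₀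
converges absolutely, and all truncations share one sup bound and one Lipschitz bound. -/
lemma exists_initial_bounds {s r : ℕ} (hs : 1 ≤ s) (hr : d + 5 ≤ 2 * r) {u₀ : E d → ℝ} {ε : ℕ → ℝ}
    (hε₀ : ∀ N, 0 < ε N) {c : ℝ} (hc : 0 ≤ c)
    (hdecay : ∀ᶠ N : ℕ in atTop, (N : ℝ) ^ (2 * r) ≤ c * (N * ε N) ^ (2 * s))
    {φ : ℕ → E d → ℝ} (hφ : ∀ N x, (φ N x : ℂ) = trig (freqs d N) (coeff u₀) x)
    {C : ℝ} (hC : ∀ N, ε N ^ s * derivNorm s (φ N) ≤ C) :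
    ∃ D L : ℝ, 0 ≤ D ∧ 0 ≤ L ∧ (∀ N, ε N ^ (2 * s) * sob N s (φ N) ≤ D) ∧
      (∀ N x, |φ N x| ≤ D) ∧
      ∀ N j (τ : ℝ), 0 ≤ τ → ∀ x, |φ N (x + τ • dir j) - φ N x| ≤ L * τ := by
  have hsob : ∀ N, ε N ^ (2 * s) * sob N s (φ N) ≤ d * C ^ 2 := by
    intro N
    have h1 : ∀ x, (φ N x : ℂ) = trig (freqs d N) (coeff (φ N)) x := fun x => by
      rw [hφ N x]
      refine trig_congr (fun ξ hξ => ?_) x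
      rw [coeff_of_eq_trig (hφ N), if_pos hξ]
    have hε := hε₀ N
    calc _ ≤ ε N ^ (2 * s) * (d * derivNorm s (φ N) ^ 2) := by
          gcongr
          exact sob_le_derivNorm_sq h1
      _ = d * (ε N ^ s * derivNorm s (φ N)) ^ 2 := by ring
      _ ≤ _ := by
        have : 0 ≤ ε N ^ s * derivNorm s (φ N) := mul_nonneg (by positivity) (Real.sqrt_nonneg _)
        gcongr
        exact hC N
  obtain ⟨n₀, hn₀⟩ := eventually_atTop.1 hdecay
  obtain ⟨L, hL, hsum⟩ := exists_sum_freqSize_mul_coeff_le (d := d) (g := u₀)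
    (A := c * (d * C ^ 2)) (by positivity) hr (n₀ := n₀) fun n hn => by
      have hε := hε₀ n
      have hS : 0 ≤ ∑ ξ ∈ (freqs d n).filter (fun ξ => freqSize ξ = n), ‖coeff u₀ ξ‖ ^ 2 :=
        Finset.sum_nonneg fun ξ _ => by positivity
      calc _ ≤ c * (n * ε n) ^ (2 * s) *
            ∑ ξ ∈ (freqs d n).filter (fun ξ => freqSize ξ = n), ‖coeff u₀ ξ‖ ^ 2 := by
            gcongr
            exact hn₀ n hn
        _ = c * (ε n ^ (2 * s) * ((n : ℝ) ^ (2 * s) *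
            ∑ ξ ∈ (freqs d n).filter (fun ξ => freqSize ξ = n), ‖coeff u₀ ξ‖ ^ 2)) := by
            rw [mul_pow]; ring
        _ ≤ c * (ε n ^ (2 * s) * sob n s (φ n)) := by
            gcongr
            exact sum_shell_le hs (hφ n)
        _ ≤ _ := mul_le_mul_of_nonneg_left (hsob n) hc
  refine ⟨d * C ^ 2 + (‖coeff u₀ 0‖ + L), L, by positivity, hL, fun N => ?_, fun N x => ?_,
    fun N j τ hτ x => abs_translate_sub_le_of_sum_freqSize_mul (hφ N) (hsum N) j hτ x⟩
  · have := norm_nonneg (coeff u₀ 0)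
    linarith [hsob N]
  · have : 0 ≤ (d : ℝ) * C ^ 2 := by positivity
    linarith [abs_le_of_sum_freqSize_mul (hφ N) (hsum N) x]

lemma exists_admissible (hd : 1 ≤ d) {T θ : ℝ} (hθ₀ : 0 < θ) (hθ₁ : θ < 1)
    {s : ℕ} (hs : (4 + (d / 2 : ℕ) : ℝ) / (1 - θ) ≤ s)
    {f : Fin d → ℝ → ℝ} (hf : ∀ j, ContDiff ℝ s (f j)) {μ : Measure (E d)} (hμ : IsLevy μ)
    {u₀ : E d → ℝ} {ε : ℕ → ℝ} (hε₀ : ∀ N, 0 < ε N)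
    (hε : ε =Θ[atTop] fun N : ℕ => (N : ℝ) ^ (-θ)) {m : ℕ → ℕ}
    (hm : (fun N : ℕ => (m N : ℝ)) =O[atTop]
      fun N : ℕ => (N : ℝ) ^ (θ / 2) * Real.log N ^ (-(d : ℝ) / 2))
    {Q : ℕ → Fin d → Fin d → ℕ → ℝ → ℝ} (hQ : IsViscosityFamily T m Q) {u : ℕ → ℝ → E d → ℝ}
    (hu : ∀ N, IsSVVSolution T f μ u₀ N (m N) (ε N) (Q N) (u N))
    (hfs : ∃ B : ℝ, ∀ N, ∀ t ∈ Set.Icc 0 T, ∀ (x : E d) (v : ℝ), |v| ≤ |u N t x| →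
      ∀ j, |iteratedDeriv s (f j) v| ≤ B)
    (hinit : ∃ C : ℝ, ∀ N, ε N ^ s * derivNorm s (u N 0) ≤ C) :
    ∃ C₀ L : ℝ, 0 ≤ L ∧
      (∀ᶠ N in atTop, Admissible s C₀ T f μ u₀ N (m N) (ε N) (Q N) (u N)) ∧
      Tendsto (fun N : ℕ => ε N * (m N : ℝ) ^ 2) atTop (𝓝 0) ∧
      ∀ N j (τ : ℝ), 0 ≤ τ → ∀ x, |u N 0 (x + τ • dir j) - u N 0 x| ≤ L * τ := by
  have hs' : ((4 + d / 2 : ℕ) : ℝ) / (1 - θ) ≤ s := by push_cast; exact hs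
  have hrs : 4 + d / 2 ≤ s := by
    have h1 : ((4 + d / 2 : ℕ) : ℝ) ≤ s := by
      refine le_trans ?_ hs'
      rw [le_div_iff₀ (by linarith)]
      exact mul_le_of_le_one_right (by positivity) (by linarith)
    exact_mod_cast h1
  obtain ⟨a, ha, hεa⟩ := hε.1.exists_pos
  obtain ⟨b, hb, hεb⟩ := hε.2.exists_pos
  obtain ⟨Cm, hCm, hmul⟩ := exists_mul_sq_le hε₀ hε.1 hm
  obtain ⟨B, hB⟩ := hfs
  obtain ⟨M, hM, hgrowth⟩ := exists_growth hf B
  obtain ⟨CQ, hCQ⟩ := hQ.bound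
  obtain ⟨Ci, hCi⟩ := hinit
  have hdecay : ∀ᶠ N : ℕ in atTop,
      (N : ℝ) ^ (2 * (4 + d / 2)) ≤ b ^ (2 * s) * (N * ε N) ^ (2 * s) := by
    filter_upwards [hεb.bound, eventually_ge_atTop 1] with N h1 hN
    rw [Real.norm_of_nonneg (hε₀ N).le, Real.norm_of_nonneg (by positivity)] at h1
    exact pow_le_of_rpow hθ₁ hs' hN h1
  obtain ⟨D, L, hD, hL, hsob, hsup, hlip⟩ := exists_initial_bounds (s := s) (by omega) (by omega) hε₀
    (by positivity) hdecay (fun N x => (hu N).init_trig x) hCi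
  set C₀ : ℝ := 1 + a + 2 * Cm + M + |CQ| + b ^ (2 * s) + D with hC₀
  have hlog : Tendsto (fun N : ℕ => Real.log N) atTop atTop :=
    Real.tendsto_log_atTop.comp tendsto_natCast_atTop_atTop
  have hbs : 0 ≤ b ^ (2 * s) := by positivity
  have hCQ0 := abs_nonneg CQ
  refine ⟨C₀, L, hL, ?_, ?_, hlip⟩
  · filter_upwards [hεa.bound, hmul, hdecay, eventually_ge_atTop 1,
      hlog.eventually_ge_atTop 1] with N h1 h2 h3 hN hl
    have hN1 : (1 : ℝ) ≤ N := by exact_mod_cast hN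
    exact
      { sol := hu N
        levy := hμ
        smooth := hf
        two_s := by omega
        one_le := by linarith
        one_le_N := hN
        eps_pos := hε₀ N
        eps_le := by
          rw [Real.norm_of_nonneg (hε₀ N).le, Real.norm_of_nonneg (by positivity)] at h1
          have : (N : ℝ) ^ (-θ) ≤ 1 := Real.rpow_le_one_of_one_le_of_nonpos hN1 (by linarith)
          have : a * (N : ℝ) ^ (-θ) ≤ a := mul_le_of_le_one_right ha.le this
          linarith
        visc_le := by
          -- For d ≥ 1 the decay (log N)^{-d} of ε m² absorbs the single logarithm lost in L^{2k}.
          have h4 : Real.log N ≤ Real.log N ^ d := le_self_pow₀ hl (by omega)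
          have h5 : (Real.log N ^ d)⁻¹ * (1 + Real.log N) ≤ 2 := by
            rw [inv_mul_le_iff₀ (by positivity)]
            linarith
          calc _ ≤ Cm * (Real.log N ^ d)⁻¹ * (1 + Real.log N) := by gcongr
            _ = Cm * ((Real.log N ^ d)⁻¹ * (1 + Real.log N)) := by ring
            _ ≤ Cm * 2 := by gcongr
            _ ≤ C₀ := by linarith
        -- 2(4 + ⌊d/2⌋) ≥ d + 7 even when d is odd.
        decay := by
          calc (N : ℝ) ^ (d + 7) ≤ (N : ℝ) ^ (2 * (4 + d / 2)) :=
                pow_le_pow_right₀ hN1 (by omega)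
            _ ≤ _ := h3
            _ ≤ _ := by
              have := hε₀ N
              gcongr
              linarith
        symbol_bound := fun t ht j k p hmp hpN => by
          refine (hCQ N j k p ⟨hmp, hpN⟩ t ht).trans ?_
          gcongr
          linarith [le_abs_self CQ]
        symbol_mono := fun t ht j k => hQ.mono N j k t ht
        growth := fun t ht j k hk x => by
          refine (hgrowth |u N t x| (abs_nonneg _) (fun v hv => hB N t ht x v hv) j k hk _
            le_rfl).trans ?_
          gcongr
          linarith
        sob_init := (hsob N).trans (by linarith)
        sup_init := fun x => (hsup N x).trans (by linarith) }
  · have h0 : Tendsto (fun N : ℕ => Cm * (Real.log N ^ d)⁻¹) atTop (𝓝 0) := by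
      simpa using (((tendsto_pow_atTop (by omega : d ≠ 0)).comp hlog).inv_tendsto_atTop).const_mul Cm
    exact squeeze_zero' (Eventually.of_forall fun N => mul_nonneg (hε₀ N).le (sq_nonneg _)) hmul h0

lemma exists_compactFamily {s : ℕ} (hd : 1 ≤ d) (hs : 2 ≤ s) {C₀ L T : ℝ} (hT : 0 < T)
    {f : Fin d → ℝ → ℝ} {μ : Measure (E d)} {u₀ : E d → ℝ} {ε : ℕ → ℝ} {m : ℕ → ℕ}
    {Q : ℕ → Fin d → Fin d → ℕ → ℝ → ℝ} {u : ℕ → ℝ → E d → ℝ} (hL : 0 ≤ L)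
    (h : ∀ᶠ N in atTop, Admissible s C₀ T f μ u₀ N (m N) (ε N) (Q N) (u N))
    (hlim : Tendsto (fun N : ℕ => ε N * (m N : ℝ) ^ 2) atTop (𝓝 0))
    (hlip : ∀ N j (τ : ℝ), 0 ≤ τ → ∀ x, |u N 0 (x + τ • dir j) - u N 0 x| ≤ L * τ) :
    ∃ (N₁ : ℕ) (B K : ℝ) (δ : ℕ → ℝ),
      CompactFamily T B K C₀ (fun n => n + N₁) δ (fun n => u (n + N₁)) := by
  obtain ⟨B, C, N₀, hB, hC, hcon⟩ := exists_controlled d s hd hs C₀ T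
  obtain ⟨N₂, hN₂⟩ := eventually_atTop.1 h
  set E₁ : ℕ → ℝ := fun N => C * ((N : ℝ)⁻¹ + ε N * (m N : ℝ) ^ 2) with hE₁
  set N₁ := max N₀ N₂ with hN₁
  have hadm : ∀ n, Admissible s C₀ T f μ u₀ (n + N₁) (m (n + N₁)) (ε (n + N₁)) (Q (n + N₁))
      (u (n + N₁)) := fun n => hN₂ _ (by omega)
  have hctl : ∀ n, Controlled s B (E₁ (n + N₁)) T f (n + N₁) (m (n + N₁)) (ε (n + N₁)) (Q (n + N₁))
      (u (n + N₁)) := fun n => hcon (hadm n) (by omega)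
  -- The sum of the constants of the translation and the cube estimates, so that one δ serves both.
  set c : ℝ := 2 * ((2 * Real.pi) ^ d + 1) * T + (9 * B + 1) * T with hc
  have hElim : Tendsto E₁ atTop (𝓝 0) := by
    simpa using (tendsto_inv_atTop_nhds_zero_nat.add hlim).const_mul C
  refine ⟨N₁, B, (2 * Real.pi) ^ d * L, fun n => c * E₁ (n + N₁), ?_⟩
  have h0 : (0 : ℝ) ∈ Set.Icc 0 T := ⟨le_rfl, hT.le⟩
  exact
    { eq_trig := fun n t ht x => (hadm n).sol.eq_trig ht x
      lip := fun ξ => by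
        obtain ⟨Λ, hΛ⟩ := exists_coeff_lipschitz s C₀ B μ ξ
        exact ⟨Λ, fun n => hΛ (hadm n) (hctl n) hT⟩
      one := fun n t ht => by simpa using (hctl n).moment t ht 1 (by omega)
      four := fun n t ht => by
        simpa only [Even.pow_abs (by decide : Even 4)] using (hctl n).moment t ht 4 (by omega)
      K_nonneg := by positivity
      transl := fun n t ht j τ hτ => by
        have hE := (hctl n).pos
        have hc0 := ((hadm n).contDiff h0 (n := 0)).continuous
        have h1 := (hctl n).integral_abs_translate_sub_le (hadm n) (τ • dir j) ht
        have h2 : ∫ x, |u (n + N₁) 0 (x + τ • dir j) - u (n + N₁) 0 x| ∂(cellVol d) ≤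
            (2 * Real.pi) ^ d * L * τ := by
          have hc1 : Continuous fun x => |u (n + N₁) 0 (x + τ • dir j) - u (n + N₁) 0 x| := by
            fun_prop
          calc _ ≤ ∫ _x, L * τ ∂(cellVol d) :=
                integral_mono (integrable_cellVol hc1) (integrable_const _)
                  fun x => hlip (n + N₁) j τ hτ x
            _ = _ := by rw [integral_const_cellVol]; ring
        have h3 : 0 ≤ (9 * B + 1) * T * E₁ (n + N₁) := by positivity
        rw [hc]
        linarith
      cube := fun n t ht σ hσ => by
        have hE := (hctl n).pos
        have h1 := (hctl n).integral_cubePos_le (hadm n) hσ ht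
        have h3 : 0 ≤ 2 * ((2 * Real.pi) ^ d + 1) * T * E₁ (n + N₁) := by positivity
        rw [hc]
        linarith
      lim := by simpa using (hElim.comp (tendsto_add_atTop_nat N₁)).const_mul c }

end SVV

end

/-! ### Convergence of a subsequence -/

theorem mainTheorem7 (d : ℕ) (hd : 1 ≤ d) (T : ℝ) (hT : 0 < T)
    (θ : ℝ) (hθ₀ : 0 < θ) (hθ₁ : θ < 1)
    (s : ℕ) (hs : (4 + (d / 2 : ℕ) : ℝ) / (1 - θ) ≤ s)
    (f : Fin d → ℝ → ℝ) (hf : ∀ j, ContDiff ℝ s (f j))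
    (μ : Measure (SVV.E d)) (hμ : SVV.IsLevy μ) (hsymm : SVV.IsSymm μ)
    (u₀ : SVV.E d → ℝ) (hper : SVV.IsPeriodic u₀)
    (hbdd : MemLp u₀ ⊤ (SVV.cellVol d)) (hbv : SVV.variation u₀ < ⊤)
    (ε : ℕ → ℝ) (hε₀ : ∀ N, 0 < ε N)
    (hε : ε =Θ[atTop] fun N : ℕ => (N : ℝ) ^ (-θ))
    (m : ℕ → ℕ)
    (hm : (fun N : ℕ => (m N : ℝ)) =Θ[atTop]
      fun N : ℕ => (N : ℝ) ^ (θ / 2) * Real.log N ^ (-(d : ℝ) / 2))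
    (Q : ℕ → Fin d → Fin d → ℕ → ℝ → ℝ) (hQ : SVV.IsViscosityFamily T m Q)
    (u : ℕ → ℝ → SVV.E d → ℝ)
    (hu : ∀ N, SVV.IsSVVSolution T f μ u₀ N (m N) (ε N) (Q N) (u N))
    (hfs : ∃ B : ℝ, ∀ N, ∀ t ∈ Set.Icc 0 T, ∀ (x : SVV.E d) (v : ℝ), |v| ≤ |u N t x| →
      ∀ j, |iteratedDeriv s (f j) v| ≤ B)
    (hinit : ∃ C : ℝ, ∀ N, ε N ^ s * SVV.derivNorm s (u N 0) ≤ C) :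
    ∃ (n : ℕ → ℕ) (U : C(Set.Icc (0 : ℝ) T, Lp ℝ 1 (SVV.cellVol d))),
      StrictMono n ∧
      Tendsto (fun k => ⨆ t : Set.Icc (0 : ℝ) T,
        eLpNorm (fun x => u (n k) t x - U t x) 1 (SVV.cellVol d)) atTop (𝓝 0) ∧
      (∃ M : ℝ, ∀ t, ∀ᵐ x ∂(SVV.cellVol d), |U t x| ≤ M) ∧
      (∃ B : NNReal, ∀ t, SVV.bvNorm (U t) ≤ B) := by
  have hs2 : 2 ≤ s := by
    have h1 : (2 : ℝ) ≤ s := by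
      refine le_trans ?_ hs
      rw [le_div_iff₀ (by linarith)]
      have : (0 : ℝ) ≤ (d / 2 : ℕ) := by positivity
      linarith
    exact_mod_cast h1
  obtain ⟨C₀, L, hL, hadm, hlim, hlip⟩ := SVV.exists_admissible hd hθ₀ hθ₁ hs hf hμ hε₀ hε
    hm.1 hQ hu hfs hinit
  obtain ⟨N₁, B, K, δ, hfam⟩ := SVV.exists_compactFamily hd hs2 hT hL hadm hlim hlip
  obtain ⟨n, U, hn, hU⟩ := hfam.exists_limit
  -- The compact family starts at N₁, where the estimates begin to hold; the indices are shifted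
  -- back here.
  exact ⟨fun k => n k + N₁, U, fun a b hab => Nat.add_lt_add_right (hn hab) N₁, hU⟩
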